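/- Let $d\in\mathbb N$, $0<\alpha\le 1$, $\beta>0$, $p>2$. For $T>0$ put $$\|F\|_{T,\infty,\alpha}=\operatorname*{ess\,sup}_{0\le t\le T}\sup_x|F(t,x)|+\operatorname*{ess\,sup}_{0\le t\le T}\sup_{x\ne y}\frac{|F(t,x)-F(t,y)|}{|x-y|^{\alpha}},$$ and let $\|\cdot\|_{T,\infty,\alpha,p}$ be the same expression for random fields on $\mathbb R^d$, with $|\cdot|$ of the values replaced by the $L^p(\Omega)$-norm. Further let $$\|u\|_{T,\infty,1+r,p}=\operatorname*{ess\,sup}_{0\le t\le T}\sup_x\|u(t,x)\|_{L^p(\Omega)}+\|Du\|_{T,\infty,r,p},$$ where $Du(t,\cdot)$ is the gradient of $x\mapsto u(t,x)\in L^p(\Omega)$ (and the norm is $\infty$ if this gradient does not exist everywhere for a.e. $t\in[0,T]$). Let $W$ be a scalar Wiener process on a filtered probability space $(\Omega,\mathcal F,(\mathcal F_t)_{t\ge0},\mathbb P)$. Let $b:[0,\infty)\times\mathbb R^d\to\mathbb R^d$, $f:[0,\infty)\times\mathbb R^d\to\mathbb R$ and $h:[0,\infty)\times\mathbb R^d\times\Omega\to\mathbb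 R$ be (jointly) measurable, let $h(t,x,\cdot)$ be $\mathcal F_t$-measurable for all $t,x$, and let $\|b\|_{T,\infty,\beta}$, $\|h\|_{T,\infty,\beta,p}$ and $\|f\|_{T,\infty,\alpha}$ be finite for every $T>0$. Consider $$du+b\cdot\nabla u\,dt-\tfrac12\Delta u\,dt=h\,dt+f\,dW_t,\qquad t>0,\ x\in\mathbb R^d,\qquad u|_{t=0}=0. \tag{1}$$ A mild solution of (1) is a jointly measurable, $\mathcal F_t$-adapted random field $u$ with $u(0,x)=0$ a.s. for every $x$, such that for every $x$ the map $t\mapsto u(t,x)\in L^2(\Omega)$ is right continuous with left limits, $u\in L^\infty_{loc}([0,\infty);W^{1,\infty}(\mathbb R^d;L^2(\Omega)))$, and for all $t>0$ and $x\in\mathbb R^d$, almost surely, $$u(t,x)=-\int_0^tP_{t-r}\big(b(r,\cdot)\cdot\nabla u(r,\cdot)\big)(x)\,dr+\int_0^tP_{t-r}h(r,\cdot)(x)\,dr+\int_0^tP_{t-r}f(r,\cdot)(x)\,dW_r,$$ where $P_s\varphi(x)=(2\pi s)^{-d/2}\int_{\mathbb R^d}e^{-|x-y|^2/(2s)}\varphi(y)\,dy$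 and the last integral is an Itô integral. Then (1) has a mild solution $u$, and it is unique: every mild solution $v$ satisfies $v(t,x)=u(t,x)$ a.s. for all $t\ge0$ and $x\in\mathbb R^d$. Moreover $u\in L^\infty_{loc}([0,\infty);\mathcal C^{1+\alpha-}_b(\mathbb R^d;L^p(\Omega)))$, that is, $\|u\|_{t,\infty,1+r,p}<\infty$ for all $0<r<\alpha$ and $t>0$, and for all such $r$ and $t$ $$\|u\|_{t,\infty,1+r,p}\le C\,\big(\|h\|_{t,\infty,\beta,p}+\|f\|_{t,\infty,\alpha}\big),$$ where $C>0$ depends only on $p$, $t$, $\|b\|_{t,\infty,\beta}$ and on $d,\alpha,\beta,r$; in particular it does not depend on $u$, $h$, $f$ or on the probability space. -/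

import Mathlib

open MeasureTheory ProbabilityTheory Set Filter Topology
open scoped ENNReal NNReal

namespace StochTransport

/-- The space `ℝ^d` with its Euclidean norm. -/
abbrev Space (d : ℕ) : Type := EuclideanSpace ℝ (Fin d)

section Driving

variable {Ω : Type*} {mΩ : MeasurableSpace Ω}

/-- `W` is a scalar Wiener process on the filtered probability space `(Ω, ℱ, P)`: a Brownian motion
with almost surely continuous paths, adapted to `ℱ`, whose increments after time `s` are
independent of `ℱ s`. -/
structure IsWienerProcess (P : Measure Ω) (ℱ : Filtration ℝ≥0 mΩ) (W : ℝ≥0 → Ω → ℝ) : Prop where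
  brownian : IsBrownianReal W P
  adapted : ∀ t : ℝ≥0, Measurable[ℱ t] (W t)
  indep : ∀ s t : ℝ≥0, s ≤ t →
    Indep (MeasurableSpace.comap (fun ω => W t ω - W s ω) inferInstance) (ℱ s) P

/-- A deterministic step function `∑ i, coef i * 1_{(left i, right i]}` on the half-line. -/
structure StepFun where
  size : ℕ
  coef : Fin size → ℝ
  left : Fin size → ℝ≥0
  right : Fin size → ℝ≥0
  left_le_right : ∀ i, left i ≤ right i

/-- The value of a step function. -/
noncomputable def StepFun.eval (S : StepFun) (r : ℝ) : ℝ :=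
  ∑ i, (Set.Ioc (S.left i : ℝ) (S.right i : ℝ)).indicator (fun _ => S.coef i) r

/-- The stochastic integral `∑ i, coef i * (W (right i) - W (left i))` of a step function. -/
noncomputable def StepFun.stochInt (S : StepFun) (W : ℝ≥0 → Ω → ℝ) (ω : Ω) : ℝ :=
  ∑ i, S.coef i * (W (S.right i) ω - W (S.left i) ω)

/-- `I` is (a version of) the Itô integral `∫_0^t F(r) dW_r` of the deterministic integrand
`F ∈ L²(0,t)`: the `L²(Ω)`-limit of the stochastic integrals of step functions supported in `(0,t]`
which converge to `F` in `L²(0,t)`. -/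
def IsItoIntegral (P : Measure Ω) (W : ℝ≥0 → Ω → ℝ) (t : ℝ) (F : ℝ → ℝ) (I : Ω → ℝ) : Prop :=
  MemLp F 2 (volume.restrict (Set.Ioc 0 t)) ∧ MemLp I 2 P ∧
    ∃ S : ℕ → StepFun, (∀ n i, ((S n).right i : ℝ) ≤ t) ∧
      Tendsto (fun n => eLpNorm (fun r => F r - (S n).eval r) 2 (volume.restrict (Set.Ioc 0 t)))
        atTop (𝓝 0) ∧
      Tendsto (fun n => eLpNorm (fun ω => I ω - (S n).stochInt W ω) 2 P) atTop (𝓝 0)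

end Driving

section Heat

variable {d : ℕ}

/-- The heat kernel `K(s,z) = (2πs)^{-d/2} exp(-|z|²/(2s))`. -/
noncomputable def heatKernel (s : ℝ) (z : Space d) : ℝ :=
  (2 * Real.pi * s) ^ (-((d : ℝ) / 2)) * Real.exp (-(‖z‖ ^ 2 / (2 * s)))

/-- The heat semigroup `(P_s φ)(x) = ∫ K(s, x - y) φ(y) dy`, generated by `½ Δ`. -/
noncomputable def heatSemigroup (s : ℝ) (φ : Space d → ℝ) (x : Space d) : ℝ :=
  ∫ y, heatKernel s (x - y) * φ y

end Heat

section Norms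

variable {d : ℕ} {V : Type*}

/-- `esssup_{0 ≤ t ≤ T} sup_x N(F(t,x))`, where `N` measures the size of the values. -/
noncomputable def supNorm (N : V → ℝ≥0∞) (T : ℝ) (F : ℝ → Space d → V) : ℝ≥0∞ :=
  essSup (fun t => ⨆ x, N (F t x)) (volume.restrict (Set.Icc 0 T))

/-- `esssup_{0 ≤ t ≤ T} sup_{x ≠ y} N(F(t,x) - F(t,y)) / |x - y|^α`. -/
noncomputable def holderSeminorm [Sub V] (N : V → ℝ≥0∞) (T α : ℝ) (F : ℝ → Space d → V) : ℝ≥0∞ :=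
  essSup (fun t => ⨆ (x) (y) (_ : x ≠ y), N (F t x - F t y) / edist x y ^ α)
    (volume.restrict (Set.Icc 0 T))

/-- The norm of `L^∞([0,T]; C^α_b(ℝ^d; V))`. -/
noncomputable def holderNorm [Sub V] (N : V → ℝ≥0∞) (T α : ℝ) (F : ℝ → Space d → V) : ℝ≥0∞ :=
  supNorm N T F + holderSeminorm N T α F

/-- The norm `‖f‖_{T,∞,α}` of a deterministic function with values in a normed space. -/
noncomputable def detNorm [NormedAddCommGroup V] (T α : ℝ) (F : ℝ → Space d → V) : ℝ≥0∞ :=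
  holderNorm (fun v => ‖v‖ₑ) T α F

variable {Ω : Type*} {mΩ : MeasurableSpace Ω}

/-- The norm `‖h‖_{T,∞,α,p}` of `L^∞([0,T]; C^α_b(ℝ^d; L^p(Ω)))`. -/
noncomputable def randNorm (P : Measure Ω) (p T α : ℝ) (h : ℝ → Space d → Ω → ℝ) : ℝ≥0∞ :=
  holderNorm (fun X : Ω → ℝ => eLpNorm X (ENNReal.ofReal p) P) T α h

/-- For almost every `t ∈ [0,T]`, the map `x ↦ u(t,x) ∈ L^p(Ω)` is differentiable at every point,
with gradient `x ↦ D(t,x) ∈ L^p(Ω; ℝ^d)`. -/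
def HasLpGradient (P : Measure Ω) (p T : ℝ) (u : ℝ → Space d → Ω → ℝ)
    (D : ℝ → Space d → Ω → Space d) : Prop :=
  ∀ᵐ t ∂(volume.restrict (Set.Icc 0 T)), ∀ x,
    MemLp (u t x) (ENNReal.ofReal p) P ∧ MemLp (D t x) (ENNReal.ofReal p) P ∧
    Tendsto (fun y => eLpNorm (fun ω => u t y ω - u t x ω - inner ℝ (D t x ω) (y - x))
      (ENNReal.ofReal p) P / ‖y - x‖ₑ) (𝓝[≠] x) (𝓝 0)

/-- The norm `‖u‖_{T,∞,1+r,p}` of `L^∞([0,T]; C^{1+r}_b(ℝ^d; L^p(Ω)))`, for `0 < r ≤ 1`. The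
gradient is unique almost surely, so the infimum only selects it; the norm is `∞` if `u` has no
gradient. -/
noncomputable def gradHolderNorm (P : Measure Ω) (p T r : ℝ) (u : ℝ → Space d → Ω → ℝ) : ℝ≥0∞ :=
  ⨅ (D : ℝ → Space d → Ω → Space d) (_ : HasLpGradient P p T u D),
    supNorm (fun X : Ω → ℝ => eLpNorm X (ENNReal.ofReal p) P) T u +
      holderNorm (fun X : Ω → Space d => eLpNorm X (ENNReal.ofReal p) P) T r D

end Norms

section Mild

variable {d : ℕ} {Ω : Type*} {mΩ : MeasurableSpace Ω}

/-- `G` is a weak spatial gradient of the random field `u` on `[0,∞) × ℝ^d`: for almost every time,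
`∫ u ∂_e φ dx = -∫ (G · e) φ dx` almost surely, for each test function `φ ∈ C_c^∞(ℝ^d)` and each
direction `e`. -/
def IsWeakGradient (P : Measure Ω) (u : ℝ → Space d → Ω → ℝ)
    (G : ℝ → Space d → Ω → Space d) : Prop :=
  ∀ᵐ t ∂(volume.restrict (Set.Ici (0 : ℝ))), ∀ φ : Space d → ℝ, ContDiff ℝ (⊤ : ℕ∞) φ →
    HasCompactSupport φ → ∀ e : Space d, ∀ᵐ ω ∂P,
      ∫ x, u t x ω * fderiv ℝ φ x e = - ∫ x, inner ℝ (G t x ω) e * φ x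

/-- `F` belongs to `L^∞_loc([0,∞); L^∞(ℝ^d; L²(Ω; V)))`. -/
def LocBoundedL2 {V : Type*} [NormedAddCommGroup V] (P : Measure Ω)
    (F : ℝ → Space d → Ω → V) : Prop :=
  ∀ T : ℝ, 0 < T →
    essSup (fun t => essSup (fun x => eLpNorm (F t x) 2 P) volume)
      (volume.restrict (Set.Icc 0 T)) < ⊤

/-- For every `x`, the path `t ↦ u(t,x) ∈ L²(Ω)` is right continuous on `[0,∞)` and has left
limits. -/
def IsCadlagL2 (P : Measure Ω) (u : ℝ → Space d → Ω → ℝ) : Prop :=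
  ∀ x : Space d,
    (∀ t : ℝ, 0 ≤ t → MemLp (u t x) 2 P) ∧
    (∀ t : ℝ, 0 ≤ t →
      Tendsto (fun s => eLpNorm (fun ω => u s x ω - u t x ω) 2 P) (𝓝[>] t) (𝓝 0)) ∧
    (∀ t : ℝ, 0 < t → ∃ L : Ω → ℝ, MemLp L 2 P ∧
      Tendsto (fun s => eLpNorm (fun ω => u s x ω - L ω) 2 P) (𝓝[<] t) (𝓝 0))

/-- `u` is a mild solution, with zero initial data, of
`du + b · ∇u dt - ½ Δu dt = h dt + f dW_t` on `(0,∞) × ℝ^d`. Times are real numbers, of which only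
the nonnegative ones matter; `G` is a jointly measurable version of the weak gradient `∇u`. -/
structure IsMildSolution (P : Measure Ω) (ℱ : Filtration ℝ≥0 mΩ) (W : ℝ≥0 → Ω → ℝ)
    (b : ℝ → Space d → Space d) (h : ℝ → Space d → Ω → ℝ) (f : ℝ → Space d → ℝ)
    (u : ℝ → Space d → Ω → ℝ) : Prop where
  measurable : Measurable (fun q : ℝ × Space d × Ω => u q.1 q.2.1 q.2.2)
  adapted : ∀ (t : ℝ≥0) (x : Space d), Measurable[ℱ t] (u t x)
  cadlag : IsCadlagL2 P u
  initial : ∀ x : Space d, ∀ᵐ ω ∂P, u 0 x ω = 0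
  bounded : LocBoundedL2 P u
  equation : ∃ G : ℝ → Space d → Ω → Space d,
    Measurable (fun q : ℝ × Space d × Ω => G q.1 q.2.1 q.2.2) ∧
    IsWeakGradient P u G ∧ LocBoundedL2 P G ∧
    ∀ t : ℝ, 0 < t → ∀ x : Space d, ∃ I : Ω → ℝ,
      IsItoIntegral P W t (fun r => heatSemigroup (t - r) (f r) x) I ∧
      ∀ᵐ ω ∂P, u t x ω =
        - (∫ r in (0 : ℝ)..t, heatSemigroup (t - r) (fun y => inner ℝ (b r y) (G r y ω)) x)
        + (∫ r in (0 : ℝ)..t, heatSemigroup (t - r) (fun y => h r y ω) x)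
        + I ω

end Mild

end StochTransport

/-!
The proof reduces the equation to a linear fixed point problem for a scalar random field. Write
`K` for the heat kernel, `Jφ(t,x) = ∫_0^t P_{t-r} φ(r)(x) dr` and `J'φ` for the same space-time
potential with kernel `∇K` (`pot heatKernel φ` and `pot gradKernel φ`), and let `Z` be the
stochastic convolution `∫_0^t P_{t-r} f(r) dW_r`, with spatial gradient `Z'`. If `u` is a mild
solution, then `φ = h - b · ∇u` satisfies `u = Jφ + Z` and `∇u = J'φ + Z'`, so that
`φ = (h - b · Z') - b · J'φ`. Conversely, each bounded solution `φ` of this equation yields the mild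
solution `Jφ + Z` (`IsSolutionField.isMildSolution`). Only bounds of `b` and `h` in the supremum
norm are needed for this; their Hölder regularity in space plays no role.

*Drift.* Since `∫ |∇K(s,z)| dz ≤ c s^{-1/2}` is integrable at `s = 0`, Minkowski's integral
inequality (`lintegral_rpow_lintegral_le`) shows that `φ ↦ -b · J'φ` is a contraction with factor
`1/2` in the norm of `L^∞((0,T) × ℝ^d; L^q(Ω))` weighted by `e^{-Λt}`, for `Λ` large depending on
the bound of `b` (`fieldBound_driftMap`). The Picard iterates therefore converge, almost surely and
with an explicit bound (`FixedPointData.fieldBound_picardLimit`,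
`FixedPointData.picardLimit_ae_eq`). The kernels `∇K(s,z+a) - ∇K(s,z)` and
`K(s,z+a) - K(s,z) - ∇K(s,z) · a` have `L¹`-norms of order `|a|^r s^{-(1+r)/2}` and
`|a|^{1+r} s^{-(1+r)/2}`; these are integrable in time for `r < 1` and give the Hölder and Taylor
estimates of `Jφ` and `J'φ`.

*Noise.* Deterministic integrands are integrated by extending `1_{(0,a]} ↦ W_a` to an isometry of
`L²(0,∞)` (`wienerInt`), which is compatible with the definition of the Itô integral
(`isItoIntegral_wienerInt`, `IsItoIntegral.ae_eq_wienerInt`). The integrals are Gaussian, so all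
their moments are controlled by the `L²`-norm of the integrand. Because `∇K(s,·)` has mean zero, the
Hölder continuity of `f` improves each of the kernel bounds above by the factor `s^{α/2}`, which
makes them square integrable in time for `r < α`.

*Versions.* Potentials of adapted fields are adapted, by an orthogonality argument for conditional
expectations (`aestronglyMeasurable_kerInt`), and fields that are Hölder continuous in `L²(Ω)` have
jointly measurable and adapted modifications (`exists_measField_modification`).

*Uniqueness.* For the difference `w` of two mild solutions put `ψ = -b · ∇w`. The stochastic
integrals cancel, `w = Jψ`, and the weak gradient of `Jψ` is `J'ψ` (`weakGradient_of_taylor`). As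
weak gradients are unique (`ae_ae_eq_of_weakGradient`), `ψ = -b · J'ψ`, and the contraction property
gives `ψ = 0` (`IsMildSolution.ae_eq`).

*Estimate.* The bounds for `φ`, `Jφ`, `J'φ`, `Z` and `Z'` are combined in
`IsSolutionField.gradHolderNorm_le`.
-/

namespace StochTransport

/-! ### Gaussian estimates for the heat kernel -/

section Kernel

variable {d : ℕ}

/-- The spatial gradient `∇K(s,z) = -(z/s) K(s,z)` of the heat kernel. -/
noncomputable def gradKernel (s : ℝ) (z : Space d) : Space d :=
  (-(heatKernel s z / s)) • z

/-- The constant in all the Gaussian bounds of the heat kernel and its derivatives. -/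
noncomputable def kernelConst (d : ℕ) : ℝ :=
  6 * ((2 : ℝ) ^ ((d : ℝ) / 2) * Real.exp 16)

lemma kernelConst_pos (d : ℕ) : 0 < kernelConst d := by unfold kernelConst; positivity

lemma one_le_kernelConst (d : ℕ) : 1 ≤ kernelConst d := by
  unfold kernelConst
  have h1 : (1 : ℝ) ≤ (2 : ℝ) ^ ((d : ℝ) / 2) := Real.one_le_rpow (by norm_num) (by positivity)
  have h2 : (1 : ℝ) ≤ Real.exp 16 := Real.one_le_exp (by norm_num)
  nlinarith

lemma heatKernel_nonneg {s : ℝ} (hs : 0 ≤ s) (z : Space d) : 0 ≤ heatKernel s z := by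
  unfold heatKernel; positivity

lemma heatKernel_neg (s : ℝ) (z : Space d) : heatKernel s (-z) = heatKernel s z := by
  simp [heatKernel]

lemma gradKernel_neg (s : ℝ) (z : Space d) : gradKernel s (-z) = -gradKernel s z := by
  simp [gradKernel, heatKernel_neg]

lemma measurable_heatKernel : Measurable (fun q : ℝ × Space d => heatKernel q.1 q.2) := by
  unfold heatKernel
  fun_prop

lemma measurable_gradKernel : Measurable (fun q : ℝ × Space d => gradKernel q.1 q.2) := by
  unfold gradKernel
  exact ((measurable_heatKernel.div measurable_fst).neg).smul measurable_snd

/-- Exponential weights in `|z|/√s` cost only a dilation of the time variable. -/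
lemma heatKernel_mul_exp_le {s : ℝ} (hs : 0 < s) (z : Space d) {k : ℝ} (hk : 0 ≤ k) (hk4 : k ≤ 4) :
    heatKernel s z * Real.exp (k * (‖z‖ / √s)) ≤
      (2 : ℝ) ^ ((d : ℝ) / 2) * Real.exp 16 * heatKernel (2 * s) z := by
  unfold heatKernel
  have h1 : (2 * Real.pi * (2 * s)) ^ (-((d : ℝ) / 2)) =
      (2 : ℝ) ^ (-((d : ℝ) / 2)) * (2 * Real.pi * s) ^ (-((d : ℝ) / 2)) := by
    rw [← Real.mul_rpow (by norm_num) (by positivity)]; ring_nf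
  rw [h1]
  have h2 : (2 : ℝ) ^ ((d : ℝ) / 2) * (2 : ℝ) ^ (-((d : ℝ) / 2)) = 1 := by
    rw [← Real.rpow_add (by norm_num)]; simp
  have h3 : Real.exp (-(‖z‖ ^ 2 / (2 * s))) * Real.exp (k * (‖z‖ / √s)) ≤
      Real.exp 16 * Real.exp (-(‖z‖ ^ 2 / (2 * (2 * s)))) := by
    rw [← Real.exp_add, ← Real.exp_add]
    apply Real.exp_le_exp.2
    set ζ := ‖z‖ / √s with hζ
    have hz : ‖z‖ ^ 2 = ζ ^ 2 * s := by
      rw [hζ, div_pow, Real.sq_sqrt hs.le]; field_simp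
    rw [hz]
    have e1 : ζ ^ 2 * s / (2 * s) = ζ ^ 2 / 2 := by field_simp
    have e2 : ζ ^ 2 * s / (2 * (2 * s)) = ζ ^ 2 / 4 := by field_simp; norm_num
    rw [e1, e2]
    nlinarith [sq_nonneg (ζ / 2 - k), mul_nonneg hk (sub_nonneg.2 hk4)]
  have hA : 0 ≤ (2 * Real.pi * s) ^ (-((d : ℝ) / 2)) := by positivity
  calc _ = (2 * Real.pi * s) ^ (-((d : ℝ) / 2)) *
        (Real.exp (-(‖z‖ ^ 2 / (2 * s))) * Real.exp (k * (‖z‖ / √s))) := by ring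
    _ ≤ (2 * Real.pi * s) ^ (-((d : ℝ) / 2)) *
        (Real.exp 16 * Real.exp (-(‖z‖ ^ 2 / (2 * (2 * s))))) := by gcongr
    _ = ((2 : ℝ) ^ ((d : ℝ) / 2) * (2 : ℝ) ^ (-((d : ℝ) / 2))) *
        ((2 * Real.pi * s) ^ (-((d : ℝ) / 2)) *
        (Real.exp 16 * Real.exp (-(‖z‖ ^ 2 / (2 * (2 * s)))))) := by rw [h2, one_mul]
    _ = _ := by ring

/-- A weight `|z|^α` is an exponential weight, up to the parabolic scaling factor `s^{α/2}`. -/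
lemma rpow_norm_le {s α : ℝ} (hs : 0 < s) (hα : 0 ≤ α) (hα1 : α ≤ 1) (z : Space d) :
    ‖z‖ ^ α ≤ s ^ (α / 2) * Real.exp (‖z‖ / √s) := by
  have hz : ‖z‖ = √s * (‖z‖ / √s) := by field_simp
  have h1 : (√s : ℝ) ^ α = s ^ (α / 2) := by
    rw [Real.sqrt_eq_rpow, ← Real.rpow_mul hs.le]; ring_nf
  have hζ : 0 ≤ ‖z‖ / √s := by positivity
  have h2 : (‖z‖ / √s) ^ α ≤ Real.exp (‖z‖ / √s) := by
    rcases le_total (‖z‖ / √s) 1 with h | h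
    · exact (Real.rpow_le_one hζ h hα).trans (Real.one_le_exp hζ)
    · calc (‖z‖ / √s) ^ α ≤ (‖z‖ / √s) ^ (1 : ℝ) := Real.rpow_le_rpow_of_exponent_le h hα1
        _ ≤ _ := by rw [Real.rpow_one]; linarith [Real.add_one_le_exp (‖z‖ / √s)]
  calc ‖z‖ ^ α = (√s * (‖z‖ / √s)) ^ α := by rw [← hz]
    _ = s ^ (α / 2) * (‖z‖ / √s) ^ α := by rw [Real.mul_rpow (by positivity) hζ, h1]
    _ ≤ _ := by gcongr

lemma norm_gradKernel {s : ℝ} (hs : 0 < s) (z : Space d) :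
    ‖gradKernel s z‖ = (√s)⁻¹ * (‖z‖ / √s) * heatKernel s z := by
  unfold gradKernel
  rw [norm_smul, norm_neg, Real.norm_of_nonneg (div_nonneg (heatKernel_nonneg hs.le z) hs.le)]
  have : s = √s ^ 2 := (Real.sq_sqrt hs.le).symm
  field_simp
  rw [← this]
  ring

lemma sqrt_inv_mul_rpow {s α : ℝ} (hs : 0 < s) : (√s)⁻¹ * s ^ (α / 2) = s ^ ((α - 1) / 2) := by
  rw [Real.sqrt_eq_rpow, ← Real.rpow_neg hs.le, ← Real.rpow_add hs]; ring_nf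

lemma inv_mul_rpow {s α : ℝ} (hs : 0 < s) : s⁻¹ * s ^ (α / 2) = s ^ (α / 2 - 1) := by
  rw [← Real.rpow_neg_one, ← Real.rpow_add hs]; ring_nf

/-- The gradient of the heat kernel is of order `s^{-1/2}` relative to the kernel at time `2s`; the
weight `|z|^α` improves this by the factor `s^{α/2}`. -/
lemma gradKernel_weight_le {s α : ℝ} (hs : 0 < s) (hα : 0 ≤ α) (hα1 : α ≤ 1) (z : Space d) :
    ‖gradKernel s z‖ * ‖z‖ ^ α ≤
      kernelConst d * s ^ ((α - 1) / 2) * heatKernel (2 * s) z := by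
  have h1 := rpow_norm_le hs hα hα1 z
  have h2 := heatKernel_mul_exp_le hs z (k := 2) (by norm_num) (by norm_num)
  have hK := heatKernel_nonneg hs.le z
  have hK2 := heatKernel_nonneg (d := d) (s := 2 * s) (by positivity) z
  rw [norm_gradKernel hs, ← sqrt_inv_mul_rpow hs]
  set ζ := ‖z‖ / √s with hζ
  have hζ0 : 0 ≤ ζ := by positivity
  have h3 : ζ ≤ Real.exp ζ := by linarith [Real.add_one_le_exp ζ]
  have e2 : Real.exp (2 * ζ) = Real.exp ζ * Real.exp ζ := by rw [← Real.exp_add]; ring_nf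
  calc (√s)⁻¹ * ζ * heatKernel s z * ‖z‖ ^ α
      ≤ (√s)⁻¹ * Real.exp ζ * heatKernel s z * (s ^ (α / 2) * Real.exp ζ) := by gcongr
    _ = (√s)⁻¹ * s ^ (α / 2) * (heatKernel s z * Real.exp (2 * ζ)) := by rw [e2]; ring
    _ ≤ (√s)⁻¹ * s ^ (α / 2) *
        ((2 : ℝ) ^ ((d : ℝ) / 2) * Real.exp 16 * heatKernel (2 * s) z) := by gcongr
    _ ≤ _ := by
      unfold kernelConst
      have : 0 ≤ (√s)⁻¹ * s ^ (α / 2) *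
        ((2 : ℝ) ^ ((d : ℝ) / 2) * Real.exp 16 * heatKernel (2 * s) z) := by positivity
      linarith

lemma abs_exp_sub_one_le (q : ℝ) : |Real.exp q - 1| ≤ |q| * Real.exp |q| := by
  have := Complex.norm_exp_sub_sum_le_norm_mul_exp (q : ℂ) 1
  simp only [Finset.range_one, Finset.sum_singleton, pow_zero, Nat.factorial_zero, Nat.cast_one,
    div_one, pow_one] at this
  rw [← Complex.ofReal_exp, Complex.norm_real] at this
  have h2 : ‖((Real.exp q : ℝ) : ℂ) - 1‖ = |Real.exp q - 1| := by
    rw [← Complex.ofReal_one, ← Complex.ofReal_sub, Complex.norm_real, Real.norm_eq_abs]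
  rwa [h2] at this

lemma abs_exp_sub_one_sub_le (q : ℝ) : |Real.exp q - 1 - q| ≤ |q| ^ 2 * Real.exp |q| := by
  have := Complex.norm_exp_sub_sum_le_norm_mul_exp (q : ℂ) 2
  simp only [Finset.sum_range_succ, Finset.range_one, Finset.sum_singleton, pow_zero,
    Nat.factorial_zero, Nat.cast_one, div_one, pow_one, Nat.factorial_one] at this
  rw [← Complex.ofReal_exp, Complex.norm_real] at this
  have h2 : ‖((Real.exp q : ℝ) : ℂ) - (1 + (q : ℂ))‖ = |Real.exp q - 1 - q| := by
    rw [← Complex.ofReal_one, ← Complex.ofReal_add, ← Complex.ofReal_sub, Complex.norm_real,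
      Real.norm_eq_abs, sub_sub]
  rw [h2] at this
  simpa using this

/-- The exponent `q` with `K(s,z+a) = exp q * K(s,z)`. -/
noncomputable def shiftExponent (s : ℝ) (z a : Space d) : ℝ :=
  -((2 * inner ℝ z a + ‖a‖ ^ 2) / (2 * s))

lemma heatKernel_add (s : ℝ) (z a : Space d) :
    heatKernel s (z + a) = heatKernel s z * Real.exp (shiftExponent s z a) := by
  unfold heatKernel shiftExponent
  rw [mul_assoc ((2 * Real.pi * s) ^ (-((d : ℝ) / 2))), ← Real.exp_add, norm_add_sq_real]
  ring_nf

/-- A displacement `a` with `|a| ≤ √s` changes the exponent by at most `(|a|/√s) e^{|z|/√s}`. -/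
lemma abs_shiftExponent_le {s : ℝ} (hs : 0 < s) (z a : Space d) (ha : ‖a‖ ≤ √s) :
    |shiftExponent s z a| ≤ ‖a‖ / √s * Real.exp (‖z‖ / √s) ∧
      Real.exp |shiftExponent s z a| ≤ 3 * Real.exp (‖z‖ / √s) := by
  have hσ : 0 < √s := Real.sqrt_pos.2 hs
  have hss : s = √s * √s := (Real.mul_self_sqrt hs.le).symm
  have hin := abs_real_inner_le_norm z a
  have hρ1 : ‖a‖ / √s ≤ 1 := (div_le_one hσ).2 ha
  have hρ0 : 0 ≤ ‖a‖ / √s := by positivity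
  have hb : |shiftExponent s z a| ≤ ‖a‖ / √s * (‖z‖ / √s + 1 / 2) := by
    unfold shiftExponent
    rw [abs_neg, abs_div, abs_of_pos (show 0 < 2 * s by positivity), div_le_iff₀ (by positivity)]
    calc |2 * inner ℝ z a + ‖a‖ ^ 2| ≤ 2 * |inner ℝ z a| + ‖a‖ ^ 2 := by
          refine (abs_add_le _ _).trans ?_
          rw [abs_mul, abs_of_pos (show (0 : ℝ) < 2 by norm_num), abs_of_nonneg (sq_nonneg ‖a‖)]
      _ ≤ 2 * (‖z‖ * ‖a‖) + ‖a‖ * √s := by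
          rw [pow_two]
          gcongr
      _ = ‖a‖ / √s * (‖z‖ / √s + 1 / 2) * (2 * (√s * √s)) := by field_simp
      _ = _ := by rw [← hss]
  have hζ0 : 0 ≤ ‖z‖ / √s := by positivity
  have he := Real.add_one_le_exp (‖z‖ / √s)
  constructor
  · refine hb.trans ?_
    gcongr
    linarith
  · have h1 : |shiftExponent s z a| ≤ ‖z‖ / √s + 1 := by
      refine hb.trans ?_
      nlinarith
    calc Real.exp |shiftExponent s z a| ≤ Real.exp (‖z‖ / √s + 1) := Real.exp_le_exp.2 h1
      _ = Real.exp 1 * Real.exp (‖z‖ / √s) := by rw [Real.exp_add]; ring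
      _ ≤ _ := by
        gcongr
        have := Real.exp_one_lt_d9
        linarith

/-- Lipschitz bound for the gradient of the heat kernel under displacements `|a| ≤ √s`. -/
lemma gradKernel_sub_weight_le {s α : ℝ} (hs : 0 < s) (hα : 0 ≤ α) (hα1 : α ≤ 1) (z a : Space d)
    (ha : ‖a‖ ≤ √s) :
    ‖gradKernel s (z + a) - gradKernel s z‖ * ‖z‖ ^ α ≤
      kernelConst d * (‖a‖ * s ^ (α / 2 - 1)) * heatKernel (2 * s) z := by
  obtain ⟨hq, hE⟩ := abs_shiftExponent_le hs z a ha
  have hw := rpow_norm_le hs hα hα1 z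
  have h2 := heatKernel_mul_exp_le hs z (k := 4) (by norm_num) (by norm_num)
  have hK := heatKernel_nonneg hs.le z
  have hσ : 0 < √s := Real.sqrt_pos.2 hs
  set q := shiftExponent s z a with hqdef
  set ζ := ‖z‖ / √s with hζ
  have hζ0 : 0 ≤ ζ := by positivity
  have h3 : ζ ≤ Real.exp ζ := by linarith [Real.add_one_le_exp ζ]
  have h4 : (1 : ℝ) ≤ Real.exp ζ := Real.one_le_exp hζ0
  have hz : ‖z‖ = √s * ζ := by rw [hζ]; field_simp
  have hss : √s * √s = s := Real.mul_self_sqrt hs.le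
  have hid : gradKernel s (z + a) - gradKernel s z =
      (-(heatKernel s z / s * (Real.exp q - 1))) • z +
        (-(heatKernel s z / s * Real.exp q)) • a := by
    unfold gradKernel
    rw [heatKernel_add]
    module
  have hqe : Real.exp q ≤ Real.exp |q| := Real.exp_le_exp.2 (le_abs_self q)
  have hnorm : ‖gradKernel s (z + a) - gradKernel s z‖ ≤
      heatKernel s z / s * (‖a‖ * (6 * (Real.exp ζ * Real.exp ζ * Real.exp ζ))) := by
    rw [hid]
    refine (norm_add_le _ _).trans ?_
    rw [norm_smul, norm_smul, norm_neg, norm_neg, norm_mul, norm_mul,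
      Real.norm_of_nonneg (div_nonneg hK hs.le), Real.norm_eq_abs, Real.norm_eq_abs,
      abs_of_pos (Real.exp_pos q)]
    have e1 : |Real.exp q - 1| * ‖z‖ ≤ ‖a‖ * (3 * (Real.exp ζ * Real.exp ζ * Real.exp ζ)) := by
      calc |Real.exp q - 1| * ‖z‖ ≤ (|q| * Real.exp |q|) * ‖z‖ := by
            gcongr; exact abs_exp_sub_one_le q
        _ ≤ ((‖a‖ / √s * Real.exp ζ) * (3 * Real.exp ζ)) * (√s * Real.exp ζ) := by
            rw [hz]; gcongr
        _ = _ := by field_simp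
    have e2 : Real.exp q * ‖a‖ ≤ ‖a‖ * (3 * (Real.exp ζ * Real.exp ζ * Real.exp ζ)) := by
      have : Real.exp q ≤ 3 * (Real.exp ζ * Real.exp ζ * Real.exp ζ) := by
        refine (hqe.trans hE).trans ?_
        have : Real.exp ζ ≤ Real.exp ζ * Real.exp ζ * Real.exp ζ := by
          nlinarith [mul_self_nonneg (Real.exp ζ)]
        linarith
      rw [mul_comm]; gcongr
    have hKs : 0 ≤ heatKernel s z / s := div_nonneg hK hs.le
    calc _ = heatKernel s z / s * (|Real.exp q - 1| * ‖z‖ + Real.exp q * ‖a‖) := by ring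
      _ ≤ heatKernel s z / s * (‖a‖ * (3 * (Real.exp ζ * Real.exp ζ * Real.exp ζ)) +
          ‖a‖ * (3 * (Real.exp ζ * Real.exp ζ * Real.exp ζ))) := by gcongr
      _ = _ := by ring
  have e4 : Real.exp (4 * ζ) = Real.exp ζ * Real.exp ζ * Real.exp ζ * Real.exp ζ := by
    rw [← Real.exp_add, ← Real.exp_add, ← Real.exp_add]; ring_nf
  calc _ ≤ heatKernel s z / s * (‖a‖ * (6 * (Real.exp ζ * Real.exp ζ * Real.exp ζ))) *
        (s ^ (α / 2) * Real.exp ζ) := by gcongr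
    _ = 6 * ‖a‖ * (s⁻¹ * s ^ (α / 2)) * (heatKernel s z * Real.exp (4 * ζ)) := by
        rw [e4]; ring
    _ ≤ 6 * ‖a‖ * (s⁻¹ * s ^ (α / 2)) *
        ((2 : ℝ) ^ ((d : ℝ) / 2) * Real.exp 16 * heatKernel (2 * s) z) := by gcongr
    _ = _ := by rw [inv_mul_rpow hs, kernelConst]; ring

/-- Second order Taylor bound for the heat kernel under displacements `|a| ≤ √s`. -/
lemma heatKernel_taylor_weight_le {s α : ℝ} (hs : 0 < s) (hα : 0 ≤ α) (hα1 : α ≤ 1)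
    (z a : Space d) (ha : ‖a‖ ≤ √s) :
    |heatKernel s (z + a) - heatKernel s z - inner ℝ (gradKernel s z) a| * ‖z‖ ^ α ≤
      kernelConst d * (‖a‖ ^ 2 * s ^ (α / 2 - 1)) * heatKernel (2 * s) z := by
  obtain ⟨hq, hE⟩ := abs_shiftExponent_le hs z a ha
  have hw := rpow_norm_le hs hα hα1 z
  have h2 := heatKernel_mul_exp_le hs z (k := 4) (by norm_num) (by norm_num)
  have hK := heatKernel_nonneg hs.le z
  have hσ : 0 < √s := Real.sqrt_pos.2 hs
  have hid : heatKernel s (z + a) - heatKernel s z - inner ℝ (gradKernel s z) a =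
      heatKernel s z * ((Real.exp (shiftExponent s z a) - 1 - shiftExponent s z a) -
        ‖a‖ ^ 2 / (2 * s)) := by
    rw [heatKernel_add, gradKernel, inner_smul_left]
    unfold shiftExponent
    simp only [map_neg, conj_trivial]
    field_simp
    ring
  set q := shiftExponent s z a with hqdef
  set ζ := ‖z‖ / √s with hζ
  have hζ0 : 0 ≤ ζ := by positivity
  have h4 : (1 : ℝ) ≤ Real.exp ζ := Real.one_le_exp hζ0
  have hss : √s ^ 2 = s := Real.sq_sqrt hs.le
  have h5 : |(Real.exp q - 1 - q) - ‖a‖ ^ 2 / (2 * s)| ≤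
      ‖a‖ ^ 2 / s * (6 * (Real.exp ζ * Real.exp ζ * Real.exp ζ)) := by
    refine (abs_sub _ _).trans ?_
    rw [abs_of_nonneg (show 0 ≤ ‖a‖ ^ 2 / (2 * s) by positivity)]
    have e1 : |Real.exp q - 1 - q| ≤
        ‖a‖ ^ 2 / s * (3 * (Real.exp ζ * Real.exp ζ * Real.exp ζ)) := by
      calc _ ≤ |q| ^ 2 * Real.exp |q| := abs_exp_sub_one_sub_le q
        _ ≤ (‖a‖ / √s * Real.exp ζ) ^ 2 * (3 * Real.exp ζ) := by gcongr
        _ = ‖a‖ ^ 2 / √s ^ 2 * (3 * (Real.exp ζ * Real.exp ζ * Real.exp ζ)) := by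
          rw [mul_pow, div_pow]; ring
        _ = _ := by rw [hss]
    have h6 : (1 : ℝ) ≤ Real.exp ζ * Real.exp ζ * Real.exp ζ := by
      nlinarith [mul_self_nonneg (Real.exp ζ), mul_le_mul h4 h4 (by norm_num) (by positivity)]
    have e2 : ‖a‖ ^ 2 / (2 * s) ≤ ‖a‖ ^ 2 / s * (3 * (Real.exp ζ * Real.exp ζ * Real.exp ζ)) := by
      have : ‖a‖ ^ 2 / (2 * s) = ‖a‖ ^ 2 / s * (1 / 2) := by field_simp
      rw [this]
      gcongr
      linarith
    linarith
  have e4 : Real.exp (4 * ζ) = Real.exp ζ * Real.exp ζ * Real.exp ζ * Real.exp ζ := by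
    rw [← Real.exp_add, ← Real.exp_add, ← Real.exp_add]; ring_nf
  rw [hid, abs_mul, abs_of_nonneg hK]
  calc _ ≤ heatKernel s z * (‖a‖ ^ 2 / s * (6 * (Real.exp ζ * Real.exp ζ * Real.exp ζ))) *
        (s ^ (α / 2) * Real.exp ζ) := by gcongr
    _ = 6 * ‖a‖ ^ 2 * (s⁻¹ * s ^ (α / 2)) * (heatKernel s z * Real.exp (4 * ζ)) := by
        rw [e4]; ring
    _ ≤ 6 * ‖a‖ ^ 2 * (s⁻¹ * s ^ (α / 2)) *
        ((2 : ℝ) ^ ((d : ℝ) / 2) * Real.exp 16 * heatKernel (2 * s) z) := by gcongr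
    _ = _ := by rw [inv_mul_rpow hs, kernelConst]; ring

lemma integral_heatKernel {s : ℝ} (hs : 0 < s) : ∫ z : Space d, heatKernel s z = 1 := by
  unfold heatKernel
  rw [integral_const_mul]
  have := GaussianFourier.integral_rexp_neg_mul_sq_norm (V := Space d)
    (b := 1 / (2 * s)) (by positivity)
  have h2 : (fun z : Space d => Real.exp (-(‖z‖ ^ 2 / (2 * s)))) =
      fun z => Real.exp (-(1 / (2 * s)) * ‖z‖ ^ 2) := by
    ext z; ring_nf
  rw [h2, this]
  simp only [finrank_euclideanSpace, Fintype.card_fin]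
  have : Real.pi / (1 / (2 * s)) = 2 * Real.pi * s := by field_simp
  rw [this, ← Real.rpow_add (by positivity)]
  simp

lemma integrable_heatKernel {s : ℝ} (hs : 0 < s) :
    Integrable (fun z : Space d => heatKernel s z) := by
  apply Integrable.of_integral_ne_zero
  rw [integral_heatKernel hs]
  exact one_ne_zero

lemma lintegral_heatKernel {s : ℝ} (hs : 0 < s) :
    ∫⁻ z : Space d, ENNReal.ofReal (heatKernel s z) = 1 := by
  rw [← ofReal_integral_eq_lintegral_ofReal (integrable_heatKernel hs)
    (Eventually.of_forall fun z => heatKernel_nonneg hs.le z), integral_heatKernel hs,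
    ENNReal.ofReal_one]

/-- A function dominated pointwise by a multiple of a heat kernel has the same integral bound. -/
lemma lintegral_le_of_le_heatKernel {E : Type*} [NormedAddCommGroup E] {s C : ℝ} (hs : 0 < s)
    (hC : 0 ≤ C) {g : Space d → E} {w : Space d → ℝ}
    (h : ∀ z, ‖g z‖ * w z ≤ C * heatKernel s z) :
    ∫⁻ z, ‖g z‖ₑ * ENNReal.ofReal (w z) ≤ ENNReal.ofReal C := by
  calc ∫⁻ z, ‖g z‖ₑ * ENNReal.ofReal (w z)
      ≤ ∫⁻ z, ENNReal.ofReal C * ENNReal.ofReal (heatKernel s z) := by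
        apply lintegral_mono
        intro z
        dsimp only
        rw [← ofReal_norm, ← ENNReal.ofReal_mul (norm_nonneg _), ← ENNReal.ofReal_mul hC]
        exact ENNReal.ofReal_le_ofReal (h z)
    _ = _ := by
        rw [lintegral_const_mul' _ _ ENNReal.ofReal_ne_top, lintegral_heatKernel hs, mul_one]

lemma heatKernel_le_two_mul {s s' : ℝ} (hs : 0 < s) (h1 : s ≤ s') (h2 : s' ≤ 2 * s)
    (z : Space d) : heatKernel s' z ≤ (2 : ℝ) ^ ((d : ℝ) / 2) * heatKernel (2 * s) z := by
  have hs' : 0 < s' := hs.trans_le h1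
  unfold heatKernel
  have e1 : (2 * Real.pi * (2 * s)) ^ (-((d : ℝ) / 2)) =
      (2 : ℝ) ^ (-((d : ℝ) / 2)) * (2 * Real.pi * s) ^ (-((d : ℝ) / 2)) := by
    rw [← Real.mul_rpow (by norm_num) (by positivity)]; ring_nf
  have e2 : (2 : ℝ) ^ ((d : ℝ) / 2) * (2 : ℝ) ^ (-((d : ℝ) / 2)) = 1 := by
    rw [← Real.rpow_add (by norm_num)]; simp
  rw [e1]
  calc _ ≤ (2 * Real.pi * s) ^ (-((d : ℝ) / 2)) * Real.exp (-(‖z‖ ^ 2 / (2 * (2 * s)))) := by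
        have h3 : (2 * Real.pi * s') ^ (-((d : ℝ) / 2)) ≤ (2 * Real.pi * s) ^ (-((d : ℝ) / 2)) := by
          apply Real.rpow_le_rpow_of_nonpos (by positivity) (by gcongr)
          simp only [Left.neg_nonpos_iff]; positivity
        gcongr
    _ = ((2 : ℝ) ^ ((d : ℝ) / 2) * (2 : ℝ) ^ (-((d : ℝ) / 2))) * ((2 * Real.pi * s) ^
        (-((d : ℝ) / 2)) * Real.exp (-(‖z‖ ^ 2 / (2 * (2 * s))))) := by rw [e2, one_mul]
    _ = _ := by ring

/-- The constant in the bound for time increments of the heat kernel. -/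
noncomputable def timeConst (d : ℕ) : ℝ :=
  2 * (d + 2) * (2 : ℝ) ^ ((d : ℝ) / 2) * kernelConst d

lemma timeConst_pos (d : ℕ) : 0 < timeConst d := by
  have := kernelConst_pos d
  unfold timeConst; positivity

lemma two_le_timeConst (d : ℕ) : 2 ≤ timeConst d := by
  have h1 : (1 : ℝ) ≤ (2 : ℝ) ^ ((d : ℝ) / 2) := Real.one_le_rpow (by norm_num) (by positivity)
  have h2 := one_le_kernelConst d
  have h3 : (2 : ℝ) ≤ 2 * (d + 2) := by have : (0 : ℝ) ≤ d := by positivity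
                                        linarith
  unfold timeConst
  calc (2 : ℝ) = 2 * 1 * 1 := by norm_num
    _ ≤ _ := by gcongr

/-- Time increments of the heat kernel, of length at most the elapsed time. -/
lemma heatKernel_time_sub_le {s δ : ℝ} (hs : 0 < s) (hδ : 0 ≤ δ) (hδs : δ ≤ s) (z : Space d) :
    |heatKernel (s + δ) z - heatKernel s z| ≤
      timeConst d * (δ / s) * heatKernel (4 * s) z := by
  set q : ℝ := -((d : ℝ) / 2) * Real.log (1 + δ / s) + ‖z‖ ^ 2 / (2 * s) - ‖z‖ ^ 2 / (2 * (s + δ))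
    with hq
  have hsd : 0 < s + δ := by linarith
  have hu : 0 ≤ δ / s := by positivity
  -- the ratio of the two kernels is `exp q`, where `q` is of order `δ/s * (d + |z|²/s)`
  have hid : heatKernel (s + δ) z = heatKernel s z * Real.exp q := by
    unfold heatKernel
    have e1 : (2 * Real.pi * (s + δ)) = (2 * Real.pi * s) * (1 + δ / s) := by field_simp
    rw [e1, Real.mul_rpow (by positivity) (by positivity),
      Real.rpow_def_of_pos (show 0 < 1 + δ / s by positivity),
      mul_assoc ((2 * Real.pi * s) ^ (-((d : ℝ) / 2))),
      mul_assoc ((2 * Real.pi * s) ^ (-((d : ℝ) / 2))), ← Real.exp_add, ← Real.exp_add, hq]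
    congr 2
    ring
  have hqabs : |q| ≤ (δ / s) * ((d : ℝ) + ‖z‖ ^ 2 / s) := by
    have hlog0 : 0 ≤ Real.log (1 + δ / s) := Real.log_nonneg (by linarith)
    have hlog1 : Real.log (1 + δ / s) ≤ δ / s := by
      have := Real.log_le_sub_one_of_pos (show 0 < 1 + δ / s by positivity)
      linarith
    have e2 : ‖z‖ ^ 2 / (2 * s) - ‖z‖ ^ 2 / (2 * (s + δ)) =
        (δ / s) * (‖z‖ ^ 2 / (2 * (s + δ))) := by field_simp; ring
    have e3 : ‖z‖ ^ 2 / (2 * (s + δ)) ≤ ‖z‖ ^ 2 / s := by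
      apply div_le_div_of_nonneg_left (by positivity) hs; linarith
    have e4 : 0 ≤ ‖z‖ ^ 2 / (2 * (s + δ)) := by positivity
    have hd : (0 : ℝ) ≤ d := by positivity
    have e5 : q = -((d : ℝ) / 2) * Real.log (1 + δ / s) +
      (δ / s) * (‖z‖ ^ 2 / (2 * (s + δ))) := by rw [hq, ← e2]; ring
    rw [e5]
    have a1 : (d : ℝ) / 2 * Real.log (1 + δ / s) ≤ d * (δ / s) := by
      have := mul_le_mul_of_nonneg_left hlog1 hd
      have := mul_nonneg hd hlog0
      linarith
    have a2 : 0 ≤ (d : ℝ) / 2 * Real.log (1 + δ / s) := by positivity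
    have a3 := mul_le_mul_of_nonneg_left e3 hu
    have a4 := mul_nonneg hu e4
    rw [abs_le]
    constructor <;> nlinarith
  have hexp : |Real.exp q - 1| ≤ |q| * (1 + Real.exp q) := by
    rcases le_total 0 q with h | h
    · rw [abs_of_nonneg (by linarith [Real.add_one_le_exp q]), abs_of_nonneg h]
      have h1 : Real.exp q * (1 - q) ≤ 1 := by
        calc _ ≤ Real.exp q * Real.exp (-q) := by
              gcongr; linarith [Real.add_one_le_exp (-q)]
          _ = 1 := by rw [← Real.exp_add]; simp
      nlinarith [Real.exp_pos q]
    · rw [abs_of_nonpos (by linarith [Real.exp_le_one_iff.2 h]), abs_of_nonpos h]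
      nlinarith [Real.exp_pos q, Real.add_one_le_exp q]
  have hK := heatKernel_nonneg hs.le z
  have hK2 := heatKernel_nonneg (d := d) (s := 2 * s) (by positivity) z
  have hK4 := heatKernel_nonneg (d := d) (s := 4 * s) (by positivity) z
  have b1 := heatKernel_le_two_mul hs le_rfl (by linarith) z
  have b2 := heatKernel_le_two_mul hs (show s ≤ s + δ by linarith) (by linarith) z
  -- the factor `1 + |z|²/s` costs another dilation of the time variable
  have b3 : heatKernel (2 * s) z * (1 + ‖z‖ ^ 2 / s) ≤
      2 * (kernelConst d * heatKernel (4 * s) z) := by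
    have h2 := heatKernel_mul_exp_le (show 0 < 2 * s by positivity) z (k := 2)
      (by norm_num) (by norm_num)
    set ζ := ‖z‖ / √(2 * s) with hζ
    have hζ2 : ‖z‖ ^ 2 / s = 2 * ζ ^ 2 := by
      rw [hζ, div_pow, Real.sq_sqrt (by positivity)]; field_simp
    have hζ0 : 0 ≤ ζ := by positivity
    have he : 1 + 2 * ζ ^ 2 ≤ 2 * Real.exp (2 * ζ) := by
      have : Real.exp (2 * ζ) = Real.exp ζ ^ 2 := by rw [← Real.exp_nat_mul]; norm_num
      rw [this]
      nlinarith [Real.add_one_le_exp ζ]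
    rw [hζ2]
    calc _ ≤ heatKernel (2 * s) z * (2 * Real.exp (2 * ζ)) := by gcongr
      _ = 2 * (heatKernel (2 * s) z * Real.exp (2 * ζ)) := by ring
      _ ≤ 2 * ((2 : ℝ) ^ ((d : ℝ) / 2) * Real.exp 16 * heatKernel (2 * (2 * s)) z) := by gcongr
      _ ≤ _ := by
        have e : 2 * (2 * s) = 4 * s := by ring
        rw [e, kernelConst]
        have : 0 ≤ (2 : ℝ) ^ ((d : ℝ) / 2) * Real.exp 16 * heatKernel (4 * s) z := by positivity
        linarith
  have hkc := kernelConst_pos d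
  have hd : (0 : ℝ) ≤ d := by positivity
  have hz0 : 0 ≤ ‖z‖ ^ 2 / s := by positivity
  calc |heatKernel (s + δ) z - heatKernel s z|
      = heatKernel s z * |Real.exp q - 1| := by
        rw [hid, ← abs_of_nonneg hK, ← abs_mul, abs_of_nonneg hK]; ring_nf
    _ ≤ heatKernel s z * (|q| * (1 + Real.exp q)) := by gcongr
    _ = |q| * (heatKernel s z + heatKernel (s + δ) z) := by rw [hid]; ring
    _ ≤ ((δ / s) * ((d : ℝ) + ‖z‖ ^ 2 / s)) * ((2 : ℝ) ^ ((d : ℝ) / 2) * heatKernel (2 * s) z +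
        (2 : ℝ) ^ ((d : ℝ) / 2) * heatKernel (2 * s) z) := by
        have := heatKernel_nonneg hsd.le z
        gcongr
    _ = 2 * (2 : ℝ) ^ ((d : ℝ) / 2) * (δ / s) *
        (((d : ℝ) + ‖z‖ ^ 2 / s) * heatKernel (2 * s) z) := by ring
    _ ≤ 2 * (2 : ℝ) ^ ((d : ℝ) / 2) * (δ / s) *
        (((d : ℝ) + 2) * (kernelConst d * heatKernel (4 * s) z)) := by
        gcongr ?_ * ?_
        have c1 : heatKernel (2 * s) z ≤ kernelConst d * heatKernel (4 * s) z := by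
          have := heatKernel_le_two_mul (show 0 < 2 * s by positivity) le_rfl (by linarith) z
          have e : 2 * (2 * s) = 4 * s := by ring
          rw [e] at this
          refine this.trans ?_
          gcongr
          unfold kernelConst
          have : (1 : ℝ) ≤ Real.exp 16 := Real.one_le_exp (by norm_num)
          have : 0 < (2 : ℝ) ^ ((d : ℝ) / 2) := by positivity
          nlinarith
        nlinarith [mul_le_mul_of_nonneg_left c1 hd]
    _ = _ := by unfold timeConst; ring

/-! ### Integrated kernel bounds -/

/-- `∫ ‖∇K(s,z)‖ |z|^α dz ≤ C s^{(α-1)/2}`. -/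
lemma lintegral_gradKernel_weight_le {s α : ℝ} (hs : 0 < s) (hα : 0 ≤ α) (hα1 : α ≤ 1) :
    ∫⁻ z : Space d, ‖gradKernel s z‖ₑ * ENNReal.ofReal (‖z‖ ^ α) ≤
      ENNReal.ofReal (kernelConst d * s ^ ((α - 1) / 2)) := by
  have := kernelConst_pos d
  exact lintegral_le_of_le_heatKernel (show 0 < 2 * s by positivity) (by positivity)
    (fun z => gradKernel_weight_le hs hα hα1 z)

lemma lintegral_gradKernel_sub_weight_le {s α : ℝ} (hs : 0 < s) (hα : 0 ≤ α) (hα1 : α ≤ 1)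
    (a : Space d) (ha : ‖a‖ ≤ √s) :
    ∫⁻ z : Space d, ‖gradKernel s (z + a) - gradKernel s z‖ₑ * ENNReal.ofReal (‖z‖ ^ α) ≤
      ENNReal.ofReal (kernelConst d * (‖a‖ * s ^ (α / 2 - 1))) := by
  have := kernelConst_pos d
  exact lintegral_le_of_le_heatKernel (show 0 < 2 * s by positivity) (by positivity)
    (fun z => gradKernel_sub_weight_le hs hα hα1 z a ha)

lemma lintegral_heatKernel_taylor_weight_le {s α : ℝ} (hs : 0 < s) (hα : 0 ≤ α) (hα1 : α ≤ 1)
    (a : Space d) (ha : ‖a‖ ≤ √s) :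
    ∫⁻ z : Space d, ‖heatKernel s (z + a) - heatKernel s z - inner ℝ (gradKernel s z) a‖ₑ *
        ENNReal.ofReal (‖z‖ ^ α) ≤
      ENNReal.ofReal (kernelConst d * (‖a‖ ^ 2 * s ^ (α / 2 - 1))) := by
  have := kernelConst_pos d
  exact lintegral_le_of_le_heatKernel (show 0 < 2 * s by positivity) (by positivity)
    (fun z => heatKernel_taylor_weight_le hs hα hα1 z a ha)

lemma lintegral_enorm_heatKernel {s : ℝ} (hs : 0 < s) :
    ∫⁻ z : Space d, ‖heatKernel s z‖ₑ = 1 := by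
  rw [← lintegral_heatKernel hs]
  congr with z
  rw [← ofReal_norm, Real.norm_of_nonneg (heatKernel_nonneg hs.le z)]

lemma lintegral_gradKernel_le {s : ℝ} (hs : 0 < s) :
    ∫⁻ z : Space d, ‖gradKernel s z‖ₑ ≤
      ENNReal.ofReal (kernelConst d * s ^ (-(1 / 2) : ℝ)) := by
  have := lintegral_gradKernel_weight_le (d := d) hs le_rfl zero_le_one
  simp only [Real.rpow_zero, ENNReal.ofReal_one, mul_one] at this
  convert this using 4
  norm_num

/-- `∫ |K(s+δ,z) - K(s,z)| dz ≤ C (δ/s)^γ` for all exponents `γ ∈ [0,1]`. -/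
lemma lintegral_heatKernel_time_sub_le {s δ γ : ℝ} (hs : 0 < s) (hδ : 0 ≤ δ) (hγ : 0 ≤ γ)
    (hγ1 : γ ≤ 1) :
    ∫⁻ z : Space d, ‖heatKernel (s + δ) z - heatKernel s z‖ₑ ≤
      ENNReal.ofReal (timeConst d * (δ / s) ^ γ) := by
  have htc := timeConst_pos d
  rcases le_total δ s with h | h
  · have h0 : 0 ≤ δ / s := by positivity
    have h1 := lintegral_le_of_le_heatKernel (d := d) (show 0 < 4 * s by positivity)
      (C := timeConst d * (δ / s)) (by positivity) (w := fun _ => 1)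
      (g := fun z => heatKernel (s + δ) z - heatKernel s z)
      (fun z => by simpa using heatKernel_time_sub_le hs hδ h z)
    simp only [ENNReal.ofReal_one, mul_one] at h1
    refine h1.trans (ENNReal.ofReal_le_ofReal ?_)
    gcongr
    have h2 : δ / s ≤ 1 := (div_le_one hs).2 h
    exact Real.self_le_rpow_of_le_one h0 h2 hγ1
  · have h2 : 1 ≤ (δ / s) ^ γ := Real.one_le_rpow ((one_le_div hs).2 h) hγ
    calc _ ≤ ∫⁻ z : Space d, (‖heatKernel (s + δ) z‖ₑ + ‖heatKernel s z‖ₑ) :=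
          lintegral_mono fun z => enorm_sub_le
      _ = 2 := by
          rw [lintegral_add_right _ (by
            exact (measurable_heatKernel.comp (measurable_const.prodMk measurable_id)).enorm),
            lintegral_enorm_heatKernel hs, lintegral_enorm_heatKernel (by linarith)]
          norm_num
      _ = ENNReal.ofReal 2 := by simp
      _ ≤ _ := by
          apply ENNReal.ofReal_le_ofReal
          have := two_le_timeConst d
          nlinarith

end Kernel

/-! ### Minkowski's integral inequality and integral operators acting on random fields -/

section Minkowski

variable {Z Ω : Type*} {mZ : MeasurableSpace Z} {mΩ : MeasurableSpace Ω} {μ : Measure Z}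
  {P : Measure Ω}

/-- Minkowski's integral inequality `‖∫ F(z,·) dμ(z)‖_q ≤ ∫ ‖F(z,·)‖_q dμ(z)`. It follows from
Hölder's inequality for the weight `z ↦ ‖F(z,·)‖_q` and Tonelli's theorem. -/
theorem lintegral_rpow_lintegral_le [SFinite μ] [SFinite P] {q : ℝ} (hq : 1 ≤ q)
    {F : Z → Ω → ℝ≥0∞} (hF : Measurable (fun p : Z × Ω => F p.1 p.2)) :
    (∫⁻ ω, (∫⁻ z, F z ω ∂μ) ^ q ∂P) ^ (1 / q) ≤ ∫⁻ z, (∫⁻ ω, F z ω ^ q ∂P) ^ (1 / q) ∂μ := by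
  have hq0 : 0 < q := by linarith
  have hFz : ∀ z, Measurable (F z) := fun z => hF.comp measurable_prodMk_left
  set N : Z → ℝ≥0∞ := fun z => (∫⁻ ω, F z ω ^ q ∂P) ^ (1 / q) with hN
  have hNm : Measurable N := by
    have : Measurable fun z => ∫⁻ ω, F z ω ^ q ∂P :=
      Measurable.lintegral_prod_right (hF.pow_const q)
    exact this.pow_const _
  have hNq : ∀ z, ∫⁻ ω, F z ω ^ q ∂P = N z ^ q := fun z => by
    rw [hN, ← ENNReal.rpow_mul, one_div_mul_cancel hq0.ne', ENNReal.rpow_one]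
  by_cases hfin : ∫⁻ z, N z ∂μ = ∞
  · rw [hfin]; exact le_top
  have hNfin : ∀ᵐ z ∂μ, N z < ∞ := ae_lt_top hNm hfin
  rcases hq.eq_or_lt with rfl | hq1
  · simp only [ENNReal.rpow_one, one_div, inv_one, hN]
    rw [lintegral_lintegral_swap]
    exact (hF.comp measurable_swap).aemeasurable
  have hconj : q.HolderConjugate (q / (q - 1)) := Real.HolderConjugate.conjExponent hq1
  set q' := q / (q - 1) with hq'
  have hq'0 : 0 < q' := hconj.symm.pos
  have hqq' : q * (1 / q') = q - 1 := by rw [hq']; field_simp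
  -- where the weight vanishes, so does the integrand
  have hzero : ∀ᵐ ω ∂P, ∀ᵐ z ∂μ, N z = 0 → F z ω = 0 := by
    have hset : MeasurableSet {p : Z × Ω | N p.1 = 0 → F p.1 p.2 = 0} := by
      have h1 : MeasurableSet {p : Z × Ω | N p.1 = 0} :=
        (hNm.comp measurable_fst) (measurableSet_singleton 0)
      have h2 : MeasurableSet {p : Z × Ω | F p.1 p.2 = 0} := hF (measurableSet_singleton 0)
      exact h1.imp h2
    have h1 : ∀ᵐ z ∂μ, ∀ᵐ ω ∂P, N z = 0 → F z ω = 0 := by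
      refine Eventually.of_forall fun z => ?_
      by_cases hz : N z = 0
      · have h2 : ∫⁻ ω, F z ω ^ q ∂P = 0 := by rw [hNq, hz, ENNReal.zero_rpow_of_pos hq0]
        rw [lintegral_eq_zero_iff ((hFz z).pow_const q)] at h2
        filter_upwards [h2] with ω hω _
        have hω' : F z ω ^ q = 0 := hω
        rcases ENNReal.rpow_eq_zero_iff.1 hω' with h | h
        · exact h.1
        · linarith [h.2]
      · exact Eventually.of_forall fun ω h => absurd h hz
    have h2 := (Measure.ae_prod_iff_ae_ae hset).2 h1
    have hset' : MeasurableSet {p : Ω × Z | N p.2 = 0 → F p.2 p.1 = 0} := measurable_swap hset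
    have h3 : ∀ᵐ p ∂(P.prod μ), N p.2 = 0 → F p.2 p.1 = 0 := by
      rw [← Measure.prod_swap] at h2
      exact ae_of_ae_map measurable_swap.aemeasurable h2
    exact (Measure.ae_prod_iff_ae_ae hset').1 h3
  -- Hölder's inequality for `F = (F * N^{-1/q'}) * N^{1/q'}`
  have hpt : ∀ᵐ ω ∂P, (∫⁻ z, F z ω ∂μ) ^ q ≤
      (∫⁻ z, (F z ω * N z ^ (-(1 / q'))) ^ q ∂μ) * (∫⁻ z, N z ∂μ) ^ (q - 1) := by
    filter_upwards [hzero] with ω hω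
    have h1 : ∫⁻ z, F z ω ∂μ = ∫⁻ z, (F z ω * N z ^ (-(1 / q'))) * N z ^ (1 / q') ∂μ := by
      apply lintegral_congr_ae
      filter_upwards [hω, hNfin] with z hz hz2
      by_cases h0 : N z = 0
      · simp [hz h0]
      · rw [mul_assoc, ← ENNReal.rpow_add _ _ h0 hz2.ne]
        simp
    have h2 := ENNReal.lintegral_mul_le_Lp_mul_Lq μ hconj
      (f := fun z => F z ω * N z ^ (-(1 / q'))) (g := fun z => N z ^ (1 / q'))
      (((hF.comp measurable_prodMk_right).mul (hNm.pow_const _)).aemeasurable)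
      ((hNm.pow_const _).aemeasurable)
    have h3 : ∀ z, (N z ^ (1 / q')) ^ q' = N z := fun z => by
      rw [← ENNReal.rpow_mul, one_div_mul_cancel hq'0.ne', ENNReal.rpow_one]
    simp only [Pi.mul_apply, h3] at h2
    rw [h1]
    calc _ ≤ _ := ENNReal.rpow_le_rpow h2 hq0.le
      _ = _ := by
        rw [ENNReal.mul_rpow_of_nonneg _ _ hq0.le, ← ENNReal.rpow_mul, ← ENNReal.rpow_mul,
          one_div_mul_cancel hq0.ne', ENNReal.rpow_one, mul_comm (1 / q') q, hqq']
  have hmeas2 : Measurable (fun p : Z × Ω => (F p.1 p.2 * N p.1 ^ (-(1 / q'))) ^ q) :=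
    (hF.mul ((hNm.comp measurable_fst).pow_const _)).pow_const _
  have hmain : ∫⁻ ω, (∫⁻ z, F z ω ∂μ) ^ q ∂P ≤ (∫⁻ z, N z ∂μ) ^ q := by
    calc _ ≤ ∫⁻ ω, (∫⁻ z, (F z ω * N z ^ (-(1 / q'))) ^ q ∂μ) * (∫⁻ z, N z ∂μ) ^ (q - 1) ∂P :=
          lintegral_mono_ae hpt
      _ = (∫⁻ ω, (∫⁻ z, (F z ω * N z ^ (-(1 / q'))) ^ q ∂μ) ∂P) * (∫⁻ z, N z ∂μ) ^ (q - 1) := by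
          rw [lintegral_mul_const' _ _ (ENNReal.rpow_ne_top_of_nonneg (by linarith) hfin)]
      _ = (∫⁻ z, (∫⁻ ω, (F z ω * N z ^ (-(1 / q'))) ^ q ∂P) ∂μ) * (∫⁻ z, N z ∂μ) ^ (q - 1) := by
          rw [lintegral_lintegral_swap]
          exact (hmeas2.comp measurable_swap).aemeasurable
      _ = (∫⁻ z, N z ∂μ) * (∫⁻ z, N z ∂μ) ^ (q - 1) := by
          congr 1
          apply lintegral_congr_ae
          filter_upwards [hNfin] with z hz
          have h1 : ∀ ω, (F z ω * N z ^ (-(1 / q'))) ^ q = F z ω ^ q * N z ^ (-(q - 1)) := by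
            intro ω
            rw [ENNReal.mul_rpow_of_nonneg _ _ hq0.le, ← ENNReal.rpow_mul]
            congr 2
            rw [← hqq']; ring
          simp_rw [h1]
          rw [lintegral_mul_const _ ((hFz z).pow_const q), hNq]
          by_cases h0 : N z = 0
          · rw [h0, ENNReal.zero_rpow_of_pos hq0, zero_mul]
          · rw [← ENNReal.rpow_add _ _ h0 hz.ne]
            simp
      _ = _ := by
          by_cases h0 : ∫⁻ z, N z ∂μ = 0
          · rw [h0, zero_mul, ENNReal.zero_rpow_of_pos hq0]
          · nth_rw 1 [← ENNReal.rpow_one (∫⁻ z, N z ∂μ)]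
            rw [← ENNReal.rpow_add _ _ h0 hfin]
            simp
  calc _ ≤ ((∫⁻ z, N z ∂μ) ^ q) ^ (1 / q) := by gcongr
    _ = _ := by rw [← ENNReal.rpow_mul, mul_one_div_cancel hq0.ne', ENNReal.rpow_one]

lemma eLpNorm_ofReal_eq {E : Type*} [NormedAddCommGroup E] {X : Ω → E} {q : ℝ} (hq : 0 < q) :
    eLpNorm X (ENNReal.ofReal q) P = (∫⁻ ω, ‖X ω‖ₑ ^ q ∂P) ^ (1 / q) := by
  rw [eLpNorm_eq_lintegral_rpow_enorm_toReal (by simpa using hq) ENNReal.ofReal_ne_top,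
    ENNReal.toReal_ofReal hq.le]

variable {E : Type*} [NormedAddCommGroup E] [NormedSpace ℝ E] [MeasurableSpace E] [BorelSpace E]
  [SecondCountableTopology E]

/-- The integral operator with kernel `κ`, applied to the random field `φ`. -/
noncomputable def kerInt (μ : Measure Z) (κ : Z → E) (φ : Z → Ω → ℝ) (ω : Ω) : E :=
  ∫ z, φ z ω • κ z ∂μ

lemma eLpNorm_lintegral_kernel_le [SFinite μ] [SFinite P] {q : ℝ} (hq : 1 ≤ q) {κ : Z → E}
    (hκ : Measurable κ) {φ : Z → Ω → ℝ} (hφ : Measurable (fun p : Z × Ω => φ p.1 p.2)) :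
    (∫⁻ ω, (∫⁻ z, ‖φ z ω • κ z‖ₑ ∂μ) ^ q ∂P) ^ (1 / q) ≤
      ∫⁻ z, ‖κ z‖ₑ * eLpNorm (φ z) (ENNReal.ofReal q) P ∂μ := by
  have hq0 : 0 < q := by linarith
  refine (lintegral_rpow_lintegral_le hq (μ := μ) (P := P) (F := fun z ω => ‖φ z ω • κ z‖ₑ)
    (hφ.smul (hκ.comp measurable_fst)).enorm).trans (le_of_eq ?_)
  congr with z
  rw [eLpNorm_ofReal_eq hq0]
  simp_rw [enorm_smul, ENNReal.mul_rpow_of_nonneg _ _ hq0.le]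
  have hφz : Measurable (φ z) := hφ.comp measurable_prodMk_left
  rw [lintegral_mul_const _ (hφz.enorm.pow_const q),
    ENNReal.mul_rpow_of_nonneg _ _ (by positivity), ← ENNReal.rpow_mul,
    mul_one_div_cancel hq0.ne', ENNReal.rpow_one, mul_comm]

/-- Minkowski's integral inequality for the operator with kernel `κ`. -/
lemma eLpNorm_kerInt_le [SFinite μ] [SFinite P] {q : ℝ} (hq : 1 ≤ q) {κ : Z → E}
    (hκ : Measurable κ) {φ : Z → Ω → ℝ} (hφ : Measurable (fun p : Z × Ω => φ p.1 p.2)) :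
    eLpNorm (kerInt μ κ φ) (ENNReal.ofReal q) P ≤
      ∫⁻ z, ‖κ z‖ₑ * eLpNorm (φ z) (ENNReal.ofReal q) P ∂μ := by
  have hq0 : 0 < q := by linarith
  refine le_trans ?_ (eLpNorm_lintegral_kernel_le hq hκ hφ)
  rw [eLpNorm_ofReal_eq hq0]
  gcongr with ω
  exact enorm_integral_le_lintegral_enorm _

/-- The integral defining `kerInt` converges absolutely, almost surely. -/
lemma ae_integrable_kernel [SFinite μ] [SFinite P] {q : ℝ} (hq : 1 ≤ q) {κ : Z → E}
    (hκ : Measurable κ) {φ : Z → Ω → ℝ} (hφ : Measurable (fun p : Z × Ω => φ p.1 p.2))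
    (hfin : ∫⁻ z, ‖κ z‖ₑ * eLpNorm (φ z) (ENNReal.ofReal q) P ∂μ < ∞) :
    ∀ᵐ ω ∂P, Integrable (fun z => φ z ω • κ z) μ := by
  have hq0 : 0 < q := by linarith
  have h1 := (eLpNorm_lintegral_kernel_le hq hκ hφ).trans_lt hfin
  have hm : Measurable (fun p : Z × Ω => φ p.1 p.2 • κ p.1) := hφ.smul (hκ.comp measurable_fst)
  have hm2 : Measurable fun ω => ∫⁻ z, ‖φ z ω • κ z‖ₑ ∂μ :=
    Measurable.lintegral_prod_left hm.enorm
  have h2 : ∫⁻ ω, (∫⁻ z, ‖φ z ω • κ z‖ₑ ∂μ) ^ q ∂P ≠ ∞ := by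
    intro h
    rw [h, ENNReal.top_rpow_of_pos (by positivity)] at h1
    exact lt_irrefl _ h1
  filter_upwards [ae_lt_top (hm2.pow_const q) h2] with ω hω
  refine ⟨(hm.comp measurable_prodMk_right).aestronglyMeasurable, ?_⟩
  exact (ENNReal.rpow_lt_top_iff_of_pos hq0).1 hω

end Minkowski

section KernelFamilies

variable {d : ℕ}

/-! ### Kernel differences of all displacements -/

/-- The increment `z ↦ ∇K(s,z+a) - ∇K(s,z)`. -/
noncomputable def gradShift (a : Space d) (s : ℝ) (z : Space d) : Space d :=
  gradKernel s (z + a) - gradKernel s z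

/-- The first order Taylor remainder `z ↦ K(s,z+a) - K(s,z) - ∇K(s,z) · a`. -/
noncomputable def taylorKernel (a : Space d) (s : ℝ) (z : Space d) : ℝ :=
  heatKernel s (z + a) - heatKernel s z - inner ℝ (gradKernel s z) a

lemma measurable_gradShift (a : Space d) :
    Measurable (fun q : ℝ × Space d => gradShift a q.1 q.2) :=
  (measurable_gradKernel.comp (measurable_fst.prodMk (measurable_snd.add_const a))).sub
    measurable_gradKernel

lemma measurable_taylorKernel (a : Space d) :
    Measurable (fun q : ℝ × Space d => taylorKernel a q.1 q.2) :=
  ((measurable_heatKernel.comp (measurable_fst.prodMk (measurable_snd.add_const a))).sub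
    measurable_heatKernel).sub (measurable_gradKernel.inner measurable_const)

lemma measurable_heatKernel_right (s : ℝ) : Measurable (fun z : Space d => heatKernel s z) :=
  measurable_heatKernel.comp measurable_prodMk_left

lemma measurable_gradKernel_right (s : ℝ) : Measurable (fun z : Space d => gradKernel s z) := by
  unfold gradKernel
  exact ((measurable_heatKernel_right s).div_const s).neg.smul measurable_id

/-- The change from the scale-invariant ratio `|a|/√s` to powers of `|a|` and `s`. -/
lemma div_sqrt_rpow_mul {s : ℝ} (hs : 0 < s) (a : Space d) (e η : ℝ) :
    (‖a‖ / √s) ^ e * s ^ η = ‖a‖ ^ e * s ^ (η - e / 2) := by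
  rw [Real.div_rpow (norm_nonneg _) (Real.sqrt_nonneg _), Real.sqrt_eq_rpow, ← Real.rpow_mul hs.le,
    Real.rpow_sub hs]
  field_simp

lemma integrable_gradKernel {s : ℝ} (hs : 0 < s) :
    Integrable (fun z : Space d => gradKernel s z) :=
  ⟨(measurable_gradKernel_right s).aestronglyMeasurable,
    (lintegral_gradKernel_le hs).trans_lt ENNReal.ofReal_lt_top⟩

/-- The gradient of the heat kernel has mean zero, being odd. -/
lemma integral_gradKernel {s : ℝ} : ∫ z : Space d, gradKernel s z = 0 := by
  have h := integral_neg_eq_self (fun z : Space d => gradKernel s z) volume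
  simp only [gradKernel_neg, integral_neg] at h
  have h2 : (2 : ℝ) • ∫ z : Space d, gradKernel s z = 0 := by
    rw [two_smul]; nth_rw 1 [← h]; exact neg_add_cancel _
  exact (smul_eq_zero.1 h2).resolve_left two_ne_zero

lemma integrable_gradShift {s : ℝ} (hs : 0 < s) (a : Space d) :
    Integrable (gradShift a s) :=
  ((integrable_gradKernel hs).comp_add_right a).sub (integrable_gradKernel hs)

lemma integral_gradShift {s : ℝ} (hs : 0 < s) (a : Space d) : ∫ z, gradShift a s z = 0 := by
  unfold gradShift
  rw [integral_sub ((integrable_gradKernel hs).comp_add_right a) (integrable_gradKernel hs),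
    integral_add_right_eq_self (fun z => gradKernel s z) a, sub_self]

lemma integrable_taylorKernel {s : ℝ} (hs : 0 < s) (a : Space d) :
    Integrable (taylorKernel a s) :=
  (((integrable_heatKernel hs).comp_add_right a).sub (integrable_heatKernel hs)).sub
    ((integrable_gradKernel hs).inner_const a)

lemma integral_taylorKernel {s : ℝ} (hs : 0 < s) (a : Space d) : ∫ z, taylorKernel a s z = 0 := by
  unfold taylorKernel
  have h1 : Integrable fun z : Space d => heatKernel s (z + a) - heatKernel s z :=
    ((integrable_heatKernel hs).comp_add_right a).sub (integrable_heatKernel hs)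
  rw [integral_sub h1 ((integrable_gradKernel hs).inner_const a),
    integral_sub ((integrable_heatKernel hs).comp_add_right a) (integrable_heatKernel hs),
    integral_add_right_eq_self (fun z => heatKernel s z) a, sub_self]
  simp_rw [real_inner_comm a]
  rw [integral_inner (integrable_gradKernel hs), integral_gradKernel]
  simp

/-- The `L¹`-norm of the increment of `∇K`. For `|a| ≤ √s` the increment is estimated by the second
derivative, for `|a| > √s` by the triangle inequality; the exponent `r` interpolates. -/
lemma lintegral_gradShift_le {s r : ℝ} (hs : 0 < s) (hr : 0 ≤ r) (hr1 : r ≤ 1) (a : Space d) :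
    ∫⁻ z, ‖gradShift a s z‖ₑ ≤
      ENNReal.ofReal (3 * kernelConst d * (‖a‖ ^ r * s ^ ((0 - 1 - r) / 2))) := by
  have hc := kernelConst_pos d
  have hσ : 0 < √s := Real.sqrt_pos.2 hs
  have hρ : 0 ≤ ‖a‖ / √s := by positivity
  have he := div_sqrt_rpow_mul hs a r (-(1 / 2))
  have he' : -(1 / 2) - r / 2 = (0 - 1 - r) / 2 := by ring
  rw [he'] at he
  rw [← he]
  have hs0 : 0 < s ^ (-(1 / 2) : ℝ) := by positivity
  rcases le_total ‖a‖ √s with h | h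
  · have h1 := lintegral_gradKernel_sub_weight_le hs le_rfl zero_le_one a h
    simp only [Real.rpow_zero, ENNReal.ofReal_one, mul_one] at h1
    refine h1.trans (ENNReal.ofReal_le_ofReal ?_)
    have h2 : ‖a‖ * s ^ ((0 : ℝ) / 2 - 1) = (‖a‖ / √s) ^ (1 : ℝ) * s ^ (-(1 / 2) : ℝ) := by
      rw [div_sqrt_rpow_mul hs, Real.rpow_one]; norm_num
    have h3 : (‖a‖ / √s) ^ (1 : ℝ) ≤ (‖a‖ / √s) ^ r := by
      rw [Real.rpow_one]
      exact Real.self_le_rpow_of_le_one hρ ((div_le_one hσ).2 h) hr1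
    rw [h2]
    have h4 : 0 ≤ (‖a‖ / √s) ^ r := by positivity
    calc kernelConst d * ((‖a‖ / √s) ^ (1 : ℝ) * s ^ (-(1 / 2) : ℝ))
        ≤ kernelConst d * ((‖a‖ / √s) ^ r * s ^ (-(1 / 2) : ℝ)) := by gcongr
      _ ≤ _ := by
        have : 0 ≤ kernelConst d * ((‖a‖ / √s) ^ r * s ^ (-(1 / 2) : ℝ)) := by positivity
        linarith
  · have h2 : 1 ≤ (‖a‖ / √s) ^ r := Real.one_le_rpow ((one_le_div hσ).2 h) hr
    calc ∫⁻ z, ‖gradShift a s z‖ₑ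
        ≤ ∫⁻ z, (‖gradKernel s (z + a)‖ₑ + ‖gradKernel s z‖ₑ) :=
          lintegral_mono fun z => enorm_sub_le
      _ = (∫⁻ z : Space d, ‖gradKernel s z‖ₑ) + ∫⁻ z : Space d, ‖gradKernel s z‖ₑ := by
          rw [lintegral_add_right _ (measurable_gradKernel_right s).enorm,
            lintegral_add_right_eq_self (fun z : Space d => ‖gradKernel s z‖ₑ) a]
      _ ≤ ENNReal.ofReal (kernelConst d * s ^ (-(1 / 2) : ℝ)) +
          ENNReal.ofReal (kernelConst d * s ^ (-(1 / 2) : ℝ)) := by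
          gcongr <;> exact lintegral_gradKernel_le hs
      _ = ENNReal.ofReal (2 * (kernelConst d * s ^ (-(1 / 2) : ℝ))) := by
          rw [← ENNReal.ofReal_add (by positivity) (by positivity)]; ring_nf
      _ ≤ _ := by
          apply ENNReal.ofReal_le_ofReal
          have h5 : 0 ≤ kernelConst d * s ^ (-(1 / 2) : ℝ) := by positivity
          nlinarith

/-- The `L¹`-norm of the Taylor remainder of `K`, again separating `|a| ≤ √s` from `|a| > √s`. -/
lemma lintegral_taylorKernel_le {s r : ℝ} (hs : 0 < s) (hr : 0 ≤ r) (hr1 : r ≤ 1) (a : Space d) :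
    ∫⁻ z, ‖taylorKernel a s z‖ₑ ≤
      ENNReal.ofReal (3 * kernelConst d * (‖a‖ ^ (1 + r) * s ^ ((0 - 1 - r) / 2))) := by
  have hc := kernelConst_pos d
  have hc1 := one_le_kernelConst d
  have hσ : 0 < √s := Real.sqrt_pos.2 hs
  have hρ : 0 ≤ ‖a‖ / √s := by positivity
  have he := div_sqrt_rpow_mul hs a (1 + r) 0
  have he' : 0 - (1 + r) / 2 = (0 - 1 - r) / 2 := by ring
  rw [he', Real.rpow_zero, mul_one] at he
  rw [← he]
  have h4 : 0 ≤ (‖a‖ / √s) ^ (1 + r) := by positivity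
  rcases le_total ‖a‖ √s with h | h
  · have h1 := lintegral_heatKernel_taylor_weight_le hs le_rfl zero_le_one a h
    simp only [Real.rpow_zero, ENNReal.ofReal_one, mul_one] at h1
    refine h1.trans (ENNReal.ofReal_le_ofReal ?_)
    have h2 : ‖a‖ ^ 2 * s ^ ((0 : ℝ) / 2 - 1) = (‖a‖ / √s) ^ (2 : ℝ) := by
      have := div_sqrt_rpow_mul hs a 2 0
      rw [Real.rpow_zero, mul_one] at this
      rw [this, Real.rpow_two]; norm_num
    have h3 : (‖a‖ / √s) ^ (2 : ℝ) ≤ (‖a‖ / √s) ^ (1 + r) :=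
      Real.rpow_le_rpow_of_exponent_ge_of_imp hρ ((div_le_one hσ).2 h) (by linarith)
        (by intro _ h; linarith)
    rw [h2]
    calc kernelConst d * (‖a‖ / √s) ^ (2 : ℝ)
        ≤ kernelConst d * (‖a‖ / √s) ^ (1 + r) := by gcongr
      _ ≤ _ := by
        have : 0 ≤ kernelConst d * (‖a‖ / √s) ^ (1 + r) := by positivity
        linarith
  · have hρ1 : 1 ≤ ‖a‖ / √s := (one_le_div hσ).2 h
    have h2 : 1 ≤ (‖a‖ / √s) ^ (1 + r) := Real.one_le_rpow hρ1 (by linarith)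
    have h3 : ‖a‖ / √s ≤ (‖a‖ / √s) ^ (1 + r) := by
      nth_rw 1 [← Real.rpow_one (‖a‖ / √s)]
      exact Real.rpow_le_rpow_of_exponent_le hρ1 (by linarith)
    calc ∫⁻ z, ‖taylorKernel a s z‖ₑ
        ≤ ∫⁻ z : Space d, (‖heatKernel s (z + a)‖ₑ +
            (‖heatKernel s z‖ₑ + ‖gradKernel s z‖ₑ * ‖a‖ₑ)) := by
          refine lintegral_mono fun z => ?_
          unfold taylorKernel
          rw [sub_sub]
          refine enorm_sub_le.trans ?_
          gcongr
          refine (enorm_add_le _ _).trans ?_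
          gcongr
          rw [← ofReal_norm, ← ofReal_norm, ← ofReal_norm, ← ENNReal.ofReal_mul (norm_nonneg _)]
          exact ENNReal.ofReal_le_ofReal (abs_real_inner_le_norm _ _)
      _ = 1 + (1 + (∫⁻ z : Space d, ‖gradKernel s z‖ₑ) * ‖a‖ₑ) := by
          rw [lintegral_add_right _ (by
              exact (measurable_heatKernel_right s).enorm.add
                ((measurable_gradKernel_right s).enorm.mul_const _)),
            lintegral_add_left (measurable_heatKernel_right s).enorm,
            lintegral_add_right_eq_self (fun z : Space d => ‖heatKernel s z‖ₑ) a,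
            lintegral_enorm_heatKernel hs,
            lintegral_mul_const _ (measurable_gradKernel_right s).enorm]
      _ ≤ ENNReal.ofReal 1 + (ENNReal.ofReal 1 +
          ENNReal.ofReal (kernelConst d * s ^ (-(1 / 2) : ℝ)) * ENNReal.ofReal ‖a‖) := by
          rw [ENNReal.ofReal_one, ofReal_norm]
          gcongr
          exact lintegral_gradKernel_le hs
      _ = ENNReal.ofReal (2 + kernelConst d * (‖a‖ / √s)) := by
          rw [← ENNReal.ofReal_mul (by positivity), ← ENNReal.ofReal_add (by positivity)
            (by positivity), ← ENNReal.ofReal_add (by positivity) (by positivity)]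
          congr 1
          rw [Real.rpow_neg hs.le, ← Real.sqrt_eq_rpow]
          field_simp
          ring
      _ ≤ _ := by
          apply ENNReal.ofReal_le_ofReal
          have := mul_le_mul_of_nonneg_left h3 hc.le
          nlinarith

/-! ### Convolution of a bounded Hölder function with a kernel -/

variable {E : Type*} [NormedAddCommGroup E] [NormedSpace ℝ E]

/-- The convolution `∫ φ(y) g(x-y) dy`. -/
noncomputable def conv (φ : Space d → ℝ) (g : Space d → E) (x : Space d) : E :=
  ∫ y, φ y • g (x - y)

/-- `φ` is measurable, bounded by `F` and `α`-Hölder continuous with constant `F`. -/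
structure HolderBound (F α : ℝ) (φ : Space d → ℝ) : Prop where
  measurable : Measurable φ
  abs_le : ∀ x, |φ x| ≤ F
  abs_sub_le : ∀ x y, |φ x - φ y| ≤ F * ‖x - y‖ ^ α

lemma heatSemigroup_eq_conv (s : ℝ) (φ : Space d → ℝ) (x : Space d) :
    heatSemigroup s φ x = conv φ (heatKernel s) x := by
  simp only [heatSemigroup, conv, smul_eq_mul, mul_comm]

variable {F α : ℝ} {φ : Space d → ℝ}

lemma HolderBound.nonneg (hφ : HolderBound F α φ) : 0 ≤ F := (abs_nonneg _).trans (hφ.abs_le 0)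

lemma HolderBound.integrable (hφ : HolderBound F α φ) {g : Space d → E} (hg : Integrable g)
    (x : Space d) : Integrable fun y => φ y • g (x - y) := by
  have h1 : Integrable fun y => g (x - y) := hg.comp_sub_left x
  exact h1.bdd_smul F hφ.measurable.aestronglyMeasurable
    (Eventually.of_forall fun y => by simpa using hφ.abs_le y)

lemma HolderBound.norm_conv_le (hφ : HolderBound F α φ) (g : Space d → E)
    (x : Space d) {B : ℝ} (hB : 0 ≤ B) (hgB : ∫⁻ z, ‖g z‖ₑ ≤ ENNReal.ofReal B) :
    ‖conv φ g x‖ ≤ F * B := by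
  have hF := hφ.nonneg
  have h1 : ‖conv φ g x‖ₑ ≤ ENNReal.ofReal (F * B) := by
    calc ‖conv φ g x‖ₑ ≤ ∫⁻ y, ‖φ y • g (x - y)‖ₑ := enorm_integral_le_lintegral_enorm _
      _ ≤ ∫⁻ y, ENNReal.ofReal F * ‖g (x - y)‖ₑ := by
          refine lintegral_mono fun y => ?_
          rw [enorm_smul]
          gcongr
          rw [← ofReal_norm]
          exact ENNReal.ofReal_le_ofReal (hφ.abs_le y)
      _ = ENNReal.ofReal F * ∫⁻ z, ‖g z‖ₑ := by
          rw [lintegral_const_mul' _ _ ENNReal.ofReal_ne_top,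
            lintegral_sub_left_eq_self (fun z => ‖g z‖ₑ)]
      _ ≤ _ := by rw [ENNReal.ofReal_mul hF]; gcongr
  rw [← ofReal_norm] at h1
  exact (ENNReal.ofReal_le_ofReal_iff (by positivity)).1 h1

/-- Against a kernel of mean zero, Hölder continuity gains the weight `|z|^α`. -/
lemma HolderBound.norm_conv_le_of_mean_zero (hφ : HolderBound F α φ) {g : Space d → E}
    (hg : Integrable g) (hg0 : ∫ z, g z = 0) (x : Space d) {B : ℝ} (hB : 0 ≤ B)
    (hgB : ∫⁻ z, ‖g z‖ₑ * ENNReal.ofReal (‖z‖ ^ α) ≤ ENNReal.ofReal B) :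
    ‖conv φ g x‖ ≤ F * B := by
  have hF := hφ.nonneg
  have h0 : conv φ g x = ∫ y, (φ y - φ x) • g (x - y) := by
    simp_rw [sub_smul]
    have hi : Integrable fun y => φ x • g (x - y) := (hg.comp_sub_left x).smul _
    rw [integral_sub (hφ.integrable hg x) hi, integral_smul,
      integral_sub_left_eq_self g volume x, hg0, smul_zero, sub_zero]
    rfl
  have h1 : ‖conv φ g x‖ₑ ≤ ENNReal.ofReal (F * B) := by
    rw [h0]
    calc _ ≤ ∫⁻ y, ‖(φ y - φ x) • g (x - y)‖ₑ := enorm_integral_le_lintegral_enorm _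
      _ ≤ ∫⁻ y, ENNReal.ofReal F * (‖g (x - y)‖ₑ * ENNReal.ofReal (‖x - y‖ ^ α)) := by
          refine lintegral_mono fun y => ?_
          rw [enorm_smul, mul_comm (‖g (x - y)‖ₑ), ← mul_assoc]
          gcongr
          rw [← ofReal_norm, ← ENNReal.ofReal_mul hF, norm_sub_rev x y]
          exact ENNReal.ofReal_le_ofReal (hφ.abs_sub_le y x)
      _ = ENNReal.ofReal F * ∫⁻ z, ‖g z‖ₑ * ENNReal.ofReal (‖z‖ ^ α) := by
          rw [lintegral_const_mul' _ _ ENNReal.ofReal_ne_top,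
            lintegral_sub_left_eq_self (fun z => ‖g z‖ₑ * ENNReal.ofReal (‖z‖ ^ α))]
      _ ≤ _ := by rw [ENNReal.ofReal_mul hF]; gcongr
  rw [← ofReal_norm] at h1
  exact (ENNReal.ofReal_le_ofReal_iff (by positivity)).1 h1

lemma conv_add (φ : Space d → ℝ) (g : Space d → E) (x a : Space d) :
    conv φ g (x + a) = conv φ (fun z => g (z + a)) x := by
  simp only [conv, add_sub_right_comm]

lemma HolderBound.conv_sub (hφ : HolderBound F α φ) {g₁ g₂ : Space d → E} (h₁ : Integrable g₁)
    (h₂ : Integrable g₂) (x : Space d) :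
    conv φ (fun z => g₁ z - g₂ z) x = conv φ g₁ x - conv φ g₂ x := by
  simp only [conv, smul_sub]
  exact integral_sub (hφ.integrable h₁ x) (hφ.integrable h₂ x)

lemma HolderBound.conv_inner (hφ : HolderBound F α φ) {g : Space d → Space d} (h : Integrable g)
    (x a : Space d) :
    conv φ (fun z => inner ℝ (g z) a) x = inner ℝ (conv φ g x) a := by
  rw [real_inner_comm, conv, conv, ← integral_inner (hφ.integrable h x)]
  congr with y
  rw [inner_smul_right, real_inner_comm, smul_eq_mul]

lemma HolderBound.abs_conv_heatKernel_le (hφ : HolderBound F α φ) {s : ℝ} (hs : 0 < s)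
    (x : Space d) : |conv φ (heatKernel s) x| ≤ F := by
  have := hφ.norm_conv_le (heatKernel s) x zero_le_one
    (by rw [lintegral_enorm_heatKernel hs, ENNReal.ofReal_one])
  rwa [mul_one] at this

lemma HolderBound.norm_conv_gradKernel_le (hφ : HolderBound F α φ) (hα : 0 ≤ α) (hα1 : α ≤ 1)
    {s : ℝ} (hs : 0 < s) (x : Space d) :
    ‖conv φ (gradKernel s) x‖ ≤ F * (kernelConst d * s ^ ((α - 1) / 2)) := by
  have hc := kernelConst_pos d
  exact hφ.norm_conv_le_of_mean_zero (integrable_gradKernel hs) integral_gradKernel x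
    (by positivity) (lintegral_gradKernel_weight_le hs hα hα1)

lemma HolderBound.conv_gradShift (hφ : HolderBound F α φ) {s : ℝ} (hs : 0 < s) (x a : Space d) :
    conv φ (gradShift a s) x = conv φ (gradKernel s) (x + a) - conv φ (gradKernel s) x := by
  rw [conv_add]
  exact hφ.conv_sub ((integrable_gradKernel hs).comp_add_right a) (integrable_gradKernel hs) x

lemma HolderBound.conv_taylorKernel (hφ : HolderBound F α φ) {s : ℝ} (hs : 0 < s)
    (x a : Space d) :
    conv φ (taylorKernel a s) x = conv φ (heatKernel s) (x + a) - conv φ (heatKernel s) x -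
      inner ℝ (conv φ (gradKernel s) x) a := by
  have h1 := (integrable_heatKernel (d := d) hs).comp_add_right a
  have h2 := integrable_heatKernel (d := d) hs
  have h3 := (integrable_gradKernel (d := d) hs).inner_const (𝕜 := ℝ) a
  have h12 : Integrable fun z : Space d => heatKernel s (z + a) - heatKernel s z := h1.sub h2
  rw [conv_add, ← hφ.conv_sub h1 h2, ← hφ.conv_inner (integrable_gradKernel hs),
    ← hφ.conv_sub h12 h3]
  rfl

/-- For Hölder continuous `φ` the bound of `lintegral_gradShift_le` improves by the factor
`s^{α/2}`, because the kernel has mean zero. -/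
lemma HolderBound.norm_conv_gradShift_le (hφ : HolderBound F α φ) (hα : 0 ≤ α) (hα1 : α ≤ 1)
    {s r : ℝ} (hs : 0 < s) (hr : 0 ≤ r) (hr1 : r ≤ 1) (x a : Space d) :
    ‖conv φ (gradShift a s) x‖ ≤
      3 * kernelConst d * F * (‖a‖ ^ r * s ^ ((α - 1 - r) / 2)) := by
  have hc := kernelConst_pos d
  have hF := hφ.nonneg
  have hσ : 0 < √s := Real.sqrt_pos.2 hs
  have hρ : 0 ≤ ‖a‖ / √s := by positivity
  have he := div_sqrt_rpow_mul hs a r ((α - 1) / 2)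
  have he' : (α - 1) / 2 - r / 2 = (α - 1 - r) / 2 := by ring
  rw [he'] at he
  rw [← he]
  have hP : 0 ≤ kernelConst d * F * s ^ ((α - 1) / 2) := by positivity
  rcases le_total ‖a‖ √s with h | h
  · have h1 := hφ.norm_conv_le_of_mean_zero (integrable_gradShift hs a) (integral_gradShift hs a) x
      (by positivity) (lintegral_gradKernel_sub_weight_le hs hα hα1 a h)
    refine h1.trans ?_
    have h2 : ‖a‖ * s ^ (α / 2 - 1) = (‖a‖ / √s) * s ^ ((α - 1) / 2) := by
      have := div_sqrt_rpow_mul hs a 1 ((α - 1) / 2)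
      rw [Real.rpow_one, Real.rpow_one] at this
      rw [this]; ring_nf
    rw [h2]
    have h3 : ‖a‖ / √s ≤ (‖a‖ / √s) ^ r :=
      Real.self_le_rpow_of_le_one hρ ((div_le_one hσ).2 h) hr1
    nlinarith [mul_le_mul_of_nonneg_left h3 hP, mul_nonneg hP (hρ.trans h3)]
  · have h2 : 1 ≤ (‖a‖ / √s) ^ r := Real.one_le_rpow ((one_le_div hσ).2 h) hr
    rw [hφ.conv_gradShift hs]
    refine (norm_sub_le _ _).trans ?_
    have e1 := hφ.norm_conv_gradKernel_le hα hα1 hs (x + a)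
    have e2 := hφ.norm_conv_gradKernel_le hα hα1 hs x
    nlinarith [mul_le_mul_of_nonneg_left h2 hP]

/-- The heat semigroup does not increase Hölder constants. -/
lemma HolderBound.abs_conv_heatKernel_sub_le (hφ : HolderBound F α φ) {s : ℝ} (hs : 0 < s)
    (x a : Space d) :
    |conv φ (heatKernel s) (x + a) - conv φ (heatKernel s) x| ≤ F * ‖a‖ ^ α := by
  have hF := hφ.nonneg
  have h0 : conv φ (heatKernel s) (x + a) = ∫ y, φ (y + a) • heatKernel s (x - y) := by
    rw [conv, ← integral_add_right_eq_self _ a]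
    congr with y
    congr 2
    abel
  have hi : Integrable fun y => φ (y + a) • heatKernel s (x - y) := by
    have h1 : Integrable fun y => heatKernel s (x - y) := (integrable_heatKernel hs).comp_sub_left x
    exact h1.bdd_smul F (hφ.measurable.comp (measurable_add_const a)).aestronglyMeasurable
      (Eventually.of_forall fun y => by simpa using hφ.abs_le (y + a))
  rw [h0, conv, ← integral_sub hi (hφ.integrable (integrable_heatKernel hs) x)]
  calc _ ≤ ∫ y, F * ‖a‖ ^ α * heatKernel s (x - y) := by
        rw [← Real.norm_eq_abs]
        refine norm_integral_le_of_norm_le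
          (((integrable_heatKernel hs).comp_sub_left x).const_mul _)
          (Eventually.of_forall fun y => ?_)
        rw [← sub_smul, norm_smul, Real.norm_of_nonneg (heatKernel_nonneg hs.le _)]
        have := hφ.abs_sub_le (y + a) y
        rw [add_sub_cancel_left] at this
        have h2 := heatKernel_nonneg hs.le (x - y)
        rw [Real.norm_eq_abs]
        gcongr
    _ = _ := by
        rw [integral_const_mul, integral_sub_left_eq_self (fun y => heatKernel s y),
          integral_heatKernel hs, mul_one]

/-- For Hölder continuous `φ` the bound of `lintegral_taylorKernel_le` improves by the factor
`s^{α/2}`. -/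
lemma HolderBound.abs_conv_taylorKernel_le (hφ : HolderBound F α φ) (hα : 0 ≤ α) (hα1 : α ≤ 1)
    {s r : ℝ} (hs : 0 < s) (hr : 0 ≤ r) (hr1 : r ≤ 1) (x a : Space d) :
    |conv φ (taylorKernel a s) x| ≤
      3 * kernelConst d * F * (‖a‖ ^ (1 + r) * s ^ ((α - 1 - r) / 2)) := by
  have hc := kernelConst_pos d
  have hc1 := one_le_kernelConst d
  have hF := hφ.nonneg
  have hσ : 0 < √s := Real.sqrt_pos.2 hs
  have hρ : 0 ≤ ‖a‖ / √s := by positivity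
  have he := div_sqrt_rpow_mul hs a (1 + r) (α / 2)
  have he' : α / 2 - (1 + r) / 2 = (α - 1 - r) / 2 := by ring
  rw [he'] at he
  rw [← he]
  have hsα : 0 < s ^ (α / 2) := by positivity
  have hP : 0 ≤ kernelConst d * F * s ^ (α / 2) := by positivity
  rcases le_total ‖a‖ √s with h | h
  · have h1 := hφ.norm_conv_le_of_mean_zero (integrable_taylorKernel hs a)
      (integral_taylorKernel hs a) x
      (by positivity) (lintegral_heatKernel_taylor_weight_le hs hα hα1 a h)
    rw [Real.norm_eq_abs] at h1
    refine h1.trans ?_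
    have h2 : ‖a‖ ^ 2 * s ^ (α / 2 - 1) = (‖a‖ / √s) ^ (2 : ℝ) * s ^ (α / 2) := by
      rw [div_sqrt_rpow_mul hs a 2 (α / 2), Real.rpow_two]; ring_nf
    have h3 : (‖a‖ / √s) ^ (2 : ℝ) ≤ (‖a‖ / √s) ^ (1 + r) :=
      Real.rpow_le_rpow_of_exponent_ge_of_imp hρ ((div_le_one hσ).2 h) (by linarith)
        (by intro _ h; linarith)
    rw [h2]
    have h4 : 0 ≤ (‖a‖ / √s) ^ (1 + r) := by positivity
    nlinarith [mul_le_mul_of_nonneg_left h3 hP, mul_nonneg hP h4]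
  · have hρ1 : 1 ≤ ‖a‖ / √s := (one_le_div hσ).2 h
    have h3 : ‖a‖ / √s ≤ (‖a‖ / √s) ^ (1 + r) := by
      nth_rw 1 [← Real.rpow_one (‖a‖ / √s)]
      exact Real.rpow_le_rpow_of_exponent_le hρ1 (by linarith)
    have h4 : (‖a‖ / √s) ^ α ≤ (‖a‖ / √s) ^ (1 + r) :=
      Real.rpow_le_rpow_of_exponent_le hρ1 (by linarith)
    rw [hφ.conv_taylorKernel hs]
    refine (abs_sub _ _).trans ?_
    have e1 := hφ.abs_conv_heatKernel_sub_le hs x a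
    have e2 := (abs_real_inner_le_norm (conv φ (gradKernel s) x) a).trans
      (mul_le_mul_of_nonneg_right (hφ.norm_conv_gradKernel_le hα hα1 hs x) (norm_nonneg a))
    have e3 : ‖a‖ ^ α = (‖a‖ / √s) ^ α * s ^ (α / 2) := by
      rw [div_sqrt_rpow_mul hs, sub_self, Real.rpow_zero, mul_one]
    have e4 : s ^ ((α - 1) / 2) * ‖a‖ = (‖a‖ / √s) * s ^ (α / 2) := by
      have := div_sqrt_rpow_mul hs a 1 (α / 2)
      rw [Real.rpow_one, Real.rpow_one] at this
      rw [this]; ring_nf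
    rw [e3] at e1
    have e5 : F * (kernelConst d * s ^ ((α - 1) / 2)) * ‖a‖ =
        kernelConst d * F * s ^ (α / 2) * (‖a‖ / √s) := by
      calc _ = F * kernelConst d * (s ^ ((α - 1) / 2) * ‖a‖) := by ring
        _ = _ := by rw [e4]; ring
    rw [e5] at e2
    have f1 := mul_le_mul_of_nonneg_left h3 hP
    have f2 : F * ((‖a‖ / √s) ^ α * s ^ (α / 2)) ≤
        kernelConst d * F * s ^ (α / 2) * (‖a‖ / √s) ^ (1 + r) := by
      calc _ = 1 * F * s ^ (α / 2) * (‖a‖ / √s) ^ α := by ring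
        _ ≤ _ := by gcongr
    have f3 : 0 ≤ kernelConst d * F * s ^ (α / 2) * (‖a‖ / √s) ^ (1 + r) := by positivity
    linarith

lemma HolderBound.abs_conv_heatKernel_time_sub_le (hφ : HolderBound F α φ) {s δ γ : ℝ}
    (hs : 0 < s) (hδ : 0 ≤ δ) (hγ : 0 ≤ γ) (hγ1 : γ ≤ 1) (x : Space d) :
    |conv φ (heatKernel (s + δ)) x - conv φ (heatKernel s) x| ≤
      F * (timeConst d * (δ / s) ^ γ) := by
  have := timeConst_pos d
  rw [← hφ.conv_sub (integrable_heatKernel (by linarith)) (integrable_heatKernel hs)]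
  exact hφ.norm_conv_le _ x (by positivity) (lintegral_heatKernel_time_sub_le hs hδ hγ hγ1)

end KernelFamilies

/-! ### Time integrals -/

section TimeIntegrals

lemma lintegral_Ioo_sub (t : ℝ) (f : ℝ → ℝ≥0∞) :
    ∫⁻ r in Ioo 0 t, f (t - r) = ∫⁻ s in Ioo 0 t, f s := by
  rw [← lintegral_indicator measurableSet_Ioo, ← lintegral_indicator measurableSet_Ioo,
    ← lintegral_sub_left_eq_self _ t]
  congr with r
  by_cases h : r ∈ Ioo 0 t
  · have h' : t - r ∈ Ioo 0 t := ⟨by linarith [h.2], by linarith [h.1]⟩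
    rw [indicator_of_mem h, indicator_of_mem h', sub_sub_cancel]
  · have h' : t - r ∉ Ioo 0 t := fun h2 => h ⟨by linarith [h2.2], by linarith [h2.1]⟩
    rw [indicator_of_notMem h, indicator_of_notMem h']

lemma lintegral_rpow_sub_le {t T e : ℝ} (he : -1 < e) (ht : t ≤ T) (hT : 0 < T) :
    ∫⁻ r in Ioo 0 t, ENNReal.ofReal ((t - r) ^ e) ≤ ENNReal.ofReal (T ^ (e + 1) / (e + 1)) := by
  rw [lintegral_Ioo_sub t (fun s => ENNReal.ofReal (s ^ e))]
  calc _ ≤ ∫⁻ s in Ioc 0 T, ENNReal.ofReal (s ^ e) :=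
        lintegral_mono_set fun s hs => ⟨hs.1, hs.2.le.trans ht⟩
    _ = ENNReal.ofReal (∫ s in Ioc 0 T, s ^ e) := by
        rw [ofReal_integral_eq_lintegral_ofReal]
        · exact (intervalIntegral.intervalIntegrable_rpow' he (a := 0) (b := T)).1
        · filter_upwards [ae_restrict_mem measurableSet_Ioc] with s hs
          exact Real.rpow_nonneg hs.1.le _
    _ = _ := by
        rw [← intervalIntegral.integral_of_le hT.le, integral_rpow (Or.inl he),
          Real.zero_rpow (by linarith), sub_zero]

/-- The weight `e^{Λ r}` makes the norm of the singular Volterra kernel `(t-r)^{-1/2}` small. -/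
lemma lintegral_rpow_mul_exp_le {t Λ : ℝ} (hΛ : 0 < Λ) :
    ∫⁻ r in Ioo 0 t, ENNReal.ofReal ((t - r) ^ (-(1 / 2) : ℝ)) * ENNReal.ofReal (Real.exp (Λ * r)) ≤
      ENNReal.ofReal (√(Real.pi / Λ) * Real.exp (Λ * t)) := by
  have hint := Real.integral_rpow_mul_exp_neg_mul_Ioi (show (0 : ℝ) < 1 / 2 by norm_num) hΛ
  rw [Real.Gamma_one_half_eq, ← Real.sqrt_eq_rpow, ← Real.sqrt_mul (by positivity)] at hint
  have he : (1 / 2 : ℝ) - 1 = -(1 / 2) := by norm_num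
  have he2 : 1 / Λ * Real.pi = Real.pi / Λ := by ring
  rw [he, he2] at hint
  have hi : IntegrableOn (fun s : ℝ => s ^ (-(1 / 2) : ℝ) * Real.exp (-(Λ * s))) (Ioi 0) := by
    apply Integrable.of_integral_ne_zero
    rw [hint]
    have := Real.pi_pos
    positivity
  calc _ = ∫⁻ r in Ioo 0 t, ENNReal.ofReal (Real.exp (Λ * t)) *
        ENNReal.ofReal ((t - r) ^ (-(1 / 2) : ℝ) * Real.exp (-(Λ * (t - r)))) := by
        apply setLIntegral_congr_fun measurableSet_Ioo
        intro r hr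
        have h0 : 0 ≤ (t - r) ^ (-(1 / 2) : ℝ) := Real.rpow_nonneg (by linarith [hr.2]) _
        dsimp only
        rw [← ENNReal.ofReal_mul h0, ← ENNReal.ofReal_mul (Real.exp_pos _).le]
        congr 1
        rw [mul_left_comm, ← Real.exp_add]
        ring_nf
    _ = ENNReal.ofReal (Real.exp (Λ * t)) *
        ∫⁻ s in Ioo 0 t, ENNReal.ofReal (s ^ (-(1 / 2) : ℝ) * Real.exp (-(Λ * s))) := by
        rw [lintegral_const_mul' _ _ ENNReal.ofReal_ne_top, lintegral_Ioo_sub t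
          (fun s => ENNReal.ofReal (s ^ (-(1 / 2) : ℝ) * Real.exp (-(Λ * s))))]
    _ ≤ ENNReal.ofReal (Real.exp (Λ * t)) *
        ∫⁻ s in Ioi 0, ENNReal.ofReal (s ^ (-(1 / 2) : ℝ) * Real.exp (-(Λ * s))) := by
        gcongr
        exact fun s hs => hs.1
    _ = ENNReal.ofReal (Real.exp (Λ * t)) * ENNReal.ofReal (√(Real.pi / Λ)) := by
        rw [← ofReal_integral_eq_lintegral_ofReal hi, hint]
        filter_upwards [ae_restrict_mem measurableSet_Ioi] with s hs
        exact mul_nonneg (Real.rpow_nonneg (le_of_lt hs) _) (Real.exp_pos _).le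
    _ = _ := by rw [mul_comm, ENNReal.ofReal_mul (Real.sqrt_nonneg _)]

end TimeIntegrals

/-! ### Space-time potentials of random fields -/

section Potentials

variable {d : ℕ} {E : Type*} [NormedAddCommGroup E]

/-- Lebesgue measure on `(0,∞) × ℝ^d`. -/
noncomputable def stMeasure (d : ℕ) : Measure (ℝ × Space d) :=
  (volume.restrict (Ioi (0 : ℝ))).prod volume

instance : SFinite (stMeasure d) := by unfold stMeasure; infer_instance

/-- The space-time kernel `(r,y) ↦ 1_{r < t} g(t-r, x-y)`. -/
noncomputable def causal (g : ℝ → Space d → E) (t : ℝ) (x : Space d) (z : ℝ × Space d) : E :=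
  if z.1 < t then g (t - z.1) (x - z.2) else 0

lemma causal_of_lt {g : ℝ → Space d → E} {t : ℝ} {x : Space d} {z : ℝ × Space d} (h : z.1 < t) :
    causal g t x z = g (t - z.1) (x - z.2) := if_pos h

lemma causal_of_le {g : ℝ → Space d → E} {t : ℝ} {x : Space d} {z : ℝ × Space d} (h : t ≤ z.1) :
    causal g t x z = 0 := if_neg h.not_gt

variable [MeasurableSpace E]

lemma measurable_causal_uncurry {g : ℝ → Space d → E}
    (hg : Measurable (fun q : ℝ × Space d => g q.1 q.2)) :
    Measurable (fun q : (ℝ × Space d) × (ℝ × Space d) => causal g q.1.1 q.1.2 q.2) := by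
  unfold causal
  refine Measurable.ite ?_ ?_ measurable_const
  · exact measurableSet_lt (measurable_fst.comp measurable_snd) (measurable_fst.comp measurable_fst)
  · have h : Measurable fun q : (ℝ × Space d) × (ℝ × Space d) =>
        (q.1.1 - q.2.1, q.1.2 - q.2.2) := by fun_prop
    exact hg.comp h

lemma measurable_causal {g : ℝ → Space d → E}
    (hg : Measurable (fun q : ℝ × Space d => g q.1 q.2)) (t : ℝ) (x : Space d) :
    Measurable (causal g t x) :=
  (measurable_causal_uncurry hg).comp (measurable_const.prodMk measurable_id :
    Measurable fun z : ℝ × Space d => ((t, x), z))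

variable [BorelSpace E]

lemma lintegral_stMeasure {f : ℝ × Space d → ℝ≥0∞} (hf : Measurable f) :
    ∫⁻ z, f z ∂stMeasure d = ∫⁻ r in Ioi 0, ∫⁻ y, f (r, y) :=
  lintegral_prod _ hf.aemeasurable

/-- The spatial `L¹`-bounds `B` of the kernel, integrated in time against a weight `w`. -/
lemma lintegral_causal_le {g : ℝ → Space d → E}
    (hg : Measurable (fun q : ℝ × Space d => g q.1 q.2)) (t : ℝ) (x : Space d)
    {w : ℝ → ℝ≥0∞} (hw : Measurable w) {B : ℝ → ℝ≥0∞}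
    (hB : ∀ s, 0 < s → ∫⁻ z, ‖g s z‖ₑ ≤ B s) :
    ∫⁻ z, ‖causal g t x z‖ₑ * w z.1 ∂stMeasure d ≤ ∫⁻ r in Ioo 0 t, B (t - r) * w r := by
  have hm : Measurable fun z : ℝ × Space d => ‖causal g t x z‖ₑ * w z.1 :=
    (measurable_causal hg t x).enorm.mul (hw.comp measurable_fst)
  rw [lintegral_stMeasure hm,
    ← lintegral_indicator measurableSet_Ioi, ← lintegral_indicator measurableSet_Ioo]
  refine lintegral_mono fun r => ?_
  by_cases h0 : 0 < r
  swap
  · rw [indicator_of_notMem (by simpa using h0)]; exact zero_le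
  rw [indicator_of_mem (by simpa using h0)]
  by_cases h1 : r < t
  swap
  · have : ∀ y : Space d, ‖causal g t x (r, y)‖ₑ * w r = 0 := fun y => by
      rw [causal_of_le (not_lt.1 h1)]; simp
    simp only [this, lintegral_zero]; exact zero_le
  rw [indicator_of_mem (show r ∈ Ioo 0 t from ⟨h0, h1⟩)]
  have hgr : Measurable fun y : Space d => ‖causal g t x (r, y)‖ₑ :=
    ((measurable_causal hg t x).comp measurable_prodMk_left).enorm
  simp only
  rw [lintegral_mul_const _ hgr]
  gcongr
  simp only [causal, h1, if_true]
  rw [lintegral_sub_left_eq_self (fun z => ‖g (t - r) z‖ₑ)]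
  exact hB _ (by linarith)

variable {Ω : Type*} {mΩ : MeasurableSpace Ω} {P : Measure Ω}

/-- The random field `φ` on `(0,T) × ℝ^d` has `L^q(Ω)`-norm at most `w(r)` at almost every
`(r,y)`. -/
def FieldBound {V : Type*} [NormedAddCommGroup V] (P : Measure Ω) (q T : ℝ) (w : ℝ → ℝ≥0∞)
    (φ : ℝ → Space d → Ω → V) : Prop :=
  ∀ᵐ z ∂stMeasure d, z.1 < T → eLpNorm (φ z.1 z.2) (ENNReal.ofReal q) P ≤ w z.1

/-- The space-time potential `∫_0^t ∫ g(t-r, x-y) φ(r,y) dy dr` of the random field `φ`. -/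
noncomputable def pot [NormedSpace ℝ E] (g : ℝ → Space d → E) (φ : ℝ → Space d → Ω → ℝ) (t : ℝ)
    (x : Space d) (ω : Ω) : E :=
  kerInt (stMeasure d) (causal g t x) (fun z => φ z.1 z.2) ω

/-- Joint measurability of a random field in time, space and chance. -/
abbrev MeasField {Ω V : Type*} [MeasurableSpace Ω] [MeasurableSpace V]
    (φ : ℝ → Space d → Ω → V) : Prop :=
  Measurable (fun q : ℝ × Space d × Ω => φ q.1 q.2.1 q.2.2)

lemma MeasField.prod {V : Type*} [MeasurableSpace V] {φ : ℝ → Space d → Ω → V}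
    (hφ : MeasField φ) :
    Measurable (fun p : (ℝ × Space d) × Ω => φ p.1.1 p.1.2 p.2) := by
  have h : Measurable fun p : (ℝ × Space d) × Ω => (p.1.1, p.1.2, p.2) := by fun_prop
  exact Measurable.comp (g := fun q : ℝ × Space d × Ω => φ q.1 q.2.1 q.2.2) hφ h

lemma MeasField.slice {V : Type*} [MeasurableSpace V] {φ : ℝ → Space d → Ω → V}
    (hφ : MeasField φ) (t : ℝ) (x : Space d) : Measurable (φ t x) := by
  have h : Measurable fun ω : Ω => (t, x, ω) := by fun_prop
  exact Measurable.comp (g := fun q : ℝ × Space d × Ω => φ q.1 q.2.1 q.2.2) hφ h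

lemma measurable_eLpNorm {V : Type*} [NormedAddCommGroup V] [MeasurableSpace V] [BorelSpace V]
    [SecondCountableTopology V] [SFinite P] {φ : ℝ → Space d → Ω → V}
    (hφ : MeasField φ) {q : ℝ} (hq : 0 < q) :
    Measurable fun z : ℝ × Space d => eLpNorm (φ z.1 z.2) (ENNReal.ofReal q) P := by
  simp_rw [eLpNorm_ofReal_eq hq]
  exact (Measurable.lintegral_prod_right (hφ.prod.enorm.pow_const q)).pow_const _

variable {φ : ℝ → Space d → Ω → ℝ} {q T t : ℝ} {w : ℝ → ℝ≥0∞}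

lemma lintegral_causal_field_le {g : ℝ → Space d → E}
    (hg : Measurable (fun q : ℝ × Space d => g q.1 q.2)) (hw : Measurable w)
    (hb : FieldBound P q T w φ) (ht : t ≤ T) (x : Space d)
    {B : ℝ → ℝ≥0∞} (hB : ∀ s, 0 < s → ∫⁻ z, ‖g s z‖ₑ ≤ B s) :
    ∫⁻ z, ‖causal g t x z‖ₑ * eLpNorm (φ z.1 z.2) (ENNReal.ofReal q) P ∂stMeasure d ≤
      ∫⁻ r in Ioo 0 t, B (t - r) * w r := by
  refine le_trans (lintegral_mono_ae ?_) (lintegral_causal_le hg t x hw hB)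
  filter_upwards [hb] with z hz
  by_cases h : z.1 < t
  · gcongr
    exact hz (h.trans_le ht)
  · rw [causal_of_le (not_lt.1 h)]; simp

variable [NormedSpace ℝ E] [SecondCountableTopology E] [SFinite P]

lemma measField_pot {g : ℝ → Space d → E}
    (hg : Measurable (fun q : ℝ × Space d => g q.1 q.2)) (hφ : MeasField φ) :
    MeasField (pot g φ) := by
  unfold pot kerInt
  have h1 : Measurable fun p : (ℝ × Space d × Ω) × (ℝ × Space d) => φ p.2.1 p.2.2 p.1.2.2 := by
    have h : Measurable fun p : (ℝ × Space d × Ω) × (ℝ × Space d) => (p.2, p.1.2.2) := by fun_prop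
    exact hφ.prod.comp h
  have h2 : Measurable fun p : (ℝ × Space d × Ω) × (ℝ × Space d) =>
      causal g p.1.1 p.1.2.1 p.2 := by
    have h : Measurable fun p : (ℝ × Space d × Ω) × (ℝ × Space d) => ((p.1.1, p.1.2.1), p.2) := by
      fun_prop
    exact (measurable_causal_uncurry hg).comp h
  have h3 : StronglyMeasurable fun p : (ℝ × Space d × Ω) × (ℝ × Space d) =>
    φ p.2.1 p.2.2 p.1.2.2 • causal g p.1.1 p.1.2.1 p.2 := (h1.smul h2).stronglyMeasurable
  exact h3.integral_prod_right.measurable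

/-- The basic estimate for potentials, from Minkowski's inequality. -/
lemma eLpNorm_pot_le (hq : 1 ≤ q) {g : ℝ → Space d → E}
    (hg : Measurable (fun q : ℝ × Space d => g q.1 q.2)) (hφ : MeasField φ) (hw : Measurable w)
    (hb : FieldBound P q T w φ) (ht : t ≤ T) (x : Space d)
    {B : ℝ → ℝ≥0∞} (hB : ∀ s, 0 < s → ∫⁻ z, ‖g s z‖ₑ ≤ B s) :
    eLpNorm (pot g φ t x) (ENNReal.ofReal q) P ≤ ∫⁻ r in Ioo 0 t, B (t - r) * w r :=
  (eLpNorm_kerInt_le hq (measurable_causal hg t x) hφ.prod).trans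
    (lintegral_causal_field_le hg hw hb ht x hB)

/-- The potential converges absolutely almost surely. -/
lemma ae_integrable_pot (hq : 1 ≤ q) {g : ℝ → Space d → E}
    (hg : Measurable (fun q : ℝ × Space d => g q.1 q.2)) (hφ : MeasField φ) (hw : Measurable w)
    (hb : FieldBound P q T w φ) (ht : t ≤ T) (x : Space d)
    {B : ℝ → ℝ≥0∞} (hB : ∀ s, 0 < s → ∫⁻ z, ‖g s z‖ₑ ≤ B s)
    (hfin : ∫⁻ r in Ioo 0 t, B (t - r) * w r < ∞) :
    ∀ᵐ ω ∂P, Integrable (fun z : ℝ × Space d => φ z.1 z.2 ω • causal g t x z) (stMeasure d) :=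
  ae_integrable_kernel hq (measurable_causal hg t x) hφ.prod
    ((lintegral_causal_field_le hg hw hb ht x hB).trans_lt hfin)

end Potentials

section Drift

variable {d : ℕ} {Ω : Type*} {mΩ : MeasurableSpace Ω} {P : Measure Ω}

/-! ### Regularity of heat potentials of bounded random fields -/

/-- The convolution of a constant with the integrable singularity `C s^e`, `e > -1`. -/
lemma lintegral_const_rpow_le {t T e C : ℝ} (hC : 0 ≤ C) (he : -1 < e) (ht : t ≤ T) (hT : 0 < T)
    (M : ℝ≥0∞) :
    ∫⁻ r in Ioo 0 t, ENNReal.ofReal (C * (t - r) ^ e) * M ≤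
      ENNReal.ofReal (C * (T ^ (e + 1) / (e + 1))) * M := by
  have hm : Measurable fun r : ℝ => ENNReal.ofReal ((t - r) ^ e) := by fun_prop
  simp_rw [ENNReal.ofReal_mul hC]
  rw [lintegral_mul_const _ (hm.const_mul _), lintegral_const_mul _ hm]
  gcongr
  exact lintegral_rpow_sub_le he ht hT

variable {E : Type*} [NormedAddCommGroup E] [NormedSpace ℝ E] [MeasurableSpace E] [BorelSpace E]
  [SecondCountableTopology E] [SFinite P] {φ : ℝ → Space d → Ω → ℝ} {q T t : ℝ} {M : ℝ≥0∞}

/-- The estimate of a potential whose kernel has spatial `L¹`-norm at most `C s^e`. -/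
lemma eLpNorm_pot_le_of_rpow (hq : 1 ≤ q) {g : ℝ → Space d → E}
    (hg : Measurable (fun q : ℝ × Space d => g q.1 q.2)) (hφ : MeasField φ)
    (hb : FieldBound P q T (fun _ => M) φ) (hT : 0 < T) (ht : t ≤ T) (x : Space d) {C e : ℝ}
    (hC : 0 ≤ C) (he : -1 < e)
    (hB : ∀ s, 0 < s → ∫⁻ z, ‖g s z‖ₑ ≤ ENNReal.ofReal (C * s ^ e)) :
    eLpNorm (pot g φ t x) (ENNReal.ofReal q) P ≤
      ENNReal.ofReal (C * (T ^ (e + 1) / (e + 1))) * M :=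
  (eLpNorm_pot_le hq hg hφ measurable_const hb ht x hB).trans
    (lintegral_const_rpow_le hC he ht hT M)

lemma ae_integrable_pot_of_rpow (hq : 1 ≤ q) {g : ℝ → Space d → E}
    (hg : Measurable (fun q : ℝ × Space d => g q.1 q.2)) (hφ : MeasField φ)
    (hb : FieldBound P q T (fun _ => M) φ) (hM : M < ∞) (hT : 0 < T) (ht : t ≤ T) (x : Space d)
    {C e : ℝ} (hC : 0 ≤ C) (he : -1 < e)
    (hB : ∀ s, 0 < s → ∫⁻ z, ‖g s z‖ₑ ≤ ENNReal.ofReal (C * s ^ e)) :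
    ∀ᵐ ω ∂P, Integrable (fun z : ℝ × Space d => φ z.1 z.2 ω • causal g t x z) (stMeasure d) :=
  ae_integrable_pot hq hg hφ measurable_const hb ht x hB
    ((lintegral_const_rpow_le hC he ht hT M).trans_lt (ENNReal.mul_lt_top ENNReal.ofReal_lt_top hM))

lemma lintegral_heatKernel_le_rpow (s : ℝ) (hs : 0 < s) :
    ∫⁻ z : Space d, ‖heatKernel s z‖ₑ ≤ ENNReal.ofReal (1 * s ^ (0 : ℝ)) := by
  rw [lintegral_enorm_heatKernel hs]; simp

lemma ae_integrable_heat (hq : 1 ≤ q) (hφ : MeasField φ) (hb : FieldBound P q T (fun _ => M) φ)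
    (hM : M < ∞) (hT : 0 < T) (ht : t ≤ T) (x : Space d) :
    ∀ᵐ ω ∂P, Integrable (fun z : ℝ × Space d => φ z.1 z.2 ω • causal heatKernel t x z)
      (stMeasure d) :=
  ae_integrable_pot_of_rpow hq measurable_heatKernel hφ hb hM hT ht x zero_le_one (by norm_num)
    lintegral_heatKernel_le_rpow

lemma ae_integrable_grad (hq : 1 ≤ q) (hφ : MeasField φ) (hb : FieldBound P q T (fun _ => M) φ)
    (hM : M < ∞) (hT : 0 < T) (ht : t ≤ T) (x : Space d) :
    ∀ᵐ ω ∂P, Integrable (fun z : ℝ × Space d => φ z.1 z.2 ω • causal gradKernel t x z)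
      (stMeasure d) :=
  ae_integrable_pot_of_rpow hq measurable_gradKernel hφ hb hM hT ht x (kernelConst_pos d).le
    (by norm_num) (fun _ hs => lintegral_gradKernel_le hs)

lemma eLpNorm_pot_heat_le (hq : 1 ≤ q) (hφ : MeasField φ)
    (hb : FieldBound P q T (fun _ => M) φ) (hT : 0 < T) (ht : t ≤ T) (x : Space d) :
    eLpNorm (pot heatKernel φ t x) (ENNReal.ofReal q) P ≤ ENNReal.ofReal T * M := by
  have := eLpNorm_pot_le_of_rpow hq measurable_heatKernel hφ hb hT ht x zero_le_one
    (by norm_num) lintegral_heatKernel_le_rpow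
  simpa using this

lemma eLpNorm_pot_grad_le (hq : 1 ≤ q) (hφ : MeasField φ)
    (hb : FieldBound P q T (fun _ => M) φ) (hT : 0 < T) (ht : t ≤ T) (x : Space d) :
    eLpNorm (pot gradKernel φ t x) (ENNReal.ofReal q) P ≤
      ENNReal.ofReal (kernelConst d * (T ^ (-(1 / 2) + 1 : ℝ) / (-(1 / 2) + 1))) * M :=
  eLpNorm_pot_le_of_rpow hq measurable_gradKernel hφ hb hT ht x (kernelConst_pos d).le
    (by norm_num) (fun _ hs => lintegral_gradKernel_le hs)

/-- For a field growing at most like `A e^{Λr}`, the gradient of the heat potential is of the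
same growth, with a constant that is small for large `Λ`. -/
lemma eLpNorm_pot_grad_exp_le (hq : 1 ≤ q) (hφ : MeasField φ) {A : ℝ≥0∞} {Λ : ℝ} (hΛ : 0 < Λ)
    (hb : FieldBound P q T (fun r => A * ENNReal.ofReal (Real.exp (Λ * r))) φ)
    (ht : t ≤ T) (x : Space d) :
    eLpNorm (pot gradKernel φ t x) (ENNReal.ofReal q) P ≤
      ENNReal.ofReal (kernelConst d * √(Real.pi / Λ)) * A *
        ENNReal.ofReal (Real.exp (Λ * t)) := by
  have hc := kernelConst_pos d
  refine (eLpNorm_pot_le hq measurable_gradKernel hφ (by fun_prop) hb ht x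
    (fun _ hs => lintegral_gradKernel_le hs)).trans ?_
  have hm : Measurable fun r : ℝ => ENNReal.ofReal ((t - r) ^ (-(1 / 2) : ℝ)) *
      ENNReal.ofReal (Real.exp (Λ * r)) := by fun_prop
  calc _ = ∫⁻ r in Ioo 0 t, (ENNReal.ofReal (kernelConst d) * A) *
        (ENNReal.ofReal ((t - r) ^ (-(1 / 2) : ℝ)) * ENNReal.ofReal (Real.exp (Λ * r))) := by
        congr with r
        rw [ENNReal.ofReal_mul hc.le]
        ring
    _ = (ENNReal.ofReal (kernelConst d) * A) * ∫⁻ r in Ioo 0 t,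
        (ENNReal.ofReal ((t - r) ^ (-(1 / 2) : ℝ)) * ENNReal.ofReal (Real.exp (Λ * r))) :=
        lintegral_const_mul _ hm
    _ ≤ (ENNReal.ofReal (kernelConst d) * A) *
        ENNReal.ofReal (√(Real.pi / Λ) * Real.exp (Λ * t)) := by
        gcongr
        exact lintegral_rpow_mul_exp_le hΛ
    _ = _ := by
        rw [ENNReal.ofReal_mul (Real.sqrt_nonneg _), ENNReal.ofReal_mul hc.le]
        ring

lemma ae_pot_gradShift (hq : 1 ≤ q) (hφ : MeasField φ) (hb : FieldBound P q T (fun _ => M) φ)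
    (hM : M < ∞) (hT : 0 < T) (ht : t ≤ T) (x a : Space d) :
    (fun ω => pot gradKernel φ t (x + a) ω - pot gradKernel φ t x ω) =ᵐ[P]
      pot (gradShift a) φ t x := by
  filter_upwards [ae_integrable_grad hq hφ hb hM hT ht x,
    ae_integrable_grad hq hφ hb hM hT ht (x + a)] with ω h1 h2
  unfold pot kerInt
  rw [← integral_sub h2 h1]
  congr with z
  simp only [causal, gradShift, add_sub_right_comm]
  split_ifs <;> simp [smul_sub]

lemma ae_pot_taylorKernel (hq : 1 ≤ q) (hφ : MeasField φ) (hb : FieldBound P q T (fun _ => M) φ)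
    (hM : M < ∞) (hT : 0 < T) (ht : t ≤ T) (x a : Space d) :
    (fun ω => pot heatKernel φ t (x + a) ω - pot heatKernel φ t x ω -
      inner ℝ (pot gradKernel φ t x ω) a) =ᵐ[P] pot (taylorKernel a) φ t x := by
  filter_upwards [ae_integrable_heat hq hφ hb hM hT ht x,
    ae_integrable_heat hq hφ hb hM hT ht (x + a),
    ae_integrable_grad hq hφ hb hM hT ht x] with ω h1 h2 h3
  unfold pot kerInt
  rw [real_inner_comm, ← integral_inner h3, ← integral_sub h2 h1, ← integral_sub]
  · congr with z
    simp only [causal, taylorKernel, add_sub_right_comm]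
    split_ifs
    · simp only [smul_eq_mul, inner_smul_right, real_inner_comm]; ring
    · simp
  · exact h2.sub h1
  · exact h3.const_inner a

/-- Hölder continuity in space, of every order `r < 1`, of the gradient of the heat potential. -/
lemma eLpNorm_pot_grad_sub_le (hq : 1 ≤ q) (hφ : MeasField φ)
    (hb : FieldBound P q T (fun _ => M) φ) (hM : M < ∞) (hT : 0 < T) (ht : t ≤ T) {r : ℝ}
    (hr : 0 ≤ r) (hr1 : r < 1) (x a : Space d) :
    eLpNorm (fun ω => pot gradKernel φ t (x + a) ω - pot gradKernel φ t x ω)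
      (ENNReal.ofReal q) P ≤ ENNReal.ofReal (3 * kernelConst d * ‖a‖ ^ r *
        (T ^ ((0 - 1 - r) / 2 + 1) / ((0 - 1 - r) / 2 + 1))) * M := by
  have hc := kernelConst_pos d
  rw [eLpNorm_congr_ae (ae_pot_gradShift hq hφ hb hM hT ht x a)]
  refine eLpNorm_pot_le_of_rpow hq (measurable_gradShift a) hφ hb hT ht x (by positivity)
    (by linarith) (fun s hs => ?_)
  rw [mul_assoc]
  exact lintegral_gradShift_le hs hr hr1.le a

/-- The first order Taylor expansion of the heat potential, with values in `L^q(Ω)`. -/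
lemma eLpNorm_pot_taylor_le (hq : 1 ≤ q) (hφ : MeasField φ)
    (hb : FieldBound P q T (fun _ => M) φ) (hM : M < ∞) (hT : 0 < T) (ht : t ≤ T) {r : ℝ}
    (hr : 0 ≤ r) (hr1 : r < 1) (x a : Space d) :
    eLpNorm (fun ω => pot heatKernel φ t (x + a) ω - pot heatKernel φ t x ω -
      inner ℝ (pot gradKernel φ t x ω) a)
      (ENNReal.ofReal q) P ≤ ENNReal.ofReal (3 * kernelConst d * ‖a‖ ^ (1 + r) *
        (T ^ ((0 - 1 - r) / 2 + 1) / ((0 - 1 - r) / 2 + 1))) * M := by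
  have hc := kernelConst_pos d
  rw [eLpNorm_congr_ae (ae_pot_taylorKernel hq hφ hb hM hT ht x a)]
  refine eLpNorm_pot_le_of_rpow hq (measurable_taylorKernel a) hφ hb hT ht x (by positivity)
    (by linarith) (fun s hs => ?_)
  rw [mul_assoc]
  exact lintegral_taylorKernel_le hs hr hr1.le a

/-- Hölder continuity of the heat potential in time. -/
lemma eLpNorm_pot_heat_time_sub_le (hq : 1 ≤ q) (hφ : MeasField φ)
    (hb : FieldBound P q T (fun _ => M) φ) (hM : M < ∞) (hT : 0 < T) {t' : ℝ} (htt' : t ≤ t')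
    (ht : t' ≤ T) (x : Space d) :
    eLpNorm (fun ω => pot heatKernel φ t' x ω - pot heatKernel φ t x ω)
      (ENNReal.ofReal q) P ≤ ENNReal.ofReal (timeConst d * (t' - t) ^ (1 / 2 : ℝ) *
        (T ^ (-(1 / 2) + 1 : ℝ) / (-(1 / 2) + 1)) + (t' - t)) * M := by
  have hc := timeConst_pos d
  set κ : ℝ × Space d → ℝ := fun z => causal heatKernel t' x z - causal heatKernel t x z with hκ
  have hκm : Measurable κ :=
    (measurable_causal measurable_heatKernel t' x).sub (measurable_causal measurable_heatKernel t x)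
  have hae : (fun ω => pot heatKernel φ t' x ω - pot heatKernel φ t x ω) =ᵐ[P]
      kerInt (stMeasure d) κ (fun z => φ z.1 z.2) := by
    filter_upwards [ae_integrable_heat hq hφ hb hM hT (htt'.trans ht) x,
      ae_integrable_heat hq hφ hb hM hT ht x] with ω h1 h2
    unfold pot kerInt
    rw [← integral_sub h2 h1]
    congr with z
    rw [smul_sub]
  rw [eLpNorm_congr_ae hae]
  refine (eLpNorm_kerInt_le hq hκm hφ.prod).trans ?_
  have hδ : 0 ≤ t' - t := by linarith
  -- `D r` bounds the spatial `L¹`-norm of the increment of the kernel: for sources before time `t`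
  -- it is the time increment of `K`, and on `[t,t')` only the kernel started at time `t'`
  -- contributes
  set D : ℝ → ℝ≥0∞ := fun r =>
    (Ioo 0 t).indicator
      (fun r => ENNReal.ofReal
        (timeConst d * (t' - t) ^ (1 / 2 : ℝ) * (t - r) ^ (-(1 / 2) : ℝ))) r +
      (Ico t t').indicator (fun _ => 1) r with hD
  calc ∫⁻ z, ‖κ z‖ₑ * eLpNorm (φ z.1 z.2) (ENNReal.ofReal q) P ∂stMeasure d
      ≤ ∫⁻ z, ‖κ z‖ₑ * M ∂stMeasure d := by
        refine lintegral_mono_ae ?_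
        filter_upwards [hb] with z hz
        by_cases h : z.1 < t'
        · gcongr
          exact hz (h.trans_le ht)
        · rw [hκ]
          simp only
          rw [causal_of_le (not_lt.1 h), causal_of_le (htt'.trans (not_lt.1 h))]
          simp
    _ = (∫⁻ r in Ioi 0, ∫⁻ y, ‖κ (r, y)‖ₑ) * M := by
        rw [lintegral_mul_const _ hκm.enorm, lintegral_stMeasure hκm.enorm]
    _ ≤ (∫⁻ r in Ioi 0, D r) * M := by
        gcongr ?_ * M
        refine setLIntegral_mono_ae' measurableSet_Ioi (Eventually.of_forall fun r hr => ?_)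
        have hr0 : 0 < r := hr
        rw [hD]
        simp only
        by_cases h1 : r < t
        · rw [indicator_of_mem (show r ∈ Ioo 0 t from ⟨hr0, h1⟩)]
          refine le_add_right ?_
          have hs : 0 < t - r := by linarith
          have := lintegral_heatKernel_time_sub_le (d := d) hs hδ (γ := 1 / 2) (by norm_num)
            (by norm_num)
          calc ∫⁻ y, ‖κ (r, y)‖ₑ
              = ∫⁻ y : Space d, ‖heatKernel (t - r + (t' - t)) (x - y) -
                  heatKernel (t - r) (x - y)‖ₑ := by
                congr with y
                simp only [hκ, causal, h1, h1.trans_le htt', if_true]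
                congr 3
                ring
            _ = _ := lintegral_sub_left_eq_self (fun z : Space d =>
                ‖heatKernel (t - r + (t' - t)) z - heatKernel (t - r) z‖ₑ) x
            _ ≤ _ := this
            _ = _ := by
                congr 1
                rw [Real.div_rpow hδ hs.le, Real.rpow_neg hs.le]
                ring
        · rw [indicator_of_notMem (show r ∉ Ioo 0 t from fun h => h1 h.2), zero_add]
          by_cases h2 : r < t'
          · rw [indicator_of_mem (show r ∈ Ico t t' from ⟨not_lt.1 h1, h2⟩)]
            calc ∫⁻ y, ‖κ (r, y)‖ₑ = ∫⁻ y : Space d, ‖heatKernel (t' - r) (x - y)‖ₑ := by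
                  congr with y
                  simp only [hκ, causal, h1, h2, if_true, if_false, sub_zero]
              _ = ∫⁻ y : Space d, ‖heatKernel (t' - r) y‖ₑ :=
                  lintegral_sub_left_eq_self (fun z : Space d => ‖heatKernel (t' - r) z‖ₑ) x
              _ ≤ 1 := (lintegral_enorm_heatKernel (by linarith)).le
          · have : ∀ y : Space d, κ (r, y) = 0 := fun y => by
              simp only [hκ, causal, h1, h2, if_false, sub_zero]
            simp [this]
    _ ≤ _ := by
        gcongr ?_ * M
        rw [hD]
        rw [lintegral_add_right _ (measurable_const.indicator measurableSet_Ico)]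
        have e1 : ∫⁻ r in Ioi 0, (Ioo 0 t).indicator (fun r => ENNReal.ofReal
            (timeConst d * (t' - t) ^ (1 / 2 : ℝ) * (t - r) ^ (-(1 / 2) : ℝ))) r ≤
            ENNReal.ofReal (timeConst d * (t' - t) ^ (1 / 2 : ℝ) *
              (T ^ (-(1 / 2) + 1 : ℝ) / (-(1 / 2) + 1))) := by
          refine (setLIntegral_le_lintegral _ _).trans ?_
          rw [lintegral_indicator measurableSet_Ioo]
          have := lintegral_const_rpow_le (t := t) (T := T) (e := -(1 / 2))
            (C := timeConst d * (t' - t) ^ (1 / 2 : ℝ)) (by positivity) (by norm_num)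
            (htt'.trans ht) hT 1
          simpa using this
        have e2 : ∫⁻ r in Ioi 0, (Ico t t').indicator (fun _ => (1 : ℝ≥0∞)) r ≤
            ENNReal.ofReal (t' - t) := by
          refine (setLIntegral_le_lintegral _ _).trans ?_
          rw [lintegral_indicator measurableSet_Ico]
          simp
        refine (add_le_add e1 e2).trans (le_of_eq ?_)
        rw [← ENNReal.ofReal_add (by
          have : 0 ≤ (t' - t) ^ (1 / 2 : ℝ) := Real.rpow_nonneg hδ _
          have : 0 ≤ T ^ (-(1 / 2) + 1 : ℝ) := Real.rpow_nonneg hT.le _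
          have : (0 : ℝ) ≤ -(1 / 2) + 1 := by norm_num
          positivity) hδ]

/-- The heat potential is the time integral of the heat semigroup. -/
lemma pot_heat_eq_intervalIntegral {t : ℝ} (ht : 0 < t) (x : Space d) {ω : Ω}
    (hi : Integrable (fun z : ℝ × Space d => φ z.1 z.2 ω • causal heatKernel t x z)
      (stMeasure d)) :
    pot heatKernel φ t x ω =
      ∫ r in (0 : ℝ)..t, heatSemigroup (t - r) (fun y => φ r y ω) x := by
  unfold pot kerInt
  unfold stMeasure at hi ⊢
  rw [integral_prod _ hi, intervalIntegral.integral_of_le ht.le,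
    ← integral_indicator measurableSet_Ioi, ← integral_indicator measurableSet_Ioc]
  apply integral_congr_ae
  filter_upwards [Measure.ae_ne volume t] with r hr
  by_cases h0 : 0 < r
  swap
  · rw [indicator_of_notMem (by simpa using h0), indicator_of_notMem (fun h => h0 h.1)]
  rw [indicator_of_mem (by simpa using h0)]
  by_cases h1 : r < t
  · rw [indicator_of_mem (show r ∈ Ioc 0 t from ⟨h0, h1.le⟩)]
    simp only [causal, h1, if_true, heatSemigroup, smul_eq_mul, mul_comm]
  · rw [indicator_of_notMem (show r ∉ Ioc 0 t from fun h => h1 (lt_of_le_of_ne h.2 hr))]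
    simp [causal, h1]

end Drift

/-! ### The Wiener integral -/

section Wiener

/-- Lebesgue measure on the half-line. -/
noncomputable abbrev halfLine : Measure ℝ := volume.restrict (Ioi (0 : ℝ))

lemma halfLine_Ioc_ne_top (a : ℝ≥0) : halfLine (Ioc (0 : ℝ) a) ≠ ∞ :=
  ((Measure.restrict_apply_le _ _).trans_lt measure_Ioc_lt_top).ne

/-- The indicator of `(0,a]` in `L²(0,∞)`. -/
noncomputable def intervalVec (a : ℝ≥0) : Lp ℝ 2 halfLine :=
  indicatorConstLp 2 (measurableSet_Ioc (a := (0 : ℝ)) (b := a))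
    (halfLine_Ioc_ne_top a) 1

lemma inner_intervalVec (a b : ℝ≥0) :
    inner ℝ (intervalVec a) (intervalVec b) = ((min a b : ℝ≥0) : ℝ) := by
  unfold intervalVec
  rw [L2.real_inner_indicatorConstLp_one_indicatorConstLp_one _ _ (halfLine_Ioc_ne_top a)
    (halfLine_Ioc_ne_top b), Ioc_inter_Ioc, measureReal_def,
    Measure.restrict_apply measurableSet_Ioc, inter_eq_left.2]
  · rw [max_self, Real.volume_Ioc, sub_zero, ENNReal.toReal_ofReal (by positivity),
      NNReal.coe_min]
  · intro x hx
    simpa using hx.1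

lemma intervalVec_ae (a : ℝ≥0) :
    intervalVec a =ᵐ[halfLine] (Ioc (0 : ℝ) a).indicator (fun _ => 1) :=
  indicatorConstLp_coeFn

/-- The linear combination `∑ c_a 1_{(0,a]}` in `L²(0,∞)`. -/
noncomputable def stepVec : (ℝ≥0 →₀ ℝ) →ₗ[ℝ] Lp ℝ 2 halfLine :=
  Finsupp.linearCombination ℝ intervalVec

/-- Step functions are dense in `L²(0,∞)`: a function whose integrals over all `(0,a]` vanish is
zero, by Lebesgue's differentiation theorem. -/
lemma denseRange_stepVec : DenseRange stepVec := by
  have hK : (LinearMap.range stepVec)ᗮ = ⊥ := by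
    rw [Submodule.eq_bot_iff]
    intro g hg
    have hint : ∀ a : ℝ≥0, ∫ x in Ioc (0 : ℝ) a, g x ∂halfLine = 0 := by
      intro a
      have h1 := (Submodule.mem_orthogonal _ _).1 hg (intervalVec a)
        ⟨Finsupp.single a 1, by simp [stepVec]⟩
      unfold intervalVec at h1
      rwa [L2.inner_indicatorConstLp_one] at h1
    set f : ℝ → ℝ := (Ioi (0 : ℝ)).indicator g with hf
    have hmem : MemLp f 2 volume := (memLp_indicator_iff_restrict measurableSet_Ioi).2 (Lp.memLp g)
    have hloc : LocallyIntegrable f volume := hmem.locallyIntegrable one_le_two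
    have hzero : ∀ x : ℝ, 0 ≤ x → ∫ s in (0 : ℝ)..x, f s = 0 := by
      intro x hx
      have h2 := hint x.toNNReal
      rw [Measure.restrict_restrict measurableSet_Ioc, Real.coe_toNNReal x hx] at h2
      have h3 : Ioc (0 : ℝ) x ∩ Ioi 0 = Ioc 0 x := by
        ext y; simp only [mem_inter_iff, mem_Ioc, mem_Ioi]; tauto
      rw [intervalIntegral.integral_of_le hx]
      refine Eq.trans ?_ h2
      rw [h3]
      apply setIntegral_congr_fun measurableSet_Ioc
      intro y hy
      exact indicator_of_mem (show y ∈ Ioi 0 from hy.1) _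
    have hfz : ∀ᵐ x ∂halfLine, f x = 0 := by
      filter_upwards [ae_restrict_of_ae (LocallyIntegrable.ae_hasDerivAt_integral hloc),
        ae_restrict_mem measurableSet_Ioi] with x hx hx0
      have h1 := hx 0
      have h2 : HasDerivAt (fun x : ℝ => ∫ t in (0 : ℝ)..x, f t) 0 x := by
        refine (hasDerivAt_const x (0 : ℝ)).congr_of_eventuallyEq ?_
        filter_upwards [Ioi_mem_nhds hx0] with y hy
        exact hzero y (le_of_lt hy)
      exact h1.unique h2
    rw [Lp.eq_zero_iff_ae_eq_zero]
    filter_upwards [hfz, ae_restrict_mem measurableSet_Ioi] with x hx hx0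
    rwa [hf, indicator_of_mem hx0] at hx
  have h := Submodule.topologicalClosure_eq_top_iff.2 hK
  rw [DenseRange, dense_iff_closure_eq]
  have h' := congrArg (fun K : Submodule ℝ (Lp ℝ 2 halfLine) => (K : Set (Lp ℝ 2 halfLine))) h
  simpa [LinearMap.coe_range] using h'

variable {Ω : Type*} {mΩ : MeasurableSpace Ω} {P : Measure Ω} {ℱ : Filtration ℝ≥0 mΩ}
  {W : ℝ≥0 → Ω → ℝ}

lemma IsWienerProcess.isGaussianProcess (hW : IsWienerProcess P ℱ W) : IsGaussianProcess W P :=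
  hW.brownian.isGaussianProcess

lemma IsWienerProcess.memLp (hW : IsWienerProcess P ℱ W) (a : ℝ≥0) : MemLp (W a) 2 P :=
  (hW.isGaussianProcess.hasGaussianLaw_eval a).memLp_two

/-- The value `W_a` of the Wiener process in `L²(Ω)`. -/
noncomputable def wienerVec (hW : IsWienerProcess P ℱ W) (a : ℝ≥0) : Lp ℝ 2 P :=
  (hW.memLp a).toLp (W a)

lemma inner_wienerVec (hW : IsWienerProcess P ℱ W) (a b : ℝ≥0) :
    inner ℝ (wienerVec hW a) (wienerVec hW b) = ((min a b : ℝ≥0) : ℝ) := by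
  have hP : IsProbabilityMeasure P := hW.isGaussianProcess.isProbabilityMeasure
  rw [← hW.brownian.covariance_eval a b, covariance_eq_sub (hW.memLp a) (hW.memLp b),
    hW.brownian.integral_eval a, zero_mul, sub_zero, L2.inner_def]
  apply integral_congr_ae
  filter_upwards [(hW.memLp a).coeFn_toLp, (hW.memLp b).coeFn_toLp] with ω h1 h2
  simp only [wienerVec, h1, h2, Pi.mul_apply, RCLike.inner_apply, conj_trivial, mul_comm]

/-- The linear combination `∑ c_a W_a` in `L²(Ω)`. -/
noncomputable def stepInt (hW : IsWienerProcess P ℱ W) : (ℝ≥0 →₀ ℝ) →ₗ[ℝ] Lp ℝ 2 P :=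
  Finsupp.linearCombination ℝ (wienerVec hW)

/-- Itô's isometry for step functions. -/
lemma norm_stepInt (hW : IsWienerProcess P ℱ W) (c : ℝ≥0 →₀ ℝ) :
    ‖stepInt hW c‖ = ‖stepVec c‖ := by
  have h : inner ℝ (stepInt hW c) (stepInt hW c) = inner ℝ (stepVec c) (stepVec c) := by
    unfold stepInt stepVec
    simp only [Finsupp.linearCombination_apply, Finsupp.sum, sum_inner, inner_sum, inner_smul_left,
      inner_smul_right, inner_wienerVec, inner_intervalVec]
  rw [real_inner_self_eq_norm_sq, real_inner_self_eq_norm_sq] at h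
  exact (sq_eq_sq₀ (norm_nonneg _) (norm_nonneg _)).1 h

/-- The Wiener integral `F ↦ ∫ F dW`, the isometric extension to `L²(0,∞)` of the integral of step
functions. -/
noncomputable def wienerInt (hW : IsWienerProcess P ℱ W) : Lp ℝ 2 halfLine →L[ℝ] Lp ℝ 2 P :=
  (stepInt hW).extendOfNorm stepVec

lemma wienerInt_stepVec (hW : IsWienerProcess P ℱ W) (c : ℝ≥0 →₀ ℝ) :
    wienerInt hW (stepVec c) = stepInt hW c :=
  LinearMap.extendOfNorm_eq denseRange_stepVec
    ⟨1, fun x => by rw [one_mul]; exact (norm_stepInt hW x).le⟩ c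

lemma sum_smul_ae {α ι : Type*} {m : MeasurableSpace α} {μ : Measure α} (s : Finset ι)
    (k : ι → ℝ) {v : ι → Lp ℝ 2 μ} {f : ι → α → ℝ} (h : ∀ i, v i =ᵐ[μ] f i) :
    ((∑ i ∈ s, k i • v i : Lp ℝ 2 μ) : α → ℝ) =ᵐ[μ] fun x => ∑ i ∈ s, k i * f i x := by
  refine (Lp.coeFn_finsetSum _ _).trans ?_
  have h' : ∀ i ∈ s, (k i • v i : Lp ℝ 2 μ) =ᵐ[μ] fun x => k i * f i x := by
    intro i _
    filter_upwards [Lp.coeFn_smul (k i) (v i), h i] with x h1 h2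
    rw [h1, Pi.smul_apply, h2, smul_eq_mul]
  filter_upwards [(s.eventually_all (l := ae μ)).2 h'] with x hx
  rw [Finset.sum_apply]
  exact Finset.sum_congr rfl hx

lemma wienerVec_ae (hW : IsWienerProcess P ℱ W) (a : ℝ≥0) : wienerVec hW a =ᵐ[P] W a :=
  (hW.memLp a).coeFn_toLp

lemma stepInt_ae (hW : IsWienerProcess P ℱ W) (c : ℝ≥0 →₀ ℝ) :
    stepInt hW c =ᵐ[P] fun ω => ∑ a ∈ c.support, c a * W a ω := by
  unfold stepInt
  rw [Finsupp.linearCombination_apply, Finsupp.sum]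
  exact sum_smul_ae _ _ (wienerVec_ae hW)

lemma stepVec_ae (c : ℝ≥0 →₀ ℝ) :
    stepVec c =ᵐ[halfLine]
      fun r => ∑ a ∈ c.support, c a * (Ioc (0 : ℝ) a).indicator (fun _ => 1) r := by
  unfold stepVec
  rw [Finsupp.linearCombination_apply, Finsupp.sum]
  exact sum_smul_ae _ _ intervalVec_ae

/-- The `L^q`-norm of a standard Gaussian variable. -/
noncomputable def gaussConst (q : ℝ) : ℝ≥0∞ := eLpNorm id (ENNReal.ofReal q) (gaussianReal 0 1)

lemma gaussConst_lt_top (q : ℝ) : gaussConst q < ∞ :=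
  (memLp_id_gaussianReal' _ ENNReal.ofReal_ne_top).2

/-- All moments of `∫ F dW`, for a step function `F`, are controlled by the variance, because
`∫ F dW` is a centred Gaussian variable. -/
lemma eLpNorm_stepInt (hW : IsWienerProcess P ℱ W) (q : ℝ) (c : ℝ≥0 →₀ ℝ) :
    eLpNorm (stepInt hW c) (ENNReal.ofReal q) P =
      ENNReal.ofReal ‖stepVec c‖ * gaussConst q := by
  have hP : IsProbabilityMeasure P := hW.isGaussianProcess.isProbabilityMeasure
  set X : Ω → ℝ := fun ω => ∑ a ∈ c.support, c a * W a ω with hX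
  have hXae := stepInt_ae hW c
  have hgauss : HasGaussianLaw X P := by
    have := (hW.isGaussianProcess.smul (fun a => c a)).hasGaussianLaw_fun_sum (I := c.support)
    simpa [hX] using this
  have hmean : ∫ ω, X ω ∂P = 0 := by
    rw [hX, integral_finsetSum]
    · refine Finset.sum_eq_zero fun a _ => ?_
      rw [integral_const_mul, hW.brownian.integral_eval, mul_zero]
    · intro a _
      exact (hW.brownian.integrable_eval a).const_mul _
  -- the variance is computed by the isometry property
  have hvar : Var[X; P] = ‖stepVec c‖ ^ 2 := by
    rw [variance_of_integral_eq_zero hgauss.aemeasurable hmean, ← norm_stepInt hW,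
      ← real_inner_self_eq_norm_sq, L2.inner_def]
    apply integral_congr_ae
    filter_upwards [hXae] with ω hω
    simp only [RCLike.inner_apply, conj_trivial, hω]
    ring
  have hlaw := hgauss.map_eq_gaussianReal
  rw [hmean, hvar] at hlaw
  -- a centred Gaussian law is a dilation of the standard one, whose `L^q`-norm is `gaussConst q`
  have hstd : gaussianReal 0 (‖stepVec c‖ ^ 2).toNNReal =
      (gaussianReal 0 1).map (‖stepVec c‖ * ·) := by
    rw [gaussianReal_map_const_mul]
    congr 1
    · simp
    · ext; simp
  rw [eLpNorm_congr_ae hXae]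
  have h1 : eLpNorm X (ENNReal.ofReal q) P = eLpNorm id (ENNReal.ofReal q) (P.map X) := by
    rw [eLpNorm_map_measure aestronglyMeasurable_id hgauss.aemeasurable]
    rfl
  rw [h1, hlaw, hstd, eLpNorm_map_measure aestronglyMeasurable_id (by fun_prop)]
  have h2 : (id ∘ fun x : ℝ => ‖stepVec c‖ * x) = ‖stepVec c‖ • (id : ℝ → ℝ) := by
    ext x; simp
  rw [h2, eLpNorm_const_smul, gaussConst, enorm_norm, ofReal_norm]

/-- The `L^q`-norm is lower semicontinuous under convergence in `L²`. -/
lemma eLpNorm_le_of_tendsto {E : Type*} [NormedAddCommGroup E] {X : ℕ → Ω → E} {Y : Ω → E}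
    (hX : ∀ n, AEStronglyMeasurable (X n) P) (hY : AEStronglyMeasurable Y P)
    (hlim : Tendsto (fun n => eLpNorm (X n - Y) 2 P) atTop (𝓝 0)) {q B : ℝ≥0∞}
    {b : ℕ → ℝ≥0∞} (hb : ∀ n, eLpNorm (X n) q P ≤ b n) (hB : Tendsto b atTop (𝓝 B)) :
    eLpNorm Y q P ≤ B := by
  have h1 := tendstoInMeasure_of_tendsto_eLpNorm two_ne_zero hX hY hlim
  obtain ⟨ns, hns, h2⟩ := h1.exists_seq_tendsto_ae
  refine (Lp.eLpNorm_lim_le_liminf_eLpNorm (fun n => hX (ns n)) Y h2).trans ?_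
  refine (liminf_le_liminf (Eventually.of_forall fun n => hb (ns n))).trans ?_
  exact (hB.comp hns.tendsto_atTop).liminf_eq.le

lemma exists_seq_stepVec (F : Lp ℝ 2 halfLine) :
    ∃ c : ℕ → (ℝ≥0 →₀ ℝ), Tendsto (fun n => stepVec (c n)) atTop (𝓝 F) := by
  have h : F ∈ closure (range stepVec) := denseRange_stepVec F
  obtain ⟨x, hx, hlim⟩ := mem_closure_iff_seq_limit.1 h
  choose c hc using hx
  exact ⟨c, by simpa [hc] using hlim⟩

lemma tendsto_eLpNorm_sub {α : Type*} {m : MeasurableSpace α} {μ : Measure α}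
    {F : ℕ → Lp ℝ 2 μ} {G : Lp ℝ 2 μ} (h : Tendsto F atTop (𝓝 G)) :
    Tendsto (fun n => eLpNorm (F n - G : α → ℝ) 2 μ) atTop (𝓝 0) :=
  (Lp.tendsto_Lp_iff_tendsto_eLpNorm' _ _).1 h

/-- The moment bound for Wiener integrals, by approximation with step functions. -/
lemma eLpNorm_wienerInt_le (hW : IsWienerProcess P ℱ W) (q : ℝ) (F : Lp ℝ 2 halfLine) :
    eLpNorm (wienerInt hW F) (ENNReal.ofReal q) P ≤ ENNReal.ofReal ‖F‖ * gaussConst q := by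
  obtain ⟨c, hc⟩ := exists_seq_stepVec F
  have h1 : Tendsto (fun n => wienerInt hW (stepVec (c n))) atTop (𝓝 (wienerInt hW F)) :=
    ((wienerInt hW).continuous.tendsto F).comp hc
  refine eLpNorm_le_of_tendsto (fun n => Lp.aestronglyMeasurable _) (Lp.aestronglyMeasurable _)
    (tendsto_eLpNorm_sub h1) (b := fun n => ENNReal.ofReal ‖stepVec (c n)‖ * gaussConst q)
    (fun n => ?_) ?_
  · rw [wienerInt_stepVec, eLpNorm_stepInt]
  · exact ENNReal.Tendsto.mul_const (ENNReal.tendsto_ofReal (hc.norm))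
      (Or.inr (gaussConst_lt_top q).ne)

/-! ### The Wiener integral as an Itô integral -/

/-- The step function `∑ c_a 1_{(0, min a t]}`. -/
noncomputable def truncStep (c : ℝ≥0 →₀ ℝ) (t : ℝ≥0) : StepFun where
  size := c.support.card
  coef i := c (c.support.equivFin.symm i)
  left _ := 0
  right i := min (c.support.equivFin.symm i : ℝ≥0) t
  left_le_right _ := zero_le

lemma truncStep_eval (c : ℝ≥0 →₀ ℝ) (t : ℝ≥0) (r : ℝ) :
    (truncStep c t).eval r =
      ∑ a ∈ c.support, c a * (Ioc (0 : ℝ) (min a t : ℝ≥0)).indicator (fun _ => 1) r := by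
  rw [← Finset.sum_coe_sort, ← Equiv.sum_comp c.support.equivFin.symm]
  have h : ∀ (A : Set ℝ) (k : ℝ),
      A.indicator (fun _ => k) r = k * A.indicator (fun _ => 1) r := by
    intro A k
    by_cases hr : r ∈ A <;> simp [hr]
  exact Finset.sum_congr rfl fun i _ => h _ _

lemma truncStep_stochInt (c : ℝ≥0 →₀ ℝ) (t : ℝ≥0) (ω : Ω) :
    (truncStep c t).stochInt W ω = ∑ a ∈ c.support, c a * (W (min a t) ω - W 0 ω) := by
  rw [← Finset.sum_coe_sort, ← Equiv.sum_comp c.support.equivFin.symm]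
  rfl

/-- The Wiener integral of a function vanishing after time `t` is its Itô integral over `(0,t]`. -/
theorem isItoIntegral_wienerInt (hW : IsWienerProcess P ℱ W) (t : ℝ≥0) (F : Lp ℝ 2 halfLine)
    (hF : ∀ᵐ r ∂halfLine, (t : ℝ) < r → F r = 0) :
    IsItoIntegral P W t F (wienerInt hW F) := by
  have hle : volume.restrict (Ioc 0 (t : ℝ)) ≤ halfLine :=
    Measure.restrict_mono (fun x hx => hx.1) le_rfl
  obtain ⟨c, hc⟩ := exists_seq_stepVec F
  have hc' := tendsto_eLpNorm_sub hc
  have hnorm : ∀ n, eLpNorm (fun r => F r - (truncStep (c n) t).eval r) 2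
      (volume.restrict (Ioc 0 (t : ℝ))) ≤ eLpNorm (stepVec (c n) - F : ℝ → ℝ) 2 halfLine := by
    intro n
    rw [← eLpNorm_neg]
    refine le_trans (le_of_eq (eLpNorm_congr_ae ?_)) (eLpNorm_mono_measure _ hle)
    filter_upwards [ae_mono hle (stepVec_ae (c n)), ae_restrict_mem measurableSet_Ioc]
      with r hr hr2
    rw [Pi.neg_apply, Pi.sub_apply, hr, truncStep_eval, neg_sub]
    congr 1
    refine Finset.sum_congr rfl fun a _ => ?_
    congr 1
    simp only [indicator, mem_Ioc, NNReal.coe_min, le_min_iff, hr2.2, and_true]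
  refine ⟨(Lp.memLp F).mono_measure hle, Lp.memLp _, fun n => truncStep (c n) t, ?_, ?_, ?_⟩
  · intro n i
    exact NNReal.coe_le_coe.2 (min_le_right _ _)
  · exact tendsto_of_tendsto_of_tendsto_of_le_of_le tendsto_const_nhds hc' (fun _ => zero_le) hnorm
  -- `c' n` represents the truncated step function, which still converges to `F` in `L²(0,∞)`
  -- because `F` vanishes after time `t`; so the integrals converge
  set c' : ℕ → (ℝ≥0 →₀ ℝ) := fun n => (c n).mapDomain (fun a => min a t) with hc'def
  have hstep : ∀ n, stepVec (c' n) =ᵐ[halfLine] (truncStep (c n) t).eval := by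
    intro n
    have : stepVec (c' n) = ∑ a ∈ (c n).support, c n a • intervalVec (min a t) := by
      rw [hc'def, stepVec, Finsupp.linearCombination_mapDomain, Finsupp.linearCombination_apply]
      rfl
    rw [this]
    refine (sum_smul_ae _ _ (fun a => intervalVec_ae (min a t))).trans ?_
    exact Eventually.of_forall fun r => (truncStep_eval (c n) t r).symm
  have hint : ∀ n, stepInt hW (c' n) =ᵐ[P] (truncStep (c n) t).stochInt W := by
    intro n
    have : stepInt hW (c' n) = ∑ a ∈ (c n).support, c n a • wienerVec hW (min a t) := by
      rw [hc'def, stepInt, Finsupp.linearCombination_mapDomain, Finsupp.linearCombination_apply]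
      rfl
    rw [this]
    refine (sum_smul_ae _ _ (fun a => wienerVec_ae hW (min a t))).trans ?_
    filter_upwards [hW.brownian.eval_zero_ae_eq_zero] with ω hω
    rw [truncStep_stochInt]
    simp [hω]
  have hbound : ∀ n, eLpNorm (stepVec (c' n) - F : ℝ → ℝ) 2 halfLine ≤
      eLpNorm (stepVec (c n) - F : ℝ → ℝ) 2 halfLine := by
    intro n
    refine eLpNorm_mono_ae ?_
    filter_upwards [hstep n, stepVec_ae (c n), hF, ae_restrict_mem measurableSet_Ioi]
      with r h1 h2 h3 h4
    simp only [Pi.sub_apply]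
    by_cases hr : r ≤ t
    · rw [h1, h2, truncStep_eval]
      refine le_of_eq ?_
      congr 2
      refine Finset.sum_congr rfl fun a _ => ?_
      congr 1
      simp only [indicator, mem_Ioc, NNReal.coe_min, le_min_iff, hr, and_true]
    · rw [h1, h3 (not_le.1 hr), truncStep_eval]
      have : ∑ a ∈ (c n).support,
          c n a * (Ioc (0 : ℝ) (min a t : ℝ≥0)).indicator (fun _ => 1) r = 0 := by
        refine Finset.sum_eq_zero fun a _ => ?_
        simp only [indicator, mem_Ioc, NNReal.coe_min, le_min_iff, hr, and_false, if_false,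
          mul_zero]
      rw [this]
      simp
  have hlim : Tendsto (fun n => stepVec (c' n)) atTop (𝓝 F) := by
    rw [Lp.tendsto_Lp_iff_tendsto_eLpNorm']
    exact tendsto_of_tendsto_of_tendsto_of_le_of_le tendsto_const_nhds hc' (fun _ => zero_le) hbound
  have h2 := tendsto_eLpNorm_sub (((wienerInt hW).continuous.tendsto F).comp hlim)
  refine h2.congr fun n => ?_
  rw [← eLpNorm_neg]
  refine eLpNorm_congr_ae ?_
  filter_upwards [hint n] with ω hω
  simp only [Function.comp_apply, Pi.neg_apply, Pi.sub_apply, wienerInt_stepVec, hω, neg_sub]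

/-- The Itô integral over `(0,t]` is unique: it is the Wiener integral of the integrand. -/
theorem IsItoIntegral.ae_eq_wienerInt (hW : IsWienerProcess P ℱ W) {t : ℝ} {F : ℝ → ℝ}
    {I : Ω → ℝ} (h : IsItoIntegral P W t F I) (G : Lp ℝ 2 halfLine)
    (hG : G =ᵐ[halfLine] (Ioc 0 t).indicator F) : I =ᵐ[P] wienerInt hW G := by
  obtain ⟨hFm, hI, S, hS, hlim, hstoch⟩ := h
  -- rewrite the step functions of the definition in terms of the indicators `1_{(0,a]}`
  set c : ℕ → (ℝ≥0 →₀ ℝ) := fun n => ∑ i, (S n).coef i •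
    (Finsupp.single ((S n).right i) 1 - Finsupp.single ((S n).left i) 1) with hc
  have hstep : ∀ n, stepVec (c n) =ᵐ[halfLine] (S n).eval := by
    intro n
    have : stepVec (c n) = ∑ i, (S n).coef i •
        (intervalVec ((S n).right i) - intervalVec ((S n).left i)) := by
      rw [hc, map_sum]
      refine Finset.sum_congr rfl fun i _ => ?_
      rw [map_smul, map_sub]
      simp [stepVec]
    rw [this]
    refine (sum_smul_ae _ _ (f := fun i r =>
      (Ioc (0 : ℝ) ((S n).right i)).indicator (fun _ => 1) r -
        (Ioc (0 : ℝ) ((S n).left i)).indicator (fun _ => 1) r) fun i => ?_).trans ?_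
    · filter_upwards [Lp.coeFn_sub (intervalVec ((S n).right i)) (intervalVec ((S n).left i)),
        intervalVec_ae ((S n).right i), intervalVec_ae ((S n).left i)] with r h1 h2 h3
      rw [h1, Pi.sub_apply, h2, h3]
    · filter_upwards [ae_restrict_mem measurableSet_Ioi] with r hr
      refine Finset.sum_congr rfl fun i _ => ?_
      have hlr : ((S n).left i : ℝ) ≤ (S n).right i := NNReal.coe_le_coe.2 ((S n).left_le_right i)
      have hr0 : 0 < r := hr
      simp only [indicator, mem_Ioc, hr0, true_and]
      by_cases h1 : r ≤ (S n).left i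
      · simp [h1, h1.trans hlr, h1.not_gt]
      · by_cases h2 : r ≤ (S n).right i
        · simp [h1, h2, not_le.1 h1]
        · simp [h1, h2]
  have hint : ∀ n, stepInt hW (c n) =ᵐ[P] (S n).stochInt W := by
    intro n
    have : stepInt hW (c n) = ∑ i, (S n).coef i •
        (wienerVec hW ((S n).right i) - wienerVec hW ((S n).left i)) := by
      rw [hc, map_sum]
      refine Finset.sum_congr rfl fun i _ => ?_
      rw [map_smul, map_sub]
      simp [stepInt]
    rw [this]
    refine (sum_smul_ae _ _ (f := fun i ω => W ((S n).right i) ω - W ((S n).left i) ω)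
      fun i => ?_)
    filter_upwards [Lp.coeFn_sub (wienerVec hW ((S n).right i)) (wienerVec hW ((S n).left i)),
      wienerVec_ae hW ((S n).right i), wienerVec_ae hW ((S n).left i)] with r h1 h2 h3
    rw [h1, Pi.sub_apply, h2, h3]
  have hnorm : ∀ n, eLpNorm (stepVec (c n) - G : ℝ → ℝ) 2 halfLine =
      eLpNorm (fun r => F r - (S n).eval r) 2 (volume.restrict (Ioc 0 t)) := by
    intro n
    have hres : volume.restrict (Ioc 0 t) = halfLine.restrict (Ioc 0 t) := by
      rw [Measure.restrict_restrict measurableSet_Ioc, inter_eq_left.2 (fun x hx => hx.1)]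
    rw [hres, ← eLpNorm_indicator_eq_eLpNorm_restrict measurableSet_Ioc, ← eLpNorm_neg]
    refine eLpNorm_congr_ae ?_
    filter_upwards [hstep n, hG] with r h1 h2
    rw [Pi.neg_apply, Pi.sub_apply, h1, h2, neg_sub]
    by_cases hr : r ∈ Ioc 0 t
    · rw [indicator_of_mem hr, indicator_of_mem hr]
    · rw [indicator_of_notMem hr, indicator_of_notMem hr, zero_sub, neg_eq_zero]
      refine Finset.sum_eq_zero fun i _ => indicator_of_notMem (fun hi => hr ?_) _
      exact ⟨lt_of_le_of_lt (NNReal.coe_nonneg _) hi.1, hi.2.trans (hS n i)⟩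
  have hlimG : Tendsto (fun n => stepVec (c n)) atTop (𝓝 G) := by
    rw [Lp.tendsto_Lp_iff_tendsto_eLpNorm']
    exact hlim.congr fun n => (hnorm n).symm
  have h1 : Tendsto (fun n => stepInt hW (c n)) atTop (𝓝 (wienerInt hW G)) := by
    have := ((wienerInt hW).continuous.tendsto G).comp hlimG
    simpa only [Function.comp_def, wienerInt_stepVec] using this
  have h2 : Tendsto (fun n => stepInt hW (c n)) atTop (𝓝 (hI.toLp I)) := by
    rw [Lp.tendsto_Lp_iff_tendsto_eLpNorm']
    refine hstoch.congr fun n => ?_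
    rw [← eLpNorm_neg]
    refine eLpNorm_congr_ae ?_
    filter_upwards [hint n, hI.coeFn_toLp] with ω h1 h2
    rw [Pi.neg_apply, Pi.sub_apply, h1, h2, neg_sub]
  rw [tendsto_nhds_unique h1 h2]
  exact hI.coeFn_toLp.symm

/-- Measurability with respect to a sub-`σ`-algebra, up to null sets, passes to `L²`-limits. -/
lemma aestronglyMeasurable_of_tendsto_eLpNorm {m : MeasurableSpace Ω} (hm : m ≤ mΩ)
    {X : ℕ → Ω → ℝ} {Y : Ω → ℝ} (hX : ∀ n, AEStronglyMeasurable[m] (X n) P)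
    (hY : AEStronglyMeasurable[mΩ] Y P)
    (hlim : Tendsto (fun n => eLpNorm (X n - Y) 2 P) atTop (𝓝 0)) :
    AEStronglyMeasurable[m] Y P := by
  have h1 := tendstoInMeasure_of_tendsto_eLpNorm two_ne_zero (fun n => (hX n).mono hm) hY hlim
  obtain ⟨ns, -, h2⟩ := h1.exists_seq_tendsto_ae
  refine ⟨fun ω => limUnder atTop fun n => (hX (ns n)).mk _ ω,
    StronglyMeasurable.limUnder fun n => (hX (ns n)).stronglyMeasurable_mk, ?_⟩
  filter_upwards [h2, ae_all_iff.2 fun n => (hX (ns n)).ae_eq_mk] with ω h3 h4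
  exact (Tendsto.limUnder_eq (h3.congr h4)).symm

/-- The Itô integral over `(0,t]` is known at time `t`. -/
theorem IsItoIntegral.aestronglyMeasurable (hW : IsWienerProcess P ℱ W) {t : ℝ≥0} {F : ℝ → ℝ}
    {I : Ω → ℝ} (h : IsItoIntegral P W t F I) : AEStronglyMeasurable[ℱ t] I P := by
  obtain ⟨-, hI, S, hS, -, hstoch⟩ := h
  refine aestronglyMeasurable_of_tendsto_eLpNorm (ℱ.le t) (X := fun n => (S n).stochInt W)
    (fun n => ?_) hI.1 (hstoch.congr fun n => ?_)
  · refine Measurable.aestronglyMeasurable ?_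
    unfold StepFun.stochInt
    refine Finset.measurable_fun_sum _ fun i _ => ?_
    have hr : (S n).right i ≤ t := NNReal.coe_le_coe.1 (hS n i)
    exact (((hW.adapted _).mono (ℱ.mono hr) le_rfl).sub
      ((hW.adapted _).mono (ℱ.mono (((S n).left_le_right i).trans hr)) le_rfl)).const_mul _
  · rw [← eLpNorm_neg]
    congr 1
    ext ω
    simp

end Wiener

/-! ### Almost sure limits and measurable, adapted modifications -/

section Limits

variable {Ω : Type*} {mΩ : MeasurableSpace Ω} {P : Measure Ω}
  {E : Type*} [NormedAddCommGroup E]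

/-- A series of nonnegative functions with summable integrals converges almost everywhere, so its
terms tend to zero. -/
lemma ae_tendsto_zero_of_tsum_lintegral_ne_top {f : ℕ → Ω → ℝ≥0∞}
    (hf : ∀ k, AEMeasurable (f k) P) (hs : ∑' k, ∫⁻ ω, f k ω ∂P ≠ ∞) :
    ∀ᵐ ω ∂P, Tendsto (fun k => f k ω) atTop (𝓝 0) := by
  rw [← lintegral_tsum hf] at hs
  filter_upwards [ae_lt_top' (AEMeasurable.tsum hf) hs] with ω hω
  exact ENNReal.tendsto_atTop_zero_of_tsum_ne_top hω.ne

/-- The Borel–Cantelli form of convergence in `L^q`: summable errors give almost sure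
convergence. -/
lemma ae_tendsto_of_tsum_eLpNorm_ne_top [IsProbabilityMeasure P] {X : ℕ → Ω → E} {Y : Ω → E}
    {q : ℝ≥0∞} (hq : 1 ≤ q) (hX : ∀ k, AEStronglyMeasurable (X k) P)
    (hY : AEStronglyMeasurable Y P) (hs : ∑' k, eLpNorm (X k - Y) q P ≠ ∞) :
    ∀ᵐ ω ∂P, Tendsto (fun k => X k ω) atTop (𝓝 (Y ω)) := by
  have h1 : ∑' k, ∫⁻ ω, ‖X k ω - Y ω‖ₑ ∂P ≠ ∞ := by
    refine ne_top_of_le_ne_top hs (ENNReal.tsum_le_tsum fun k => ?_)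
    have := eLpNorm_le_eLpNorm_of_exponent_le hq ((hX k).sub hY)
    rwa [eLpNorm_one_eq_lintegral_enorm] at this
  filter_upwards [ae_tendsto_zero_of_tsum_lintegral_ne_top
    (fun k => ((hX k).sub hY).enorm) h1] with ω hω
  rw [tendsto_iff_edist_tendsto_0]
  simpa [edist_eq_enorm_sub] using hω

lemma tsum_ofReal_ne_top_of_summable {f : ℕ → ℝ} (hf : Summable f) :
    ∑' k, ENNReal.ofReal (f k) ≠ ∞ :=
  (Summable.tsum_ofReal_lt_top hf).ne

lemma summable_const_mul_two_pow_rpow (C : ℝ) {γ : ℝ} (hγ : 0 < γ) :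
    Summable fun k : ℕ => C * ((1 / 2 : ℝ) ^ k) ^ γ := by
  refine Summable.mul_left _ ?_
  have h : ∀ k : ℕ, ((1 / 2 : ℝ) ^ k) ^ γ = ((1 / 2 : ℝ) ^ γ) ^ k := fun k => by
    rw [← Real.rpow_natCast, ← Real.rpow_natCast, ← Real.rpow_mul (by norm_num),
      ← Real.rpow_mul (by norm_num), mul_comm]
  simp_rw [h]
  exact summable_geometric_of_lt_one (by positivity)
    (Real.rpow_lt_one (by norm_num) (by norm_num) hγ)

end Limits

section Modification

variable {d : ℕ} {Ω : Type*} {mΩ : MeasurableSpace Ω} {P : Measure Ω}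

open Classical in
/-- The index of the first point of the standard dense sequence at distance less than `2^{-k}`
from `x`. -/
noncomputable def denseIndex (d k : ℕ) (x : Space d) : ℕ :=
  Nat.find (p := fun n => dist x (TopologicalSpace.denseSeq (Space d) n) < (1 / 2 : ℝ) ^ k)
    ((TopologicalSpace.denseRange_denseSeq (Space d)).exists_dist_lt x (by positivity))

lemma dist_denseIndex_lt (k : ℕ) (x : Space d) :
    dist x (TopologicalSpace.denseSeq (Space d) (denseIndex d k x)) < (1 / 2 : ℝ) ^ k := by
  classical
  exact Nat.find_spec
    (p := fun n => dist x (TopologicalSpace.denseSeq (Space d) n) < (1 / 2 : ℝ) ^ k)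
    ((TopologicalSpace.denseRange_denseSeq (Space d)).exists_dist_lt x (by positivity))

lemma measurable_denseIndex (k : ℕ) : Measurable (denseIndex d k) := by
  classical
  refine measurable_find (p := fun x n =>
    dist x (TopologicalSpace.denseSeq (Space d) n) < (1 / 2 : ℝ) ^ k) _ fun n => ?_
  exact measurableSet_lt (measurable_id.dist measurable_const) measurable_const

/-- A random field which is locally Hölder continuous in `L²(Ω)`, in space and backwards in time,
and whose values are measurable with respect to the filtration up to null sets, has a jointly
measurable and adapted modification: the almost sure limit of its values at nearby points of a
countable dense set, the times being approximated from below. -/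
theorem exists_measField_modification [IsProbabilityMeasure P] {ℱ : Filtration ℝ≥0 mΩ}
    {Y : ℝ → Space d → Ω → ℝ}
    (hY : ∀ (t : ℝ≥0) (x : Space d), AEStronglyMeasurable[ℱ t] (Y t x) P)
    (hmod : ∀ (t : ℝ≥0) (x : Space d), ∃ C γ : ℝ, 0 < γ ∧ ∀ (s : ℝ≥0) (y : Space d), s ≤ t →
      (t : ℝ) - s ≤ 1 → ‖y - x‖ ≤ 1 →
        eLpNorm (Y s y - Y t x) 2 P ≤ ENNReal.ofReal (C * (((t : ℝ) - s) ^ γ + ‖y - x‖ ^ γ))) :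
    ∃ U : ℝ → Space d → Ω → ℝ, MeasField U ∧
      (∀ (t : ℝ≥0) (x : Space d), Measurable[ℱ t] (U t x)) ∧
      ∀ (t : ℝ≥0) (x : Space d), U t x =ᵐ[P] Y t x := by
  -- `X k t x` is the value at the dyadic time `⌊2^k t⌋/2^k ≤ t` and at the point of the dense
  -- sequence near `x`; the times are rounded down to keep the approximations adapted
  choose! Y' hY'm hY' using hY
  set ξ := TopologicalSpace.denseSeq (Space d) with hξ
  set X : ℕ → ℝ → Space d → Ω → ℝ := fun k t x =>
    Y' ((⌊(2 : ℝ) ^ k * t⌋₊ : ℝ≥0) / 2 ^ k) (ξ (denseIndex d k x)) with hX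
  have hle : ∀ (k : ℕ) (t : ℝ≥0), (⌊(2 : ℝ) ^ k * t⌋₊ : ℝ≥0) / 2 ^ k ≤ t := fun k t => by
    rw [← NNReal.coe_le_coe]; push_cast
    rw [div_le_iff₀ (by positivity), mul_comm (t : ℝ)]
    exact Nat.floor_le (by positivity)
  have hge : ∀ (k : ℕ) (t : ℝ≥0),
      (t : ℝ) - ((⌊(2 : ℝ) ^ k * t⌋₊ : ℝ≥0) / 2 ^ k : ℝ≥0) ≤ (1 / 2 : ℝ) ^ k := fun k t => by
    push_cast
    have h1 := (Nat.lt_floor_add_one ((2 : ℝ) ^ k * t)).le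
    have h2 : (0 : ℝ) < 2 ^ k := by positivity
    rw [one_div, inv_pow, sub_le_iff_le_add, ← one_div, ← add_div, le_div_iff₀ h2]
    linarith
  have hXm : ∀ k, Measurable fun q : ℝ × Space d × Ω => X k q.1 q.2.1 q.2.2 := fun k => by
    have h1 : Measurable fun q : (ℕ × ℕ) × Ω => Y' ((q.1.1 : ℝ≥0) / 2 ^ k) (ξ q.1.2) q.2 :=
      measurable_from_prod_countable_right fun i =>
        ((hY'm ((i.1 : ℝ≥0) / 2 ^ k) (ξ i.2)).measurable.mono (ℱ.le _) le_rfl :)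
    have h2 : Measurable fun q : ℝ × Space d × Ω =>
        ((⌊(2 : ℝ) ^ k * q.1⌋₊, denseIndex d k q.2.1), q.2.2) :=
      ((Nat.measurable_floor.comp (measurable_fst.const_mul _)).prodMk
        ((measurable_denseIndex k).comp (measurable_fst.comp measurable_snd))).prodMk
        (measurable_snd.comp measurable_snd)
    exact Measurable.comp h1 h2
  have hXa : ∀ k (t : ℝ≥0) x, StronglyMeasurable[ℱ t] (X k t x) := fun k t x =>
    (hY'm _ _).mono (ℱ.mono (hle k t))
  refine ⟨fun t x ω => limUnder atTop fun k => X k t x ω, ?_, fun t x => ?_, fun t x => ?_⟩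
  · exact (StronglyMeasurable.limUnder fun k => (hXm k).stronglyMeasurable).measurable
  · exact (@StronglyMeasurable.limUnder _ _ _ (ℱ t) _ _ _ _ _ _ _ fun k => hXa k t x).measurable
  · obtain ⟨C, γ, hγ, hC⟩ := hmod t x
    have hm0 : ∀ (s : ℝ≥0) y, AEStronglyMeasurable (Y s y) P := fun s y =>
      ⟨Y' s y, (hY'm s y).mono (ℱ.le s), hY' s y⟩
    -- the errors are of order `2^{-kγ}`, hence summable
    have hs : ∑' k, eLpNorm (X k t x - Y t x) 2 P ≠ ∞ := by
      refine ne_top_of_le_ne_top (tsum_ofReal_ne_top_of_summable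
        (summable_const_mul_two_pow_rpow (2 * |C|) hγ)) (ENNReal.tsum_le_tsum fun k => ?_)
      have hk1 : (1 / 2 : ℝ) ^ k ≤ 1 := pow_le_one₀ (by norm_num) (by norm_num)
      have hd := dist_denseIndex_lt k x
      rw [dist_comm, dist_eq_norm] at hd
      set s : ℝ≥0 := (⌊(2 : ℝ) ^ k * t⌋₊ : ℝ≥0) / 2 ^ k with hs
      have h1 : eLpNorm (X k t x - Y t x) 2 P = eLpNorm (Y s (ξ (denseIndex d k x)) - Y t x) 2 P :=
        eLpNorm_congr_ae ((hY' s _).symm.sub (ae_eq_refl _))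
      rw [h1]
      refine (hC s _ (hle k t) ((hge k t).trans hk1) (hd.le.trans hk1)).trans
        (ENNReal.ofReal_le_ofReal ?_)
      have h0 : 0 ≤ (t : ℝ) - s := sub_nonneg.2 (NNReal.coe_le_coe.2 (hle k t))
      have h2 : ((t : ℝ) - s) ^ γ ≤ ((1 / 2 : ℝ) ^ k) ^ γ := by
        gcongr; exact hge k t
      have h3 : ‖ξ (denseIndex d k x) - x‖ ^ γ ≤ ((1 / 2 : ℝ) ^ k) ^ γ := by gcongr
      have h4 : 0 ≤ ((t : ℝ) - s) ^ γ + ‖ξ (denseIndex d k x) - x‖ ^ γ := by positivity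
      calc C * (((t : ℝ) - s) ^ γ + ‖ξ (denseIndex d k x) - x‖ ^ γ)
          ≤ |C| * (((t : ℝ) - s) ^ γ + ‖ξ (denseIndex d k x) - x‖ ^ γ) := by
            gcongr; exact le_abs_self C
        _ ≤ |C| * (((1 / 2 : ℝ) ^ k) ^ γ + ((1 / 2 : ℝ) ^ k) ^ γ) := by gcongr
        _ = _ := by ring
    have h1 := ae_tendsto_of_tsum_eLpNorm_ne_top (by norm_num)
      (fun k => ((hXa k t x).mono (ℱ.le t)).aestronglyMeasurable) (hm0 t x) hs
    filter_upwards [h1] with ω hω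
    exact hω.limUnder_eq

end Modification

/-! ### Integral operators preserve adaptedness -/

section Adapted

variable {Z Ω : Type*} {mZ : MeasurableSpace Z} {mΩ : MeasurableSpace Ω} {μ : Measure Z}
  {P : Measure Ω}

/-- `Y - E[Y | m]` is orthogonal to the square integrable random variables that are measurable
with respect to `m`. -/
lemma integral_mul_sub_condExp_eq_zero [IsProbabilityMeasure P] {m : MeasurableSpace Ω}
    (hm : m ≤ mΩ) {Y X : Ω → ℝ} (hY : MemLp Y 2 P) (hX : MemLp X 2 P)
    (hXm : AEStronglyMeasurable[m] X P) : ∫ ω, X ω * (Y ω - (P[Y|m]) ω) ∂P = 0 := by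
  have hYi : Integrable Y P := hY.integrable (by norm_num)
  have hR : MemLp (Y - P[Y|m]) 2 P := hY.sub (hY.condExp (by norm_num))
  have hRi : Integrable (Y - P[Y|m]) P := hR.integrable (by norm_num)
  have hXR : Integrable (X * (Y - P[Y|m])) P := hX.integrable_mul hR
  have h1 := condExp_mul_of_aestronglyMeasurable_left hXm hXR hRi
  have h2 : P[Y - P[Y|m]|m] =ᵐ[P] 0 := by
    have h3 : P[P[Y|m]|m] = P[Y|m] :=
      condExp_of_stronglyMeasurable hm stronglyMeasurable_condExp integrable_condExp
    have h4 := condExp_sub hYi (integrable_condExp (f := Y) (m := m) (μ := P)) m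
    rw [h3, sub_self] at h4
    exact h4
  calc _ = ∫ ω, (X * (Y - P[Y|m])) ω ∂P := rfl
    _ = ∫ ω, (P[X * (Y - P[Y|m])|m]) ω ∂P := (integral_condExp hm).symm
    _ = ∫ ω, (0 : ℝ) ∂P := by
        apply integral_congr_ae
        filter_upwards [h1, h2] with ω hω1 hω2
        simp only [hω1, Pi.mul_apply, hω2, Pi.zero_apply, mul_zero]
    _ = 0 := integral_zero _ _

lemma measurable_eLpNorm_two [SFinite P] {φ : Z → Ω → ℝ}
    (hφ : Measurable (fun p : Z × Ω => φ p.1 p.2)) : Measurable fun z => eLpNorm (φ z) 2 P := by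
  have h3 : Measurable fun z => ∫⁻ ω, ‖φ z ω‖ₑ ^ (2 : ℝ) ∂P :=
    Measurable.lintegral_prod_right ((hφ.enorm).pow_const 2)
  have h4 : (fun z => eLpNorm (φ z) 2 P) =
      fun z => (∫⁻ ω, ‖φ z ω‖ₑ ^ (2 : ℝ) ∂P) ^ (1 / 2 : ℝ) := by
    funext z
    have := eLpNorm_ofReal_eq (P := P) (X := φ z) (q := 2) (by norm_num)
    rwa [ENNReal.ofReal_ofNat] at this
  rw [h4]; exact h3.pow_const _

lemma memLp_kerInt [SFinite P] [SFinite μ] {κ : Z → ℝ} (hκ : Measurable κ) {φ : Z → Ω → ℝ}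
    (hφ : Measurable (fun p : Z × Ω => φ p.1 p.2))
    (hfin : ∫⁻ z, ‖κ z‖ₑ * eLpNorm (φ z) 2 P ∂μ < ∞) : MemLp (kerInt μ κ φ) 2 P := by
  have h1 : StronglyMeasurable fun p : Ω × Z => φ p.2 p.1 • κ p.2 :=
    ((hφ.comp measurable_swap).smul (hκ.comp measurable_snd)).stronglyMeasurable
  refine ⟨(h1.integral_prod_right (ν := μ)).aestronglyMeasurable, lt_of_le_of_lt ?_ hfin⟩
  have := eLpNorm_kerInt_le (P := P) (μ := μ) (q := 2) (by norm_num) hκ hφ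
  rwa [ENNReal.ofReal_ofNat] at this

/-- Orthogonality to the values of a random field is inherited by its image under an integral
operator. -/
lemma integral_mul_kerInt_eq_zero [SFinite P] [SFinite μ] {κ : Z → ℝ} (hκ : Measurable κ)
    {φ : Z → Ω → ℝ} (hφ : Measurable (fun p : Z × Ω => φ p.1 p.2))
    (hfin : ∫⁻ z, ‖κ z‖ₑ * eLpNorm (φ z) 2 P ∂μ < ∞) {R : Ω → ℝ} (hR : MemLp R 2 P)
    (horth : ∀ᵐ z ∂μ, κ z ≠ 0 → MemLp (φ z) 2 P → ∫ ω, φ z ω * R ω ∂P = 0) :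
    ∫ ω, R ω * kerInt μ κ φ ω ∂P = 0 := by
  have hφz : ∀ z, Measurable (φ z) := fun z => hφ.comp measurable_prodMk_left
  have hNm : Measurable fun z => eLpNorm (φ z) 2 P := measurable_eLpNorm_two hφ
  obtain ⟨R', hR'm, hR'⟩ := hR.1
  have hjm : Measurable fun p : Ω × Z => R' p.1 * (φ p.2 p.1 • κ p.2) :=
    (hR'm.measurable.comp measurable_fst).mul
      ((hφ.comp measurable_swap).smul (hκ.comp measurable_snd))
  have hint : Integrable (fun p : Ω × Z => R' p.1 * (φ p.2 p.1 • κ p.2)) (P.prod μ) := by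
    refine ⟨hjm.aestronglyMeasurable, ?_⟩
    unfold HasFiniteIntegral
    rw [lintegral_prod_symm _ hjm.enorm.aemeasurable]
    calc ∫⁻ z, ∫⁻ ω, ‖R' ω * (φ z ω • κ z)‖ₑ ∂P ∂μ
        ≤ ∫⁻ z, ‖κ z‖ₑ * eLpNorm (φ z) 2 P * eLpNorm R 2 P ∂μ := by
          apply lintegral_mono
          intro z
          have h3 : ∫⁻ ω, ‖R' ω * (φ z ω • κ z)‖ₑ ∂P = ‖κ z‖ₑ * ∫⁻ ω, ‖(φ z • R') ω‖ₑ ∂P := by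
            rw [← lintegral_const_mul _ ((hφz z).smul hR'm.measurable).enorm]
            refine lintegral_congr fun ω => ?_
            simp only [smul_eq_mul, enorm_mul, Pi.smul_apply']
            ring
          simp only [h3, mul_assoc]
          gcongr
          rw [← eLpNorm_one_eq_lintegral_enorm, eLpNorm_congr_ae hR']
          exact eLpNorm_smul_le_mul_eLpNorm hR'm.aestronglyMeasurable (hφz z).aestronglyMeasurable
      _ = (∫⁻ z, ‖κ z‖ₑ * eLpNorm (φ z) 2 P ∂μ) * eLpNorm R 2 P := by
          rw [lintegral_mul_const]
          exact hκ.enorm.mul hNm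
      _ < ∞ := ENNReal.mul_lt_top hfin hR.2
  calc ∫ ω, R ω * kerInt μ κ φ ω ∂P = ∫ ω, ∫ z, R' ω * (φ z ω • κ z) ∂μ ∂P := by
        apply integral_congr_ae
        filter_upwards [hR'] with ω hω
        rw [integral_const_mul, hω]
        rfl
    _ = ∫ z, ∫ ω, R' ω * (φ z ω • κ z) ∂P ∂μ := integral_integral_swap hint
    _ = ∫ z, (0 : ℝ) ∂μ := by
        have hfinz : ∀ᵐ z ∂μ, ‖κ z‖ₑ * eLpNorm (φ z) 2 P < ∞ :=
          ae_lt_top (hκ.enorm.mul hNm) hfin.ne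
        apply integral_congr_ae
        filter_upwards [horth, hfinz] with z hz hzf
        by_cases h0 : κ z = 0
        · simp [h0]
        have hφL : MemLp (φ z) 2 P := by
          refine ⟨(hφz z).aestronglyMeasurable, ?_⟩
          by_contra hcon
          rw [not_lt, top_le_iff] at hcon
          rw [hcon, ENNReal.mul_top (by simpa using h0)] at hzf
          exact lt_irrefl _ hzf
        calc ∫ ω, R' ω * (φ z ω • κ z) ∂P = ∫ ω, κ z * (φ z ω * R ω) ∂P := by
              apply integral_congr_ae
              filter_upwards [hR'] with ω hω
              rw [hω, smul_eq_mul]; ring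
          _ = 0 := by rw [integral_const_mul, hz h0 hφL, mul_zero]
    _ = 0 := integral_zero _ _

/-- If the values of a random field are measurable with respect to `m` wherever the kernel does
not vanish, then so is its image under the integral operator: by Fubini's theorem the image is
orthogonal to its difference from its conditional expectation. -/
theorem aestronglyMeasurable_kerInt [IsProbabilityMeasure P] [SFinite μ] {m : MeasurableSpace Ω}
    (hm : m ≤ mΩ) {κ : Z → ℝ} (hκ : Measurable κ) {φ : Z → Ω → ℝ}
    (hφ : Measurable[mZ.prod mΩ] (fun p : Z × Ω => φ p.1 p.2))
    (had : ∀ᵐ z ∂μ, κ z ≠ 0 → AEStronglyMeasurable[m] (φ z) P)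
    (hfin : ∫⁻ z, ‖κ z‖ₑ * eLpNorm (φ z) 2 P ∂μ < ∞) :
    AEStronglyMeasurable[m] (kerInt μ κ φ) P := by
  have hY : MemLp (kerInt μ κ φ) 2 P := memLp_kerInt hκ hφ hfin
  set Y := kerInt μ κ φ with hYdef
  set R : Ω → ℝ := fun ω => Y ω - (P[Y|m]) ω with hRdef
  have hR : MemLp R 2 P := hY.sub (hY.condExp (by norm_num))
  have hRYm : ∫ ω, (P[Y|m]) ω * R ω ∂P = 0 :=
    integral_mul_sub_condExp_eq_zero hm hY (hY.condExp (by norm_num))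
      stronglyMeasurable_condExp.aestronglyMeasurable
  -- `R` is orthogonal to the `m`-measurable variables `φ z`, hence to `Y`
  have hRY : ∫ ω, R ω * Y ω ∂P = 0 := by
    refine integral_mul_kerInt_eq_zero hκ hφ hfin hR ?_
    filter_upwards [had] with z hz h0 hL
    exact integral_mul_sub_condExp_eq_zero hm hY hL (hz h0)
  have hRR : ∫ ω, R ω * R ω ∂P = 0 := by
    have h3 : ∀ ω, R ω * R ω = R ω * Y ω - (P[Y|m]) ω * R ω := fun ω => by
      simp only [hRdef]; ring
    simp_rw [h3]
    rw [integral_sub, hRY, hRYm, sub_zero]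
    · exact hR.integrable_mul hY
    · exact (hY.condExp (by norm_num)).integrable_mul hR
  have hR0 : R =ᵐ[P] 0 := by
    have h3 := (integral_eq_zero_iff_of_nonneg (fun ω => mul_self_nonneg (R ω))
      (hR.integrable_mul hR)).1 hRR
    filter_upwards [h3] with ω hω
    simpa using hω
  refine ⟨P[Y|m], stronglyMeasurable_condExp, ?_⟩
  filter_upwards [hR0] with ω hω
  exact sub_eq_zero.1 hω

end Adapted

/-! ### Weak gradients of random fields -/

section TestFunctions

variable {d : ℕ}

/-- Countably many test functions suffice to detect locally integrable functions: translates of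
normalised bump functions, centred at the points of a dense sequence. -/
lemma exists_countable_testFunctions (d : ℕ) : ∃ φ : ℕ × ℕ → Space d → ℝ,
    (∀ i, ContDiff ℝ (⊤ : ℕ∞) (φ i) ∧ HasCompactSupport (φ i)) ∧
    ∀ g : Space d → ℝ, LocallyIntegrable g volume → (∀ i, ∫ x, g x * φ i x = 0) →
      g =ᵐ[volume] 0 := by
  let B : ℕ → ContDiffBump (0 : Space d) := fun n =>
    { rIn := (1 / 2 : ℝ) ^ (n + 1), rOut := (1 / 2 : ℝ) ^ n, rIn_pos := by positivity
      rIn_lt_rOut := by rw [pow_succ]; linarith [show (0 : ℝ) < (1 / 2) ^ n by positivity] }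
  let ξ := TopologicalSpace.denseSeq (Space d)
  refine ⟨fun i x => (B i.1).normed volume (ξ i.2 - x), fun i => ⟨?_, ?_⟩, fun g hg h0 => ?_⟩
  · exact ((B i.1).contDiff_normed).comp (contDiff_const.sub contDiff_id)
  · have h1 : HasCompactSupport ((B i.1).normed (volume : Measure (Space d))) :=
      (B i.1).hasCompactSupport_normed
    exact h1.comp_homeomorph (Homeomorph.subLeft (ξ i.2))
  · have hlim := ContDiffBump.ae_convolution_tendsto_right_of_locallyIntegrable (φ := B)
      (l := atTop) (K := 2) (g := g) (μ := volume)
      (tendsto_pow_atTop_nhds_zero_of_lt_one (by norm_num) (by norm_num))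
      (Eventually.of_forall fun n => by
        change (1 / 2 : ℝ) ^ n ≤ 2 * (1 / 2 : ℝ) ^ (n + 1)
        rw [pow_succ]; linarith) hg
    -- the convolutions with the bump functions vanish on a dense set, hence everywhere
    have hz : ∀ n x, convolution ((B n).normed volume) g (ContinuousLinearMap.lsmul ℝ ℝ) volume x
        = 0 := by
      intro n
      have hc := HasCompactSupport.continuous_convolution_left (μ := volume) (g := g)
        (ContinuousLinearMap.lsmul ℝ ℝ) ((B n).hasCompactSupport_normed (μ := volume))
        ((B n).continuous_normed (μ := volume)) hg
      have hd : ∀ j, convolution ((B n).normed volume) g (ContinuousLinearMap.lsmul ℝ ℝ) volume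
          (ξ j) = 0 := by
        intro j
        rw [← h0 (n, j), convolution_eq_swap]
        refine integral_congr_ae (Eventually.of_forall fun x => ?_)
        simp [mul_comm]
      have := (TopologicalSpace.denseRange_denseSeq (Space d)).equalizer hc
        (continuous_const (y := (0 : ℝ))) (funext hd)
      exact fun x => congrFun this x
    filter_upwards [hlim] with x hx
    simp_rw [hz] at hx
    exact tendsto_nhds_unique hx tendsto_const_nhds

/-- Difference quotients of a locally integrable function converge weakly to minus its pairing with
the derivative of the test function. -/
lemma tendsto_integral_diffQuotient {X φ : Space d → ℝ} (hX : LocallyIntegrable X volume)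
    (hφ : ContDiff ℝ (⊤ : ℕ∞) φ) (hφc : HasCompactSupport φ) (e : Space d) :
    Tendsto (fun n : ℕ => ∫ x, (2 ^ n * (X (x + (1 / 2 : ℝ) ^ n • e) - X x)) * φ x) atTop
      (𝓝 (-∫ x, X x * fderiv ℝ φ x e)) := by
  have hcont : Continuous φ := hφ.continuous
  have hXφ : ∀ a : Space d, Integrable (fun x => X x * φ (x - a)) volume := fun a =>
    hX.integrable_smul_right_of_hasCompactSupport (g := fun x => φ (x - a)) (by fun_prop)
      (hφc.comp_homeomorph (Homeomorph.subRight a))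
  have hXφ0 : Integrable (fun x => X x * φ x) volume := by simpa using hXφ 0
  have hXa : ∀ a : Space d, Integrable (fun x => X (x + a) * φ x) volume := fun a => by
    have := (hXφ a).comp_add_right a
    simpa using this
  -- discrete integration by parts moves the difference quotient to the test function
  have hshift : ∀ n : ℕ, ∫ x, (2 ^ n * (X (x + (1 / 2 : ℝ) ^ n • e) - X x)) * φ x =
      ∫ x, X x * (2 ^ n * (φ (x - (1 / 2 : ℝ) ^ n • e) - φ x)) := by
    intro n
    set a : Space d := (1 / 2 : ℝ) ^ n • e
    have h1 : ∫ x, X (x + a) * φ x = ∫ x, X x * φ (x - a) := by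
      have := integral_add_right_eq_self (μ := volume) (fun x => X x * φ (x - a)) a
      simpa using this
    have h2 : ∀ x, (2 ^ n * (X (x + a) - X x)) * φ x =
        2 ^ n * (X (x + a) * φ x - X x * φ x) := fun x => by ring
    have h3 : ∀ x, X x * (2 ^ n * (φ (x - a) - φ x)) =
        2 ^ n * (X x * φ (x - a) - X x * φ x) := fun x => by ring
    simp_rw [h2, h3]
    rw [integral_const_mul, integral_const_mul, integral_sub (hXa a) hXφ0,
      integral_sub (hXφ a) hXφ0, h1]
  simp_rw [hshift]
  rw [← integral_neg]
  obtain ⟨L, hL⟩ := hφ.lipschitzWith_of_hasCompactSupport hφc (by simp)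
  obtain ⟨R, hR⟩ := hφc.isCompact.isBounded.subset_closedBall (0 : Space d)
  have hzero : ∀ x : Space d, R < ‖x‖ → φ x = 0 := fun x hx => by
    by_contra h
    have := hR (subset_tsupport φ h)
    rw [mem_closedBall_zero_iff] at this
    linarith
  have hK : IntegrableOn X (Metric.closedBall 0 (R + ‖e‖)) volume :=
    hX.integrableOn_isCompact (isCompact_closedBall _ _)
  refine tendsto_integral_of_dominated_convergence
    (fun x => (Metric.closedBall (0 : Space d) (R + ‖e‖)).indicator (fun x => |X x|) x * (L * ‖e‖))
    (fun n => ?_) ?_ (fun n => Eventually.of_forall fun x => ?_) (Eventually.of_forall fun x => ?_)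
  · exact hX.aestronglyMeasurable.mul (by fun_prop)
  · exact ((integrable_indicator_iff measurableSet_closedBall).2 (Integrable.abs hK)).mul_const _
  · have hn : (1 / 2 : ℝ) ^ n ≤ 1 := pow_le_one₀ (by norm_num) (by norm_num)
    have hn2 : ‖(1 / 2 : ℝ) ^ n • e‖ = (1 / 2 : ℝ) ^ n * ‖e‖ := by
      rw [norm_smul, Real.norm_of_nonneg (by positivity)]
    have hn3 : ‖(1 / 2 : ℝ) ^ n • e‖ ≤ ‖e‖ := by
      rw [hn2]; exact mul_le_of_le_one_left (norm_nonneg _) hn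
    by_cases hx : x ∈ Metric.closedBall (0 : Space d) (R + ‖e‖)
    · rw [indicator_of_mem hx, norm_mul, Real.norm_eq_abs]
      gcongr
      rw [norm_mul, Real.norm_of_nonneg (by positivity)]
      have h1 := hL.dist_le_mul (x - (1 / 2 : ℝ) ^ n • e) x
      rw [dist_eq_norm, dist_eq_norm, sub_sub_cancel_left, norm_neg, hn2] at h1
      calc (2 : ℝ) ^ n * ‖φ (x - (1 / 2 : ℝ) ^ n • e) - φ x‖
          ≤ 2 ^ n * (L * ((1 / 2 : ℝ) ^ n * ‖e‖)) := by gcongr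
        _ = (2 * (1 / 2)) ^ n * (L * ‖e‖) := by rw [mul_pow]; ring
        _ = L * ‖e‖ := by norm_num
    · rw [indicator_of_notMem hx]
      rw [mem_closedBall_zero_iff, not_le] at hx
      have h1 : φ x = 0 := hzero x (by linarith [norm_nonneg e])
      have h2 : φ (x - (1 / 2 : ℝ) ^ n • e) = 0 := hzero _ (by
        have := norm_sub_norm_le x ((1 / 2 : ℝ) ^ n • e)
        linarith)
      rw [h1, h2]; simp
  · have hd : HasFDerivAt φ (fderiv ℝ φ x) x :=
      (hφ.differentiable (by simp) x).hasFDerivAt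
    have h1 := hd.lim e (c := fun n : ℕ => -(2 : ℝ) ^ n) (l := atTop) (by
      simp only [norm_neg, norm_pow, Real.norm_ofNat]
      exact tendsto_pow_atTop_atTop_of_one_lt (by norm_num))
    have h2 := (h1.const_mul (X x)).neg
    refine h2.congr fun n => ?_
    have h3 : x + (-(2 : ℝ) ^ n)⁻¹ • e = x - (1 / 2 : ℝ) ^ n • e := by
      rw [inv_neg, neg_smul, ← sub_eq_add_neg, one_div, inv_pow]
    rw [h3, smul_eq_mul]; ring

end TestFunctions

section WeakGradient

variable {d : ℕ} {Ω : Type*} {mΩ : MeasurableSpace Ω} {P : Measure Ω}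
  {E : Type*} [NormedAddCommGroup E] [MeasurableSpace E] [BorelSpace E] [SecondCountableTopology E]

/-- A random field bounded in `L¹(Ω)` has locally integrable sample functions, by Tonelli. -/
lemma ae_locallyIntegrable [SFinite P] {X : Space d → Ω → E}
    (hX : Measurable fun p : Space d × Ω => X p.1 p.2) {M : ℝ≥0∞} (hM : M < ∞)
    (hb : ∀ᵐ x, eLpNorm (X x) 1 P ≤ M) :
    ∀ᵐ ω ∂P, LocallyIntegrable (fun x => X x ω) volume := by
  have h1 : ∀ n : ℕ, ∀ᵐ ω ∂P, IntegrableOn (fun x => X x ω) (Metric.closedBall 0 n) volume := by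
    intro n
    have h2 : ∫⁻ ω, (∫⁻ x in Metric.closedBall (0 : Space d) n, ‖X x ω‖ₑ) ∂P ≠ ∞ := by
      rw [lintegral_lintegral_swap (hX.comp measurable_swap).enorm.aemeasurable]
      have h3 : ∫⁻ x in Metric.closedBall (0 : Space d) n, (∫⁻ ω, ‖X x ω‖ₑ ∂P) ≤
          ∫⁻ _ in Metric.closedBall (0 : Space d) n, M := by
        refine lintegral_mono_ae (ae_restrict_of_ae ?_)
        filter_upwards [hb] with x hx
        rwa [eLpNorm_one_eq_lintegral_enorm] at hx
      rw [setLIntegral_const] at h3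
      exact (h3.trans_lt (ENNReal.mul_lt_top hM measure_closedBall_lt_top)).ne
    have h4 : Measurable fun ω => ∫⁻ x in Metric.closedBall (0 : Space d) n, ‖X x ω‖ₑ :=
      Measurable.lintegral_prod_left hX.enorm
    filter_upwards [ae_lt_top h4 h2] with ω hω
    exact ⟨(hX.comp measurable_prodMk_right).aestronglyMeasurable, hω⟩
  filter_upwards [ae_all_iff.2 h1] with ω hω
  rw [locallyIntegrable_iff]
  intro k hk
  obtain ⟨R, hR⟩ := hk.isBounded.subset_closedBall (0 : Space d)
  obtain ⟨n, hn⟩ := exists_nat_ge R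
  exact (hω n).mono_set (hR.trans (Metric.closedBall_subset_closedBall hn))

/-- A random field is almost surely almost everywhere zero if, for each test function, its pairing
with the test function vanishes almost surely. -/
lemma ae_ae_eq_zero_of_forall_testFunction [SFinite P] {g : Space d → Ω → ℝ}
    (hg : Measurable fun p : Space d × Ω => g p.1 p.2) {M : ℝ≥0∞} (hM : M < ∞)
    (hb : ∀ᵐ x, eLpNorm (g x) 1 P ≤ M)
    (h : ∀ φ : Space d → ℝ, ContDiff ℝ (⊤ : ℕ∞) φ → HasCompactSupport φ →
      ∀ᵐ ω ∂P, ∫ x, g x ω * φ x = 0) :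
    ∀ᵐ ω ∂P, ∀ᵐ x, g x ω = 0 := by
  obtain ⟨φ, hφ, hφ0⟩ := exists_countable_testFunctions d
  filter_upwards [ae_locallyIntegrable hg hM hb,
    ae_all_iff.2 fun i => h (φ i) (hφ i).1 (hφ i).2] with ω h1 h2
  exact hφ0 _ h1 h2

/-- The weak gradient of a random field is unique. -/
lemma ae_ae_eq_of_weakGradient [SFinite P] {X : Space d → Ω → ℝ} {G D : Space d → Ω → Space d}
    (hG : Measurable fun p : Space d × Ω => G p.1 p.2)
    (hD : Measurable fun p : Space d × Ω => D p.1 p.2) {M : ℝ≥0∞} (hM : M < ∞)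
    (hGb : ∀ᵐ x, eLpNorm (G x) 1 P ≤ M) (hDb : ∀ᵐ x, eLpNorm (D x) 1 P ≤ M)
    (hGw : ∀ φ : Space d → ℝ, ContDiff ℝ (⊤ : ℕ∞) φ → HasCompactSupport φ → ∀ e : Space d,
      ∀ᵐ ω ∂P, ∫ x, X x ω * fderiv ℝ φ x e = - ∫ x, inner ℝ (G x ω) e * φ x)
    (hDw : ∀ φ : Space d → ℝ, ContDiff ℝ (⊤ : ℕ∞) φ → HasCompactSupport φ → ∀ e : Space d,
      ∀ᵐ ω ∂P, ∫ x, X x ω * fderiv ℝ φ x e = - ∫ x, inner ℝ (D x ω) e * φ x) :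
    ∀ᵐ ω ∂P, ∀ᵐ x, G x ω = D x ω := by
  have hGD : Measurable fun p : Space d × Ω => G p.1 p.2 - D p.1 p.2 := hG.sub hD
  have hsub : ∀ᵐ x, eLpNorm (G x - D x) 1 P ≤ M + M := by
    filter_upwards [hGb, hDb] with x h1 h2
    exact (eLpNorm_sub_le (hG.comp measurable_prodMk_left).aestronglyMeasurable
      (hD.comp measurable_prodMk_left).aestronglyMeasurable le_rfl).trans (add_le_add h1 h2)
  have hmain : ∀ i : Fin d, ∀ᵐ ω ∂P, ∀ᵐ x, (G x ω - D x ω) i = 0 := by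
    intro i
    set e : Space d := EuclideanSpace.single i 1
    have he : ∀ y : Space d, inner ℝ y e = y i := fun y => by
      simp [e, EuclideanSpace.inner_single_right]
    have hin : ∀ {F : Space d → ℝ} {φ : Space d → ℝ} , LocallyIntegrable F volume →
        ContDiff ℝ (⊤ : ℕ∞) φ → HasCompactSupport φ →
        Integrable (fun x => F x * φ x) volume := fun hF hφ hφc =>
      hF.integrable_smul_right_of_hasCompactSupport hφ.continuous hφc
    have hcoord : ∀ {Y : Space d → Ω → Space d},
        (Measurable fun p : Space d × Ω => Y p.1 p.2) → ∀ {K : ℝ≥0∞},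
        (∀ᵐ x, eLpNorm (Y x) 1 P ≤ K) → ∀ᵐ x, eLpNorm (fun ω => Y x ω i) 1 P ≤ K := by
      intro Y hY K hK
      filter_upwards [hK] with x hx
      refine le_trans (eLpNorm_mono fun ω => ?_) hx
      exact PiLp.norm_apply_le (Y x ω) i
    have hm : ∀ {Y : Space d → Ω → Space d}, (Measurable fun p : Space d × Ω => Y p.1 p.2) →
        Measurable fun p : Space d × Ω => Y p.1 p.2 i := fun hY => by fun_prop
    refine ae_ae_eq_zero_of_forall_testFunction (g := fun x ω => (G x ω - D x ω) i)
      (hm (Y := fun x ω => G x ω - D x ω) hGD)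
      (ENNReal.add_lt_top.2 ⟨hM, hM⟩) (hcoord (Y := fun x ω => G x ω - D x ω) hGD hsub)
      fun φ hφ hφc => ?_
    filter_upwards [hGw φ hφ hφc e, hDw φ hφ hφc e, ae_locallyIntegrable (hm hG) hM (hcoord hG hGb),
      ae_locallyIntegrable (hm hD) hM (hcoord hD hDb)] with ω h1 h2 h3 h4
    simp_rw [he] at h1 h2
    simp_rw [PiLp.sub_apply, sub_mul]
    rw [integral_sub (hin h3 hφ hφc) (hin h4 hφ hφc)]
    linarith
  filter_upwards [ae_all_iff.2 hmain] with ω hω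
  filter_upwards [ae_all_iff.2 hω] with x hx
  rw [← sub_eq_zero]
  ext i
  exact hx i

/-- A random field with a uniform Taylor expansion in `L¹(Ω)` has a weak gradient. Along the
increments `2^{-n} e` the remainders are summable, hence the difference quotients converge weakly,
almost surely. -/
theorem weakGradient_of_taylor [SFinite P] {X : Space d → Ω → ℝ} {D : Space d → Ω → Space d}
    (hX : Measurable fun p : Space d × Ω => X p.1 p.2)
    (hD : Measurable fun p : Space d × Ω => D p.1 p.2) {M : ℝ≥0∞} (hM : M < ∞)
    (hXb : ∀ᵐ x, eLpNorm (X x) 1 P ≤ M) (hDb : ∀ᵐ x, eLpNorm (D x) 1 P ≤ M) {C r : ℝ} (hr : 0 < r)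
    (htay : ∀ x a, eLpNorm (fun ω => X (x + a) ω - X x ω - inner ℝ (D x ω) a) 1 P ≤
      ENNReal.ofReal (C * ‖a‖ ^ (1 + r))) {φ : Space d → ℝ} (hφ : ContDiff ℝ (⊤ : ℕ∞) φ)
    (hφc : HasCompactSupport φ) (e : Space d) :
    ∀ᵐ ω ∂P, ∫ x, X x ω * fderiv ℝ φ x e = - ∫ x, inner ℝ (D x ω) e * φ x := by
  have hφm : Measurable φ := hφ.continuous.measurable
  set R : ℕ → Space d → Ω → ℝ := fun n x ω =>
    (2 ^ n * (X (x + (1 / 2 : ℝ) ^ n • e) ω - X x ω) - inner ℝ (D x ω) e) * φ x with hR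
  have hRm : ∀ n, Measurable fun p : Space d × Ω => R n p.1 p.2 := fun n => by
    have h1 : Measurable fun p : Space d × Ω => X (p.1 + (1 / 2 : ℝ) ^ n • e) p.2 :=
      Measurable.comp (f := fun p : Space d × Ω => (p.1 + (1 / 2 : ℝ) ^ n • e, p.2)) hX
        ((measurable_fst.add_const _).prodMk measurable_snd)
    have h2 : Measurable fun p : Space d × Ω => φ p.1 := hφm.comp measurable_fst
    exact (((h1.sub hX).const_mul _).sub (hD.inner measurable_const)).mul h2
  have hφi : ∫⁻ x, ‖φ x‖ₑ < ∞ := (hφ.continuous.integrable_of_hasCompactSupport hφc).2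
  -- the remainders decay like `2^{-nr}`, because the Taylor remainder is of order `1 + r`
  have hRb : ∀ n, ∫⁻ ω, (∫⁻ x, ‖R n x ω‖ₑ) ∂P ≤
      ENNReal.ofReal (C * ‖e‖ ^ (1 + r) * ((1 / 2 : ℝ) ^ n) ^ r) * ∫⁻ x, ‖φ x‖ₑ := by
    intro n
    rw [lintegral_lintegral_swap ((hRm n).comp measurable_swap).enorm.aemeasurable,
      ← lintegral_const_mul _ hφm.enorm]
    refine lintegral_mono fun x => ?_
    set a : Space d := (1 / 2 : ℝ) ^ n • e with ha
    have h1 : ∀ ω, ‖R n x ω‖ₑ = ENNReal.ofReal (2 ^ n) * ‖φ x‖ₑ *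
        ‖X (x + a) ω - X x ω - inner ℝ (D x ω) a‖ₑ := by
      intro ω
      have h2 : R n x ω = 2 ^ n * φ x * (X (x + a) ω - X x ω - inner ℝ (D x ω) a) := by
        have h3 : inner ℝ (D x ω) a = (1 / 2 : ℝ) ^ n * inner ℝ (D x ω) e := by
          rw [ha, inner_smul_right]
        have h4 : (2 : ℝ) ^ n * (1 / 2) ^ n = 1 := by rw [← mul_pow]; norm_num
        simp only [hR]
        rw [h3]
        linear_combination (inner ℝ (D x ω) e * φ x) * h4
      rw [h2, enorm_mul, enorm_mul, Real.enorm_eq_ofReal (by positivity : (0 : ℝ) ≤ 2 ^ n)]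
    simp_rw [h1]
    rw [lintegral_const_mul' _ _ (ENNReal.mul_ne_top ENNReal.ofReal_ne_top (by simp)),
      ← eLpNorm_one_eq_lintegral_enorm]
    have h5 := htay x a
    have h6 : ‖a‖ ^ (1 + r) = (1 / 2 : ℝ) ^ n * ((1 / 2 : ℝ) ^ n) ^ r * ‖e‖ ^ (1 + r) := by
      rw [ha, norm_smul, Real.norm_of_nonneg (by positivity),
        Real.mul_rpow (by positivity) (norm_nonneg _), Real.rpow_add (by positivity), Real.rpow_one]
    calc ENNReal.ofReal (2 ^ n) * ‖φ x‖ₑ *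
        eLpNorm (fun ω => X (x + a) ω - X x ω - inner ℝ (D x ω) a) 1 P
        ≤ ENNReal.ofReal (2 ^ n) * ‖φ x‖ₑ * ENNReal.ofReal (C * ‖a‖ ^ (1 + r)) := by gcongr
      _ = (ENNReal.ofReal (2 ^ n) * ENNReal.ofReal (C * ‖a‖ ^ (1 + r))) * ‖φ x‖ₑ := by ring
      _ = _ := by
        rw [← ENNReal.ofReal_mul (by positivity), h6]
        congr 2
        have h4 : (2 : ℝ) ^ n * (1 / 2) ^ n = 1 := by rw [← mul_pow]; norm_num
        linear_combination (C * ((1 / 2 : ℝ) ^ n) ^ r * ‖e‖ ^ (1 + r)) * h4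
  have hsum : ∑' n, ∫⁻ ω, (∫⁻ x, ‖R n x ω‖ₑ) ∂P ≠ ∞ := by
    refine ne_top_of_le_ne_top ?_ (ENNReal.tsum_le_tsum hRb)
    rw [ENNReal.tsum_mul_right]
    exact ENNReal.mul_ne_top (tsum_ofReal_ne_top_of_summable
      (summable_const_mul_two_pow_rpow _ hr)) hφi.ne
  have hconv := ae_tendsto_zero_of_tsum_lintegral_ne_top (P := P)
    (f := fun n ω => ∫⁻ x, ‖R n x ω‖ₑ)
    (fun n => (Measurable.lintegral_prod_left (hRm n).enorm).aemeasurable) hsum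
  filter_upwards [hconv, ae_locallyIntegrable hX hM hXb, ae_locallyIntegrable hD hM hDb]
    with ω h1 h2 h3
  have hDi : Integrable (fun x => inner ℝ (D x ω) e * φ x) volume := by
    have h4 : Integrable (fun x => φ x • D x ω) volume :=
      h3.integrable_smul_left_of_hasCompactSupport hφ.continuous hφc
    refine (h4.inner_const e).congr (Eventually.of_forall fun x => ?_)
    simp only [inner_smul_left, mul_comm]; rfl
  have hXi : ∀ a : Space d, Integrable (fun x => X (x + a) ω * φ x) volume := fun a => by
    have h4 : Integrable (fun x => X x ω * φ (x - a)) volume :=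
      h2.integrable_smul_right_of_hasCompactSupport (g := fun x => φ (x - a))
        (by have := hφ.continuous; fun_prop)
        (hφc.comp_homeomorph (Homeomorph.subRight a))
    simpa using h4.comp_add_right a
  have hXi0 : Integrable (fun x => X x ω * φ x) volume := by simpa using hXi 0
  have hlim := tendsto_integral_diffQuotient h2 hφ hφc e
  have hlim2 : Tendsto (fun n : ℕ => ∫ x, (2 ^ n * (X (x + (1 / 2 : ℝ) ^ n • e) ω - X x ω)) * φ x)
      atTop (𝓝 (∫ x, inner ℝ (D x ω) e * φ x)) := by
    rw [tendsto_iff_edist_tendsto_0]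
    refine tendsto_of_tendsto_of_tendsto_of_le_of_le tendsto_const_nhds h1 (fun _ => zero_le)
      fun n => ?_
    have hqi : Integrable (fun x => (2 ^ n * (X (x + (1 / 2 : ℝ) ^ n • e) ω - X x ω)) * φ x)
        volume := by
      refine (((hXi ((1 / 2 : ℝ) ^ n • e)).sub hXi0).const_mul (2 ^ n)).congr
        (Eventually.of_forall fun x => ?_)
      simp only [Pi.sub_apply]; ring
    change edist (∫ x, (2 ^ n * (X (x + (1 / 2 : ℝ) ^ n • e) ω - X x ω)) * φ x) _ ≤ _
    rw [edist_eq_enorm_sub, ← integral_sub hqi hDi]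
    refine (enorm_integral_le_lintegral_enorm _).trans (le_of_eq ?_)
    refine lintegral_congr fun x => ?_
    simp only [hR]; congr 1; ring
  have := tendsto_nhds_unique hlim hlim2
  linarith

end WeakGradient

/-! ### The stochastic convolution -/

section ItoInt

variable {Ω : Type*} {mΩ : MeasurableSpace Ω} {P : Measure Ω} {ℱ : Filtration ℝ≥0 mΩ}
  {W : ℝ≥0 → Ω → ℝ}

open Classical in
/-- The Wiener integral of a function on the half-line, with value `0` if the function is not square
integrable. -/
noncomputable def itoInt (hW : IsWienerProcess P ℱ W) (Φ : ℝ → ℝ) : Ω → ℝ :=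
  if h : MemLp Φ 2 halfLine then wienerInt hW (h.toLp Φ) else 0

lemma itoInt_of_memLp (hW : IsWienerProcess P ℱ W) {Φ : ℝ → ℝ} (h : MemLp Φ 2 halfLine) :
    itoInt hW Φ = wienerInt hW (h.toLp Φ) := dif_pos h

lemma aestronglyMeasurable_itoInt (hW : IsWienerProcess P ℱ W) {Φ : ℝ → ℝ}
    (h : MemLp Φ 2 halfLine) : AEStronglyMeasurable (itoInt hW Φ) P := by
  rw [itoInt_of_memLp hW h]; exact Lp.aestronglyMeasurable _

lemma eLpNorm_itoInt_le (hW : IsWienerProcess P ℱ W) {Φ : ℝ → ℝ} (h : MemLp Φ 2 halfLine) (q : ℝ) :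
    eLpNorm (itoInt hW Φ) (ENNReal.ofReal q) P ≤ eLpNorm Φ 2 halfLine * gaussConst q := by
  rw [itoInt_of_memLp hW h]
  refine (eLpNorm_wienerInt_le hW q _).trans ?_
  rw [Lp.norm_toLp, ENNReal.ofReal_toReal h.2.ne]

lemma itoInt_congr (hW : IsWienerProcess P ℱ W) {Φ Ψ : ℝ → ℝ} (h : Φ =ᵐ[halfLine] Ψ) :
    itoInt hW Φ = itoInt hW Ψ := by
  by_cases hΦ : MemLp Φ 2 halfLine
  · have hΨ : MemLp Ψ 2 halfLine := hΦ.ae_eq h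
    rw [itoInt_of_memLp hW hΦ, itoInt_of_memLp hW hΨ, (MemLp.toLp_eq_toLp_iff hΦ hΨ).2 h]
  · have hΨ : ¬ MemLp Ψ 2 halfLine := fun h' => hΦ (h'.ae_eq h.symm)
    rw [itoInt, itoInt, dif_neg hΦ, dif_neg hΨ]

lemma itoInt_sub (hW : IsWienerProcess P ℱ W) {Φ Ψ : ℝ → ℝ} (hΦ : MemLp Φ 2 halfLine)
    (hΨ : MemLp Ψ 2 halfLine) : itoInt hW (Φ - Ψ) =ᵐ[P] itoInt hW Φ - itoInt hW Ψ := by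
  rw [itoInt_of_memLp hW hΦ, itoInt_of_memLp hW hΨ, itoInt_of_memLp hW (hΦ.sub hΨ),
    MemLp.toLp_sub hΦ hΨ, map_sub]
  exact Lp.coeFn_sub _ _

lemma itoInt_add (hW : IsWienerProcess P ℱ W) {Φ Ψ : ℝ → ℝ} (hΦ : MemLp Φ 2 halfLine)
    (hΨ : MemLp Ψ 2 halfLine) : itoInt hW (Φ + Ψ) =ᵐ[P] itoInt hW Φ + itoInt hW Ψ := by
  rw [itoInt_of_memLp hW hΦ, itoInt_of_memLp hW hΨ, itoInt_of_memLp hW (hΦ.add hΨ),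
    MemLp.toLp_add hΦ hΨ, map_add]
  exact Lp.coeFn_add _ _

lemma itoInt_const_smul (hW : IsWienerProcess P ℱ W) {Φ : ℝ → ℝ} (hΦ : MemLp Φ 2 halfLine)
    (c : ℝ) : itoInt hW (c • Φ) =ᵐ[P] c • itoInt hW Φ := by
  rw [itoInt_of_memLp hW hΦ, itoInt_of_memLp hW (hΦ.const_smul c), MemLp.toLp_const_smul c hΦ,
    map_smul]
  exact Lp.coeFn_smul _ _

lemma itoInt_zero (hW : IsWienerProcess P ℱ W) : itoInt hW 0 =ᵐ[P] 0 := by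
  have h : MemLp (0 : ℝ → ℝ) 2 halfLine := MemLp.zero'
  have := itoInt_const_smul hW h 0
  rwa [zero_smul, zero_smul] at this

lemma itoInt_sum (hW : IsWienerProcess P ℱ W) {ι : Type*} (s : Finset ι) (c : ι → ℝ)
    {Φ : ι → ℝ → ℝ} (hΦ : ∀ i, MemLp (Φ i) 2 halfLine) :
    itoInt hW (∑ i ∈ s, c i • Φ i) =ᵐ[P] ∑ i ∈ s, c i • itoInt hW (Φ i) := by
  classical
  induction s using Finset.induction_on with
  | empty => simpa using itoInt_zero hW
  | insert a s ha ih =>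
    rw [Finset.sum_insert ha, Finset.sum_insert ha]
    refine (itoInt_add hW ((hΦ a).const_smul _)
      (memLp_finsetSum' s fun i _ => (hΦ i).const_smul (c i))).trans ?_
    exact (itoInt_const_smul hW (hΦ a) (c a)).add ih

lemma IsItoIntegral.congr {t : ℝ} {F F' : ℝ → ℝ} {I I' : Ω → ℝ} (h : IsItoIntegral P W t F I)
    (hF : F =ᵐ[volume.restrict (Ioc 0 t)] F') (hI : I =ᵐ[P] I') : IsItoIntegral P W t F' I' := by
  obtain ⟨h1, h2, S, h3, h4, h5⟩ := h
  refine ⟨h1.ae_eq hF, h2.ae_eq hI, S, h3, h4.congr fun n => eLpNorm_congr_ae ?_,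
    h5.congr fun n => eLpNorm_congr_ae ?_⟩
  · filter_upwards [hF] with r hr using by rw [hr]
  · filter_upwards [hI] with r hr using by rw [hr]

/-- `itoInt` is an Itô integral over `(0,t]` when the integrand vanishes from time `t` on; only the
values of the integrand before time `t` matter. -/
lemma isItoIntegral_itoInt (hW : IsWienerProcess P ℱ W) (t : ℝ≥0) {Φ F : ℝ → ℝ}
    (hΦ : MemLp Φ 2 halfLine) (h0 : ∀ r : ℝ, (t : ℝ) < r → Φ r = 0)
    (hF : ∀ r : ℝ, r < t → F r = Φ r) : IsItoIntegral P W t F (itoInt hW Φ) := by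
  rw [itoInt_of_memLp hW hΦ]
  have hae : hΦ.toLp Φ =ᵐ[halfLine] Φ := hΦ.coeFn_toLp
  refine (isItoIntegral_wienerInt hW t (hΦ.toLp Φ) ?_).congr ?_ (ae_eq_refl _)
  · filter_upwards [hae] with r hr h using by rw [hr, h0 r h]
  · have h1 : ∀ᵐ r ∂volume.restrict (Ioc 0 (t : ℝ)), (hΦ.toLp Φ : ℝ → ℝ) r = Φ r :=
      ae_mono (Measure.restrict_mono (fun x hx => hx.1) le_rfl) hae
    have h2 : ∀ᵐ r : ℝ ∂volume.restrict (Ioc 0 (t : ℝ)), r ≠ t :=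
      ae_restrict_of_ae (Measure.ae_ne volume (t : ℝ))
    filter_upwards [h1, h2, ae_restrict_mem measurableSet_Ioc] with r hr hr2 hr3
    rw [hr, hF r (lt_of_le_of_ne hr3.2 hr2)]

/-- The `L²`-norm of a function dominated by `C (t-r)^e` on `(0,t)`. -/
lemma eLpNorm_two_le_of_rpow {Φ : ℝ → ℝ} {t T C e : ℝ} (hC : 0 ≤ C) (he : 0 < 2 * e + 1)
    (ht : t ≤ T) (hT : 0 < T)
    (hb : ∀ᵐ r ∂halfLine, |Φ r| ≤ if r < t then C * (t - r) ^ e else 0) :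
    eLpNorm Φ 2 halfLine ≤ ENNReal.ofReal (C * √(T ^ (2 * e + 1) / (2 * e + 1))) := by
  have h0 : 0 ≤ T ^ (2 * e + 1) / (2 * e + 1) := by positivity
  have h1 : ∫⁻ r, ‖Φ r‖ₑ ^ (2 : ℝ) ∂halfLine ≤
      ENNReal.ofReal (C ^ 2 * (T ^ (2 * e + 1) / (2 * e + 1))) := by
    calc ∫⁻ r, ‖Φ r‖ₑ ^ (2 : ℝ) ∂halfLine
        ≤ ∫⁻ r in Ioi 0, (Ioo 0 t).indicator
            (fun r => ENNReal.ofReal (C ^ 2) * ENNReal.ofReal ((t - r) ^ (2 * e))) r := by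
          apply lintegral_mono_ae
          filter_upwards [hb, ae_restrict_mem measurableSet_Ioi] with r hr hr0
          by_cases h : r < t
          · rw [indicator_of_mem (show r ∈ Ioo 0 t from ⟨hr0, h⟩)]
            rw [if_pos h] at hr
            rw [← ENNReal.ofReal_mul (by positivity), Real.enorm_eq_ofReal_abs,
              ENNReal.ofReal_rpow_of_nonneg (abs_nonneg _) (by norm_num)]
            apply ENNReal.ofReal_le_ofReal
            rw [Real.rpow_two, two_mul e, Real.rpow_add (by linarith)]
            calc |Φ r| ^ 2 ≤ (C * (t - r) ^ e) ^ 2 := by gcongr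
              _ = _ := by ring
          · rw [if_neg h] at hr
            have : Φ r = 0 := by simpa using hr
            rw [this]; simp
      _ ≤ ∫⁻ r, (Ioo 0 t).indicator
            (fun r => ENNReal.ofReal (C ^ 2) * ENNReal.ofReal ((t - r) ^ (2 * e))) r :=
          lintegral_mono' Measure.restrict_le_self le_rfl
      _ = ENNReal.ofReal (C ^ 2) * ∫⁻ r in Ioo 0 t, ENNReal.ofReal ((t - r) ^ (2 * e)) := by
          rw [lintegral_indicator measurableSet_Ioo, lintegral_const_mul _ (by fun_prop)]
      _ ≤ ENNReal.ofReal (C ^ 2) * ENNReal.ofReal (T ^ (2 * e + 1) / (2 * e + 1)) := by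
          gcongr; exact lintegral_rpow_sub_le (by linarith) ht hT
      _ = _ := by rw [← ENNReal.ofReal_mul (by positivity)]
  have h2 := eLpNorm_ofReal_eq (P := halfLine) (X := Φ) (q := 2) (by norm_num)
  rw [ENNReal.ofReal_ofNat] at h2
  rw [h2]
  calc _ ≤ ENNReal.ofReal (C ^ 2 * (T ^ (2 * e + 1) / (2 * e + 1))) ^ (1 / 2 : ℝ) := by gcongr
    _ = _ := by
      rw [ENNReal.ofReal_rpow_of_nonneg (by positivity) (by norm_num), ← Real.sqrt_eq_rpow,
        Real.sqrt_mul (by positivity), Real.sqrt_sq hC]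

end ItoInt

section Convolution

variable {d : ℕ} {Ω : Type*} {mΩ : MeasurableSpace Ω} {P : Measure Ω} {ℱ : Filtration ℝ≥0 mΩ}
  {W : ℝ≥0 → Ω → ℝ}

/-- The function `r ↦ 1_{r < t} (f(r,·) * g(t-r,·))(x)`, the integrand of the stochastic convolution
with kernel `g`. -/
noncomputable def causalConv (g : ℝ → Space d → ℝ) (f : ℝ → Space d → ℝ) (t : ℝ) (x : Space d)
    (r : ℝ) : ℝ :=
  if r < t then conv (f r) (g (t - r)) x else 0

/-- For almost every time before `T`, the function `f(r,·)` is bounded by `F` and `α`-Hölder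
continuous with constant `F`. -/
def HolderField (f : ℝ → Space d → ℝ) (α T F : ℝ) : Prop :=
  ∀ᵐ r ∂halfLine, r < T → HolderBound F α (f r)

variable {f : ℝ → Space d → ℝ} {α T F t : ℝ}

lemma measurable_causalConv {g : ℝ → Space d → ℝ} (hf : Measurable fun q : ℝ × Space d => f q.1 q.2)
    (hg : Measurable fun q : ℝ × Space d => g q.1 q.2) (t : ℝ) (x : Space d) :
    Measurable (causalConv g f t x) := by
  unfold causalConv conv
  refine Measurable.ite measurableSet_Iio ?_ measurable_const
  have h1 : Measurable fun q : ℝ × Space d => (t - q.1, x - q.2) := by fun_prop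
  have h2 : StronglyMeasurable fun q : ℝ × Space d => f q.1 q.2 • g (t - q.1) (x - q.2) :=
    (hf.smul (Measurable.comp (g := fun q : ℝ × Space d => g q.1 q.2) hg h1)).stronglyMeasurable
  exact (h2.integral_prod_right (ν := volume)).measurable

/-- The kernel `∂_a K`. -/
noncomputable def dirKernel (a : Space d) (s : ℝ) (z : Space d) : ℝ := inner ℝ (gradKernel s z) a

/-- The kernel `z ↦ ∂_a K(s,z+c) - ∂_a K(s,z)`. -/
noncomputable def dirShift (a c : Space d) (s : ℝ) (z : Space d) : ℝ := inner ℝ (gradShift c s z) a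

lemma measurable_dirKernel (a : Space d) :
    Measurable (fun q : ℝ × Space d => dirKernel a q.1 q.2) :=
  measurable_gradKernel.inner measurable_const

lemma measurable_dirShift (a c : Space d) :
    Measurable (fun q : ℝ × Space d => dirShift a c q.1 q.2) :=
  (measurable_gradShift c).inner measurable_const

lemma eLpNorm_causalConv_le {g : ℝ → Space d → ℝ} {e C : ℝ} (hC : 0 ≤ C) (he : 0 < 2 * e + 1)
    (hT : 0 < T) (ht : t ≤ T) (hF : HolderField f α T F) (x : Space d)
    (hb : ∀ (φ : Space d → ℝ) (s : ℝ), HolderBound F α φ → 0 < s → |conv φ (g s) x| ≤ C * s ^ e) :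
    eLpNorm (causalConv g f t x) 2 halfLine ≤
      ENNReal.ofReal (C * √(T ^ (2 * e + 1) / (2 * e + 1))) := by
  refine eLpNorm_two_le_of_rpow hC he ht hT ?_
  filter_upwards [hF] with r hr
  unfold causalConv
  by_cases h : r < t
  · rw [if_pos h, if_pos h]
    exact hb _ _ (hr (h.trans_le ht)) (by linarith)
  · rw [if_neg h, if_neg h, abs_zero]

section Integrands

lemma eLpNorm_causalConv_heat_le (hF0 : 0 ≤ F) (hT : 0 < T) (ht : t ≤ T)
    (hF : HolderField f α T F) (x : Space d) :
    eLpNorm (causalConv heatKernel f t x) 2 halfLine ≤ ENNReal.ofReal (F * √T) := by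
  have := eLpNorm_causalConv_le (g := heatKernel) (e := 0) hF0 (by norm_num) hT ht hF x
    (fun φ s hφ hs => by simpa using hφ.abs_conv_heatKernel_le hs x)
  simpa using this

lemma eLpNorm_causalConv_dir_le (hα : 0 < α) (hα1 : α ≤ 1) (hF0 : 0 ≤ F) (hT : 0 < T) (ht : t ≤ T)
    (hF : HolderField f α T F) (a x : Space d) :
    eLpNorm (causalConv (dirKernel a) f t x) 2 halfLine ≤
      ENNReal.ofReal (F * kernelConst d * ‖a‖ * √(T ^ α / α)) := by
  have hc := kernelConst_pos d
  have := eLpNorm_causalConv_le (g := dirKernel a) (e := (α - 1) / 2)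
    (C := F * kernelConst d * ‖a‖) (by positivity) (by linarith) hT ht hF x
    (fun φ s hφ hs => by
      unfold dirKernel
      rw [hφ.conv_inner (integrable_gradKernel hs)]
      calc _ ≤ ‖conv φ (gradKernel s) x‖ * ‖a‖ := abs_real_inner_le_norm _ _
        _ ≤ (F * (kernelConst d * s ^ ((α - 1) / 2))) * ‖a‖ := by
          gcongr; exact hφ.norm_conv_gradKernel_le hα.le hα1 hs x
        _ = _ := by ring)
  have h2 : 2 * ((α - 1) / 2) + 1 = α := by ring
  rwa [h2] at this

lemma eLpNorm_causalConv_dirShift_le {r : ℝ} (hr : 0 < r) (hrα : r < α) (hα1 : α ≤ 1) (hF0 : 0 ≤ F)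
    (hT : 0 < T) (ht : t ≤ T) (hF : HolderField f α T F) (a c x : Space d) :
    eLpNorm (causalConv (dirShift a c) f t x) 2 halfLine ≤
      ENNReal.ofReal (3 * kernelConst d * F * ‖c‖ ^ r * ‖a‖ * √(T ^ (α - r) / (α - r))) := by
  have hc := kernelConst_pos d
  have := eLpNorm_causalConv_le (g := dirShift a c) (e := (α - 1 - r) / 2)
    (C := 3 * kernelConst d * F * ‖c‖ ^ r * ‖a‖) (by positivity) (by linarith) hT ht hF x
    (fun φ s hφ hs => by
      unfold dirShift
      rw [hφ.conv_inner (integrable_gradShift hs c)]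
      calc _ ≤ ‖conv φ (gradShift c s) x‖ * ‖a‖ := abs_real_inner_le_norm _ _
        _ ≤ (3 * kernelConst d * F * (‖c‖ ^ r * s ^ ((α - 1 - r) / 2))) * ‖a‖ := by
          gcongr
          exact hφ.norm_conv_gradShift_le (hr.trans hrα).le hα1 hs hr.le (hrα.le.trans hα1) x c
        _ = _ := by ring)
  have h2 : 2 * ((α - 1 - r) / 2) + 1 = α - r := by ring
  rwa [h2] at this

lemma eLpNorm_causalConv_taylor_le {r : ℝ} (hr : 0 < r) (hrα : r < α) (hα1 : α ≤ 1) (hF0 : 0 ≤ F)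
    (hT : 0 < T) (ht : t ≤ T) (hF : HolderField f α T F) (a x : Space d) :
    eLpNorm (causalConv (taylorKernel a) f t x) 2 halfLine ≤
      ENNReal.ofReal (3 * kernelConst d * F * ‖a‖ ^ (1 + r) * √(T ^ (α - r) / (α - r))) := by
  have hc := kernelConst_pos d
  have := eLpNorm_causalConv_le (g := taylorKernel a) (e := (α - 1 - r) / 2)
    (C := 3 * kernelConst d * F * ‖a‖ ^ (1 + r)) (by positivity) (by linarith) hT ht hF x
    (fun φ s hφ hs => by
      refine (hφ.abs_conv_taylorKernel_le (hr.trans hrα).le hα1 hs hr.le (hrα.le.trans hα1)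
        x a).trans (le_of_eq ?_)
      ring)
  have h2 : 2 * ((α - 1 - r) / 2) + 1 = α - r := by ring
  rwa [h2] at this

lemma causalConv_dirShift_ae (ht : t ≤ T) (hF : HolderField f α T F) (a c x : Space d) :
    causalConv (dirShift a c) f t x =ᵐ[halfLine]
      causalConv (dirKernel a) f t (x + c) - causalConv (dirKernel a) f t x := by
  filter_upwards [hF] with r hr
  simp only [causalConv, Pi.sub_apply]
  split_ifs with h
  · have hs : 0 < t - r := by linarith
    have hB := hr (h.trans_le ht)
    unfold dirShift dirKernel
    rw [hB.conv_inner (integrable_gradShift hs c), hB.conv_gradShift hs,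
      hB.conv_inner (integrable_gradKernel hs), hB.conv_inner (integrable_gradKernel hs),
      inner_sub_left]
  · simp

lemma causalConv_taylor_ae (ht : t ≤ T) (hF : HolderField f α T F) (a x : Space d) :
    causalConv (taylorKernel a) f t x =ᵐ[halfLine]
      causalConv heatKernel f t (x + a) - causalConv heatKernel f t x -
        causalConv (dirKernel a) f t x := by
  filter_upwards [hF] with r hr
  simp only [causalConv, Pi.sub_apply]
  split_ifs with h
  · have hs : 0 < t - r := by linarith
    have hB := hr (h.trans_le ht)
    unfold dirKernel
    rw [hB.conv_taylorKernel hs, hB.conv_inner (integrable_gradKernel hs)]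
  · simp

lemma causalConv_dir_ae (ht : t ≤ T) (hF : HolderField f α T F) (a x : Space d) :
    causalConv (dirKernel a) f t x =ᵐ[halfLine]
      ∑ i, a i • causalConv (dirKernel (EuclideanSpace.single i 1)) f t x := by
  filter_upwards [hF] with r hr
  simp only [Finset.sum_apply, Pi.smul_apply, causalConv, smul_eq_mul]
  split_ifs with h
  · have hs : 0 < t - r := by linarith
    have hB := hr (h.trans_le ht)
    unfold dirKernel
    rw [hB.conv_inner (integrable_gradKernel hs)]
    simp_rw [hB.conv_inner (integrable_gradKernel hs)]
    simp [PiLp.inner_apply]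
  · simp

/-- The continuity in time of the integrand of the stochastic convolution. On `(t,t')` the
integrand is bounded by `F ≤ F ((t'-t)/(t'-r))^{1/4}`, which makes the two parts of the difference
comparable. -/
lemma eLpNorm_causalConv_time_sub_le {t' : ℝ} (hF0 : 0 ≤ F) (hT : 0 < T) (ht : t ≤ t')
    (ht' : t' ≤ T) (hfm : Measurable fun q : ℝ × Space d => f q.1 q.2)
    (hF : HolderField f α T F) (x : Space d) :
    eLpNorm (causalConv heatKernel f t' x - causalConv heatKernel f t x) 2 halfLine ≤
      ENNReal.ofReal (F * (timeConst d + 1) * (t' - t) ^ (1 / 4 : ℝ) *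
        √(T ^ (1 / 2 : ℝ) / (1 / 2))) := by
  have hc := timeConst_pos d
  have hδ : 0 ≤ t' - t := by linarith
  set D : ℝ → ℝ := causalConv heatKernel f t' x - causalConv heatKernel f t x with hD
  have hDm : Measurable D :=
    (measurable_causalConv hfm measurable_heatKernel t' x).sub
      (measurable_causalConv hfm measurable_heatKernel t x)
  -- before time `t` the increment of the kernel is estimated; on `[t,t']` the bound by `F` is
  -- multiplied by `((t' - t)/(t' - r))^{1/4} ≥ 1`
  have hsplit : D = (Iio t).indicator D + (Ici t).indicator D := by
    rw [← compl_Iio, indicator_self_add_compl]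
  have he : 2 * (-(1 / 4) : ℝ) + 1 = 1 / 2 := by norm_num
  have h1 : eLpNorm ((Iio t).indicator D) 2 halfLine ≤
      ENNReal.ofReal (F * timeConst d * (t' - t) ^ (1 / 4 : ℝ) * √(T ^ (1 / 2 : ℝ) / (1 / 2))) := by
    have := eLpNorm_two_le_of_rpow (Φ := (Iio t).indicator D) (t := t) (T := T)
      (C := F * timeConst d * (t' - t) ^ (1 / 4 : ℝ)) (e := -(1 / 4)) (by positivity)
      (by norm_num) (ht.trans ht') hT (by
        filter_upwards [hF] with r hr
        split_ifs with h
        · rw [indicator_of_mem (show r ∈ Iio t from h)]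
          simp only [hD, Pi.sub_apply, causalConv, if_pos h, if_pos (h.trans_le ht)]
          have h2 := (hr (h.trans_le (ht.trans ht'))).abs_conv_heatKernel_time_sub_le
            (s := t - r) (δ := t' - t) (γ := 1 / 4) (by linarith) hδ (by norm_num) (by norm_num) x
          have h3 : t - r + (t' - t) = t' - r := by ring
          rw [h3, Real.div_rpow hδ (by linarith)] at h2
          refine h2.trans (le_of_eq ?_)
          rw [Real.rpow_neg (by linarith)]; ring
        · rw [indicator_of_notMem (show r ∉ Iio t from h), abs_zero])
    rwa [he] at this
  have h2 : eLpNorm ((Ici t).indicator D) 2 halfLine ≤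
      ENNReal.ofReal (F * (t' - t) ^ (1 / 4 : ℝ) * √(T ^ (1 / 2 : ℝ) / (1 / 2))) := by
    have := eLpNorm_two_le_of_rpow (Φ := (Ici t).indicator D) (t := t') (T := T)
      (C := F * (t' - t) ^ (1 / 4 : ℝ)) (e := -(1 / 4)) (by positivity)
      (by norm_num) ht' hT (by
        filter_upwards [hF] with r hr
        by_cases hrt : r < t
        · rw [indicator_of_notMem (show r ∉ Ici t from not_le.2 hrt), abs_zero]
          split_ifs with h
          · have : 0 < t' - r := by linarith
            positivity
          · exact le_rfl
        · rw [indicator_of_mem (show r ∈ Ici t from not_lt.1 hrt)]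
          simp only [hD, Pi.sub_apply, causalConv, if_neg hrt, sub_zero]
          split_ifs with h
          · have hs : 0 < t' - r := by linarith
            refine ((hr (h.trans_le ht')).abs_conv_heatKernel_le hs x).trans ?_
            rw [mul_assoc, Real.rpow_neg hs.le, ← div_eq_mul_inv, ← Real.div_rpow hδ hs.le]
            refine le_mul_of_one_le_right hF0 (Real.one_le_rpow ?_ (by norm_num))
            rw [one_le_div hs]
            linarith [not_lt.1 hrt]
          · rw [abs_zero])
    rwa [he] at this
  rw [hsplit]
  refine (eLpNorm_add_le (hDm.indicator measurableSet_Iio).aestronglyMeasurable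
    (hDm.indicator measurableSet_Ici).aestronglyMeasurable (by norm_num)).trans
    ((add_le_add h1 h2).trans (le_of_eq ?_))
  rw [← ENNReal.ofReal_add (by positivity) (by positivity)]
  congr 1
  ring

end Integrands

end Convolution

section StochConv

variable {d : ℕ} {Ω : Type*} {mΩ : MeasurableSpace Ω} {P : Measure Ω} {ℱ : Filtration ℝ≥0 mΩ}
  {W : ℝ≥0 → Ω → ℝ} {f : ℝ → Space d → ℝ} {α T F t : ℝ}

lemma eLpNorm_itoInt_le_of_le (hW : IsWienerProcess P ℱ W) {Φ : ℝ → ℝ} (hΦ : Measurable Φ) {C : ℝ}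
    (hC : eLpNorm Φ 2 halfLine ≤ ENNReal.ofReal C) (q : ℝ) :
    eLpNorm (itoInt hW Φ) (ENNReal.ofReal q) P ≤ ENNReal.ofReal C * gaussConst q :=
  (eLpNorm_itoInt_le hW ⟨hΦ.aestronglyMeasurable, hC.trans_lt ENNReal.ofReal_lt_top⟩ q).trans
    (by gcongr)

lemma memLp_causalConv_heat (hf : Measurable fun q : ℝ × Space d => f q.1 q.2) (hF0 : 0 ≤ F)
    (hT : 0 < T) (ht : t ≤ T) (hF : HolderField f α T F) (x : Space d) :
    MemLp (causalConv heatKernel f t x) 2 halfLine :=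
  ⟨(measurable_causalConv hf measurable_heatKernel t x).aestronglyMeasurable,
    (eLpNorm_causalConv_heat_le hF0 hT ht hF x).trans_lt ENNReal.ofReal_lt_top⟩

lemma memLp_causalConv_dir (hf : Measurable fun q : ℝ × Space d => f q.1 q.2) (hα : 0 < α)
    (hα1 : α ≤ 1) (hF0 : 0 ≤ F) (hT : 0 < T) (ht : t ≤ T) (hF : HolderField f α T F)
    (a x : Space d) : MemLp (causalConv (dirKernel a) f t x) 2 halfLine :=
  ⟨(measurable_causalConv hf (measurable_dirKernel a) t x).aestronglyMeasurable,
    (eLpNorm_causalConv_dir_le hα hα1 hF0 hT ht hF a x).trans_lt ENNReal.ofReal_lt_top⟩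

lemma itoInt_dirShift_ae (hW : IsWienerProcess P ℱ W)
    (hf : Measurable fun q : ℝ × Space d => f q.1 q.2) (hα : 0 < α) (hα1 : α ≤ 1) (hF0 : 0 ≤ F)
    (hT : 0 < T) (ht : t ≤ T) (hF : HolderField f α T F) (a c x : Space d) :
    itoInt hW (causalConv (dirShift a c) f t x) =ᵐ[P]
      itoInt hW (causalConv (dirKernel a) f t (x + c)) -
        itoInt hW (causalConv (dirKernel a) f t x) := by
  rw [itoInt_congr hW (causalConv_dirShift_ae ht hF a c x)]
  exact itoInt_sub hW (memLp_causalConv_dir hf hα hα1 hF0 hT ht hF a _)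
    (memLp_causalConv_dir hf hα hα1 hF0 hT ht hF a _)

lemma itoInt_taylor_ae (hW : IsWienerProcess P ℱ W)
    (hf : Measurable fun q : ℝ × Space d => f q.1 q.2) (hα : 0 < α) (hα1 : α ≤ 1) (hF0 : 0 ≤ F)
    (hT : 0 < T) (ht : t ≤ T) (hF : HolderField f α T F) (a x : Space d) :
    itoInt hW (causalConv (taylorKernel a) f t x) =ᵐ[P]
      itoInt hW (causalConv heatKernel f t (x + a)) - itoInt hW (causalConv heatKernel f t x) -
        itoInt hW (causalConv (dirKernel a) f t x) := by
  have h1 := memLp_causalConv_heat (t := t) hf hF0 hT ht hF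
  rw [itoInt_congr hW (causalConv_taylor_ae ht hF a x)]
  exact (itoInt_sub hW ((h1 (x + a)).sub (h1 x))
    (memLp_causalConv_dir hf hα hα1 hF0 hT ht hF a _)).trans
    ((itoInt_sub hW (h1 (x + a)) (h1 x)).sub (ae_eq_refl _))

lemma eLpNorm_itoInt_taylor_le (hW : IsWienerProcess P ℱ W)
    (hf : Measurable fun q : ℝ × Space d => f q.1 q.2) {r : ℝ} (hr : 0 < r) (hrα : r < α)
    (hα1 : α ≤ 1) (hF0 : 0 ≤ F) (hT : 0 < T) (ht : t ≤ T) (hF : HolderField f α T F)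
    (a x : Space d) (q : ℝ) :
    eLpNorm (itoInt hW (causalConv heatKernel f t (x + a)) -
      itoInt hW (causalConv heatKernel f t x) - itoInt hW (causalConv (dirKernel a) f t x))
      (ENNReal.ofReal q) P ≤
      ENNReal.ofReal (3 * kernelConst d * F * ‖a‖ ^ (1 + r) * √(T ^ (α - r) / (α - r))) *
        gaussConst q := by
  rw [← eLpNorm_congr_ae (itoInt_taylor_ae hW hf (hr.trans hrα) hα1 hF0 hT ht hF a x)]
  exact eLpNorm_itoInt_le_of_le hW (measurable_causalConv hf (measurable_taylorKernel a) t x)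
    (eLpNorm_causalConv_taylor_le hr hrα hα1 hF0 hT ht hF a x) q

lemma eLpNorm_itoInt_time_sub_le (hW : IsWienerProcess P ℱ W)
    (hf : Measurable fun q : ℝ × Space d => f q.1 q.2) {t' : ℝ} (hF0 : 0 ≤ F) (hT : 0 < T)
    (ht : t ≤ t') (ht' : t' ≤ T) (hF : HolderField f α T F) (x : Space d) (q : ℝ) :
    eLpNorm (itoInt hW (causalConv heatKernel f t' x) - itoInt hW (causalConv heatKernel f t x))
      (ENNReal.ofReal q) P ≤
      ENNReal.ofReal (F * (timeConst d + 1) * (t' - t) ^ (1 / 4 : ℝ) *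
        √(T ^ (1 / 2 : ℝ) / (1 / 2))) * gaussConst q := by
  rw [← eLpNorm_congr_ae (itoInt_sub hW (memLp_causalConv_heat hf hF0 hT ht' hF x)
    (memLp_causalConv_heat hf hF0 hT (ht.trans ht') hF x))]
  exact eLpNorm_itoInt_le_of_le hW ((measurable_causalConv hf measurable_heatKernel t' x).sub
    (measurable_causalConv hf measurable_heatKernel t x))
    (eLpNorm_causalConv_time_sub_le hF0 hT ht ht' hf hF x) q

/-- `Z` is a jointly measurable, adapted version of the stochastic convolution
`∫_0^t P_{t-r} f(r,·)(x) dW_r`, and `Z'` is a jointly measurable, adapted version of its spatial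
gradient; both satisfy the natural estimates in terms of the Hölder bounds of `f`. -/
structure IsStochConv (P : Measure Ω) (ℱ : Filtration ℝ≥0 mΩ) (W : ℝ≥0 → Ω → ℝ)
    (f : ℝ → Space d → ℝ) (α : ℝ) (Z : ℝ → Space d → Ω → ℝ) (Z' : ℝ → Space d → Ω → Space d) :
    Prop where
  measField : MeasField Z
  measField_grad : MeasField Z'
  adapted : ∀ (t : ℝ≥0) (x : Space d), Measurable[ℱ t] (Z t x)
  adapted_grad : ∀ (t : ℝ≥0) (x : Space d), Measurable[ℱ t] (Z' t x)
  isItoIntegral : ∀ (t : ℝ≥0) (x : Space d),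
    IsItoIntegral P W t (fun r => heatSemigroup (t - r) (f r) x) (Z t x)
  zero : ∀ x : Space d, Z 0 x =ᵐ[P] 0
  norm_le : ∀ {T F t : ℝ}, 0 ≤ F → 0 < T → 0 ≤ t → t ≤ T → HolderField f α T F →
    ∀ (q : ℝ) (x : Space d),
      eLpNorm (Z t x) (ENNReal.ofReal q) P ≤ ENNReal.ofReal (F * √T) * gaussConst q
  norm_grad_le : ∀ {T F t : ℝ}, 0 ≤ F → 0 < T → 0 ≤ t → t ≤ T → HolderField f α T F →
    ∀ {q : ℝ}, 1 ≤ q → ∀ x : Space d, eLpNorm (Z' t x) (ENNReal.ofReal q) P ≤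
      ENNReal.ofReal (d * (F * kernelConst d * √(T ^ α / α))) * gaussConst q
  norm_grad_sub_le : ∀ {T F t : ℝ}, 0 ≤ F → 0 < T → 0 ≤ t → t ≤ T → HolderField f α T F →
    ∀ {r : ℝ}, 0 < r → r < α → ∀ {q : ℝ}, 1 ≤ q → ∀ x c : Space d,
      eLpNorm (Z' t (x + c) - Z' t x) (ENNReal.ofReal q) P ≤
        ENNReal.ofReal (d * (3 * kernelConst d * F * ‖c‖ ^ r * √(T ^ (α - r) / (α - r)))) *
          gaussConst q
  taylor_le : ∀ {T F t : ℝ}, 0 ≤ F → 0 < T → 0 ≤ t → t ≤ T → HolderField f α T F →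
    ∀ {r : ℝ}, 0 < r → r < α → ∀ (q : ℝ) (x a : Space d),
      eLpNorm (fun ω => Z t (x + a) ω - Z t x ω - inner ℝ (Z' t x ω) a) (ENNReal.ofReal q) P ≤
        ENNReal.ofReal (3 * kernelConst d * F * ‖a‖ ^ (1 + r) * √(T ^ (α - r) / (α - r))) *
          gaussConst q
  time_sub_le : ∀ {T F t t' : ℝ}, 0 ≤ F → 0 < T → 0 ≤ t → t ≤ t' → t' ≤ T → HolderField f α T F →
    ∀ (q : ℝ) (x : Space d), eLpNorm (Z t' x - Z t x) (ENNReal.ofReal q) P ≤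
      ENNReal.ofReal (F * (timeConst d + 1) * (t' - t) ^ (1 / 4 : ℝ) *
        √(T ^ (1 / 2 : ℝ) / (1 / 2))) * gaussConst q

lemma ofReal_toReal_gaussConst (q : ℝ) : ENNReal.ofReal (gaussConst q).toReal = gaussConst q :=
  ENNReal.ofReal_toReal (gaussConst_lt_top q).ne

/-- The measurable, adapted version of the stochastic convolution itself. -/
lemma exists_stochConv_modification (hW : IsWienerProcess P ℱ W)
    (hf : Measurable fun q : ℝ × Space d => f q.1 q.2) (hα : 0 < α) (hα1 : α ≤ 1)
    (hF : ∀ T, 0 < T → ∃ F, 0 ≤ F ∧ HolderField f α T F) :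
    ∃ Z : ℝ → Space d → Ω → ℝ, MeasField Z ∧
      (∀ (t : ℝ≥0) (x : Space d), Measurable[ℱ t] (Z t x)) ∧
      (∀ (t : ℝ≥0) (x : Space d), Z t x =ᵐ[P] itoInt hW (causalConv heatKernel f t x)) ∧
      ∀ (t : ℝ≥0) (x : Space d),
        IsItoIntegral P W t (fun r => heatSemigroup (t - r) (f r) x) (Z t x) := by
  have hP : IsProbabilityMeasure P := hW.isGaussianProcess.isProbabilityMeasure
  have hito : ∀ (t : ℝ≥0) (x : Space d),
      IsItoIntegral P W t (fun r => heatSemigroup (t - r) (f r) x)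
        (itoInt hW (causalConv heatKernel f t x)) := by
    intro t x
    obtain ⟨F, hF0, hFT⟩ := hF (t + 1) (by positivity)
    refine isItoIntegral_itoInt hW t (memLp_causalConv_heat hf hF0 (by positivity)
      (by linarith) hFT x) (fun r hr => ?_) fun r hr => ?_
    · exact if_neg (by linarith)
    · rw [causalConv, if_pos hr, heatSemigroup_eq_conv]
  have hmod : ∀ (t : ℝ≥0) (x : Space d), ∃ C γ : ℝ, 0 < γ ∧ ∀ (s : ℝ≥0) (y : Space d), s ≤ t →
      (t : ℝ) - s ≤ 1 → ‖y - x‖ ≤ 1 →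
        eLpNorm (itoInt hW (causalConv heatKernel f s y) -
          itoInt hW (causalConv heatKernel f t x)) 2 P ≤
          ENNReal.ofReal (C * (((t : ℝ) - s) ^ γ + ‖y - x‖ ^ γ)) := by
    intro t x
    set T : ℝ := t + 1 with hTdef
    have hT : 0 < T := by positivity
    obtain ⟨F, hF0, hFT⟩ := hF T hT
    have hk := kernelConst_pos d
    have htc := timeConst_pos d
    set g := (gaussConst 2).toReal with hg
    have hg0 : 0 ≤ g := ENNReal.toReal_nonneg
    set A := 3 * kernelConst d * F * √(T ^ (α - α / 2) / (α - α / 2)) with hA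
    set B := F * kernelConst d * √(T ^ α / α) with hB
    set D := F * (timeConst d + 1) * √(T ^ (1 / 2 : ℝ) / (1 / 2)) with hD
    have hA0 : 0 ≤ A := by positivity
    have hB0 : 0 ≤ B := by positivity
    have hD0 : 0 ≤ D := by positivity
    refine ⟨(A + B + D) * g, 1 / 4, by norm_num, fun s y hst _ hyx => ?_⟩
    have hst' : (s : ℝ) ≤ t := NNReal.coe_le_coe.2 hst
    have hsT : (s : ℝ) ≤ T := by linarith
    set a := y - x with ha
    have hy : y = x + a := by rw [ha]; abel
    have h1 := eLpNorm_itoInt_taylor_le hW hf (r := α / 2) (by linarith) (by linarith) hα1 hF0 hT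
      hsT hFT a x 2
    have h2 := eLpNorm_itoInt_le_of_le hW (measurable_causalConv hf (measurable_dirKernel a) s x)
      (eLpNorm_causalConv_dir_le hα hα1 hF0 hT hsT hFT a x) 2
    have h3 := eLpNorm_itoInt_time_sub_le hW hf hF0 hT hst' (show (t : ℝ) ≤ T by linarith) hFT x 2
    rw [ENNReal.ofReal_ofNat, ← ofReal_toReal_gaussConst, ← hg,
      ← ENNReal.ofReal_mul (by positivity)] at h1 h2 h3
    have hm : ∀ (r : ℝ≥0) (z : Space d), (r : ℝ) ≤ T →
        AEStronglyMeasurable (itoInt hW (causalConv heatKernel f r z)) P := fun r z hr =>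
      aestronglyMeasurable_itoInt hW (memLp_causalConv_heat hf hF0 hT hr hFT z)
    have hmd : AEStronglyMeasurable (itoInt hW (causalConv (dirKernel a) f s x)) P :=
      aestronglyMeasurable_itoInt hW (memLp_causalConv_dir hf hα hα1 hF0 hT hsT hFT a x)
    -- Taylor remainder in space, plus the linear term, minus the time increment
    have hsplit : itoInt hW (causalConv heatKernel f s y) - itoInt hW (causalConv heatKernel f t x)
        = ((itoInt hW (causalConv heatKernel f s (x + a)) - itoInt hW (causalConv heatKernel f s x)
          - itoInt hW (causalConv (dirKernel a) f s x)) +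
          itoInt hW (causalConv (dirKernel a) f s x)) -
          (itoInt hW (causalConv heatKernel f t x) - itoInt hW (causalConv heatKernel f s x)) := by
      rw [hy]; abel
    rw [hsplit]
    refine (eLpNorm_sub_le ((((hm s _ hsT).sub (hm s _ hsT)).sub hmd).add hmd)
      ((hm t _ (by linarith)).sub (hm s _ hsT)) (by norm_num)).trans ?_
    refine (add_le_add (eLpNorm_add_le (((hm s _ hsT).sub (hm s _ hsT)).sub hmd) hmd
      (by norm_num)) le_rfl).trans ?_
    refine (add_le_add (add_le_add h1 h2) h3).trans ?_
    have hts : 0 ≤ (t : ℝ) - s := by linarith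
    rw [← ENNReal.ofReal_add (by positivity) (by positivity),
      ← ENNReal.ofReal_add (by positivity) (by positivity)]
    apply ENNReal.ofReal_le_ofReal
    have e1 : ‖a‖ ^ (1 + α / 2) ≤ ‖a‖ ^ (1 / 4 : ℝ) :=
      Real.rpow_le_rpow_of_exponent_ge_of_imp (norm_nonneg _) hyx (by linarith) (by
        intro _ h; linarith)
    have e2 : ‖a‖ ≤ ‖a‖ ^ (1 / 4 : ℝ) := by
      nth_rw 1 [← Real.rpow_one ‖a‖]
      exact Real.rpow_le_rpow_of_exponent_ge_of_imp (norm_nonneg _) hyx (by norm_num) (by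
        intro _ h; norm_num at h)
    calc _ = (A * ‖a‖ ^ (1 + α / 2) + B * ‖a‖ + D * ((t : ℝ) - s) ^ (1 / 4 : ℝ)) * g := by
          rw [hA, hB, hD]; ring
      _ ≤ (A * ‖a‖ ^ (1 / 4 : ℝ) + B * ‖a‖ ^ (1 / 4 : ℝ) +
          D * ((t : ℝ) - s) ^ (1 / 4 : ℝ)) * g := by gcongr
      _ ≤ (A + B + D) * g * (((t : ℝ) - s) ^ (1 / 4 : ℝ) + ‖a‖ ^ (1 / 4 : ℝ)) := by
          have p1 : 0 ≤ ((t : ℝ) - s) ^ (1 / 4 : ℝ) := by positivity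
          have p2 : 0 ≤ ‖a‖ ^ (1 / 4 : ℝ) := by positivity
          nlinarith [mul_nonneg (mul_nonneg hA0 hg0) p1, mul_nonneg (mul_nonneg hB0 hg0) p1,
            mul_nonneg (mul_nonneg hD0 hg0) p2]
  obtain ⟨Z, hZ1, hZ2, hZ3⟩ := exists_measField_modification
    (Y := fun t x => itoInt hW (causalConv heatKernel f t x))
    (fun t x => (hito t x).aestronglyMeasurable hW) hmod
  exact ⟨Z, hZ1, hZ2, hZ3, fun t x => (hito t x).congr (ae_eq_refl _) (hZ3 t x).symm⟩

/-- Existence of the stochastic convolution. The coordinates of the gradient are almost sure limits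
of difference quotients along the increments `2^{-k} e_i`. -/
theorem exists_isStochConv (hW : IsWienerProcess P ℱ W)
    (hf : Measurable fun q : ℝ × Space d => f q.1 q.2) (hα : 0 < α) (hα1 : α ≤ 1)
    (hF : ∀ T, 0 < T → ∃ F, 0 ≤ F ∧ HolderField f α T F) :
    ∃ Z Z', IsStochConv P ℱ W f α Z Z' := by
  have hP : IsProbabilityMeasure P := hW.isGaussianProcess.isProbabilityMeasure
  obtain ⟨Z, hZm, hZa, hZ, hZI⟩ := exists_stochConv_modification hW hf hα hα1 hF
  set e : Fin d → Space d := fun i => EuclideanSpace.single i 1 with he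
  have hen : ∀ i, ‖e i‖ = 1 := fun i => by simp [he]
  set X : ℕ → Fin d → ℝ → Space d → Ω → ℝ := fun k i t x ω =>
    2 ^ k * (Z t (x + (1 / 2 : ℝ) ^ k • e i) ω - Z t x ω) with hX
  set z : Fin d → ℝ → Space d → Ω → ℝ := fun i t x ω => limUnder atTop fun k => X k i t x ω with hz
  have hXm : ∀ k i, MeasField (X k i) := fun k i => by
    have h1 : Measurable fun q : ℝ × Space d × Ω =>
        (q.1, q.2.1 + (1 / 2 : ℝ) ^ k • e i, q.2.2) :=
      measurable_fst.prodMk (((measurable_fst.comp measurable_snd).add_const _).prodMk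
        (measurable_snd.comp measurable_snd))
    have h2 : Measurable fun q : ℝ × Space d × Ω => Z q.1 (q.2.1 + (1 / 2 : ℝ) ^ k • e i) q.2.2 :=
      Measurable.comp (g := fun q : ℝ × Space d × Ω => Z q.1 q.2.1 q.2.2) hZm h1
    exact (h2.sub hZm).const_mul _
  have hXa : ∀ k i (t : ℝ≥0) x, Measurable[ℱ t] (X k i t x) := fun k i t x =>
    ((hZa t _).sub (hZa t x)).const_mul _
  have hzm : ∀ i, MeasField (z i) := fun i =>
    (StronglyMeasurable.limUnder fun k => (hXm k i).stronglyMeasurable).measurable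
  have hza : ∀ i (t : ℝ≥0) x, Measurable[ℱ t] (z i t x) := fun i t x =>
    (@StronglyMeasurable.limUnder _ _ _ (ℱ t) _ _ _ _ _ _ _
      fun k => (hXa k i t x).stronglyMeasurable).measurable
  -- the difference quotients converge almost surely, by the Taylor estimate
  have hzae : ∀ i (t : ℝ≥0) x, z i t x =ᵐ[P] itoInt hW (causalConv (dirKernel (e i)) f t x) := by
    intro i t x
    have hT : (0 : ℝ) < t + 1 := by positivity
    have htT : (t : ℝ) ≤ t + 1 := by linarith
    obtain ⟨F, hF0, hFT⟩ := hF (t + 1) hT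
    set T : ℝ := t + 1
    have hk := kernelConst_pos d
    have hs : ∑' k, eLpNorm (X k i t x - itoInt hW (causalConv (dirKernel (e i)) f t x)) 2 P
        ≠ ∞ := by
      set g := (gaussConst 2).toReal with hg
      have hg0 : 0 ≤ g := ENNReal.toReal_nonneg
      set A := 3 * kernelConst d * F * √(T ^ (α - α / 2) / (α - α / 2)) with hA
      refine ne_top_of_le_ne_top (tsum_ofReal_ne_top_of_summable
        (summable_const_mul_two_pow_rpow (A * g) (half_pos hα))) (ENNReal.tsum_le_tsum fun k => ?_)
      set a : Space d := (1 / 2 : ℝ) ^ k • e i with ha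
      have han : ‖a‖ = (1 / 2 : ℝ) ^ k := by
        rw [ha, norm_smul, hen, mul_one, Real.norm_of_nonneg (by positivity)]
      have h1 := eLpNorm_itoInt_taylor_le hW hf (r := α / 2) (by linarith) (by linarith) hα1 hF0 hT
        htT hFT a x 2
      rw [ENNReal.ofReal_ofNat, ← ofReal_toReal_gaussConst, ← hg,
        ← ENNReal.ofReal_mul (by positivity)] at h1
      have hdir : itoInt hW (causalConv (dirKernel a) f t x) =ᵐ[P]
          (1 / 2 : ℝ) ^ k • itoInt hW (causalConv (dirKernel (e i)) f t x) := by
        have h2 : causalConv (dirKernel a) f t x =ᵐ[halfLine]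
            (1 / 2 : ℝ) ^ k • causalConv (dirKernel (e i)) f t x := by
          refine Eventually.of_forall fun r => ?_
          simp only [causalConv, Pi.smul_apply, smul_eq_mul]
          split_ifs
          · unfold conv dirKernel
            rw [← integral_const_mul]
            congr with y
            rw [ha, inner_smul_right, smul_eq_mul, smul_eq_mul]; ring
          · simp
        rw [itoInt_congr hW h2]
        exact itoInt_const_smul hW (memLp_causalConv_dir hf hα hα1 hF0 hT htT hFT _ x) _
      have h4 : (2 : ℝ) ^ k * (1 / 2) ^ k = 1 := by rw [← mul_pow]; norm_num
      have h3 : X k i t x - itoInt hW (causalConv (dirKernel (e i)) f t x) =ᵐ[P]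
          (2 : ℝ) ^ k • (itoInt hW (causalConv heatKernel f t (x + a)) -
            itoInt hW (causalConv heatKernel f t x) -
            itoInt hW (causalConv (dirKernel a) f t x)) := by
        filter_upwards [hZ t (x + a), hZ t x, hdir] with ω w1 w2 w3
        simp only [Pi.sub_apply, Pi.smul_apply, smul_eq_mul, hX] at w3 ⊢
        rw [w3, ← ha, w1, w2]
        linear_combination (itoInt hW (causalConv (dirKernel (e i)) f t x) ω) * h4
      rw [eLpNorm_congr_ae h3, eLpNorm_const_smul, Real.enorm_eq_ofReal (by positivity)]
      calc _ ≤ ENNReal.ofReal (2 ^ k) * ENNReal.ofReal _ := by gcongr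
        _ = _ := by
          rw [← ENNReal.ofReal_mul (by positivity), han, Real.rpow_add (by positivity),
            Real.rpow_one]
          congr 1
          rw [hA]
          linear_combination (3 * kernelConst d * F * √(T ^ (α - α / 2) / (α - α / 2)) * g *
            ((1 / 2 : ℝ) ^ k) ^ (α / 2)) * h4
    have h1 := ae_tendsto_of_tsum_eLpNorm_ne_top (by norm_num)
      (fun k => ((hXm k i).slice t x).aestronglyMeasurable)
      (aestronglyMeasurable_itoInt hW (memLp_causalConv_dir hf hα hα1 hF0 hT htT hFT _ x)) hs
    filter_upwards [h1] with ω hω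
    exact hω.limUnder_eq
  set Z' : ℝ → Space d → Ω → Space d := fun t x ω => ∑ i, z i t x ω • e i with hZ'
  -- `Z' · a` is the stochastic convolution with the derivative of the kernel in direction `a`
  have hinner : ∀ {T F : ℝ} {t : ℝ≥0}, 0 ≤ F → 0 < T → (t : ℝ) ≤ T → HolderField f α T F →
      ∀ x a, (fun ω => inner ℝ (Z' t x ω) a) =ᵐ[P] itoInt hW (causalConv (dirKernel a) f t x) := by
    intro T F t hF0 hT htT hFT x a
    rw [itoInt_congr hW (causalConv_dir_ae htT hFT a x)]
    have h1 := itoInt_sum hW Finset.univ (fun i => a i) (fun i =>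
      memLp_causalConv_dir hf hα hα1 hF0 hT htT hFT (e i) x)
    refine EventuallyEq.trans ?_ h1.symm
    filter_upwards [ae_all_iff.2 fun i => hzae i t x] with ω hω
    simp only [hZ', sum_inner, Finset.sum_apply, Pi.smul_apply, smul_eq_mul]
    refine Finset.sum_congr rfl fun i _ => ?_
    rw [hω i, real_inner_smul_left, he]
    simp [EuclideanSpace.inner_single_left, mul_comm]
  have hsumle : ∀ {q : ℝ} {K : ℝ≥0∞} {Y : Fin d → Ω → ℝ}, 1 ≤ q →
      (∀ i, AEStronglyMeasurable (Y i) P) → (∀ i, eLpNorm (Y i) (ENNReal.ofReal q) P ≤ K) →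
      eLpNorm (fun ω => ∑ i, Y i ω • e i) (ENNReal.ofReal q) P ≤ d * K := by
    intro q K Y hq hYm hK
    have h1 : (fun ω => ∑ i, Y i ω • e i) = ∑ i, fun ω => Y i ω • e i := by
      ext1 ω; rw [Finset.sum_apply]
    rw [h1]
    refine (eLpNorm_sum_le (fun i _ => (hYm i).smul_const (e i)) (by simpa using hq)).trans ?_
    calc ∑ i, eLpNorm (fun ω => Y i ω • e i) (ENNReal.ofReal q) P ≤ ∑ _i : Fin d, K := by
          refine Finset.sum_le_sum fun i _ => le_trans (eLpNorm_mono fun ω => ?_) (hK i)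
          rw [norm_smul, hen, mul_one]
      _ = d * K := by simp
  refine ⟨Z, Z', hZm, ?_, hZa, ?_, hZI, ?_, ?_, ?_, ?_, ?_, ?_⟩
  · exact Finset.measurable_fun_sum _ fun i _ => (hzm i).smul_const (e i)
  · exact fun t x => Finset.measurable_fun_sum _ fun i _ => (hza i t x).smul_const (e i)
  · intro x
    obtain ⟨F, hF0, hFT⟩ := hF 1 one_pos
    have h1 : causalConv heatKernel f ((0 : ℝ≥0) : ℝ) x =ᵐ[halfLine] 0 := by
      filter_upwards [ae_restrict_mem measurableSet_Ioi] with r hr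
      exact if_neg (not_lt.2 (le_of_lt hr))
    have h2 := hZ 0 x
    rw [itoInt_congr hW h1] at h2
    exact h2.trans (itoInt_zero hW)
  · intro T F t hF0 hT ht0 htT hFT q x
    lift t to ℝ≥0 using ht0
    rw [eLpNorm_congr_ae (hZ t x)]
    exact eLpNorm_itoInt_le_of_le hW (measurable_causalConv hf measurable_heatKernel t x)
      (eLpNorm_causalConv_heat_le hF0 hT htT hFT x) q
  · intro T F t hF0 hT ht0 htT hFT q hq x
    lift t to ℝ≥0 using ht0
    rw [ENNReal.ofReal_mul (by positivity), ENNReal.ofReal_natCast, mul_assoc]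
    refine hsumle hq (fun i => ((hzm i).slice t x).aestronglyMeasurable) fun i => ?_
    rw [eLpNorm_congr_ae (hzae i t x)]
    have := eLpNorm_itoInt_le_of_le hW (measurable_causalConv hf (measurable_dirKernel (e i)) t x)
      (eLpNorm_causalConv_dir_le hα hα1 hF0 hT htT hFT (e i) x) q
    rwa [hen, mul_one] at this
  · intro T F t hF0 hT ht0 htT hFT r hr hrα q hq x c
    lift t to ℝ≥0 using ht0
    have h1 : Z' t (x + c) - Z' t x = fun ω => ∑ i, (z i t (x + c) ω - z i t x ω) • e i := by
      ext1 ω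
      simp only [hZ', Pi.sub_apply, sub_smul, Finset.sum_sub_distrib]
    rw [h1, ENNReal.ofReal_mul (by positivity), ENNReal.ofReal_natCast, mul_assoc]
    refine hsumle (Y := fun i ω => z i t (x + c) ω - z i t x ω) hq (fun i =>
      (((hzm i).slice t (x + c)).sub ((hzm i).slice t x)).aestronglyMeasurable) fun i => ?_
    have h2 : (fun ω => z i t (x + c) ω - z i t x ω) =ᵐ[P]
        itoInt hW (causalConv (dirShift (e i) c) f t x) :=
      ((hzae i t (x + c)).sub (hzae i t x)).trans
        (itoInt_dirShift_ae hW hf hα hα1 hF0 hT htT hFT (e i) c x).symm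
    rw [eLpNorm_congr_ae h2]
    have := eLpNorm_itoInt_le_of_le hW (measurable_causalConv hf (measurable_dirShift (e i) c) t x)
      (eLpNorm_causalConv_dirShift_le hr hrα hα1 hF0 hT htT hFT (e i) c x) q
    rwa [hen, mul_one] at this
  · intro T F t hF0 hT ht0 htT hFT r hr hrα q x a
    lift t to ℝ≥0 using ht0
    have h1 := ((hZ t (x + a)).sub (hZ t x)).sub (hinner hF0 hT htT hFT x a)
    refine (eLpNorm_congr_ae h1).trans_le ?_
    exact eLpNorm_itoInt_taylor_le hW hf hr hrα hα1 hF0 hT htT hFT a x q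
  · intro T F t t' hF0 hT ht0 htt ht' hFT q x
    lift t to ℝ≥0 using ht0
    lift t' to ℝ≥0 using t.2.trans htt
    rw [eLpNorm_congr_ae ((hZ t' x).sub (hZ t x))]
    exact eLpNorm_itoInt_time_sub_le hW hf hF0 hT htt ht' hFT x q

end StochConv

/-! ### The fixed point equation for the drift -/

section FixedPoint

variable {d : ℕ} {Ω : Type*} {mΩ : MeasurableSpace Ω} {P : Measure Ω} {ℱ : Filtration ℝ≥0 mΩ}
  {φ : ℝ → Space d → Ω → ℝ} {b : ℝ → Space d → Space d} {q T B : ℝ}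

lemma ae_stMeasure_pos : ∀ᵐ z ∂stMeasure d, 0 < z.1 :=
  Measure.quasiMeasurePreserving_fst.ae (ae_restrict_mem measurableSet_Ioi)

lemma FieldBound.mono {w w' : ℝ → ℝ≥0∞} (h : FieldBound P q T w φ)
    (hw : ∀ r, 0 < r → r < T → w r ≤ w' r) : FieldBound P q T w' φ := by
  filter_upwards [h, ae_stMeasure_pos] with z hz hz0 hzT
  exact (hz hzT).trans (hw _ hz0 hzT)

lemma FieldBound.exponent_mono [IsProbabilityMeasure P] {w : ℝ → ℝ≥0∞} {q' : ℝ} (hqq : q' ≤ q)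
    (hφ : MeasField φ) (h : FieldBound P q T w φ) : FieldBound P q' T w φ := by
  filter_upwards [h] with z hz hzT
  exact (eLpNorm_le_eLpNorm_of_exponent_le (ENNReal.ofReal_le_ofReal hqq)
    (hφ.slice z.1 z.2).aestronglyMeasurable).trans (hz hzT)

/-- An exponential bound implies a constant bound on a bounded time interval. -/
lemma FieldBound.of_exp {A : ℝ≥0∞} {Λ : ℝ} (hΛ : 0 ≤ Λ)
    (h : FieldBound P q T (fun r => A * ENNReal.ofReal (Real.exp (Λ * r))) φ) :
    FieldBound P q T (fun _ => A * ENNReal.ofReal (Real.exp (Λ * T))) φ :=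
  h.mono fun r _ hr => by gcongr

lemma FieldBound.sub {w w' : ℝ → ℝ≥0∞} {ψ : ℝ → Space d → Ω → ℝ} (hq : 1 ≤ q) (hφ : MeasField φ)
    (hψ : MeasField ψ) (h : FieldBound P q T w φ) (h' : FieldBound P q T w' ψ) :
    FieldBound P q T (fun r => w r + w' r) (fun t x ω => φ t x ω - ψ t x ω) := by
  filter_upwards [h, h'] with z hz hz' hzT
  exact (eLpNorm_sub_le (hφ.slice z.1 z.2).aestronglyMeasurable
    (hψ.slice z.1 z.2).aestronglyMeasurable (by simpa using hq)).trans
    (add_le_add (hz hzT) (hz' hzT))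

/-- The drift `b` is bounded by `B` almost everywhere before time `T`. -/
def DriftBound (b : ℝ → Space d → Space d) (T B : ℝ) : Prop :=
  ∀ᵐ z ∂stMeasure d, z.1 < T → ‖b z.1 z.2‖ ≤ B

/-- The map `φ ↦ -b · ∇ ∫_0^t P_{t-r} φ(r) dr`, whose fixed points describe the source term of the
equation. -/
noncomputable def driftMap (b : ℝ → Space d → Space d) (φ : ℝ → Space d → Ω → ℝ) (t : ℝ)
    (x : Space d) (ω : Ω) : ℝ :=
  -inner ℝ (b t x) (pot gradKernel φ t x ω)

lemma measField_inner {V : ℝ → Space d → Ω → Space d}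
    (hb : Measurable fun q : ℝ × Space d => b q.1 q.2) (hV : MeasField V) :
    MeasField fun t x ω => inner ℝ (b t x) (V t x ω) := by
  have h : Measurable fun q : ℝ × Space d × Ω => b q.1 q.2.1 :=
    Measurable.comp (g := fun q : ℝ × Space d => b q.1 q.2) hb
      (measurable_fst.prodMk (measurable_fst.comp measurable_snd))
  exact h.inner hV

lemma measField_driftMap (hb : Measurable fun q : ℝ × Space d => b q.1 q.2)
    (hφ : MeasField φ) : MeasField (driftMap b φ) :=
  (measField_inner hb (measField_pot measurable_gradKernel hφ)).neg

lemma eLpNorm_inner_le {v : Space d} (hB : 0 ≤ B) (hv : ‖v‖ ≤ B) (Y : Ω → Space d) (p : ℝ≥0∞) :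
    eLpNorm (fun ω => inner ℝ v (Y ω)) p P ≤ ENNReal.ofReal B * eLpNorm Y p P := by
  have h1 : eLpNorm (fun ω => inner ℝ v (Y ω)) p P ≤ eLpNorm (B • Y) p P := by
    refine eLpNorm_mono fun ω => ?_
    rw [Pi.smul_apply, norm_smul, Real.norm_of_nonneg hB]
    exact (norm_inner_le_norm _ _).trans (by gcongr)
  rwa [eLpNorm_const_smul, Real.enorm_eq_ofReal hB] at h1

/-- The growth rate for which the drift map is a contraction with factor `1/2` in the norm weighted
by `exp(-Λ t)`. -/
noncomputable def growthRate (d : ℕ) (B : ℝ) : ℝ := 4 * Real.pi * (kernelConst d * B) ^ 2 + 1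

lemma growthRate_pos (d : ℕ) (B : ℝ) : 0 < growthRate d B := by
  unfold growthRate; positivity

/-- The choice of the growth rate: `∫_0^∞ c s^{-1/2} e^{-Λs} ds = c √(π/Λ)`, times `B`, is at most
`1/2`. -/
lemma mul_kernelConst_mul_sqrt_le (d : ℕ) (B : ℝ) :
    B * (kernelConst d * √(Real.pi / growthRate d B)) ≤ 1 / 2 := by
  have hc := kernelConst_pos d
  have hΛ := growthRate_pos d B
  have h : (B * (kernelConst d * √(Real.pi / growthRate d B))) ^ 2 ≤ (1 / 2) ^ 2 := by
    rw [mul_pow, mul_pow, Real.sq_sqrt (by positivity), ← mul_assoc, mul_div_assoc', div_le_iff₀ hΛ]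
    unfold growthRate
    nlinarith
  exact le_of_sq_le_sq h (by norm_num)

lemma eLpNorm_driftMap_le [SFinite P] (hq : 1 ≤ q) (hφ : MeasField φ) (hB : 0 ≤ B) {A : ℝ≥0∞}
    (hA : FieldBound P q T (fun r => A * ENNReal.ofReal (Real.exp (growthRate d B * r))) φ)
    {t : ℝ} (ht : t ≤ T) {x : Space d} (hbx : ‖b t x‖ ≤ B) :
    eLpNorm (driftMap b φ t x) (ENNReal.ofReal q) P ≤
      ENNReal.ofReal (1 / 2) * A * ENNReal.ofReal (Real.exp (growthRate d B * t)) := by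
  have h1 := eLpNorm_pot_grad_exp_le hq hφ (growthRate_pos d B) hA ht x
  have h2 : driftMap b φ t x = -fun ω => inner ℝ (b t x) (pot gradKernel φ t x ω) := rfl
  rw [h2, eLpNorm_neg]
  refine (eLpNorm_inner_le hB hbx _ _).trans ?_
  calc _ ≤ ENNReal.ofReal B * (ENNReal.ofReal (kernelConst d * √(Real.pi / growthRate d B)) * A *
        ENNReal.ofReal (Real.exp (growthRate d B * t))) := by gcongr
    _ = ENNReal.ofReal (B * (kernelConst d * √(Real.pi / growthRate d B))) * A *
        ENNReal.ofReal (Real.exp (growthRate d B * t)) := by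
      rw [ENNReal.ofReal_mul hB]; ring
    _ ≤ _ := by gcongr; exact mul_kernelConst_mul_sqrt_le d B

/-- The drift map is a contraction with factor `1/2` in an exponentially weighted norm. -/
lemma fieldBound_driftMap [SFinite P] (hq : 1 ≤ q) (hφ : MeasField φ) (hB : 0 ≤ B)
    (hb : DriftBound b T B) {A : ℝ≥0∞}
    (hA : FieldBound P q T (fun r => A * ENNReal.ofReal (Real.exp (growthRate d B * r))) φ) :
    FieldBound P q T (fun r => ENNReal.ofReal (1 / 2) * A *
      ENNReal.ofReal (Real.exp (growthRate d B * r))) (driftMap b φ) := by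
  filter_upwards [hb] with z hz hzT
  exact eLpNorm_driftMap_le hq hφ hB hA hzT.le (hz hzT)

lemma one_le_ofReal_exp {Λ r : ℝ} (hΛ : 0 ≤ Λ) (hr : 0 ≤ r) :
    1 ≤ ENNReal.ofReal (Real.exp (Λ * r)) := by
  rw [← ENNReal.ofReal_one]
  exact ENNReal.ofReal_le_ofReal (Real.one_le_exp (by positivity))

lemma FieldBound.exp_of_const {A : ℝ≥0∞} {Λ : ℝ} (hΛ : 0 ≤ Λ)
    (h : FieldBound P q T (fun _ => A) φ) :
    FieldBound P q T (fun r => A * ENNReal.ofReal (Real.exp (Λ * r))) φ :=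
  h.mono fun _ hr _ => le_mul_of_one_le_right' (one_le_ofReal_exp hΛ hr.le)

/-- A fixed point of the drift map vanishes. -/
lemma fieldBound_zero_of_eq_driftMap [SFinite P] (hq : 1 ≤ q) (hφ : MeasField φ) (hB : 0 ≤ B)
    (hb : DriftBound b T B) {M : ℝ≥0∞} (hM : M < ∞) (hφM : FieldBound P q T (fun _ => M) φ)
    (hfix : ∀ᵐ z ∂stMeasure d, z.1 < T → φ z.1 z.2 =ᵐ[P] driftMap b φ z.1 z.2) :
    FieldBound P q T (fun _ => 0) φ := by
  -- iterating the contraction estimate improves the bound by a factor `1/2` each time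
  have hn : ∀ n : ℕ, FieldBound P q T (fun r => ENNReal.ofReal (1 / 2) ^ n * M *
      ENNReal.ofReal (Real.exp (growthRate d B * r))) φ := by
    intro n
    induction n with
    | zero => simpa using hφM.exp_of_const (growthRate_pos d B).le
    | succ n ih =>
      filter_upwards [fieldBound_driftMap hq hφ hB hb ih, hfix] with z hz hz2 hzT
      rw [eLpNorm_congr_ae (hz2 hzT), pow_succ']
      simpa only [mul_assoc] using hz hzT
  filter_upwards [ae_all_iff.2 hn] with z hz hzT
  have hlim : Tendsto (fun n : ℕ => ENNReal.ofReal (1 / 2) ^ n * (M *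
      ENNReal.ofReal (Real.exp (growthRate d B * z.1)))) atTop (𝓝 (0 * (M *
      ENNReal.ofReal (Real.exp (growthRate d B * z.1))))) := by
    refine ENNReal.Tendsto.mul_const (ENNReal.tendsto_pow_atTop_nhds_zero_of_lt_one ?_)
      (Or.inr (ENNReal.mul_ne_top hM.ne ENNReal.ofReal_ne_top))
    rw [← ENNReal.ofReal_one]
    exact (ENNReal.ofReal_lt_ofReal_iff one_pos).2 (by norm_num)
  rw [zero_mul] at hlim
  exact ge_of_tendsto' hlim fun n => by simpa only [mul_assoc] using hz n hzT

/-- Potentials with scalar kernels inherit adaptedness. -/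
lemma aestronglyMeasurable_pot [IsProbabilityMeasure P] {g : ℝ → Space d → ℝ}
    (hg : Measurable fun q : ℝ × Space d => g q.1 q.2) (hφ : MeasField φ)
    (had : ∀ (t : ℝ≥0) (x : Space d), AEStronglyMeasurable[ℱ t] (φ t x) P) {M : ℝ≥0∞} (hM : M < ∞)
    (hT : 0 < T) (hb : FieldBound P 2 T (fun _ => M) φ) {C e : ℝ} (hC : 0 ≤ C) (he : -1 < e)
    (hgC : ∀ s, 0 < s → ∫⁻ z, ‖g s z‖ₑ ≤ ENNReal.ofReal (C * s ^ e)) (t : ℝ≥0) (ht : (t : ℝ) ≤ T)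
    (x : Space d) : AEStronglyMeasurable[ℱ t] (pot g φ t x) P := by
  have h1 := lintegral_causal_field_le hg (w := fun _ => M) measurable_const hb ht x hgC
  rw [ENNReal.ofReal_ofNat] at h1
  refine aestronglyMeasurable_kerInt (ℱ.le t) (measurable_causal hg t x) hφ.prod ?_
    ((h1.trans (lintegral_const_rpow_le hC he ht hT M)).trans_lt
      (ENNReal.mul_lt_top ENNReal.ofReal_lt_top hM))
  filter_upwards [ae_stMeasure_pos] with z hz hne
  have hlt : z.1 < t := by
    by_contra h
    exact hne (causal_of_le (not_lt.1 h))
  lift z.1 to ℝ≥0 using hz.le with s hs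
  exact (had s z.2).mono (ℱ.mono (NNReal.coe_le_coe.1 hlt.le))

lemma lintegral_dirKernel_le (a : Space d) {s : ℝ} (hs : 0 < s) :
    ∫⁻ z, ‖dirKernel a s z‖ₑ ≤ ENNReal.ofReal (‖a‖ * kernelConst d * s ^ (-(1 / 2) : ℝ)) := by
  calc ∫⁻ z, ‖dirKernel a s z‖ₑ ≤ ∫⁻ z, ENNReal.ofReal ‖a‖ * ‖gradKernel s z‖ₑ := by
        refine lintegral_mono fun z => ?_
        rw [ofReal_norm, mul_comm]
        unfold dirKernel
        rw [← ofReal_norm, ← ofReal_norm, ← ofReal_norm, ← ENNReal.ofReal_mul (norm_nonneg _)]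
        exact ENNReal.ofReal_le_ofReal (norm_inner_le_norm _ _)
    _ = ENNReal.ofReal ‖a‖ * ∫⁻ z, ‖gradKernel s z‖ₑ :=
        lintegral_const_mul' _ _ ENNReal.ofReal_ne_top
    _ ≤ ENNReal.ofReal ‖a‖ * ENNReal.ofReal (kernelConst d * s ^ (-(1 / 2) : ℝ)) := by
        gcongr; exact lintegral_gradKernel_le hs
    _ = _ := by rw [← ENNReal.ofReal_mul (norm_nonneg _), mul_assoc]

/-- The components of the vector-valued potential are scalar potentials, so that adaptedness reduces
to the scalar case. -/
lemma pot_dirKernel_ae [SFinite P] (hq : 1 ≤ q) (hφ : MeasField φ) {M : ℝ≥0∞} (hM : M < ∞)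
    (hT : 0 < T) (hb : FieldBound P q T (fun _ => M) φ) {t : ℝ} (ht : t ≤ T) (x a : Space d) :
    pot (dirKernel a) φ t x =ᵐ[P] fun ω => inner ℝ a (pot gradKernel φ t x ω) := by
  filter_upwards [ae_integrable_grad hq hφ hb hM hT ht x] with ω hω
  unfold pot kerInt
  rw [← integral_inner hω]
  congr with z
  rw [inner_smul_right, smul_eq_mul]
  congr 1
  by_cases h : z.1 < t
  · rw [causal_of_lt h, causal_of_lt h, dirKernel, real_inner_comm]
  · rw [causal_of_le (not_lt.1 h), causal_of_le (not_lt.1 h), inner_zero_right]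

lemma aestronglyMeasurable_driftMap [IsProbabilityMeasure P] (hφ : MeasField φ)
    (had : ∀ (t : ℝ≥0) (x : Space d), AEStronglyMeasurable[ℱ t] (φ t x) P) {M : ℝ≥0∞} (hM : M < ∞)
    (hT : 0 < T) (hb : FieldBound P 2 T (fun _ => M) φ) (t : ℝ≥0) (ht : (t : ℝ) ≤ T)
    (x : Space d) : AEStronglyMeasurable[ℱ t] (driftMap b φ t x) P := by
  have hc := kernelConst_pos d
  refine ((aestronglyMeasurable_pot (measurable_dirKernel (b t x)) hφ had hM hT hb
    (C := ‖b t x‖ * kernelConst d) (by positivity) (e := -(1 / 2)) (by norm_num)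
    (fun s hs => lintegral_dirKernel_le _ hs) t ht x).congr
    (pot_dirKernel_ae (by norm_num) hφ hM hT hb ht x (b t x))).neg

lemma pot_sub_ae [SFinite P] {ψ : ℝ → Space d → Ω → ℝ} (hq : 1 ≤ q) (hφ : MeasField φ)
    (hψ : MeasField ψ) {M M' : ℝ≥0∞} (hM : M < ∞) (hM' : M' < ∞) (hT : 0 < T)
    (hb : FieldBound P q T (fun _ => M) φ) (hb' : FieldBound P q T (fun _ => M') ψ) {t : ℝ}
    (ht : t ≤ T) (x : Space d) :
    pot gradKernel (fun r y ω => φ r y ω - ψ r y ω) t x =ᵐ[P]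
      pot gradKernel φ t x - pot gradKernel ψ t x := by
  filter_upwards [ae_integrable_grad hq hφ hb hM hT ht x,
    ae_integrable_grad hq hψ hb' hM' hT ht x] with ω h1 h2
  simp only [pot, kerInt, sub_smul, Pi.sub_apply]
  exact integral_sub h1 h2

lemma driftMap_sub_ae [SFinite P] {ψ : ℝ → Space d → Ω → ℝ} (hq : 1 ≤ q) (hφ : MeasField φ)
    (hψ : MeasField ψ) {M M' : ℝ≥0∞} (hM : M < ∞) (hM' : M' < ∞) (hT : 0 < T)
    (hb : FieldBound P q T (fun _ => M) φ) (hb' : FieldBound P q T (fun _ => M') ψ) {t : ℝ}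
    (ht : t ≤ T) (x : Space d) :
    driftMap b (fun r y ω => φ r y ω - ψ r y ω) t x =ᵐ[P]
      driftMap b φ t x - driftMap b ψ t x := by
  filter_upwards [pot_sub_ae hq hφ hψ hM hM' hT hb hb' ht x] with ω hω
  simp only [driftMap, Pi.sub_apply, hω, inner_sub_right]
  ring

/-- A sequence of random variables with geometrically small increments in `L^q` converges almost
surely, and its limit is approximated at the same rate. -/
lemma tendsto_limUnder_of_geometric [IsProbabilityMeasure P] {X : ℕ → Ω → ℝ}
    (hX : ∀ n, Measurable (X n)) (hq : 1 ≤ q) {A : ℝ≥0∞} (hA : A < ∞)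
    (hD : ∀ n, eLpNorm (X (n + 1) - X n) (ENNReal.ofReal q) P ≤ A * ENNReal.ofReal ((1 / 2) ^ n)) :
    (∀ᵐ ω ∂P, Tendsto (fun n => X n ω) atTop (𝓝 (limUnder atTop fun n => X n ω))) ∧
      ∀ N, eLpNorm (fun ω => limUnder atTop (fun n => X n ω) - X N ω) (ENNReal.ofReal q) P ≤
        A * ENNReal.ofReal (2 * (1 / 2) ^ N) := by
  have hq' : 1 ≤ ENNReal.ofReal q := by simpa using hq
  have hDm : ∀ n, AEStronglyMeasurable (X (n + 1) - X n) P := fun n =>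
    ((hX (n + 1)).sub (hX n)).aestronglyMeasurable
  have hconv : ∀ᵐ ω ∂P, Tendsto (fun n => X n ω) atTop (𝓝 (limUnder atTop fun n => X n ω)) := by
    have h1 : ∑' n, ∫⁻ ω, ‖(X (n + 1) - X n) ω‖ₑ ∂P ≠ ∞ := by
      refine ne_top_of_le_ne_top (b := ∑' n : ℕ, A * ENNReal.ofReal ((1 / 2) ^ n)) ?_
        (ENNReal.tsum_le_tsum fun n => ?_)
      · rw [ENNReal.tsum_mul_left]
        exact ENNReal.mul_ne_top hA.ne (tsum_ofReal_ne_top_of_summable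
          (summable_geometric_of_lt_one (by norm_num) (by norm_num)))
      · rw [← eLpNorm_one_eq_lintegral_enorm]
        exact (eLpNorm_le_eLpNorm_of_exponent_le hq' (hDm n)).trans (hD n)
    rw [← lintegral_tsum fun n => (hDm n).enorm] at h1
    filter_upwards [ae_lt_top' (AEMeasurable.tsum fun n => (hDm n).enorm) h1] with ω hω
    have h2 : CauchySeq fun n => X n ω :=
      cauchySeq_of_edist_le_of_tsum_ne_top (fun n => ‖(X (n + 1) - X n) ω‖ₑ)
        (fun n => by rw [edist_comm, edist_eq_enorm_sub]; rfl) hω.ne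
    exact tendsto_nhds_limUnder (cauchySeq_tendsto_of_complete h2)
  refine ⟨hconv, fun N => ?_⟩
  have hfin : ∀ k, eLpNorm (X (N + k) - X N) (ENNReal.ofReal q) P ≤
      A * ENNReal.ofReal (2 * ((1 / 2) ^ N - (1 / 2) ^ (N + k))) := by
    intro k
    induction k with
    | zero => simp
    | succ k ih =>
      have h1 : X (N + (k + 1)) - X N = (X (N + k + 1) - X (N + k)) + (X (N + k) - X N) := by
        rw [← add_assoc]; abel
      have h2 : (1 / 2 : ℝ) ^ (N + k) ≤ (1 / 2) ^ N :=
        pow_le_pow_of_le_one (by norm_num) (by norm_num) (by omega)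
      rw [h1]
      refine (eLpNorm_add_le (hDm _) ((hX _).sub (hX _)).aestronglyMeasurable hq').trans
        ((add_le_add (hD _) ih).trans (le_of_eq ?_))
      rw [← mul_add, ← ENNReal.ofReal_add (by positivity) (by linarith), ← add_assoc, pow_succ]
      congr 2; ring
  refine (Lp.eLpNorm_lim_le_liminf_eLpNorm (f := fun k => X (N + k) - X N)
    (fun k => ((hX _).sub (hX _)).aestronglyMeasurable) _ ?_).trans ?_
  · filter_upwards [hconv] with ω hω
    have h1 : Tendsto (fun k => X (N + k) ω) atTop (𝓝 (limUnder atTop fun n => X n ω)) := by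
      simpa only [add_comm] using (tendsto_add_atTop_iff_nat N).2 hω
    exact h1.sub_const _
  · refine liminf_le_of_frequently_le' (Frequently.of_forall fun k => (hfin k).trans ?_)
    gcongr
    exact sub_le_self _ (by positivity)

/-- Picard iterates for the equation `φ = ψ - b · ∇ ∫_0^t P_{t-r} φ(r) dr`. -/
noncomputable def picard (b : ℝ → Space d → Space d) (ψ : ℝ → Space d → Ω → ℝ) :
    ℕ → ℝ → Space d → Ω → ℝ
  | 0 => fun _ _ _ => 0
  | n + 1 => fun t x ω => ψ t x ω + driftMap b (picard b ψ n) t x ω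

variable {ψ : ℝ → Space d → Ω → ℝ}

lemma measField_picard (hb : Measurable fun q : ℝ × Space d => b q.1 q.2)
    (hψ : MeasField ψ) (n : ℕ) : MeasField (picard b ψ n) := by
  induction n with
  | zero => exact measurable_const
  | succ n ih => exact Measurable.add hψ (measField_driftMap hb ih)

end FixedPoint

/-! ### Solution of the fixed point equation by Picard iteration -/

section FixedPointExistence

variable {d : ℕ} {Ω : Type*} {mΩ : MeasurableSpace Ω} {P : Measure Ω} {ℱ : Filtration ℝ≥0 mΩ}
  {φ ψ : ℝ → Space d → Ω → ℝ} {b : ℝ → Space d → Space d} {q T B : ℝ}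

lemma FieldBound.add {w w' : ℝ → ℝ≥0∞} (hq : 1 ≤ q) (hφ : MeasField φ)
    (hψ : MeasField ψ) (h : FieldBound P q T w φ) (h' : FieldBound P q T w' ψ) :
    FieldBound P q T (fun r => w r + w' r) (fun t x ω => φ t x ω + ψ t x ω) := by
  filter_upwards [h, h'] with z hz hz' hzT
  exact (eLpNorm_add_le (hφ.slice z.1 z.2).aestronglyMeasurable
    (hψ.slice z.1 z.2).aestronglyMeasurable (by simpa using hq)).trans
    (add_le_add (hz hzT) (hz' hzT))

/-- The data under which the fixed point equation is solved: `b` is bounded on bounded time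
intervals, and the field `ψ` is bounded in `L^q(Ω)` there. -/
structure FixedPointData (P : Measure Ω) (ℱ : Filtration ℝ≥0 mΩ) (q : ℝ)
    (b : ℝ → Space d → Space d) (ψ : ℝ → Space d → Ω → ℝ) : Prop where
  measurable_drift : Measurable fun q : ℝ × Space d => b q.1 q.2
  measField : MeasField ψ
  adapted : ∀ (t : ℝ≥0) (x : Space d), AEStronglyMeasurable[ℱ t] (ψ t x) P
  driftBound : ∀ T, 0 < T → ∃ B, 0 ≤ B ∧ DriftBound b T B
  fieldBound : ∀ T, 0 < T → ∃ M < ∞, FieldBound P q T (fun _ => M) ψ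

namespace FixedPointData

variable [IsProbabilityMeasure P]

lemma fieldBound_picard (h : FixedPointData P ℱ q b ψ) (hq : 1 ≤ q) (hT : 0 < T) (n : ℕ) :
    ∃ K < ∞, FieldBound P q T (fun _ => K) (picard b ψ n) := by
  have hm := fun n => measField_picard h.measurable_drift h.measField n
  induction n with
  | zero =>
    refine ⟨0, ENNReal.zero_lt_top, Eventually.of_forall fun z _ => ?_⟩
    exact (eLpNorm_zero' (p := ENNReal.ofReal q) (μ := P)).le
  | succ n ih =>
    obtain ⟨K, hK, hKb⟩ := ih
    obtain ⟨B, hB, hBb⟩ := h.driftBound T hT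
    obtain ⟨M, hM, hMb⟩ := h.fieldBound T hT
    have hΛ := (growthRate_pos d B).le
    exact ⟨_, ENNReal.add_lt_top.2 ⟨hM, ENNReal.mul_lt_top (ENNReal.mul_lt_top
      ENNReal.ofReal_lt_top hK) ENNReal.ofReal_lt_top⟩,
      hMb.add hq h.measField (measField_driftMap h.measurable_drift (hm n))
        (fieldBound_driftMap hq (hm n) hB hBb (hKb.exp_of_const hΛ) |>.of_exp hΛ)⟩

lemma adapted_picard (h : FixedPointData P ℱ q b ψ) (hq : 2 ≤ q) (n : ℕ) (t : ℝ≥0) (x : Space d) :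
    AEStronglyMeasurable[ℱ t] (picard b ψ n t x) P := by
  induction n generalizing t x with
  | zero => exact aestronglyMeasurable_const
  | succ n ih =>
    have hT : (0 : ℝ) < t + 1 := by positivity
    have hm := measField_picard h.measurable_drift h.measField n
    obtain ⟨K, hK, hKb⟩ := h.fieldBound_picard (by linarith) hT n
    exact (h.adapted t x).add (aestronglyMeasurable_driftMap hm ih hK hT
      (hKb.exponent_mono hq hm) t (by linarith) x)

/-- Successive Picard iterates differ by at most `2^{-n}` in the weighted norm. -/
lemma fieldBound_picard_sub (h : FixedPointData P ℱ q b ψ) (hq : 1 ≤ q) (hT : 0 < T) (hB : 0 ≤ B)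
    (hb : DriftBound b T B) {M : ℝ≥0∞} (hM : FieldBound P q T (fun _ => M) ψ) (n : ℕ) :
    FieldBound P q T (fun r => ENNReal.ofReal (1 / 2) ^ n * M *
      ENNReal.ofReal (Real.exp (growthRate d B * r)))
      (fun t x ω => picard b ψ (n + 1) t x ω - picard b ψ n t x ω) := by
  have hm := fun n => measField_picard h.measurable_drift h.measField n
  induction n with
  | zero =>
    have h0 : (fun t x ω => picard b ψ (0 + 1) t x ω - picard b ψ 0 t x ω) = ψ := by
      ext t x ω
      simp [picard, driftMap, pot, kerInt]
    rw [h0]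
    simpa using hM.exp_of_const (growthRate_pos d B).le
  | succ n ih =>
    obtain ⟨K, hK, hKb⟩ := h.fieldBound_picard hq hT n
    obtain ⟨K', hK', hKb'⟩ := h.fieldBound_picard hq hT (n + 1)
    filter_upwards [fieldBound_driftMap hq ((hm (n + 1)).sub (hm n)) hB hb ih] with z hz hzT
    have h1 := driftMap_sub_ae (b := b) hq (hm (n + 1)) (hm n) hK' hK hT hKb' hKb hzT.le z.2
    have h2 : (fun ω => picard b ψ (n + 1 + 1) z.1 z.2 ω - picard b ψ (n + 1) z.1 z.2 ω) =
        driftMap b (picard b ψ (n + 1)) z.1 z.2 - driftMap b (picard b ψ n) z.1 z.2 := by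
      ext ω
      simp only [picard, Pi.sub_apply]; ring
    rw [h2, ← eLpNorm_congr_ae h1, pow_succ']
    simpa only [mul_assoc] using hz hzT

end FixedPointData

/-- The limit of the Picard iterates. -/
noncomputable def picardLimit (b : ℝ → Space d → Space d) (ψ : ℝ → Space d → Ω → ℝ) (t : ℝ)
    (x : Space d) (ω : Ω) : ℝ :=
  limUnder atTop fun n => picard b ψ n t x ω

namespace FixedPointData

lemma measField_picardLimit (h : FixedPointData P ℱ q b ψ) : MeasField (picardLimit b ψ) :=
  (StronglyMeasurable.limUnder fun n =>
    (measField_picard h.measurable_drift h.measField n).stronglyMeasurable).measurable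

variable [IsProbabilityMeasure P]

lemma adapted_picardLimit (h : FixedPointData P ℱ q b ψ) (hq : 2 ≤ q) (t : ℝ≥0) (x : Space d) :
    AEStronglyMeasurable[ℱ t] (picardLimit b ψ t x) P := by
  have hn := fun n => h.adapted_picard hq n t x
  refine ⟨fun ω => limUnder atTop fun n => (hn n).mk _ ω,
    @StronglyMeasurable.limUnder _ _ _ (ℱ t) _ _ _ _ _ _ _
      fun n => (hn n).stronglyMeasurable_mk, ?_⟩
  filter_upwards [ae_all_iff.2 fun n => (hn n).ae_eq_mk] with ω hω
  unfold picardLimit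
  simp_rw [hω]

lemma fieldBound_picardLimit_sub (h : FixedPointData P ℱ q b ψ) (hq : 1 ≤ q) (hT : 0 < T)
    (hB : 0 ≤ B) (hb : DriftBound b T B) {M : ℝ≥0∞} (hM : M < ∞)
    (hMb : FieldBound P q T (fun _ => M) ψ) (N : ℕ) :
    FieldBound P q T (fun r => M * ENNReal.ofReal (2 * (1 / 2) ^ N) *
      ENNReal.ofReal (Real.exp (growthRate d B * r)))
      (fun t x ω => picardLimit b ψ t x ω - picard b ψ N t x ω) := by
  filter_upwards [ae_all_iff.2 fun n => h.fieldBound_picard_sub hq hT hB hb hMb n] with z hz hzT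
  have h1 := (tendsto_limUnder_of_geometric (P := P) (X := fun n => picard b ψ n z.1 z.2)
    (fun n => (measField_picard h.measurable_drift h.measField n).slice _ _) hq
    (A := M * ENNReal.ofReal (Real.exp (growthRate d B * z.1)))
    (ENNReal.mul_lt_top hM ENNReal.ofReal_lt_top) (fun n => by
      refine (hz n hzT).trans (le_of_eq ?_)
      rw [ENNReal.ofReal_pow (by norm_num)]; ring)).2 N
  refine h1.trans (le_of_eq ?_)
  ring

lemma fieldBound_picardLimit (h : FixedPointData P ℱ q b ψ) (hq : 1 ≤ q) (hT : 0 < T)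
    (hB : 0 ≤ B) (hb : DriftBound b T B) {M : ℝ≥0∞} (hM : M < ∞)
    (hMb : FieldBound P q T (fun _ => M) ψ) :
    FieldBound P q T (fun _ => ENNReal.ofReal (2 * Real.exp (growthRate d B * T)) * M)
      (picardLimit b ψ) := by
  have h1 := (h.fieldBound_picardLimit_sub hq hT hB hb hM hMb 0).of_exp (growthRate_pos d B).le
  have h0 : (fun t x ω => picardLimit b ψ t x ω - picard b ψ 0 t x ω) = picardLimit b ψ := by
    ext t x ω; simp [picard]
  rw [h0] at h1
  refine h1.mono fun r _ _ => le_of_eq ?_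
  rw [pow_zero, mul_one, ENNReal.ofReal_mul (by norm_num)]
  ring

/-- The limit of the Picard iterates solves the fixed point equation. -/
lemma picardLimit_ae_eq (h : FixedPointData P ℱ q b ψ) (hq : 1 ≤ q) :
    ∀ᵐ z ∂stMeasure d, picardLimit b ψ z.1 z.2 =ᵐ[P]
      fun ω => ψ z.1 z.2 ω + driftMap b (picardLimit b ψ) z.1 z.2 ω := by
  have hq' : 1 ≤ ENNReal.ofReal q := by simpa using hq
  have hm := fun n => measField_picard h.measurable_drift h.measField n
  have hl := h.measField_picardLimit
  have hmain : ∀ n : ℕ, ∀ᵐ z ∂stMeasure d, z.1 < (n : ℝ) + 1 → picardLimit b ψ z.1 z.2 =ᵐ[P]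
      fun ω => ψ z.1 z.2 ω + driftMap b (picardLimit b ψ) z.1 z.2 ω := by
    intro n
    set T : ℝ := n + 1
    have hT : 0 < T := by positivity
    obtain ⟨B, hB, hBb⟩ := h.driftBound T hT
    obtain ⟨M, hM, hMb⟩ := h.fieldBound T hT
    have hlb := h.fieldBound_picardLimit hq hT hB hBb hM hMb
    have hs := fun N => h.fieldBound_picardLimit_sub hq hT hB hBb hM hMb N
    filter_upwards [ae_all_iff.2 hs, ae_all_iff.2 fun N =>
      fieldBound_driftMap hq (hl.sub (hm N)) hB hBb (hs N)] with z h1 h2 hzT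
    -- `R` is the defect in the equation; it is compared with the `N`-th iterate for every `N`
    set R : Ω → ℝ := fun ω =>
      picardLimit b ψ z.1 z.2 ω - (ψ z.1 z.2 ω + driftMap b (picardLimit b ψ) z.1 z.2 ω) with hR
    have hdm : ∀ {χ : ℝ → Space d → Ω → ℝ}, MeasField χ →
        AEStronglyMeasurable (driftMap b χ z.1 z.2) P := fun hχ =>
      ((measField_driftMap h.measurable_drift hχ).slice _ _).aestronglyMeasurable
    have hRm : AEStronglyMeasurable R P := ((hl.slice _ _).sub ((h.measField.slice _ _).add
      ((measField_driftMap h.measurable_drift hl).slice _ _))).aestronglyMeasurable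
    set K := M * ENNReal.ofReal (Real.exp (growthRate d B * z.1)) with hK
    have hKfin : K < ∞ := ENNReal.mul_lt_top hM ENNReal.ofReal_lt_top
    have hbound : ∀ N : ℕ, eLpNorm R (ENNReal.ofReal q) P ≤
        K * ENNReal.ofReal (2 * (1 / 2) ^ N) := by
      intro N
      obtain ⟨C, hC, hCb⟩ := h.fieldBound_picard hq hT N
      have h3 := driftMap_sub_ae (b := b) hq hl (hm N) (ENNReal.mul_lt_top ENNReal.ofReal_lt_top hM)
        hC hT hlb hCb hzT.le z.2
      have h4 : R =ᵐ[P] (fun ω => picardLimit b ψ z.1 z.2 ω - picard b ψ (N + 1) z.1 z.2 ω) -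
          driftMap b (fun r y ω => picardLimit b ψ r y ω - picard b ψ N r y ω) z.1 z.2 := by
        filter_upwards [h3] with ω hω
        rw [Pi.sub_apply, hω]
        simp only [hR, picard, Pi.sub_apply]; ring
      rw [eLpNorm_congr_ae h4]
      refine (eLpNorm_sub_le ((hl.slice _ _).sub ((hm (N + 1)).slice _ _)).aestronglyMeasurable
        (hdm (hl.sub (hm N))) hq').trans ((add_le_add (h1 (N + 1) hzT) (h2 N hzT)).trans
        (le_of_eq ?_))
      have e1 : ENNReal.ofReal (2 * (1 / 2) ^ (N + 1)) =
          ENNReal.ofReal (1 / 2) * ENNReal.ofReal (2 * (1 / 2) ^ N) := by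
        rw [← ENNReal.ofReal_mul (by norm_num)]; congr 1; ring
      have e2 : ENNReal.ofReal (1 / 2) + ENNReal.ofReal (1 / 2) = 1 := by
        rw [← ENNReal.ofReal_add (by norm_num) (by norm_num)]; norm_num
      rw [e1, hK]
      calc _ = (ENNReal.ofReal (1 / 2) + ENNReal.ofReal (1 / 2)) *
            (M * ENNReal.ofReal (Real.exp (growthRate d B * z.1)) *
              ENNReal.ofReal (2 * (1 / 2) ^ N)) := by ring
        _ = _ := by rw [e2, one_mul]
    have hzero : eLpNorm R (ENNReal.ofReal q) P = 0 := by
      have hlim : Tendsto (fun N : ℕ => K * ENNReal.ofReal (2 * (1 / 2) ^ N)) atTop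
          (𝓝 (K * ENNReal.ofReal (2 * 0))) := by
        refine ENNReal.Tendsto.const_mul (ENNReal.tendsto_ofReal
          (Tendsto.const_mul _ (tendsto_pow_atTop_nhds_zero_of_lt_one (by norm_num)
            (by norm_num)))) (Or.inr hKfin.ne)
      rw [mul_zero, ENNReal.ofReal_zero, mul_zero] at hlim
      exact le_antisymm (ge_of_tendsto' hlim hbound) zero_le
    rw [eLpNorm_eq_zero_iff hRm (by simp; linarith)] at hzero
    filter_upwards [hzero] with ω hω
    exact sub_eq_zero.1 hω
  filter_upwards [ae_all_iff.2 hmain] with z hz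
  obtain ⟨n, hn⟩ := exists_nat_gt z.1
  exact hz n (by linarith)

end FixedPointData

end FixedPointExistence

/-! ### The solution generated by a source field -/

section Solution

variable {d : ℕ} {Ω : Type*} {mΩ : MeasurableSpace Ω} {P : Measure Ω} {ℱ : Filtration ℝ≥0 mΩ}
  {W : ℝ≥0 → Ω → ℝ} {f : ℝ → Space d → ℝ} {α : ℝ} {φ : ℝ → Space d → Ω → ℝ}
  {Z : ℝ → Space d → Ω → ℝ} {Z' : ℝ → Space d → Ω → Space d} {q T F t : ℝ} {M : ℝ≥0∞}

/-- The potential of an adapted field has a jointly measurable, adapted modification. -/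
lemma exists_pot_heat_modification [IsProbabilityMeasure P] (hφ : MeasField φ)
    (had : ∀ (t : ℝ≥0) (x : Space d), AEStronglyMeasurable[ℱ t] (φ t x) P)
    (hb : ∀ T, 0 < T → ∃ M < ∞, FieldBound P 2 T (fun _ => M) φ) :
    ∃ U : ℝ → Space d → Ω → ℝ, MeasField U ∧
      (∀ (t : ℝ≥0) (x : Space d), Measurable[ℱ t] (U t x)) ∧
      ∀ (t : ℝ≥0) (x : Space d), U t x =ᵐ[P] pot heatKernel φ t x := by
  refine exists_measField_modification (Y := fun t x => pot heatKernel φ t x) (fun t x => ?_)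
    fun t x => ?_
  · obtain ⟨M, hM, hMb⟩ := hb (t + 1) (by positivity)
    exact aestronglyMeasurable_pot measurable_heatKernel hφ had hM (by positivity) hMb zero_le_one
      (by norm_num) lintegral_heatKernel_le_rpow t (by linarith) x
  · set T : ℝ := t + 1 with hTdef
    have hT : 0 < T := by positivity
    obtain ⟨M, hM, hMb⟩ := hb T hT
    have hk := kernelConst_pos d
    have htc := timeConst_pos d
    set m := M.toReal with hm
    have hm0 : 0 ≤ m := ENNReal.toReal_nonneg
    have hMm : M = ENNReal.ofReal m := (ENNReal.ofReal_toReal hM.ne).symm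
    set A := 3 * kernelConst d * (T ^ ((0 - 1 - 1 / 2 : ℝ) / 2 + 1) / ((0 - 1 - 1 / 2) / 2 + 1))
      with hA
    set D := kernelConst d * (T ^ (-(1 / 2) + 1 : ℝ) / (-(1 / 2) + 1)) with hD
    set E := timeConst d * (T ^ (-(1 / 2) + 1 : ℝ) / (-(1 / 2) + 1)) with hE
    have e0 : (0 : ℝ) < (0 - 1 - 1 / 2) / 2 + 1 := by norm_num
    have e1 : (0 : ℝ) < -(1 / 2) + 1 := by norm_num
    have hA0 : 0 ≤ A := by positivity
    have hD0 : 0 ≤ D := by positivity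
    have hE0 : 0 ≤ E := by positivity
    refine ⟨(A + D + E + 1) * m, 1 / 2, by norm_num, fun s y hst hts1 hyx => ?_⟩
    have hst' : (s : ℝ) ≤ t := NNReal.coe_le_coe.2 hst
    have hsT : (s : ℝ) ≤ T := by linarith
    have htT : (t : ℝ) ≤ T := by linarith
    have hts : 0 ≤ (t : ℝ) - s := by linarith
    set a := y - x with ha
    have hy : y = x + a := by rw [ha]; abel
    have h2r : ENNReal.ofReal 2 = 2 := ENNReal.ofReal_ofNat 2
    have h1 := eLpNorm_pot_taylor_le (q := 2) (by norm_num) hφ hMb hM hT hsT (r := 1 / 2)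
      (by norm_num) (by norm_num) x a
    have h2 := (eLpNorm_inner_le (norm_nonneg a) le_rfl (pot gradKernel φ s x)
      (ENNReal.ofReal 2) (P := P)).trans (mul_le_mul_right
        (eLpNorm_pot_grad_le (q := 2) (by norm_num) hφ hMb hT hsT x) _)
    have h3 := eLpNorm_pot_heat_time_sub_le (q := 2) (by norm_num) hφ hMb hM hT hst' htT x
    rw [h2r, hMm] at h1 h2 h3
    rw [← ENNReal.ofReal_mul (by positivity)] at h1
    rw [← ENNReal.ofReal_mul (by positivity), ← ENNReal.ofReal_mul (by positivity)] at h2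
    rw [← ENNReal.ofReal_mul (by positivity)] at h3
    have hpm : ∀ (r : ℝ≥0) z, Measurable (pot heatKernel φ r z) := fun r z =>
      (measField_pot measurable_heatKernel hφ).slice r z
    have hgm : Measurable (pot gradKernel φ s x) :=
      (measField_pot measurable_gradKernel hφ).slice s x
    -- Taylor remainder in space, plus the linear term, minus the time increment
    have hsplit : pot heatKernel φ s y - pot heatKernel φ t x =
        ((fun ω => pot heatKernel φ s (x + a) ω - pot heatKernel φ s x ω -
          inner ℝ (pot gradKernel φ s x ω) a) + fun ω => inner ℝ a (pot gradKernel φ s x ω)) -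
          fun ω => pot heatKernel φ t x ω - pot heatKernel φ s x ω := by
      ext ω
      simp only [Pi.sub_apply, Pi.add_apply, hy, real_inner_comm a]
      ring
    have m1 : Measurable fun ω => pot heatKernel φ s (x + a) ω - pot heatKernel φ s x ω -
          inner ℝ (pot gradKernel φ s x ω) a :=
      ((hpm s _).sub (hpm s x)).sub (hgm.inner measurable_const)
    have m2 : Measurable fun ω => inner ℝ a (pot gradKernel φ s x ω) := measurable_const.inner hgm
    have m3 : Measurable fun ω => pot heatKernel φ t x ω - pot heatKernel φ s x ω :=
      (hpm t x).sub (hpm s x)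
    rw [hsplit]
    refine (eLpNorm_sub_le (m1.add m2).aestronglyMeasurable m3.aestronglyMeasurable
      (by norm_num)).trans ?_
    refine (add_le_add (eLpNorm_add_le m1.aestronglyMeasurable m2.aestronglyMeasurable
      (by norm_num)) le_rfl).trans ?_
    refine (add_le_add (add_le_add h1 h2) h3).trans ?_
    rw [← ENNReal.ofReal_add (by positivity) (by positivity),
      ← ENNReal.ofReal_add (by positivity) (by positivity)]
    apply ENNReal.ofReal_le_ofReal
    have hpow : ∀ {y e : ℝ}, 0 ≤ y → y ≤ 1 → 1 / 2 ≤ e → y ^ e ≤ y ^ (1 / 2 : ℝ) :=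
      fun h0 h1 h => Real.rpow_le_rpow_of_exponent_ge_of_imp h0 h1 h (by intro _ h'; linarith)
    have e2 : ‖a‖ ^ (1 + 1 / 2 : ℝ) ≤ ‖a‖ ^ (1 / 2 : ℝ) := hpow (norm_nonneg _) hyx (by norm_num)
    have e3 : ‖a‖ ≤ ‖a‖ ^ (1 / 2 : ℝ) := by
      simpa using hpow (e := 1) (norm_nonneg _) hyx (by norm_num)
    have e4 : (t : ℝ) - s ≤ ((t : ℝ) - s) ^ (1 / 2 : ℝ) := by
      simpa using hpow (e := 1) hts hts1 (by norm_num)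
    calc _ = (A * ‖a‖ ^ (1 + 1 / 2 : ℝ) + D * ‖a‖ + (E * ((t : ℝ) - s) ^ (1 / 2 : ℝ) +
            ((t : ℝ) - s))) * m := by rw [hA, hD, hE]; ring
      _ ≤ (A * ‖a‖ ^ (1 / 2 : ℝ) + D * ‖a‖ ^ (1 / 2 : ℝ) + (E * ((t : ℝ) - s) ^ (1 / 2 : ℝ) +
            ((t : ℝ) - s) ^ (1 / 2 : ℝ))) * m := by gcongr
      _ ≤ (A + D + E + 1) * m * (((t : ℝ) - s) ^ (1 / 2 : ℝ) + ‖a‖ ^ (1 / 2 : ℝ)) := by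
          have p1 : 0 ≤ ((t : ℝ) - s) ^ (1 / 2 : ℝ) := by positivity
          have p2 : 0 ≤ ‖a‖ ^ (1 / 2 : ℝ) := by positivity
          nlinarith [mul_nonneg (mul_nonneg hA0 hm0) p1, mul_nonneg (mul_nonneg hD0 hm0) p1,
            mul_nonneg (mul_nonneg hE0 hm0) p2, mul_nonneg hm0 p2]

/-- The gradient of the solution generated by the source field `φ`. -/
noncomputable def solGrad (φ : ℝ → Space d → Ω → ℝ) (Z' : ℝ → Space d → Ω → Space d) (t : ℝ)
    (x : Space d) (ω : Ω) : Space d :=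
  pot gradKernel φ t x ω + Z' t x ω

/-- `u` is a jointly measurable, adapted version of the sum of the potential of the source field `φ`
and the stochastic convolution `Z`. -/
structure IsSolutionField (P : Measure Ω) (ℱ : Filtration ℝ≥0 mΩ) (W : ℝ≥0 → Ω → ℝ)
    (f : ℝ → Space d → ℝ) (α : ℝ) (φ Z : ℝ → Space d → Ω → ℝ) (Z' : ℝ → Space d → Ω → Space d)
    (u : ℝ → Space d → Ω → ℝ) : Prop where
  stochConv : IsStochConv P ℱ W f α Z Z'
  source : MeasField φ
  measField : MeasField u
  adapted : ∀ (t : ℝ≥0) (x : Space d), Measurable[ℱ t] (u t x)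
  ae_eq : ∀ (t : ℝ≥0) (x : Space d), u t x =ᵐ[P] pot heatKernel φ t x + Z t x

/-- The hypotheses under which the estimates of the solution on `[0,T]` are stated: the source is
bounded by `M` in `L^q(Ω)` and the noise coefficient has Hölder bound `F`. -/
structure SourceBound (P : Measure Ω) (f : ℝ → Space d → ℝ) (α : ℝ) (φ : ℝ → Space d → Ω → ℝ)
    (q T F : ℝ) (M : ℝ≥0∞) : Prop where
  one_le : 1 ≤ q
  pos : 0 < T
  nonneg : 0 ≤ F
  lt_top : M < ∞
  source : FieldBound P q T (fun _ => M) φ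
  noise : HolderField f α T F

namespace IsSolutionField

variable {u : ℝ → Space d → Ω → ℝ}

lemma measField_solGrad (hu : IsSolutionField P ℱ W f α φ Z Z' u) : MeasField (solGrad φ Z') :=
  (measField_pot measurable_gradKernel hu.source).add hu.stochConv.measField_grad

lemma ae_eq' (hu : IsSolutionField P ℱ W f α φ Z Z' u) (ht : 0 ≤ t) (x : Space d) :
    u t x =ᵐ[P] pot heatKernel φ t x + Z t x := by
  lift t to ℝ≥0 using ht
  exact hu.ae_eq t x

variable [IsProbabilityMeasure P]

lemma norm_le (hu : IsSolutionField P ℱ W f α φ Z Z' u) (hS : SourceBound P f α φ q T F M)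
    (ht : 0 ≤ t) (htT : t ≤ T) (x : Space d) :
    eLpNorm (u t x) (ENNReal.ofReal q) P ≤
      ENNReal.ofReal T * M + ENNReal.ofReal (F * √T) * gaussConst q := by
  rw [eLpNorm_congr_ae (hu.ae_eq' ht x)]
  exact (eLpNorm_add_le ((measField_pot measurable_heatKernel
    hu.source).slice t x).aestronglyMeasurable
    (hu.stochConv.measField.slice t x).aestronglyMeasurable (by simpa using hS.one_le)).trans
    (add_le_add (eLpNorm_pot_heat_le hS.one_le hu.source hS.source hS.pos htT x)
      (hu.stochConv.norm_le hS.nonneg hS.pos ht htT hS.noise q x))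

lemma norm_grad_le (hu : IsSolutionField P ℱ W f α φ Z Z' u) (hS : SourceBound P f α φ q T F M)
    (ht : 0 ≤ t) (htT : t ≤ T) (x : Space d) :
    eLpNorm (solGrad φ Z' t x) (ENNReal.ofReal q) P ≤
      ENNReal.ofReal (kernelConst d * (T ^ (-(1 / 2) + 1 : ℝ) / (-(1 / 2) + 1))) * M +
        ENNReal.ofReal (d * (F * kernelConst d * √(T ^ α / α))) * gaussConst q :=
  (eLpNorm_add_le ((measField_pot measurable_gradKernel
    hu.source).slice t x).aestronglyMeasurable
    (hu.stochConv.measField_grad.slice t x).aestronglyMeasurable (by simpa using hS.one_le)).trans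
    (add_le_add (eLpNorm_pot_grad_le hS.one_le hu.source hS.source hS.pos htT x)
      (hu.stochConv.norm_grad_le hS.nonneg hS.pos ht htT hS.noise hS.one_le x))

lemma norm_grad_sub_le (hu : IsSolutionField P ℱ W f α φ Z Z' u)
    (hS : SourceBound P f α φ q T F M) (ht : 0 ≤ t) (htT : t ≤ T) {r : ℝ} (hr : 0 < r)
    (hrα : r < α) (hα1 : α ≤ 1) (x c : Space d) :
    eLpNorm (solGrad φ Z' t (x + c) - solGrad φ Z' t x) (ENNReal.ofReal q) P ≤
      ENNReal.ofReal (3 * kernelConst d * ‖c‖ ^ r *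
        (T ^ ((0 - 1 - r) / 2 + 1) / ((0 - 1 - r) / 2 + 1))) * M +
      ENNReal.ofReal (d * (3 * kernelConst d * F * ‖c‖ ^ r * √(T ^ (α - r) / (α - r)))) *
        gaussConst q := by
  have hp := fun y => (measField_pot measurable_gradKernel hu.source).slice t y
  have hz := fun y => hu.stochConv.measField_grad.slice t y
  have h1 : solGrad φ Z' t (x + c) - solGrad φ Z' t x =
      (fun ω => pot gradKernel φ t (x + c) ω - pot gradKernel φ t x ω) +
        (Z' t (x + c) - Z' t x) := by
    ext1 ω
    simp only [solGrad, Pi.sub_apply, Pi.add_apply]; abel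
  rw [h1]
  exact (eLpNorm_add_le ((hp _).sub (hp x)).aestronglyMeasurable
    ((hz _).sub (hz x)).aestronglyMeasurable (by simpa using hS.one_le)).trans
    (add_le_add (eLpNorm_pot_grad_sub_le hS.one_le hu.source hS.source hS.lt_top hS.pos htT hr.le
      (hrα.trans_le hα1) x c)
      (hu.stochConv.norm_grad_sub_le hS.nonneg hS.pos ht htT hS.noise hr hrα hS.one_le x c))

lemma taylor_le (hu : IsSolutionField P ℱ W f α φ Z Z' u)
    (hS : SourceBound P f α φ q T F M) (ht : 0 ≤ t) (htT : t ≤ T) {r : ℝ} (hr : 0 < r)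
    (hrα : r < α) (hα1 : α ≤ 1) (x a : Space d) :
    eLpNorm (fun ω => u t (x + a) ω - u t x ω - inner ℝ (solGrad φ Z' t x ω) a)
      (ENNReal.ofReal q) P ≤
      ENNReal.ofReal (3 * kernelConst d * ‖a‖ ^ (1 + r) *
        (T ^ ((0 - 1 - r) / 2 + 1) / ((0 - 1 - r) / 2 + 1))) * M +
      ENNReal.ofReal (3 * kernelConst d * F * ‖a‖ ^ (1 + r) * √(T ^ (α - r) / (α - r))) *
        gaussConst q := by
  have hp := fun y => (measField_pot measurable_heatKernel hu.source).slice t y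
  have hg := (measField_pot measurable_gradKernel hu.source).slice t x
  have hz := fun y => hu.stochConv.measField.slice t y
  have hz' := hu.stochConv.measField_grad.slice t x
  have h1 : (fun ω => u t (x + a) ω - u t x ω - inner ℝ (solGrad φ Z' t x ω) a) =ᵐ[P]
      (fun ω => pot heatKernel φ t (x + a) ω - pot heatKernel φ t x ω -
        inner ℝ (pot gradKernel φ t x ω) a) +
      (fun ω => Z t (x + a) ω - Z t x ω - inner ℝ (Z' t x ω) a) := by
    filter_upwards [hu.ae_eq' ht x, hu.ae_eq' ht (x + a)] with ω h1 h2
    simp only [h1, h2, solGrad, Pi.add_apply, inner_add_left]; ring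
  have m1 : Measurable fun ω => pot heatKernel φ t (x + a) ω - pot heatKernel φ t x ω -
      inner ℝ (pot gradKernel φ t x ω) a :=
    ((hp _).sub (hp x)).sub (hg.inner measurable_const)
  have m2 : Measurable fun ω => Z t (x + a) ω - Z t x ω - inner ℝ (Z' t x ω) a :=
    ((hz _).sub (hz x)).sub (hz'.inner measurable_const)
  rw [eLpNorm_congr_ae h1]
  exact (eLpNorm_add_le m1.aestronglyMeasurable m2.aestronglyMeasurable
    (by simpa using hS.one_le)).trans
    (add_le_add (eLpNorm_pot_taylor_le hS.one_le hu.source hS.source hS.lt_top hS.pos htT hr.le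
      (hrα.trans_le hα1) x a)
      (hu.stochConv.taylor_le hS.nonneg hS.pos ht htT hS.noise hr hrα q x a))

lemma time_sub_le (hu : IsSolutionField P ℱ W f α φ Z Z' u)
    (hS : SourceBound P f α φ q T F M) {t' : ℝ} (ht : 0 ≤ t) (htt : t ≤ t') (htT : t' ≤ T)
    (x : Space d) :
    eLpNorm (fun ω => u t' x ω - u t x ω) (ENNReal.ofReal q) P ≤
      ENNReal.ofReal (timeConst d * (t' - t) ^ (1 / 2 : ℝ) *
        (T ^ (-(1 / 2) + 1 : ℝ) / (-(1 / 2) + 1)) + (t' - t)) * M +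
      ENNReal.ofReal (F * (timeConst d + 1) * (t' - t) ^ (1 / 4 : ℝ) *
        √(T ^ (1 / 2 : ℝ) / (1 / 2))) * gaussConst q := by
  have hp := fun s => (measField_pot measurable_heatKernel hu.source).slice s x
  have hz := fun s => hu.stochConv.measField.slice s x
  have h1 : (fun ω => u t' x ω - u t x ω) =ᵐ[P]
      (fun ω => pot heatKernel φ t' x ω - pot heatKernel φ t x ω) + (Z t' x - Z t x) := by
    filter_upwards [hu.ae_eq' ht x, hu.ae_eq' (ht.trans htt) x] with ω h1 h2
    simp only [h1, h2, Pi.add_apply, Pi.sub_apply]; ring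
  rw [eLpNorm_congr_ae h1]
  exact (eLpNorm_add_le ((hp _).sub (hp _)).aestronglyMeasurable
    ((hz _).sub (hz _)).aestronglyMeasurable (by simpa using hS.one_le)).trans
    (add_le_add (eLpNorm_pot_heat_time_sub_le hS.one_le hu.source hS.source hS.lt_top hS.pos htt
      htT x) (hu.stochConv.time_sub_le hS.nonneg hS.pos ht htt htT hS.noise q x))

end IsSolutionField

end Solution

/-! ### The solution field is a mild solution -/

section MildSolution

variable {d : ℕ} {Ω : Type*} {mΩ : MeasurableSpace Ω} {P : Measure Ω} {ℱ : Filtration ℝ≥0 mΩ}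
  {W : ℝ≥0 → Ω → ℝ} {f : ℝ → Space d → ℝ} {α : ℝ} {φ : ℝ → Space d → Ω → ℝ}
  {Z : ℝ → Space d → Ω → ℝ} {Z' : ℝ → Space d → Ω → Space d} {q T F t : ℝ} {M : ℝ≥0∞}
  {u : ℝ → Space d → Ω → ℝ}

/-- Fields that agree almost everywhere have the same potentials, almost surely. -/
lemma ae_pot_congr [SFinite P] {ψ : ℝ → Space d → Ω → ℝ} (hφ : MeasField φ) (hψ : MeasField ψ)
    (h : ∀ᵐ z ∂stMeasure d, φ z.1 z.2 =ᵐ[P] ψ z.1 z.2) {E : Type*} [NormedAddCommGroup E]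
    [NormedSpace ℝ E] (g : ℝ → Space d → E) :
    ∀ᵐ ω ∂P, ∀ t x, pot g φ t x ω = pot g ψ t x ω := by
  have hm : MeasurableSet {p : (ℝ × Space d) × Ω | φ p.1.1 p.1.2 p.2 = ψ p.1.1 p.1.2 p.2} :=
    measurableSet_eq_fun hφ.prod hψ.prod
  have h1 := (Measure.ae_ae_comm (μ := stMeasure d) (ν := P)
    (p := fun z ω => φ z.1 z.2 ω = ψ z.1 z.2 ω) hm).1 h
  filter_upwards [h1] with ω hω t x
  unfold pot kerInt
  refine integral_congr_ae ?_
  filter_upwards [hω] with z hz using by rw [hz]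

lemma locBoundedL2_of_le {V : Type*} [NormedAddCommGroup V]
    {Y : ℝ → Space d → Ω → V}
    (h : ∀ T : ℝ, 0 < T → ∃ K < ∞, ∀ t, 0 ≤ t → t ≤ T → ∀ x, eLpNorm (Y t x) 2 P ≤ K) :
    LocBoundedL2 P Y := by
  intro T hT
  obtain ⟨K, hK, hb⟩ := h T hT
  refine lt_of_le_of_lt (essSup_le_of_ae_le K ?_) hK
  filter_upwards [ae_restrict_mem measurableSet_Icc] with t ht
  exact essSup_le_of_ae_le K (Eventually.of_forall fun x => hb t ht.1 ht.2 x)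

lemma SourceBound.exponent_mono [IsProbabilityMeasure P] {q' : ℝ} (hφ : MeasField φ) (hq' : 1 ≤ q')
    (hqq : q' ≤ q) (hS : SourceBound P f α φ q T F M) : SourceBound P f α φ q' T F M :=
  ⟨hq', hS.pos, hS.nonneg, hS.lt_top, hS.source.exponent_mono hqq hφ, hS.noise⟩

namespace IsSolutionField

variable [IsProbabilityMeasure P]

/-- The paths in `L²(Ω)` are even continuous, locally uniformly, by the time estimate. -/
lemma isCadlagL2 (hu : IsSolutionField P ℱ W f α φ Z Z' u)
    (hS : ∀ T, 0 < T → ∃ F M, SourceBound P f α φ 2 T F M) : IsCadlagL2 P u := by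
  intro x
  have h2 : ENNReal.ofReal 2 = 2 := ENNReal.ofReal_ofNat 2
  have hmem : ∀ t : ℝ, 0 ≤ t → MemLp (u t x) 2 P := fun t ht => by
    obtain ⟨F, M, hb⟩ := hS (t + 1) (by positivity)
    have h1 := hu.norm_le hb ht (by linarith) x
    rw [h2] at h1
    exact ⟨(hu.measField.slice t x).aestronglyMeasurable, h1.trans_lt (ENNReal.add_lt_top.2
      ⟨ENNReal.mul_lt_top ENNReal.ofReal_lt_top hb.lt_top,
        ENNReal.mul_lt_top ENNReal.ofReal_lt_top (gaussConst_lt_top 2)⟩)⟩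
  have hmod : ∀ t : ℝ, 0 ≤ t → ∃ k : ℝ → ℝ≥0∞, Tendsto k (𝓝 0) (𝓝 0) ∧
      ∀ s s', 0 ≤ s → s ≤ s' → s' ≤ t + 1 →
        eLpNorm (fun ω => u s' x ω - u s x ω) 2 P ≤ k (s' - s) := by
    intro t ht
    obtain ⟨F, M, hb⟩ := hS (t + 1) (by positivity)
    have h1 := fun (s s' : ℝ) (hs : 0 ≤ s) (hss : s ≤ s') (hst : s' ≤ t + 1) =>
      hu.time_sub_le hb hs hss hst x
    rw [h2] at h1
    refine ⟨fun δ => ENNReal.ofReal (timeConst d * δ ^ (1 / 2 : ℝ) *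
        ((t + 1) ^ (-(1 / 2) + 1 : ℝ) / (-(1 / 2) + 1)) + δ) * M +
      ENNReal.ofReal (F * (timeConst d + 1) * δ ^ (1 / 4 : ℝ) *
        √((t + 1) ^ (1 / 2 : ℝ) / (1 / 2))) * gaussConst 2, ?_, h1⟩
    have c1 : Continuous fun δ : ℝ => timeConst d * δ ^ (1 / 2 : ℝ) *
        ((t + 1) ^ (-(1 / 2) + 1 : ℝ) / (-(1 / 2) + 1)) + δ :=
      ((continuous_const.mul (Real.continuous_rpow_const (by norm_num))).mul
        continuous_const).add continuous_id
    have c2 : Continuous fun δ : ℝ => F * (timeConst d + 1) * δ ^ (1 / 4 : ℝ) *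
        √((t + 1) ^ (1 / 2 : ℝ) / (1 / 2)) :=
      (continuous_const.mul (Real.continuous_rpow_const (by norm_num))).mul continuous_const
    have t1 := ENNReal.Tendsto.mul_const (b := M) (ENNReal.tendsto_ofReal (c1.tendsto 0))
      (Or.inr hb.lt_top.ne)
    have t2 := ENNReal.Tendsto.mul_const (b := gaussConst 2) (ENNReal.tendsto_ofReal (c2.tendsto 0))
      (Or.inr (gaussConst_lt_top 2).ne)
    have := t1.add t2
    rw [Real.zero_rpow (by norm_num), Real.zero_rpow (by norm_num)] at this
    simpa using this
  refine ⟨hmem, fun t ht => ?_, fun t ht => ⟨u t x, hmem t ht.le, ?_⟩⟩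
  · obtain ⟨k, hk, hkb⟩ := hmod t ht
    have h1 : Tendsto (fun s => k (s - t)) (𝓝[>] t) (𝓝 0) := by
      refine hk.comp ?_
      have : Tendsto (fun s => s - t) (𝓝 t) (𝓝 (t - t)) := (continuous_sub_right t).tendsto t
      rw [sub_self] at this
      exact this.mono_left nhdsWithin_le_nhds
    refine tendsto_of_tendsto_of_tendsto_of_le_of_le' tendsto_const_nhds h1
      (Eventually.of_forall fun _ => zero_le) ?_
    filter_upwards [Ioo_mem_nhdsGT (show t < t + 1 by linarith)] with s hs
    exact hkb t s ht hs.1.le hs.2.le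
  · obtain ⟨k, hk, hkb⟩ := hmod t ht.le
    have h1 : Tendsto (fun s => k (t - s)) (𝓝[<] t) (𝓝 0) := by
      refine hk.comp ?_
      have : Tendsto (fun s => t - s) (𝓝 t) (𝓝 (t - t)) := (continuous_sub_left t).tendsto t
      rw [sub_self] at this
      exact this.mono_left nhdsWithin_le_nhds
    refine tendsto_of_tendsto_of_tendsto_of_le_of_le' tendsto_const_nhds h1
      (Eventually.of_forall fun _ => zero_le) ?_
    filter_upwards [Ioo_mem_nhdsLT ht] with s hs
    have h3 := hkb s t hs.1.le hs.2.le (by linarith)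
    have h4 := eLpNorm_sub_comm (u s x) (u t x) 2 P
    exact h4.trans_le h3

lemma exists_norm_le (hu : IsSolutionField P ℱ W f α φ Z Z' u)
    (hS : SourceBound P f α φ q T F M) :
    ∃ K < ∞, ∀ t, 0 ≤ t → t ≤ T → ∀ x, eLpNorm (u t x) (ENNReal.ofReal q) P ≤ K :=
  ⟨_, ENNReal.add_lt_top.2 ⟨ENNReal.mul_lt_top ENNReal.ofReal_lt_top hS.lt_top,
    ENNReal.mul_lt_top ENNReal.ofReal_lt_top (gaussConst_lt_top q)⟩,
    fun _ ht htT x => hu.norm_le hS ht htT x⟩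

lemma exists_norm_grad_le (hu : IsSolutionField P ℱ W f α φ Z Z' u)
    (hS : SourceBound P f α φ q T F M) :
    ∃ K < ∞, ∀ t, 0 ≤ t → t ≤ T → ∀ x,
      eLpNorm (solGrad φ Z' t x) (ENNReal.ofReal q) P ≤ K :=
  ⟨_, ENNReal.add_lt_top.2 ⟨ENNReal.mul_lt_top ENNReal.ofReal_lt_top hS.lt_top,
    ENNReal.mul_lt_top ENNReal.ofReal_lt_top (gaussConst_lt_top q)⟩,
    fun _ ht htT x => hu.norm_grad_le hS ht htT x⟩

/-- By the Taylor estimate, `solGrad φ Z'` is the weak gradient of `u`. -/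
lemma isWeakGradient (hu : IsSolutionField P ℱ W f α φ Z Z' u) (hα : 0 < α) (hα1 : α ≤ 1)
    (hS : ∀ T, 0 < T → ∃ F M, SourceBound P f α φ 2 T F M) :
    IsWeakGradient P u (solGrad φ Z') := by
  filter_upwards [ae_restrict_mem measurableSet_Ici] with t ht
  obtain ⟨F, M, hb2⟩ := hS (t + 1) (by have : 0 ≤ t := ht; positivity)
  have hb := hb2.exponent_mono hu.source le_rfl (by norm_num : (1 : ℝ) ≤ 2)
  have htT : t ≤ t + 1 := by linarith
  obtain ⟨K, hK, hKb⟩ := hu.exists_norm_le hb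
  obtain ⟨K', hK', hKb'⟩ := hu.exists_norm_grad_le hb
  have h1 : ENNReal.ofReal 1 = 1 := ENNReal.ofReal_one
  have hk := kernelConst_pos d
  have hF := hb.nonneg
  set T : ℝ := t + 1
  have hT : 0 < T := hb.pos
  have htay := fun x a => hu.taylor_le hb ht htT (r := α / 2) (by linarith) (by linarith) hα1 x a
  rw [h1] at hKb hKb' htay
  have hMm : M = ENNReal.ofReal M.toReal := (ENNReal.ofReal_toReal hb.lt_top.ne).symm
  have hg : gaussConst 1 = ENNReal.ofReal (gaussConst 1).toReal := (ofReal_toReal_gaussConst 1).symm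
  have e0 : 0 < (0 - 1 - α / 2) / 2 + 1 := by linarith
  have e1 : 0 < α - α / 2 := by linarith
  intro ψ hψ hψc e
  refine weakGradient_of_taylor (M := K + K')
    (C := 3 * kernelConst d * (T ^ ((0 - 1 - α / 2) / 2 + 1) / ((0 - 1 - α / 2) / 2 + 1)) *
      M.toReal + 3 * kernelConst d * F * √(T ^ (α - α / 2) / (α - α / 2)) *
      (gaussConst 1).toReal) (r := α / 2)
    ?_ ?_ (ENNReal.add_lt_top.2 ⟨hK, hK'⟩)
    (Eventually.of_forall fun x => (hKb t ht htT x).trans (self_le_add_right _ _))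
    (Eventually.of_forall fun x => (hKb' t ht htT x).trans (self_le_add_left _ _))
    (by linarith) (fun x a => (htay x a).trans (le_of_eq ?_)) hψ hψc e
  · exact hu.measField.prod.comp (g := fun p : (ℝ × Space d) × Ω => u p.1.1 p.1.2 p.2)
      (f := fun p : Space d × Ω => ((t, p.1), p.2)) (by fun_prop)
  · exact hu.measField_solGrad.prod.comp
      (g := fun p : (ℝ × Space d) × Ω => solGrad φ Z' p.1.1 p.1.2 p.2)
      (f := fun p : Space d × Ω => ((t, p.1), p.2)) (by fun_prop)
  · conv_lhs => rw [hMm, hg]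
    have e2 : 0 ≤ M.toReal := ENNReal.toReal_nonneg
    have e3 : 0 ≤ (gaussConst 1).toReal := ENNReal.toReal_nonneg
    rw [← ENNReal.ofReal_mul (by positivity), ← ENNReal.ofReal_mul (by positivity),
      ← ENNReal.ofReal_add (by positivity) (by positivity)]
    congr 1
    ring

/-- The solution field generated by a source `φ` with `φ = h - b · ∇u` is a mild solution. -/
theorem isMildSolution (hu : IsSolutionField P ℱ W f α φ Z Z' u) (hα : 0 < α) (hα1 : α ≤ 1)
    (hS : ∀ T, 0 < T → ∃ F M, SourceBound P f α φ 2 T F M)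
    {b : ℝ → Space d → Space d} {h : ℝ → Space d → Ω → ℝ}
    (hb : Measurable fun q : ℝ × Space d => b q.1 q.2) (hh : MeasField h)
    (hbT : ∀ T, 0 < T → ∃ B, 0 ≤ B ∧ DriftBound b T B)
    (hhT : ∀ T, 0 < T → ∃ M < ∞, FieldBound P 2 T (fun _ => M) h)
    (hφ : ∀ᵐ z ∂stMeasure d, φ z.1 z.2 =ᵐ[P]
      fun ω => h z.1 z.2 ω - inner ℝ (b z.1 z.2) (solGrad φ Z' z.1 z.2 ω)) :
    IsMildSolution P ℱ W b h f u := by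
  have h2 : ENNReal.ofReal 2 = 2 := ENNReal.ofReal_ofNat 2
  have hG := hu.measField_solGrad
  refine ⟨hu.measField, hu.adapted, hu.isCadlagL2 hS, fun x => ?_, ?_, solGrad φ Z', hG,
    hu.isWeakGradient hα hα1 hS, ?_, fun t ht x => ?_⟩
  · have h1 := hu.ae_eq 0 x
    filter_upwards [h1, hu.stochConv.zero x] with ω h3 h4
    rw [NNReal.coe_zero] at h3
    rw [h3, Pi.add_apply, h4]
    have h5 : pot heatKernel φ 0 x ω = 0 := by
      unfold pot kerInt
      refine integral_eq_zero_of_ae ?_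
      filter_upwards [ae_stMeasure_pos] with z hz
      rw [causal_of_le hz.le, smul_zero, Pi.zero_apply]
    rw [h5]; simp
  · refine locBoundedL2_of_le fun T hT => ?_
    obtain ⟨F, M, hb⟩ := hS T hT
    simpa only [h2] using hu.exists_norm_le hb
  · refine locBoundedL2_of_le fun T hT => ?_
    obtain ⟨F, M, hb⟩ := hS T hT
    simpa only [h2] using hu.exists_norm_grad_le hb
  · refine ⟨Z t x, ?_, ?_⟩
    · lift t to ℝ≥0 using ht.le
      exact hu.stochConv.isItoIntegral t x
    · obtain ⟨F, M, hSt⟩ := hS t ht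
      obtain ⟨B, hB, hBb⟩ := hbT t ht
      obtain ⟨H, hH, hHb⟩ := hhT t ht
      obtain ⟨K, hK, hKb⟩ := hu.exists_norm_grad_le hSt
      have hk : MeasField fun t x ω => inner ℝ (b t x) (solGrad φ Z' t x ω) := measField_inner hb hG
      have hkb : FieldBound P 2 t (fun _ => ENNReal.ofReal B * K)
          (fun t x ω => inner ℝ (b t x) (solGrad φ Z' t x ω)) := by
        filter_upwards [hBb, ae_stMeasure_pos] with z hz hz0 hzt
        exact (eLpNorm_inner_le hB (hz hzt) _ _).trans
          (mul_le_mul_right (hKb z.1 hz0.le hzt.le z.2) _)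
      have hKfin : ENNReal.ofReal B * K < ∞ := ENNReal.mul_lt_top ENNReal.ofReal_lt_top hK
      have hw : MeasField fun t x ω => h t x ω - inner ℝ (b t x) (solGrad φ Z' t x ω) :=
        Measurable.sub hh hk
      have hpot := ae_pot_congr hu.source hw hφ (heatKernel (d := d))
      filter_upwards [hu.ae_eq' ht.le x, hpot,
        ae_integrable_heat (by norm_num) hh hHb hH ht le_rfl x,
        ae_integrable_heat (by norm_num) hk hkb hKfin ht le_rfl x] with ω w1 w2 w3 w4
      rw [w1, Pi.add_apply, w2 t x, ← pot_heat_eq_intervalIntegral ht x w3,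
        ← pot_heat_eq_intervalIntegral (ω := ω)
          (φ := fun t x ω => inner ℝ (b t x) (solGrad φ Z' t x ω)) ht x w4]
      congr 1
      have h5 : pot heatKernel (fun t x ω => h t x ω - inner ℝ (b t x) (solGrad φ Z' t x ω)) t x ω =
          pot heatKernel h t x ω -
            pot heatKernel (fun t x ω => inner ℝ (b t x) (solGrad φ Z' t x ω)) t x ω := by
        simp only [pot, kerInt, sub_smul]
        exact integral_sub w3 w4
      refine Eq.trans h5 ?_
      ring

end IsSolutionField

end MildSolution

/-! ### Uniqueness of mild solutions -/

section Uniqueness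

variable {d : ℕ} {Ω : Type*} {mΩ : MeasurableSpace Ω} {P : Measure Ω} {ℱ : Filtration ℝ≥0 mΩ}
  {W : ℝ≥0 → Ω → ℝ} {f : ℝ → Space d → ℝ} {b : ℝ → Space d → Space d}
  {h u v : ℝ → Space d → Ω → ℝ} {T : ℝ}

lemma ae_halfLine_of_ae_Icc {p : ℝ → Prop} (hp : ∀ᵐ t ∂(volume.restrict (Icc 0 T)), p t) :
    ∀ᵐ t ∂halfLine, t < T → p t := by
  rw [ae_restrict_iff' measurableSet_Icc] at hp
  refine (ae_restrict_iff' measurableSet_Ioi).2 ?_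
  filter_upwards [hp] with t ht h0 htT using ht ⟨le_of_lt h0, htT.le⟩

lemma ae_stMeasure_of_ae_halfLine {p : ℝ → Prop} (hp : ∀ᵐ t ∂halfLine, p t) :
    ∀ᵐ z ∂stMeasure d, p z.1 :=
  Measure.quasiMeasurePreserving_fst.ae hp

lemma LocBoundedL2.exists_ae_le {V : Type*} [NormedAddCommGroup V] {Y : ℝ → Space d → Ω → V}
    (hY : LocBoundedL2 P Y) (hT : 0 < T) :
    ∃ K < ∞, ∀ᵐ t ∂halfLine, t < T → ∀ᵐ x, eLpNorm (Y t x) 2 P ≤ K := by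
  refine ⟨_, hY T hT, ae_halfLine_of_ae_Icc ?_⟩
  filter_upwards [ENNReal.ae_le_essSup fun t => essSup (fun x => eLpNorm (Y t x) 2 P) volume]
    with t ht
  filter_upwards [ENNReal.ae_le_essSup fun x => eLpNorm (Y t x) 2 P] with x hx
  exact hx.trans ht

lemma ae_stMeasure_of_ae_ae {s : Set (ℝ × Space d)} (hs : MeasurableSet s)
    (h : ∀ᵐ t ∂halfLine, ∀ᵐ x, (t, x) ∈ s) : ∀ᵐ z ∂stMeasure d, z ∈ s :=
  (Measure.ae_prod_iff_ae_ae (p := fun z => z ∈ s) hs).2 h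

/-- Iterated essential suprema bound a jointly measurable field almost everywhere in space-time. -/
lemma LocBoundedL2.exists_fieldBound [SFinite P] {V : Type*} [NormedAddCommGroup V]
    [MeasurableSpace V] [BorelSpace V] [SecondCountableTopology V] {Y : ℝ → Space d → Ω → V}
    (hY : LocBoundedL2 P Y) (hm : MeasField Y) (hT : 0 < T) :
    ∃ K < ∞, FieldBound P 2 T (fun _ => K) Y := by
  obtain ⟨K, hK, hb⟩ := hY.exists_ae_le hT
  refine ⟨K, hK, ae_stMeasure_of_ae_ae
    (s := {z | z.1 < T → eLpNorm (Y z.1 z.2) (ENNReal.ofReal 2) P ≤ K}) ?_ ?_⟩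
  · have h1 : MeasurableSet {z : ℝ × Space d | z.1 < T} :=
      measurable_fst measurableSet_Iio
    have h2 : MeasurableSet {z : ℝ × Space d | eLpNorm (Y z.1 z.2) (ENNReal.ofReal 2) P ≤ K} :=
      measurable_eLpNorm hm two_pos measurableSet_Iic
    exact h1.imp h2
  · filter_upwards [hb] with t ht
    by_cases htT : t < T
    · filter_upwards [ht htT] with x hx _
      simpa only [ENNReal.ofReal_ofNat] using hx
    · exact Eventually.of_forall fun x hxT => absurd hxT htT

lemma fieldBound_inner {V : ℝ → Space d → Ω → Space d} {q B : ℝ} {K : ℝ≥0∞} (hB : 0 ≤ B)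
    (hb : DriftBound b T B) (hV : FieldBound P q T (fun _ => K) V) :
    FieldBound P q T (fun _ => ENNReal.ofReal B * K) (fun t x ω => inner ℝ (b t x) (V t x ω)) := by
  filter_upwards [hb, hV] with z hz hz2 hzT
  exact (eLpNorm_inner_le hB (hz hzT) _ _).trans (mul_le_mul_right (hz2 hzT) _)

lemma MeasField.space {V : Type*} [MeasurableSpace V] {Y : ℝ → Space d → Ω → V} (hY : MeasField Y)
    (t : ℝ) : Measurable fun p : Space d × Ω => Y t p.1 p.2 :=
  hY.prod.comp (g := fun p : (ℝ × Space d) × Ω => Y p.1.1 p.1.2 p.2)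
    (f := fun p : Space d × Ω => ((t, p.1), p.2)) (by fun_prop)

/-- Two versions of an Itô integral agree almost surely. -/
lemma IsItoIntegral.ae_eq (hW : IsWienerProcess P ℱ W) {t : ℝ} {F : ℝ → ℝ} {I J : Ω → ℝ}
    (hI : IsItoIntegral P W t F I) (hJ : IsItoIntegral P W t F J) : I =ᵐ[P] J := by
  have h1 : MemLp ((Ioc 0 t).indicator F) 2 volume :=
    (memLp_indicator_iff_restrict measurableSet_Ioc).2 hI.1
  have h2 : MemLp ((Ioc 0 t).indicator F) 2 halfLine := h1.restrict _
  exact (hI.ae_eq_wienerInt hW _ h2.coeFn_toLp).trans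
    (hJ.ae_eq_wienerInt hW _ h2.coeFn_toLp).symm

/-- The weak gradient is linear. -/
lemma weakGradient_sub [SFinite P] {X Y : Space d → Ω → ℝ} {G H : Space d → Ω → Space d}
    (hX : Measurable fun p : Space d × Ω => X p.1 p.2)
    (hY : Measurable fun p : Space d × Ω => Y p.1 p.2)
    (hG : Measurable fun p : Space d × Ω => G p.1 p.2)
    (hH : Measurable fun p : Space d × Ω => H p.1 p.2) {M : ℝ≥0∞} (hM : M < ∞)
    (hXb : ∀ᵐ x, eLpNorm (X x) 1 P ≤ M) (hYb : ∀ᵐ x, eLpNorm (Y x) 1 P ≤ M)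
    (hGb : ∀ᵐ x, eLpNorm (G x) 1 P ≤ M) (hHb : ∀ᵐ x, eLpNorm (H x) 1 P ≤ M)
    {φ : Space d → ℝ} (hφ : ContDiff ℝ (⊤ : ℕ∞) φ) (hφc : HasCompactSupport φ) {e : Space d}
    (hXG : ∀ᵐ ω ∂P, ∫ x, X x ω * fderiv ℝ φ x e = - ∫ x, inner ℝ (G x ω) e * φ x)
    (hYH : ∀ᵐ ω ∂P, ∫ x, Y x ω * fderiv ℝ φ x e = - ∫ x, inner ℝ (H x ω) e * φ x) :
    ∀ᵐ ω ∂P, ∫ x, (X x ω - Y x ω) * fderiv ℝ φ x e = - ∫ x, inner ℝ (G x ω - H x ω) e * φ x := by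
  have hd : Continuous fun x => fderiv ℝ φ x e :=
    (hφ.continuous_fderiv (by simp)).clm_apply continuous_const
  have hdc : HasCompactSupport fun x => fderiv ℝ φ x e := hφc.fderiv_apply ℝ e
  have hin : ∀ {V : Space d → Space d}, LocallyIntegrable V volume →
      Integrable (fun x => inner ℝ (V x) e * φ x) volume := fun hV => by
    refine ((hV.integrable_smul_left_of_hasCompactSupport hφ.continuous hφc).inner_const e).congr
      (Eventually.of_forall fun x => ?_)
    simp only [inner_smul_left, mul_comm]; rfl
  filter_upwards [hXG, hYH, ae_locallyIntegrable hX hM hXb, ae_locallyIntegrable hY hM hYb,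
    ae_locallyIntegrable hG hM hGb, ae_locallyIntegrable hH hM hHb] with ω h1 h2 h3 h4 h5 h6
  have i1 : Integrable (fun x => X x ω * fderiv ℝ φ x e) volume :=
    h3.integrable_smul_right_of_hasCompactSupport hd hdc
  have i2 : Integrable (fun x => Y x ω * fderiv ℝ φ x e) volume :=
    h4.integrable_smul_right_of_hasCompactSupport hd hdc
  simp_rw [sub_mul, inner_sub_left, sub_mul]
  rw [integral_sub i1 i2, integral_sub (hin h5) (hin h6), h1, h2]
  ring

/-- The potential of a bounded field has the potential with kernel `∇K` as its weak gradient. -/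
lemma weakGradient_pot [IsProbabilityMeasure P] {ψ : ℝ → Space d → Ω → ℝ} (hψ : MeasField ψ)
    (hT : 0 < T) {M : ℝ≥0∞} (hM : M < ∞) (hb : FieldBound P 2 T (fun _ => M) ψ) {t : ℝ} (ht : t ≤ T)
    {X : Space d → Ω → ℝ} (hX : Measurable fun p : Space d × Ω => X p.1 p.2)
    (hXψ : ∀ x, X x =ᵐ[P] pot heatKernel ψ t x)
    {φ : Space d → ℝ} (hφ : ContDiff ℝ (⊤ : ℕ∞) φ) (hφc : HasCompactSupport φ) (e : Space d) :
    ∀ᵐ ω ∂P, ∫ x, X x ω * fderiv ℝ φ x e = - ∫ x, inner ℝ (pot gradKernel ψ t x ω) e * φ x := by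
  have hb1 : FieldBound P 1 T (fun _ => M) ψ := hb.exponent_mono (by norm_num) hψ
  have h1 : ENNReal.ofReal 1 = 1 := ENNReal.ofReal_one
  have n1 := fun x => eLpNorm_pot_heat_le le_rfl hψ hb1 hT ht x
  have n2 := fun x => eLpNorm_pot_grad_le le_rfl hψ hb1 hT ht x
  have n3 := fun x a => eLpNorm_pot_taylor_le le_rfl hψ hb1 hM hT ht (r := 1 / 2) (by norm_num)
    (by norm_num) x a
  rw [h1] at n1 n2 n3
  have hk := kernelConst_pos d
  have e0 : (0 : ℝ) < (0 - 1 - 1 / 2) / 2 + 1 := by norm_num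
  refine weakGradient_of_taylor (M := ENNReal.ofReal T * M +
    ENNReal.ofReal (kernelConst d * (T ^ (-(1 / 2) + 1 : ℝ) / (-(1 / 2) + 1))) * M)
    (C := 3 * kernelConst d * (T ^ ((0 - 1 - 1 / 2 : ℝ) / 2 + 1) / ((0 - 1 - 1 / 2) / 2 + 1)) *
      M.toReal) (r := 1 / 2) hX ((measField_pot measurable_gradKernel hψ).space t)
    (ENNReal.add_lt_top.2 ⟨ENNReal.mul_lt_top ENNReal.ofReal_lt_top hM,
      ENNReal.mul_lt_top ENNReal.ofReal_lt_top hM⟩)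
    (Eventually.of_forall fun x => ?_) (Eventually.of_forall fun x => ?_) (by norm_num)
    (fun x a => ?_) hφ hφc e
  · rw [eLpNorm_congr_ae (hXψ x)]
    exact (n1 x).trans (self_le_add_right _ _)
  · exact (n2 x).trans (self_le_add_left _ _)
  · have h2 : (fun ω => X (x + a) ω - X x ω - inner ℝ (pot gradKernel ψ t x ω) a) =ᵐ[P]
        fun ω => pot heatKernel ψ t (x + a) ω - pot heatKernel ψ t x ω -
          inner ℝ (pot gradKernel ψ t x ω) a := by
      filter_upwards [hXψ (x + a), hXψ x] with ω w1 w2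
      rw [w1, w2]
    rw [eLpNorm_congr_ae h2]
    refine (n3 x a).trans (le_of_eq ?_)
    conv_lhs => rw [← ENNReal.ofReal_toReal hM.ne]
    rw [← ENNReal.ofReal_mul (by positivity)]
    congr 1; ring

/-- Mild solutions are unique. The difference `w` of two solutions is the potential of
`ψ = -b · ∇w`, hence `∇w` is the potential of `ψ` with kernel `∇K` and `ψ` is a fixed point of the
drift map. -/
theorem IsMildSolution.ae_eq [IsProbabilityMeasure P] (hW : IsWienerProcess P ℱ W)
    (hb : Measurable fun q : ℝ × Space d => b q.1 q.2)
    (hbT : ∀ T, 0 < T → ∃ B, 0 ≤ B ∧ DriftBound b T B)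
    (hv : IsMildSolution P ℱ W b h f v) (hu : IsMildSolution P ℱ W b h f u) {t : ℝ} (ht : 0 ≤ t)
    (x : Space d) : v t x =ᵐ[P] u t x := by
  rcases ht.eq_or_lt with rfl | ht
  · filter_upwards [hv.initial x, hu.initial x] with ω h1 h2
    rw [h1, h2]
  obtain ⟨Gv, hGvm, hGvw, hGvb, hveq⟩ := hv.equation
  obtain ⟨Gu, hGum, hGuw, hGub, hueq⟩ := hu.equation
  set T : ℝ := t + 1 with hTdef
  have hT : 0 < T := by positivity
  obtain ⟨B, hB, hBb⟩ := hbT T hT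
  obtain ⟨Kv, hKv, hKvb⟩ := hGvb.exists_fieldBound hGvm hT
  obtain ⟨Ku, hKu, hKub⟩ := hGub.exists_fieldBound hGum hT
  set kv : ℝ → Space d → Ω → ℝ := fun t x ω => inner ℝ (b t x) (Gv t x ω) with hkv
  set ku : ℝ → Space d → Ω → ℝ := fun t x ω => inner ℝ (b t x) (Gu t x ω) with hku
  have hkvm : MeasField kv := measField_inner hb hGvm
  have hkum : MeasField ku := measField_inner hb hGum
  have hkvb := fieldBound_inner hB hBb hKvb
  have hkub := fieldBound_inner hB hBb hKub
  set ψ : ℝ → Space d → Ω → ℝ := fun t x ω => ku t x ω - kv t x ω with hψ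
  have hψm : MeasField ψ := Measurable.sub hkum hkvm
  have hψb : FieldBound P 2 T (fun _ => ENNReal.ofReal B * Ku + ENNReal.ofReal B * Kv) ψ :=
    hkub.sub (by norm_num) hkum hkvm hkvb
  have hfu : ENNReal.ofReal B * Ku < ∞ := ENNReal.mul_lt_top ENNReal.ofReal_lt_top hKu
  have hfv : ENNReal.ofReal B * Kv < ∞ := ENNReal.mul_lt_top ENNReal.ofReal_lt_top hKv
  have hMfin : ENNReal.ofReal B * Ku + ENNReal.ofReal B * Kv < ∞ := ENNReal.add_lt_top.2 ⟨hfu, hfv⟩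
  -- the stochastic integrals cancel
  have hdiff : ∀ s : ℝ, 0 < s → s ≤ T → ∀ y : Space d,
      (fun ω => v s y ω - u s y ω) =ᵐ[P] pot heatKernel ψ s y := by
    intro s hs hsT y
    obtain ⟨Iv, hIv, hve⟩ := hveq s hs y
    obtain ⟨Iu, hIu, hue⟩ := hueq s hs y
    filter_upwards [hve, hue, hIv.ae_eq hW hIu,
      ae_integrable_heat (by norm_num) hkvm hkvb hfv hT hsT y,
      ae_integrable_heat (by norm_num) hkum hkub hfu hT hsT y] with ω w1 w2 w3 w4 w5
    have h1 : pot heatKernel ψ s y ω = pot heatKernel ku s y ω - pot heatKernel kv s y ω := by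
      simp only [pot, kerInt, hψ, sub_smul]
      exact integral_sub w5 w4
    rw [w1, w2, w3, h1, pot_heat_eq_intervalIntegral hs y w5, pot_heat_eq_intervalIntegral hs y w4]
    ring
  -- the difference of the gradients is the potential of `ψ`
  have hgrad : ∀ᵐ s ∂halfLine, s < T →
      ∀ᵐ y, (fun ω => Gv s y ω - Gu s y ω) =ᵐ[P] pot gradKernel ψ s y := by
    have hIoi : halfLine ≤ volume.restrict (Ici (0 : ℝ)) :=
      Measure.restrict_mono Ioi_subset_Ici_self le_rfl
    obtain ⟨A1, hA1, hA1b⟩ := hv.bounded.exists_ae_le hT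
    obtain ⟨A2, hA2, hA2b⟩ := hu.bounded.exists_ae_le hT
    obtain ⟨A3, hA3, hA3b⟩ := hGvb.exists_ae_le hT
    obtain ⟨A4, hA4, hA4b⟩ := hGub.exists_ae_le hT
    filter_upwards [ae_mono hIoi hGvw, ae_mono hIoi hGuw, hA1b, hA2b, hA3b, hA4b,
      ae_restrict_mem measurableSet_Ioi] with s w1 w2 b1 b2 b3 b4 hs hsT
    have hs0 : 0 < s := hs
    have hGsub : Measurable fun p : Space d × Ω => Gv s p.1 p.2 - Gu s p.1 p.2 :=
      (MeasField.space hGvm s).sub (MeasField.space hGum s)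
    have hpm : Measurable fun p : Space d × Ω => pot gradKernel ψ s p.1 p.2 :=
      (measField_pot measurable_gradKernel hψm).space s
    have hdown : ∀ {V : Type} [NormedAddCommGroup V] [MeasurableSpace V] [BorelSpace V]
        [SecondCountableTopology V] {Y : Space d → Ω → V} {A A' : ℝ≥0∞}, A ≤ A' →
        (Measurable fun p : Space d × Ω => Y p.1 p.2) → (∀ᵐ y, eLpNorm (Y y) 2 P ≤ A) →
        ∀ᵐ y, eLpNorm (Y y) 1 P ≤ A' := by
      intro V _ _ _ _ Y A A' hA hY hYb
      filter_upwards [hYb] with y hy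
      exact (eLpNorm_le_eLpNorm_of_exponent_le (by norm_num)
        (hY.comp measurable_prodMk_left).aestronglyMeasurable).trans (hy.trans hA)
    set A := A1 + A2 + (A3 + A4) with hAdef
    have hA : A < ∞ := by simp [hAdef, hA1, hA2, hA3, hA4]
    have c1 := hdown (A' := A) (by rw [hAdef, add_assoc]; exact self_le_add_right _ _)
      (MeasField.space hv.measurable s) (b1 hsT)
    have c2 := hdown (A' := A) (by rw [hAdef, add_comm A1, add_assoc]; exact self_le_add_right _ _)
      (MeasField.space hu.measurable s) (b2 hsT)
    have c3 := hdown (A' := A) (by rw [hAdef, add_comm, add_assoc]; exact self_le_add_right _ _)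
      (MeasField.space hGvm s) (b3 hsT)
    have c4 := hdown (A' := A) (by
      rw [hAdef, add_comm A3, add_comm, add_assoc]; exact self_le_add_right _ _)
      (MeasField.space hGum s) (b4 hsT)
    have c5 : ∀ᵐ y, eLpNorm (fun ω => Gv s y ω - Gu s y ω) 1 P ≤ A + A := by
      filter_upwards [c3, c4] with y h1 h2
      exact (eLpNorm_sub_le ((MeasField.slice hGvm s y).aestronglyMeasurable)
        ((MeasField.slice hGum s y).aestronglyMeasurable) le_rfl).trans (add_le_add h1 h2)
    have hψb1 := hψb.exponent_mono (by norm_num : (1 : ℝ) ≤ 2) hψm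
    have c6 := fun y => eLpNorm_pot_grad_le le_rfl hψm hψb1 hT hsT.le y
    rw [ENNReal.ofReal_one] at c6
    have hae := ae_ae_eq_of_weakGradient (X := fun y ω => v s y ω - u s y ω) hGsub hpm
      (M := (A + A) + _) (ENNReal.add_lt_top.2 ⟨ENNReal.add_lt_top.2 ⟨hA, hA⟩,
        ENNReal.mul_lt_top ENNReal.ofReal_lt_top hMfin⟩)
      (c5.mono fun y hy => hy.trans (self_le_add_right _ _))
      (Eventually.of_forall fun y => (c6 y).trans (self_le_add_left _ _))
      (fun φ hφ hφc e => weakGradient_sub (MeasField.space hv.measurable s)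
        (MeasField.space hu.measurable s) (MeasField.space hGvm s) (MeasField.space hGum s) hA
        c1 c2 c3 c4 hφ hφc (w1 φ hφ hφc e) (w2 φ hφ hφc e))
      (fun φ hφ hφc e => weakGradient_pot hψm hT hMfin hψb hsT.le
        ((MeasField.space hv.measurable s).sub (MeasField.space hu.measurable s))
        (hdiff s hs0 hsT.le) hφ hφc e)
    have hset : MeasurableSet {p : Space d × Ω | Gv s p.1 p.2 - Gu s p.1 p.2 =
        pot gradKernel ψ s p.1 p.2} := measurableSet_eq_fun hGsub hpm
    exact (Measure.ae_ae_comm (μ := (volume : Measure (Space d))) (ν := P)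
      (p := fun y ω => Gv s y ω - Gu s y ω = pot gradKernel ψ s y ω) hset).2 hae
  -- thus `ψ` is a fixed point of the drift map
  have hfix : ∀ᵐ z ∂stMeasure d, z.1 < T → ψ z.1 z.2 =ᵐ[P] driftMap b ψ z.1 z.2 := by
    have hRm : MeasField fun s y ω => Gv s y ω - Gu s y ω - pot gradKernel ψ s y ω :=
      Measurable.sub (Measurable.sub hGvm hGum) (measField_pot measurable_gradKernel hψm)
    have h1 : ∀ᵐ z ∂stMeasure d, z ∈ {z : ℝ × Space d | z.1 < T →
        eLpNorm (fun ω => Gv z.1 z.2 ω - Gu z.1 z.2 ω - pot gradKernel ψ z.1 z.2 ω)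
          (ENNReal.ofReal 1) P = 0} := by
      refine ae_stMeasure_of_ae_ae ?_ ?_
      · have h1 : MeasurableSet {z : ℝ × Space d | z.1 < T} := measurable_fst measurableSet_Iio
        exact h1.imp (measurable_eLpNorm hRm one_pos (measurableSet_singleton 0))
      · filter_upwards [hgrad] with s hs
        by_cases hsT : s < T
        · filter_upwards [hs hsT] with y hy _
          refine (eLpNorm_congr_ae (g := fun _ => (0 : Space d)) ?_).trans eLpNorm_zero'
          filter_upwards [hy] with ω hω
          rw [hω, sub_self]
        · exact Eventually.of_forall fun y hyT => absurd hyT hsT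
    filter_upwards [h1] with z hz hzT
    have h2 := hz hzT
    rw [eLpNorm_eq_zero_iff (hRm.slice z.1 z.2).aestronglyMeasurable (by simp)] at h2
    filter_upwards [h2] with ω hω
    have h3 : Gv z.1 z.2 ω - Gu z.1 z.2 ω = pot gradKernel ψ z.1 z.2 ω := sub_eq_zero.1 hω
    change ku z.1 z.2 ω - kv z.1 z.2 ω = -inner ℝ (b z.1 z.2) (pot gradKernel ψ z.1 z.2 ω)
    rw [← h3]
    simp only [hku, hkv, inner_sub_right]
    ring
  have hzero := fieldBound_zero_of_eq_driftMap (by norm_num) hψm hB hBb hMfin hψb hfix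
  have h1 := eLpNorm_pot_heat_le (by norm_num) hψm hzero hT (show t ≤ T by linarith) x
  rw [mul_zero, nonpos_iff_eq_zero, eLpNorm_eq_zero_iff
    ((measField_pot measurable_heatKernel hψm).slice t x).aestronglyMeasurable (by simp)] at h1
  filter_upwards [h1, hdiff t ht (by linarith) x] with ω w1 w2
  rw [w1] at w2
  exact sub_eq_zero.1 w2

end Uniqueness

/-! ### Existence of the solution field -/

section Existence

variable {d : ℕ} {Ω : Type*} {mΩ : MeasurableSpace Ω} {P : Measure Ω} {ℱ : Filtration ℝ≥0 mΩ}
  {W : ℝ≥0 → Ω → ℝ} {f : ℝ → Space d → ℝ} {α : ℝ} {b : ℝ → Space d → Space d}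
  {h : ℝ → Space d → Ω → ℝ} {q T : ℝ}

/-- The factor of the `L²(0,T)` bound for the integrand of the gradient of the stochastic
convolution. -/
noncomputable def noiseGradConst (d : ℕ) (α T : ℝ) : ℝ := d * (kernelConst d * √(T ^ α / α))

/-- The bound for the source of the solution on `[0,T]`, where `B` bounds the drift, `H` bounds `h`
and `F` is a Hölder bound for the noise coefficient. -/
noncomputable def sourceSize (d : ℕ) (α q T B F : ℝ) (H : ℝ≥0∞) : ℝ≥0∞ :=
  ENNReal.ofReal (2 * Real.exp (growthRate d B * T)) *
    (H + ENNReal.ofReal B * (ENNReal.ofReal (F * noiseGradConst d α T) * gaussConst q))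

lemma stronglyMeasurable_sub_inner {m : MeasurableSpace Ω} {X : Ω → ℝ} {Y : Ω → Space d}
    (hX : Measurable[m] X) (hY : Measurable[m] Y) (v : Space d) :
    StronglyMeasurable[m] fun ω => X ω - inner ℝ v (Y ω) :=
  (hX.sub (measurable_const.inner hY)).stronglyMeasurable

lemma measurable_add_fun {m : MeasurableSpace Ω} {X Y : Ω → ℝ} (hX : Measurable[m] X)
    (hY : Measurable[m] Y) : Measurable[m] fun ω => X ω + Y ω :=
  hX.add hY

/-- The solution field generated by the solution `φ` of the fixed point equation
`φ = h - b · ∇u`. -/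
theorem exists_isSolutionField [IsProbabilityMeasure P] (hW : IsWienerProcess P ℱ W)
    (hb : Measurable fun q : ℝ × Space d => b q.1 q.2) (hh : MeasField h)
    (had : ∀ (t : ℝ≥0) (x : Space d), Measurable[ℱ t] (h t x))
    (hf : Measurable fun q : ℝ × Space d => f q.1 q.2) (hα : 0 < α) (hα1 : α ≤ 1) (hq : 2 ≤ q)
    (hbT : ∀ T, 0 < T → ∃ B, 0 ≤ B ∧ DriftBound b T B)
    (hhT : ∀ T, 0 < T → ∃ H < ∞, FieldBound P q T (fun _ => H) h)
    (hfT : ∀ T, 0 < T → ∃ F, 0 ≤ F ∧ HolderField f α T F) :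
    ∃ (φ Z : ℝ → Space d → Ω → ℝ) (Z' : ℝ → Space d → Ω → Space d) (u : ℝ → Space d → Ω → ℝ),
      IsSolutionField P ℱ W f α φ Z Z' u ∧
      (∀ᵐ z ∂stMeasure d, φ z.1 z.2 =ᵐ[P]
        fun ω => h z.1 z.2 ω - inner ℝ (b z.1 z.2) (solGrad φ Z' z.1 z.2 ω)) ∧
      ∀ {T B F : ℝ} {H : ℝ≥0∞}, 0 < T → 0 ≤ B → DriftBound b T B → H < ∞ →
        FieldBound P q T (fun _ => H) h → 0 ≤ F → HolderField f α T F →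
        SourceBound P f α φ q T F (sourceSize d α q T B F H) := by
  obtain ⟨Z, Z', hZ⟩ := exists_isStochConv (P := P) (ℱ := ℱ) (d := d) hW hf hα hα1 hfT
  have hq1 : 1 ≤ q := by linarith
  have hZb : MeasField fun t x ω => inner ℝ (b t x) (Z' t x ω) :=
    measField_inner hb hZ.measField_grad
  set ψ : ℝ → Space d → Ω → ℝ := fun t x ω => h t x ω - inner ℝ (b t x) (Z' t x ω) with hψ
  have hψm : MeasField ψ := Measurable.sub hh hZb
  have hψb : ∀ {T B F : ℝ} {H : ℝ≥0∞}, 0 < T → 0 ≤ B → DriftBound b T B →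
      FieldBound P q T (fun _ => H) h → 0 ≤ F → HolderField f α T F →
      FieldBound P q T (fun _ => H + ENNReal.ofReal B *
        (ENNReal.ofReal (F * noiseGradConst d α T) * gaussConst q)) ψ := by
    intro T B F H hT hB hBb hHb hF hFb
    have h1 : FieldBound P q T
        (fun _ => ENNReal.ofReal (F * noiseGradConst d α T) * gaussConst q) Z' := by
      filter_upwards [ae_stMeasure_pos] with z hz hzT
      refine (hZ.norm_grad_le hF hT hz.le hzT.le hFb hq1 z.2).trans (le_of_eq ?_)
      unfold noiseGradConst
      congr 2; ring
    exact hHb.sub hq1 hh hZb (fieldBound_inner hB hBb h1)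
  have hfin : ∀ (T B F : ℝ) {H : ℝ≥0∞}, H < ∞ → H + ENNReal.ofReal B *
        (ENNReal.ofReal (F * noiseGradConst d α T) * gaussConst q) < ∞ := fun T B F H hH =>
    ENNReal.add_lt_top.2 ⟨hH, ENNReal.mul_lt_top ENNReal.ofReal_lt_top
      (ENNReal.mul_lt_top ENNReal.ofReal_lt_top (gaussConst_lt_top q))⟩
  have hdata : FixedPointData P ℱ q b ψ := by
    refine ⟨hb, hψm, fun t x => ?_, hbT, fun T hT => ?_⟩
    · exact (stronglyMeasurable_sub_inner (had t x) (hZ.adapted_grad t x) _).aestronglyMeasurable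
    · obtain ⟨B, hB, hBb⟩ := hbT T hT
      obtain ⟨H, hH, hHb⟩ := hhT T hT
      obtain ⟨F, hF, hFb⟩ := hfT T hT
      exact ⟨_, hfin T B F hH, hψb hT hB hBb hHb hF hFb⟩
  have hS : ∀ {T B F : ℝ} {H : ℝ≥0∞}, 0 < T → 0 ≤ B → DriftBound b T B → H < ∞ →
      FieldBound P q T (fun _ => H) h → 0 ≤ F → HolderField f α T F →
      SourceBound P f α (picardLimit b ψ) q T F (sourceSize d α q T B F H) := by
    intro T B F H hT hB hBb hH hHb hF hFb
    exact ⟨hq1, hT, hF, ENNReal.mul_lt_top ENNReal.ofReal_lt_top (hfin T B F hH),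
      hdata.fieldBound_picardLimit hq1 hT hB hBb (hfin T B F hH) (hψb hT hB hBb hHb hF hFb), hFb⟩
  have hφm : MeasField (picardLimit b ψ) := hdata.measField_picardLimit
  have hφad := hdata.adapted_picardLimit hq
  obtain ⟨U, hUm, hUad, hU⟩ := exists_pot_heat_modification hφm hφad fun T hT => by
    obtain ⟨B, hB, hBb⟩ := hbT T hT
    obtain ⟨H, hH, hHb⟩ := hhT T hT
    obtain ⟨F, hF, hFb⟩ := hfT T hT
    have h1 := hS hT hB hBb hH hHb hF hFb
    exact ⟨_, h1.lt_top, h1.source.exponent_mono hq hφm⟩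
  refine ⟨picardLimit b ψ, Z, Z', fun t x ω => U t x ω + Z t x ω,
    ⟨hZ, hφm, Measurable.add hUm hZ.measField, fun t x => ?_, fun t x => ?_⟩, ?_, hS⟩
  · exact measurable_add_fun (hUad t x) (hZ.adapted t x)
  · filter_upwards [hU t x] with ω hω
    rw [hω, Pi.add_apply]
  · filter_upwards [hdata.picardLimit_ae_eq hq1] with z hz
    filter_upwards [hz] with ω hω
    rw [hω]
    simp only [hψ, driftMap, solGrad, inner_add_right]
    ring

/-! ### Bounds of the coefficients from their norms -/

/-- At almost every time, the values of a field are bounded by its supremum norm. -/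
lemma ae_le_supNorm {V : Type*} (N : V → ℝ≥0∞) (F : ℝ → Space d → V) :
    ∀ᵐ t ∂halfLine, t < T → ∀ x, N (F t x) ≤ supNorm N T F := by
  refine ae_halfLine_of_ae_Icc ?_
  filter_upwards [ENNReal.ae_le_essSup fun t => ⨆ x, N (F t x)] with t ht x
  exact (le_iSup (fun x => N (F t x)) x).trans ht

lemma ae_le_holderSeminorm {V : Type*} [Sub V] (N : V → ℝ≥0∞) (F : ℝ → Space d → V) :
    ∀ᵐ t ∂halfLine, t < T → ∀ x y, x ≠ y →
      N (F t x - F t y) / edist x y ^ α ≤ holderSeminorm N T α F := by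
  refine ae_halfLine_of_ae_Icc ?_
  filter_upwards [ENNReal.ae_le_essSup
    fun t => ⨆ (x) (y) (_ : x ≠ y), N (F t x - F t y) / edist x y ^ α] with t ht x y hxy
  exact (le_iSup_of_le x (le_iSup_of_le y (le_iSup
    (fun _ : x ≠ y => N (F t x - F t y) / edist x y ^ α) hxy))).trans ht

lemma driftBound_of_detNorm (hb : detNorm T α b < ⊤) :
    DriftBound b T (detNorm T α b).toReal := by
  refine (ae_stMeasure_of_ae_halfLine
    (ae_le_supNorm (T := T) (fun v : Space d => ‖v‖ₑ) b)).mono fun z hz hzT => ?_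
  have h1 : ‖b z.1 z.2‖ₑ ≤ detNorm T α b := (hz hzT z.2).trans le_self_add
  rw [← toReal_enorm]
  exact ENNReal.toReal_mono hb.ne h1

lemma fieldBound_of_randNorm (P : Measure Ω) (h : ℝ → Space d → Ω → ℝ) :
    FieldBound P q T (fun _ => randNorm P q T α h) h :=
  (ae_stMeasure_of_ae_halfLine (ae_le_supNorm (T := T)
    (fun X : Ω → ℝ => eLpNorm X (ENNReal.ofReal q) P) h)).mono fun z hz hzT =>
      (hz hzT z.2).trans le_self_add

/-- The norm of `f` is both a supremum bound and a Hölder constant. -/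
lemma holderField_of_detNorm (hfm : Measurable fun q : ℝ × Space d => f q.1 q.2) (hα : 0 < α)
    (hf : detNorm T α f < ⊤) : HolderField f α T (detNorm T α f).toReal := by
  filter_upwards [ae_le_supNorm (T := T) (fun v : ℝ => ‖v‖ₑ) f,
    ae_le_holderSeminorm (T := T) (α := α) (fun v : ℝ => ‖v‖ₑ) f] with t h1 h2 htT
  refine ⟨hfm.comp measurable_prodMk_left, fun x => ?_, fun x y => ?_⟩
  · rw [← Real.norm_eq_abs, ← toReal_enorm]
    exact ENNReal.toReal_mono hf.ne ((h1 htT x).trans le_self_add)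
  · rcases eq_or_ne x y with rfl | hxy
    · simp [Real.zero_rpow hα.ne']
    · have h3 : ‖f t x - f t y‖ₑ / edist x y ^ α ≤ detNorm T α f :=
        (h2 htT x y hxy).trans le_add_self
      have hpos : 0 < ‖x - y‖ := norm_pos_iff.2 (sub_ne_zero.2 hxy)
      have h4 : edist x y ^ α = ENNReal.ofReal (‖x - y‖ ^ α) := by
        rw [edist_dist, dist_eq_norm, ENNReal.ofReal_rpow_of_pos hpos]
      have hpα : 0 < ‖x - y‖ ^ α := Real.rpow_pos_of_pos hpos α
      rw [h4, ENNReal.div_le_iff (by simpa using hpα) ENNReal.ofReal_ne_top] at h3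
      have h5 := ENNReal.toReal_mono (ENNReal.mul_ne_top hf.ne ENNReal.ofReal_ne_top) h3
      rwa [ENNReal.toReal_mul, ENNReal.toReal_ofReal hpα.le, toReal_enorm, Real.norm_eq_abs] at h5

end Existence

/-! ### The gradient estimate -/

section Estimate

variable {d : ℕ} {Ω : Type*} {mΩ : MeasurableSpace Ω} {P : Measure Ω} {ℱ : Filtration ℝ≥0 mΩ}
  {W : ℝ≥0 → Ω → ℝ} {f : ℝ → Space d → ℝ} {α : ℝ} {φ : ℝ → Space d → Ω → ℝ}
  {Z : ℝ → Space d → Ω → ℝ} {Z' : ℝ → Space d → Ω → Space d} {q T F r : ℝ} {M : ℝ≥0∞}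
  {u : ℝ → Space d → Ω → ℝ}

lemma supNorm_le {V : Type*} {N : V → ℝ≥0∞} {F : ℝ → Space d → V} {K : ℝ≥0∞}
    (h : ∀ t, 0 ≤ t → t ≤ T → ∀ x, N (F t x) ≤ K) : supNorm N T F ≤ K := by
  refine essSup_le_of_ae_le K ?_
  filter_upwards [ae_restrict_mem measurableSet_Icc] with t ht
  exact iSup_le fun x => h t ht.1 ht.2 x

lemma holderSeminorm_le {V : Type*} [Sub V] {N : V → ℝ≥0∞} {F : ℝ → Space d → V} {K : ℝ≥0∞}
    (h : ∀ t, 0 ≤ t → t ≤ T → ∀ x y, N (F t x - F t y) ≤ K * edist x y ^ r) :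
    holderSeminorm N T r F ≤ K := by
  refine essSup_le_of_ae_le K ?_
  filter_upwards [ae_restrict_mem measurableSet_Icc] with t ht
  exact iSup_le fun x => iSup_le fun y => iSup_le fun _ =>
    ENNReal.div_le_of_le_mul (h t ht.1 ht.2 x y)

/-- The constant in front of the source in the estimate of the norm `‖u‖_{T,∞,1+r,q}`. -/
noncomputable def sourceConst (d : ℕ) (r T : ℝ) : ℝ :=
  T + kernelConst d * (T ^ (-(1 / 2) + 1 : ℝ) / (-(1 / 2) + 1)) +
    3 * kernelConst d * (T ^ ((0 - 1 - r) / 2 + 1) / ((0 - 1 - r) / 2 + 1))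

/-- The constant in front of the noise coefficient in the estimate of the norm
`‖u‖_{T,∞,1+r,q}`. -/
noncomputable def noiseConst (d : ℕ) (α r T : ℝ) : ℝ :=
  √T + noiseGradConst d α T + d * (3 * kernelConst d * √(T ^ (α - r) / (α - r)))

lemma sourceConst_nonneg (d : ℕ) (hT : 0 < T) (hr : r < 1) : 0 ≤ sourceConst d r T := by
  have h1 := kernelConst_pos d
  have h2 : 0 < (0 - 1 - r) / 2 + 1 := by linarith
  have h3 : (0 : ℝ) < -(1 / 2) + 1 := by norm_num
  unfold sourceConst; positivity

lemma noiseGradConst_nonneg (d : ℕ) (α T : ℝ) : 0 ≤ noiseGradConst d α T := by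
  have h1 := kernelConst_pos d
  unfold noiseGradConst; positivity

lemma noiseConst_nonneg (d : ℕ) (α r T : ℝ) : 0 ≤ noiseConst d α r T := by
  have h1 := kernelConst_pos d
  have h2 := noiseGradConst_nonneg d α T
  unfold noiseConst; positivity

lemma add_mul_ofReal {A B c : ℝ} (hA : 0 ≤ A) (hB : 0 ≤ B) (M N : ℝ≥0∞) :
    (ENNReal.ofReal A * M + ENNReal.ofReal B * N) * ENNReal.ofReal c =
      ENNReal.ofReal (A * c) * M + ENNReal.ofReal (B * c) * N := by
  rw [ENNReal.ofReal_mul hA, ENNReal.ofReal_mul hB]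
  ring

namespace IsSolutionField

variable [IsProbabilityMeasure P]

/-- The Taylor estimate with exponent `1 + α/2` makes `solGrad φ Z'` the gradient of `u` in
`L^q(Ω)`. -/
lemma hasLpGradient (hu : IsSolutionField P ℱ W f α φ Z Z' u) (hα : 0 < α) (hα1 : α ≤ 1)
    (hS : SourceBound P f α φ q T F M) : HasLpGradient P q T u (solGrad φ Z') := by
  filter_upwards [ae_restrict_mem measurableSet_Icc] with t ht x
  obtain ⟨K, hK, hKb⟩ := hu.exists_norm_le hS
  obtain ⟨K', hK', hKb'⟩ := hu.exists_norm_grad_le hS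
  refine ⟨⟨(hu.measField.slice t x).aestronglyMeasurable, (hKb t ht.1 ht.2 x).trans_lt hK⟩,
    ⟨(hu.measField_solGrad.slice t x).aestronglyMeasurable, (hKb' t ht.1 ht.2 x).trans_lt hK'⟩, ?_⟩
  have hT := hS.pos
  have hk := kernelConst_pos d
  have hF := hS.nonneg
  have e0 : 0 < (0 - 1 - α / 2) / 2 + 1 := by linarith
  set A := ENNReal.ofReal
      (3 * kernelConst d * (T ^ ((0 - 1 - α / 2) / 2 + 1) / ((0 - 1 - α / 2) / 2 + 1))) * M +
    ENNReal.ofReal (3 * kernelConst d * F * √(T ^ (α - α / 2) / (α - α / 2))) * gaussConst q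
    with hA
  have hAfin : A < ∞ := ENNReal.add_lt_top.2 ⟨ENNReal.mul_lt_top ENNReal.ofReal_lt_top hS.lt_top,
    ENNReal.mul_lt_top ENNReal.ofReal_lt_top (gaussConst_lt_top q)⟩
  have hle : ∀ y, eLpNorm (fun ω => u t y ω - u t x ω - inner ℝ (solGrad φ Z' t x ω) (y - x))
      (ENNReal.ofReal q) P / ‖y - x‖ₑ ≤ A * ENNReal.ofReal (‖y - x‖ ^ (α / 2)) := by
    intro y
    refine ENNReal.div_le_of_le_mul ?_
    have h1 := hu.taylor_le hS ht.1 ht.2 (r := α / 2) (by linarith) (by linarith) hα1 x (y - x)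
    rw [add_sub_cancel] at h1
    refine h1.trans (le_of_eq ?_)
    set a := ‖y - x‖ with ha
    have ha0 : 0 ≤ a := norm_nonneg _
    have h2 : a ^ (1 + α / 2) = a * a ^ (α / 2) := by
      rw [Real.rpow_add_of_nonneg ha0 (by norm_num) (by linarith), Real.rpow_one]
    have h3 : ‖y - x‖ₑ = ENNReal.ofReal a := (ofReal_norm _).symm
    rw [h2, h3, hA, add_mul_ofReal (by positivity) (by positivity),
      add_mul_ofReal (by positivity) (by positivity)]
    congr 3 <;> ring
  refine tendsto_of_tendsto_of_tendsto_of_le_of_le tendsto_const_nhds ?_ (fun _ => zero_le) hle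
  have h1 : Continuous fun y : Space d => ‖y - x‖ ^ (α / 2) :=
    (continuous_norm.comp (continuous_sub_right x)).rpow_const fun _ => Or.inr (by linarith)
  have h2 := ENNReal.Tendsto.const_mul (a := A) (ENNReal.tendsto_ofReal (h1.tendsto x))
    (Or.inr hAfin.ne)
  rw [sub_self, norm_zero, Real.zero_rpow (by linarith), ENNReal.ofReal_zero, mul_zero] at h2
  exact h2.mono_left nhdsWithin_le_nhds

/-- The estimate of `u` in terms of bounds `M` of its source and `F` of the noise coefficient. -/
lemma gradHolderNorm_le (hu : IsSolutionField P ℱ W f α φ Z Z' u) (hα : 0 < α) (hα1 : α ≤ 1)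
    (hS : SourceBound P f α φ q T F M) (hr : 0 < r) (hrα : r < α) :
    gradHolderNorm P q T r u ≤ ENNReal.ofReal (sourceConst d r T) * M +
      ENNReal.ofReal (F * noiseConst d α r T) * gaussConst q := by
  have hT := hS.pos
  have hk := kernelConst_pos d
  have hF := hS.nonneg
  have e0 : 0 < (0 - 1 - r) / 2 + 1 := by linarith
  have e1 : (0 : ℝ) < -(1 / 2) + 1 := by norm_num
  refine (iInf₂_le _ (hu.hasLpGradient hα hα1 hS)).trans ?_
  have h1 := supNorm_le (N := fun X : Ω → ℝ => eLpNorm X (ENNReal.ofReal q) P)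
    fun t ht htT x => hu.norm_le hS ht htT x
  have h2 := supNorm_le (N := fun X : Ω → Space d => eLpNorm X (ENNReal.ofReal q) P)
    fun t ht htT x => hu.norm_grad_le hS ht htT x
  have h3 : holderSeminorm (fun X : Ω → Space d => eLpNorm X (ENNReal.ofReal q) P) T r
      (solGrad φ Z') ≤ ENNReal.ofReal
        (3 * kernelConst d * (T ^ ((0 - 1 - r) / 2 + 1) / ((0 - 1 - r) / 2 + 1))) * M +
      ENNReal.ofReal (d * (3 * kernelConst d * F * √(T ^ (α - r) / (α - r)))) * gaussConst q := by
    refine holderSeminorm_le fun t ht htT x y => ?_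
    have h1 := hu.norm_grad_sub_le hS ht htT hr hrα hα1 y (x - y)
    rw [add_sub_cancel] at h1
    refine h1.trans (le_of_eq ?_)
    have h4 : edist x y ^ r = ENNReal.ofReal (‖x - y‖ ^ r) := by
      rw [edist_dist, dist_eq_norm, ENNReal.ofReal_rpow_of_nonneg (norm_nonneg _) hr.le]
    rw [h4, add_mul_ofReal (by positivity) (by positivity)]
    congr 3 <;> ring
  refine (add_le_add h1 (add_le_add h2 h3)).trans (le_of_eq ?_)
  have h5 : ENNReal.ofReal (sourceConst d r T) = ENNReal.ofReal T +
      ENNReal.ofReal (kernelConst d * (T ^ (-(1 / 2) + 1 : ℝ) / (-(1 / 2) + 1))) +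
      ENNReal.ofReal
        (3 * kernelConst d * (T ^ ((0 - 1 - r) / 2 + 1) / ((0 - 1 - r) / 2 + 1))) := by
    rw [← ENNReal.ofReal_add (by positivity) (by positivity),
      ← ENNReal.ofReal_add (by positivity) (by positivity)]
    rfl
  have h6 : ENNReal.ofReal (F * noiseConst d α r T) = ENNReal.ofReal (F * √T) +
      ENNReal.ofReal (d * (F * kernelConst d * √(T ^ α / α))) +
      ENNReal.ofReal (d * (3 * kernelConst d * F * √(T ^ (α - r) / (α - r)))) := by
    rw [← ENNReal.ofReal_add (by positivity) (by positivity),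
      ← ENNReal.ofReal_add (by positivity) (by positivity)]
    congr 1
    unfold noiseConst noiseGradConst; ring
  rw [h5, h6]
  ring

end IsSolutionField

/-- The constant of the a priori estimate; the maximum with `1` makes it positive for all values of
the parameters. -/
noncomputable def estimateConst (d : ℕ) (α p r T B : ℝ) : ℝ :=
  max 1 (sourceConst d r T * (2 * Real.exp (growthRate d B * T)) +
    (sourceConst d r T * (2 * Real.exp (growthRate d B * T)) * B * noiseGradConst d α T +
      noiseConst d α r T) * (gaussConst p).toReal)

/-- Inserting the bound of the source makes the estimate linear in the norms of `h` and `f`. -/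
lemma sourceSize_estimate (hT : 0 < T) (hr1 : r < 1) {B : ℝ} (hB : 0 ≤ B) (hF : 0 ≤ F)
    (H : ℝ≥0∞) :
    ENNReal.ofReal (sourceConst d r T) * sourceSize d α q T B F H +
        ENNReal.ofReal (F * noiseConst d α r T) * gaussConst q ≤
      ENNReal.ofReal (estimateConst d α q r T B) * (H + ENNReal.ofReal F) := by
  have h1 := sourceConst_nonneg d hT hr1
  have h2 := noiseGradConst_nonneg d α T
  have h3 := noiseConst_nonneg d α r T
  have h4 : 0 ≤ (gaussConst q).toReal := ENNReal.toReal_nonneg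
  rw [sourceSize, ← ofReal_toReal_gaussConst q]
  set S := sourceConst d r T
  set n := noiseGradConst d α T
  set m := noiseConst d α r T
  set g := (gaussConst q).toReal
  set γ := 2 * Real.exp (growthRate d B * T) with hγ
  have h5 : 0 ≤ γ := by positivity
  have h6 : 0 ≤ (S * γ * B * n + m) * g := by positivity
  calc _ = ENNReal.ofReal (S * γ) * H +
        ENNReal.ofReal ((S * γ * B * n + m) * g) * ENNReal.ofReal F := by
        rw [mul_add, mul_add, ← mul_assoc, ← mul_assoc, add_assoc,
          ← ENNReal.ofReal_mul h1, ← ENNReal.ofReal_mul (by positivity),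
          ← ENNReal.ofReal_mul (by positivity), ← ENNReal.ofReal_mul (by positivity),
          ← ENNReal.ofReal_mul (by positivity), ← ENNReal.ofReal_mul (by positivity),
          ← ENNReal.ofReal_add (by positivity) (by positivity)]
        congr 2; ring
    _ ≤ ENNReal.ofReal (estimateConst d α q r T B) * H +
        ENNReal.ofReal (estimateConst d α q r T B) * ENNReal.ofReal F := by
        gcongr
        · exact (le_add_of_nonneg_right h6).trans (le_max_right _ _)
        · exact (le_add_of_nonneg_left (by positivity)).trans (le_max_right _ _)
    _ = _ := (mul_add _ _ _).symm

end Estimate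

end StochTransport

open StochTransport in
theorem corollary4p1 (d : ℕ) (α β p : ℝ) (hα : 0 < α) (hα1 : α ≤ 1) (hβ : 0 < β) (hp : 2 < p) :
    ∃ C : ℝ → ℝ → ℝ → ℝ, (∀ r t B : ℝ, 0 < C r t B) ∧
      ∀ (Ω : Type*) (mΩ : MeasurableSpace Ω) (P : Measure Ω) (_ : IsProbabilityMeasure P)
        (ℱ : Filtration ℝ≥0 mΩ) (W : ℝ≥0 → Ω → ℝ) (_ : IsWienerProcess P ℱ W)
        (b : ℝ → Space d → Space d) (h : ℝ → Space d → Ω → ℝ) (f : ℝ → Space d → ℝ)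
        (_ : Measurable (fun q : ℝ × Space d => b q.1 q.2))
        (_ : Measurable (fun q : ℝ × Space d × Ω => h q.1 q.2.1 q.2.2))
        (_ : ∀ (t : ℝ≥0) (x : Space d), Measurable[ℱ t] (h t x))
        (_ : Measurable (fun q : ℝ × Space d => f q.1 q.2))
        (_ : ∀ T : ℝ, 0 < T → detNorm T β b < ⊤)
        (_ : ∀ T : ℝ, 0 < T → randNorm P p T β h < ⊤)
        (_ : ∀ T : ℝ, 0 < T → detNorm T α f < ⊤),
        ∃ u : ℝ → Space d → Ω → ℝ,
          IsMildSolution P ℱ W b h f u ∧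
          (∀ v : ℝ → Space d → Ω → ℝ, IsMildSolution P ℱ W b h f v →
            ∀ t : ℝ, 0 ≤ t → ∀ x : Space d, v t x =ᵐ[P] u t x) ∧
          ∀ r : ℝ, 0 < r → r < α → ∀ t : ℝ, 0 < t →
            gradHolderNorm P p t r u < ⊤ ∧
            gradHolderNorm P p t r u ≤
              ENNReal.ofReal (C r t (detNorm t β b).toReal) *
                (randNorm P p t β h + detNorm t α f) := by
  refine ⟨estimateConst d α p, fun r t B => lt_max_of_lt_left one_pos, ?_⟩
  intro Ω mΩ P _ ℱ W hW b h f hb hh had hf hbT hhT hfT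
  have hB : ∀ T, 0 < T → ∃ B, 0 ≤ B ∧ DriftBound b T B := fun T hT =>
    ⟨_, ENNReal.toReal_nonneg, driftBound_of_detNorm (hbT T hT)⟩
  have hH : ∀ T, 0 < T → ∃ H < ∞, FieldBound P p T (fun _ => H) h := fun T hT =>
    ⟨_, hhT T hT, fieldBound_of_randNorm P h⟩
  have hF : ∀ T, 0 < T → ∃ F, 0 ≤ F ∧ HolderField f α T F := fun T hT =>
    ⟨_, ENNReal.toReal_nonneg, holderField_of_detNorm hf hα (hfT T hT)⟩
  obtain ⟨φ, Z, Z', u, hu, hφ, hS⟩ :=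
    exists_isSolutionField hW hb hh had hf hα hα1 hp.le hB hH hF
  have hST : ∀ T, 0 < T → SourceBound P f α φ p T (detNorm T α f).toReal
      (sourceSize d α p T (detNorm T β b).toReal (detNorm T α f).toReal (randNorm P p T β h)) :=
    fun T hT => hS hT ENNReal.toReal_nonneg (driftBound_of_detNorm (hbT T hT)) (hhT T hT)
      (fieldBound_of_randNorm P h) ENNReal.toReal_nonneg (holderField_of_detNorm hf hα (hfT T hT))
  have hsol : IsMildSolution P ℱ W b h f u :=
    hu.isMildSolution hα hα1
      (fun T hT => ⟨_, _, (hST T hT).exponent_mono hu.source one_le_two hp.le⟩) hb hh hB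
      (fun T hT => ⟨_, hhT T hT, (fieldBound_of_randNorm P h).exponent_mono hp.le hh⟩) hφ
  refine ⟨u, hsol, fun v hv t ht x => hv.ae_eq hW hb hB hsol ht x, fun r hr hrα t ht => ?_⟩
  have h1 := (hu.gradHolderNorm_le hα hα1 (hST t ht) hr hrα).trans
    (sourceSize_estimate ht (hrα.trans_le hα1) ENNReal.toReal_nonneg ENNReal.toReal_nonneg _)
  rw [ENNReal.ofReal_toReal (hfT t ht).ne] at h1
  exact ⟨h1.trans_lt (ENNReal.mul_lt_top ENNReal.ofReal_lt_top
    (ENNReal.add_lt_top.2 ⟨hhT t ht, hfT t ht⟩)), h1⟩
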